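/- Let $m,n\ge 1$ be integers and let $\mathcal{O}=S^2(m,n)$ be the spindle orbifold, i.e. the smooth orientable $2$-orbifold with underlying space the $2$-sphere whose two poles have cyclic local groups of orders $m$ and $n$ (acting by rotations in orbifold charts) and which is regular elsewhere. Equip $\mathcal{O}$ with a smooth Riemannian orbifold metric that is rotationally symmetric, i.e. invariant under the standard $S^1$-action on $S^2(m,n)$ by rotations about the two poles. A geodesic of $\mathcal{O}$ is a path that locally lifts to a (nonconstant) geodesic in the Riemannian orbifold charts; the length of a closed geodesic is its length as a parametrized closed curve (so iterates are allowed). The metric is called Besse if all of its geodesics are closed. The unit tangent bundle $T^1\mathcal{O}$ is obtained by gluing the quotients of the unit tangent bundles of the charts by the local groups. Every closed geodesic $\gamma$ lifts to the loop $(\gamma,\dot\gamma/\|\dot\gamma\|)$ in $T^1\mathcal{O}$. Let $\mathrm{area}(\mathcal{O})$ be the Riemannian area of the regular part of $\mathcal{O}$. Then there is a shortest one among the closed geodesics of $\mathcal{O}$ whose lift to $T^1\mathcal{O}$ is contractible. Denote its length by $\ell_{\mathrm{min,contr}}$, and define the contractible systolic ratio by $$\rho_{\mathrm{contr}}(\mathcal{O})=\frac{\ell_{\mathrm{min,contr}}^2}{\mathrm{area}(\mathcal{O})}.$$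 It satisfies $$\rho_{\mathrm{contr}}(\mathcal{O})\le 2(m+n)\pi,$$ and equality holds if and only if the metric is Besse. -/

import Mathlib

open Filter Topology

/-!
The closed spindle `S²(m,n)` is the orbifold obtained from two uniformizing charts, both copies of
the complex plane: chart `false`, with local group the `m`-th roots of unity, and chart `true`,
with local group the `n`-th roots of unity (in both cases acting by multiplication).  Away from the
origins the charts are glued by the local diffeomorphisms `w = z ^ (-m / n)`, that is along
`z ^ m * w ^ n = 1`.  The underlying space is a sphere, and the two origins give the two points
with local groups of orders `m` and `n`.
-/

namespace Spindle

/-- The order of the local group at the origin of a chart. -/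
def order (m n : ℕ) : Bool → ℕ
  | false => m
  | true => n

/-- Two chart points `(i, z)` and `(j, w)` represent the same point of `S²(m,n)`. -/
def PointRel (m n : ℕ) (x y : Bool × ℂ) : Prop :=
  if x.1 = y.1 then
    ∃ ζ : ℂ, ζ ^ order m n x.1 = 1 ∧ y.2 = ζ * x.2
  else
    x.2 ^ order m n x.1 * y.2 ^ order m n y.1 = 1

/-- Two chart tangent vectors `(i, z, v)` and `(j, w, u)` represent the same tangent vector of
`S²(m,n)`: they correspond under the derivative of an element `z ↦ ζ * z` of the local group, or
under the derivative of a branch of `z ^ m * w ^ n = 1`, which is given by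
`m * dz / z + n * dw / w = 0`. -/
def TangentRel (m n : ℕ) (x y : Bool × ℂ × ℂ) : Prop :=
  if x.1 = y.1 then
    ∃ ζ : ℂ, ζ ^ order m n x.1 = 1 ∧ y.2.1 = ζ * x.2.1 ∧ y.2.2 = ζ * x.2.2
  else
    x.2.1 ^ order m n x.1 * y.2.1 ^ order m n y.1 = 1 ∧
      (order m n x.1 : ℂ) * y.2.1 * x.2.2 + (order m n y.1 : ℂ) * x.2.1 * y.2.2 = 0

/-- The underlying topological space of the spindle orbifold `S²(m,n)` (quotient topology). -/
def Space (m n : ℕ) : Type :=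
  Quot (PointRel m n)

instance (m n : ℕ) : TopologicalSpace (Space m n) :=
  inferInstanceAs (TopologicalSpace (Quot (PointRel m n)))

/-- The point of `S²(m,n)` represented by the point `z` of the chart `i`. -/
def Space.mk (m n : ℕ) (i : Bool) (z : ℂ) : Space m n :=
  Quot.mk _ (i, z)

/-- A smooth Riemannian orbifold metric on `S²(m,n)`: a smooth Riemannian metric on each of the two
charts, such that identified tangent vectors have the same length (so that the local groups and the
gluing maps act by isometries). -/
structure Metric (m n : ℕ) where
  /-- the metric tensor of the chart `i` at the point `z` -/
  form : Bool → ℂ → LinearMap.BilinForm ℝ ℂ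
  smooth : ∀ i v u, ContDiff ℝ (⊤ : ℕ∞) (fun z => form i z v u)
  symm : ∀ i z v u, form i z v u = form i z u v
  pos : ∀ i z v, v ≠ 0 → 0 < form i z v v
  compat : ∀ x y : Bool × ℂ × ℂ, TangentRel m n x y →
    form x.1 x.2.1 x.2.2 x.2.2 = form y.1 y.2.1 y.2.2 y.2.2

namespace Metric

variable {m n : ℕ}

/-- Rotational symmetry: the circle action on `S²(m,n)` that rotates about the two poles,
`e^{iθ} • [z] = [e^{iθ/m} z]` in the first chart and `e^{iθ} • [w] = [e^{-iθ/n} w]` in the second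
one, is isometric.  Its local lifts to the charts are all the rotations of the charts. -/
def IsRotationallySymmetric (g : Metric m n) : Prop :=
  ∀ (i : Bool) (ζ : ℂ), ‖ζ‖ = 1 → ∀ z v u : ℂ,
    g.form i (ζ * z) (ζ * v) (ζ * u) = g.form i z v u

/-- The Riemannian area density `√det g` of the chart `i` with respect to Lebesgue measure. -/
noncomputable def areaDensity (g : Metric m n) (i : Bool) (z : ℂ) : ℝ :=
  Real.sqrt (g.form i z 1 1 * g.form i z Complex.I Complex.I - g.form i z 1 Complex.I ^ 2)

/-- The area of the orbifold.  The sphere is the union of the images of the two closed unit discs,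
which meet along the circle `|z| = |w| = 1`, and the chart `i` is generically `order i`-to-one. -/
noncomputable def area (g : Metric m n) : ℝ :=
  ∑ i : Bool, (order m n i : ℝ)⁻¹ * ∫ z in Metric.closedBall (0 : ℂ) 1, g.areaDensity i z

/-- Unit tangent vectors in the charts. -/
def UnitVector (g : Metric m n) : Type :=
  {x : Bool × ℂ × ℂ // g.form x.1 x.2.1 x.2.2 x.2.2 = 1}

instance (g : Metric m n) : TopologicalSpace g.UnitVector :=
  inferInstanceAs (TopologicalSpace {x : Bool × ℂ × ℂ // g.form x.1 x.2.1 x.2.2 x.2.2 = 1})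

/-- The unit tangent bundle `T¹S²(m,n)` of the orbifold, with the quotient topology. -/
def UnitTangentBundle (g : Metric m n) : Type :=
  Quot fun x y : g.UnitVector => TangentRel m n x.1 y.1

instance (g : Metric m n) : TopologicalSpace g.UnitTangentBundle :=
  inferInstanceAs (TopologicalSpace (Quot fun x y : g.UnitVector => TangentRel m n x.1 y.1))

/-- The element of `T¹S²(m,n)` represented by the unit tangent vector `v` at `z` in chart `i`. -/
def UnitTangentBundle.mk (g : Metric m n) (i : Bool) (z v : ℂ) (h : g.form i z v v = 1) :
    g.UnitTangentBundle :=
  Quot.mk _ (⟨(i, z, v), h⟩ : g.UnitVector)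

/-- At time `t`, the curve `c` in the chart `i` has velocity `v`, has unit speed and satisfies the
geodesic equation.  With `a = c''`, the last expression is `g(∇_{c'} c', w)`. -/
def IsChartGeodesicAt (g : Metric m n) (i : Bool) (c v : ℝ → ℂ) (t : ℝ) : Prop :=
  HasDerivAt c (v t) t ∧ g.form i (c t) (v t) (v t) = 1 ∧
    ∃ a : ℂ, HasDerivAt v a t ∧ ∀ w : ℂ,
      g.form i (c t) a w + fderiv ℝ (fun z => g.form i z (v t) w) (c t) (v t)
        - (1 / 2 : ℝ) * fderiv ℝ (fun z => g.form i z (v t) (v t)) (c t) w = 0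

/-- Around the time `t`, the path `γ` in the orbifold lifts to the unit speed geodesic `c` (with
velocity `v`) of the chart `i`. -/
def IsGeodesicLiftNear (g : Metric m n) (γ : ℝ → Space m n) (i : Bool) (c v : ℝ → ℂ)
    (t : ℝ) : Prop :=
  ∀ᶠ τ in 𝓝 t, g.IsChartGeodesicAt i c v τ ∧ γ τ = Space.mk m n i (c τ)

/-- A (complete, unit speed) orbifold geodesic: a path that locally lifts to a geodesic of a
chart. -/
def IsGeodesic (g : Metric m n) (γ : ℝ → Space m n) : Prop :=
  ∀ t : ℝ, ∃ (i : Bool) (c v : ℝ → ℂ), g.IsGeodesicLiftNear γ i c v t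

/-- `Γ` is the lift `(γ, γ')` of the geodesic `γ` to the unit tangent bundle. -/
def IsTangentLift (g : Metric m n) (γ : ℝ → Space m n) (Γ : ℝ → g.UnitTangentBundle) : Prop :=
  ∀ t : ℝ, ∃ (i : Bool) (c v : ℝ → ℂ), g.IsGeodesicLiftNear γ i c v t ∧
    ∀ᶠ τ in 𝓝 t, ∃ h : g.form i (c τ) (v τ) (v τ) = 1,
      Γ τ = UnitTangentBundle.mk g i (c τ) (v τ) h

/-- `γ` is a closed geodesic when it is traversed on an interval of length `ℓ`; since `γ` has unit
speed, `ℓ` is its length as a parametrized closed curve. -/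
def IsClosedGeodesic (g : Metric m n) (γ : ℝ → Space m n) (ℓ : ℝ) : Prop :=
  0 < ℓ ∧ g.IsGeodesic γ ∧ Function.Periodic γ ℓ

/-- The metric is Besse: all geodesics are closed. -/
def IsBesse (g : Metric m n) : Prop :=
  ∀ γ : ℝ → Space m n, g.IsGeodesic γ → ∃ ℓ : ℝ, g.IsClosedGeodesic γ ℓ

/-- The lengths of the closed geodesics whose lift to the unit tangent bundle is a contractible
loop. -/
def contractibleLengths (g : Metric m n) : Set ℝ :=
  {ℓ | ∃ γ : ℝ → Space m n, g.IsClosedGeodesic γ ℓ ∧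
    ∃ Γ : C(AddCircle ℓ, g.UnitTangentBundle),
      g.IsTangentLift γ (fun t : ℝ => Γ (t : AddCircle ℓ)) ∧ Γ.Nullhomotopic}

/-- The length of the shortest closed geodesic with contractible lift to the unit tangent
bundle. -/
noncomputable def contractibleSystole (g : Metric m n) : ℝ :=
  sInf g.contractibleLengths

/-- The contractible systolic ratio. -/
noncomputable def contractibleSystolicRatio (g : Metric m n) : ℝ :=
  g.contractibleSystole ^ 2 / g.area

end Metric

end Spindle

/-! In geodesic polar coordinates a rotationally symmetric metric is `ds² + r(s)² dψ²` on `0 ≤ s ≤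
L`, where the profile `r` (`prof`) vanishes at both ends with slopes `1 / m` and `-1 / n`. Geodesics
other than the meridians avoid the poles and have a nonzero Clairaut constant `K = r² ψ'`. Let `c`
be the smallest critical value of `r`. For `0 < K < c` the coordinate `s` oscillates between the two
points with `r = K`, and everything is governed by the action `A(K) = 2 ∫ √(1 - (K / r)²) ds`
(`act`): during one period `ψ` advances by `ρ(K) = -A'(K)`, one period has length `A(K) + K ρ(K)`
(`period_data`), and `ρ` extends continuously to `K = 0` with the value `W = π (m + n)`
(`continuousOn_rot`). Fubini and the area of a quarter disc give `area = 4 ∫ A dK` (`area_eq`,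
`integral_act`).

Contractibility is detected by a covering. The maps `hopf` and `toLens` compare the unit tangent
bundle with the quotient of `ℂ² \ 0` by the `(m + n)`-th roots of unity. A loop that is contractible
in the quotient lifts to a closed curve of `ℂ² \ 0`, and the closed lifts that occur are null
homotopic there. So a meridian has to be traversed for a multiple of `4 L`, and on any other closed
geodesic `ψ` has to advance by a multiple of `2 π (m + n) = 2 W`. Hence the set of contractible
lengths contains `4 L`, the length `2 W c` of a multiple of a critical parallel, and `q (A + K ρ)`
whenever `q ρ(K) = 2 W k`; all its other elements are at least as large as `4 L` or `2 W c`
(`isSpectrum`). Below the smaller of these two numbers only finitely many pairs `(q, k)` and a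
compact range of `K` matter, so a minimum `ℓ` exists.

The inequality comes from comparing `A` with the line `ℓ / 2 - W K` on `[0, ℓ / (2 W)]` (`le_act`).
At the left end `A(0) = 2 L ≥ ℓ / 2`, at the right end the line vanishes. At an interior minimum of
the difference `ρ = W`, so two periods form a contractible closed geodesic and `2 (A + W K) ≥ ℓ`.
Thus `A` lies above the line, its integral is at least the triangle area `ℓ² / (8 W)`, and `ℓ² ≤ 2 W
· area`.

Equality forces `A` to coincide with the line and to vanish beyond it, so `ρ = W` throughout and `c`
is the maximum of `r`; then all geodesics close up. Conversely, for a Besse metric `ρ` takes values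
in `πℚ`, so by continuity it is the constant `W` and all periods are `2 L`. If the critical points
filled more than one parallel, geodesics with `K` close to `c` would need arbitrarily long to cross
the critical region (`le_of_period_eq`). So `c` is the maximum and equality holds. -/

namespace Spindle

/-! ### Rotation invariant metrics on a chart and their coefficients along the real axis. -/

/-- A smooth rotation invariant Riemannian metric on the complex plane. -/
structure IsRotForm (b : ℂ → LinearMap.BilinForm ℝ ℂ) : Prop where
  smooth : ∀ v u, ContDiff ℝ (⊤ : ℕ∞) (fun z => b z v u)
  symm : ∀ z v u, b z v u = b z u v
  pos : ∀ z v, v ≠ 0 → 0 < b z v v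
  rot : ∀ ζ : ℂ, ‖ζ‖ = 1 → ∀ z v u, b (ζ * z) (ζ * v) (ζ * u) = b z v u

/-- The coefficient `g(∂x, ∂x)` along the real axis. -/
noncomputable def coefE (b : ℂ → LinearMap.BilinForm ℝ ℂ) (y : ℝ) : ℝ := b y 1 1
/-- The coefficient `g(∂x, ∂y)` along the real axis. -/
noncomputable def coefF (b : ℂ → LinearMap.BilinForm ℝ ℂ) (y : ℝ) : ℝ := b y 1 Complex.I
/-- The coefficient `g(∂y, ∂y)` along the real axis. -/
noncomputable def coefG (b : ℂ → LinearMap.BilinForm ℝ ℂ) (y : ℝ) : ℝ := b y Complex.I Complex.I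

namespace IsRotForm

variable {b : ℂ → LinearMap.BilinForm ℝ ℂ} (hb : IsRotForm b)
include hb

theorem expand (z v u : ℂ) : b z v u = b z 1 1 * v.re * u.re
    + b z 1 Complex.I * (v.re * u.im + v.im * u.re) + b z Complex.I Complex.I * v.im * u.im := by
  have hv : v = v.re • (1 : ℂ) + v.im • Complex.I := by
    apply Complex.ext <;> simp
  have hu : u = u.re • (1 : ℂ) + u.im • Complex.I := by
    apply Complex.ext <;> simp
  conv_lhs => rw [hv, hu]
  simp only [map_add, map_smul, LinearMap.add_apply, LinearMap.smul_apply, smul_eq_mul]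
  rw [hb.symm z Complex.I 1]
  ring

theorem differentiableAt_form (z v u : ℂ) : DifferentiableAt ℝ (fun z => b z v u) z :=
  ((hb.smooth v u).differentiable (by simp)).differentiableAt

/-- Reduces base point derivatives of the tensor to those of its three coefficients; the product
rule and the limits at the origin rest on this. -/
theorem fderiv_form (z v u w : ℂ) :
    fderiv ℝ (fun z => b z v u) z w = fderiv ℝ (fun z => b z 1 1) z w * (v.re * u.re)
      + fderiv ℝ (fun z => b z 1 Complex.I) z w * (v.re * u.im + v.im * u.re)
      + fderiv ℝ (fun z => b z Complex.I Complex.I) z w * (v.im * u.im) := by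
  have h1 : (fun z => b z v u) = fun z => b z 1 1 * (v.re * u.re)
    + b z 1 Complex.I * (v.re * u.im + v.im * u.re)
    + b z Complex.I Complex.I * (v.im * u.im) := by
    funext z; rw [hb.expand z v u]; ring
  have e1 := (hb.differentiableAt_form z 1 1).hasFDerivAt
  have e2 := (hb.differentiableAt_form z 1 Complex.I).hasFDerivAt
  have e3 := (hb.differentiableAt_form z Complex.I Complex.I).hasFDerivAt
  have h3 := ((e1.mul_const (v.re * u.re)).add (e2.mul_const (v.re * u.im + v.im * u.re))).add
    (e3.mul_const (v.im * u.im))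
  rw [h1]
  refine (congrArg (fun f : ℂ →L[ℝ] ℝ => f w) h3.fderiv).trans ?_
  simp
  ring

/-- The product rule for the metric tensor along a curve. -/
theorem hasDerivAt_form {c V W : ℝ → ℂ} {c' V' W' : ℂ} {t : ℝ} (hc : HasDerivAt c c' t)
    (hV : HasDerivAt V V' t) (hW : HasDerivAt W W' t) :
    HasDerivAt (fun τ => b (c τ) (V τ) (W τ))
      (fderiv ℝ (fun z => b z (V t) (W t)) (c t) c' + b (c t) V' (W t) + b (c t) (V t) W') t := by
  have h1 : (fun τ => b (c τ) (V τ) (W τ)) = fun τ => b (c τ) 1 1 * ((V τ).re * (W τ).re)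
    + b (c τ) 1 Complex.I * ((V τ).re * (W τ).im + (V τ).im * (W τ).re)
    + b (c τ) Complex.I Complex.I * ((V τ).im * (W τ).im) := by
    funext τ; rw [hb.expand]; ring
  have re' {f : ℝ → ℂ} {f' : ℂ} (hf : HasDerivAt f f' t) : HasDerivAt (fun τ => (f τ).re) f'.re t :=
    (Complex.reCLM.hasFDerivAt (x := f t)).comp_hasDerivAt t hf
  have im' {f : ℝ → ℂ} {f' : ℂ} (hf : HasDerivAt f f' t) : HasDerivAt (fun τ => (f τ).im) f'.im t :=
    (Complex.imCLM.hasFDerivAt (x := f t)).comp_hasDerivAt t hf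
  have e1 := (hb.differentiableAt_form (c t) 1 1).hasFDerivAt.comp_hasDerivAt t hc
  have e2 := (hb.differentiableAt_form (c t) 1 Complex.I).hasFDerivAt.comp_hasDerivAt t hc
  have e3 := (hb.differentiableAt_form (c t) Complex.I Complex.I).hasFDerivAt.comp_hasDerivAt t hc
  have h3 := ((e1.mul ((re' hV).mul (re' hW))).add
    (e2.mul (((re' hV).mul (im' hW)).add ((im' hV).mul (re' hW))))).add
    (e3.mul ((im' hV).mul (im' hW)))
  rw [h1]
  convert! h3 using 1
  rw [hb.fderiv_form, hb.expand (c t) V' (W t), hb.expand (c t) (V t) W']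
  simp only [Function.comp, Pi.add_apply, Pi.mul_apply]
  ring

theorem contDiff_coefE : ContDiff ℝ (⊤ : ℕ∞) (coefE b) :=
  (hb.smooth 1 1).comp Complex.ofRealCLM.contDiff
theorem contDiff_coefF : ContDiff ℝ (⊤ : ℕ∞) (coefF b) :=
  (hb.smooth 1 Complex.I).comp Complex.ofRealCLM.contDiff
theorem contDiff_coefG : ContDiff ℝ (⊤ : ℕ∞) (coefG b) :=
  (hb.smooth Complex.I Complex.I).comp Complex.ofRealCLM.contDiff

theorem coefG_pos (y : ℝ) : 0 < coefG b y := hb.pos _ _ Complex.I_ne_zero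

theorem det_pos (y : ℝ) : 0 < coefE b y * coefG b y - coefF b y ^ 2 := by
  have hG := hb.coefG_pos y
  -- The vector `G ∂x - F ∂y` is orthogonal to `∂y` and has squared norm `G (E G - F²)`.
  have h1 := hb.pos y ((coefG b y : ℂ) - coefF b y * Complex.I) (by
    intro h
    have := congrArg Complex.re h
    simp at this
    exact hG.ne' this)
  rw [hb.expand] at h1
  simp at h1
  have h2 : 0 < coefG b y * (coefE b y * coefG b y - coefF b y ^ 2) := by
    unfold coefE coefF coefG at *
    nlinarith [h1]
  exact pos_of_mul_pos_right h2 hG.le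

/-- Rotation by `-1` moves the base point `y` to `-y` and changes the sign of both vectors, which
cancels. Evenness of the coefficients makes arclength odd and the twist even, so that a signed
radius can be used through the origin. -/
theorem even_aux (y : ℝ) (v u : ℂ) : b (-y : ℝ) v u = b y v u := by
  have := hb.rot (-1) (by simp) y v u
  simp only [neg_mul, one_mul, map_neg, LinearMap.neg_apply, neg_neg] at this
  rw [← this]
  push_cast
  rfl

theorem coefE_neg (y : ℝ) : coefE b (-y) = coefE b y := hb.even_aux y _ _
theorem coefF_neg (y : ℝ) : coefF b (-y) = coefF b y := hb.even_aux y _ _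
theorem coefG_neg (y : ℝ) : coefG b (-y) = coefG b y := hb.even_aux y _ _

/-- The quarter turn fixes the origin and is an isometry of its tangent space, which forces `F =
-F`. Together with `coefE_zero`, the form at the origin is a multiple of the Euclidean one. -/
theorem coefF_zero : coefF b 0 = 0 := by
  have := hb.rot Complex.I (by simp) 0 1 Complex.I
  simp only [mul_zero, mul_one, Complex.I_mul_I, map_neg] at this
  rw [hb.symm] at this
  unfold coefF
  simp only [Complex.ofReal_zero]
  linarith

theorem coefE_zero : coefE b 0 = coefG b 0 := by
  have := hb.rot Complex.I (by simp) 0 1 1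
  simp only [mul_zero, mul_one] at this
  unfold coefE coefG
  simp only [Complex.ofReal_zero]
  exact this.symm

end IsRotForm

/-! ### Arclength, twist and orbit length as radial functions. -/

/-- The radial speed factor: arclength is `∫ radA`. -/
noncomputable def radA (b : ℂ → LinearMap.BilinForm ℝ ℂ) (y : ℝ) : ℝ :=
  Real.sqrt ((coefE b y * coefG b y - coefF b y ^ 2) / coefG b y)
/-- The slope of the twist. -/
noncomputable def kap (b : ℂ → LinearMap.BilinForm ℝ ℂ) (y : ℝ) : ℝ := coefF b y / coefG b y
/-- The arclength function along the curves orthogonal to the orbits. -/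
noncomputable def arc (b : ℂ → LinearMap.BilinForm ℝ ℂ) (y : ℝ) : ℝ := ∫ x in (0 : ℝ)..y, radA b x
/-- The twist of the curves orthogonal to the orbits. -/
noncomputable def twist (b : ℂ → LinearMap.BilinForm ℝ ℂ) (y : ℝ) : ℝ :=
  ∫ x in (0 : ℝ)..y, kap b x / x
/-- The norm of the rotation field along the real axis, with a sign. -/
noncomputable def orb (b : ℂ → LinearMap.BilinForm ℝ ℂ) (y : ℝ) : ℝ := Real.sqrt (coefG b y) * y

namespace IsRotForm

variable {b : ℂ → LinearMap.BilinForm ℝ ℂ} (hb : IsRotForm b)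
include hb

theorem radA_arg_pos (y : ℝ) : 0 < (coefE b y * coefG b y - coefF b y ^ 2) / coefG b y :=
  div_pos (hb.det_pos y) (hb.coefG_pos y)

theorem radA_pos (y : ℝ) : 0 < radA b y := Real.sqrt_pos.2 (hb.radA_arg_pos y)

theorem radA_sq (y : ℝ) :
    radA b y ^ 2 = (coefE b y * coefG b y - coefF b y ^ 2) / coefG b y :=
  Real.sq_sqrt (hb.radA_arg_pos y).le

theorem contDiff_radA : ContDiff ℝ (⊤ : ℕ∞) (radA b) := by
  unfold radA
  refine ContDiff.sqrt ?_ (fun y => (hb.radA_arg_pos y).ne')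
  exact ((hb.contDiff_coefE.mul hb.contDiff_coefG).sub (hb.contDiff_coefF.pow 2)).div
    hb.contDiff_coefG (fun y => (hb.coefG_pos y).ne')

theorem contDiff_kap : ContDiff ℝ (⊤ : ℕ∞) (kap b) :=
  hb.contDiff_coefF.div hb.contDiff_coefG (fun y => (hb.coefG_pos y).ne')

theorem contDiff_sqrtG : ContDiff ℝ (⊤ : ℕ∞) (fun y => Real.sqrt (coefG b y)) :=
  hb.contDiff_coefG.sqrt (fun y => (hb.coefG_pos y).ne')

theorem contDiff_orb : ContDiff ℝ (⊤ : ℕ∞) (orb b) := hb.contDiff_sqrtG.mul contDiff_id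

theorem radA_neg (y : ℝ) : radA b (-y) = radA b y := by
  simp [radA, hb.coefE_neg, hb.coefF_neg, hb.coefG_neg]
theorem kap_neg (y : ℝ) : kap b (-y) = kap b y := by
  simp [kap, hb.coefF_neg, hb.coefG_neg]

theorem kap_zero : kap b 0 = 0 := by simp [kap, hb.coefF_zero]
theorem radA_zero : radA b 0 = Real.sqrt (coefG b 0) := by
  have := hb.coefG_pos 0
  rw [radA, hb.coefF_zero, hb.coefE_zero]
  congr 1
  field_simp
  ring
omit hb in
theorem orb_zero : orb b 0 = 0 := by simp [orb]

/-- An even differentiable function has slope zero at the origin. This is what keeps the integrand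
`kap y / y` of the twist continuous there. -/
theorem deriv_kap_zero : HasDerivAt (kap b) 0 0 := by
  have hd : HasDerivAt (kap b) (deriv (kap b) 0) 0 :=
    (hb.contDiff_kap.differentiable (by simp)).differentiableAt.hasDerivAt
  have h2 : HasDerivAt (fun y => kap b (-y)) (deriv (kap b) 0 * (-1)) 0 := by
    have := HasDerivAt.comp (0 : ℝ) (h₂ := kap b) (h := fun y => -y) (h' := -1)
      (h₂' := deriv (kap b) 0) (by simpa using hd) (hasDerivAt_neg 0)
    exact this
  have h3 : (fun y => kap b (-y)) = kap b := funext hb.kap_neg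
  rw [h3] at h2
  have := hd.unique h2
  have h4 : deriv (kap b) 0 = 0 := by linarith
  rwa [h4] at hd

/-- At the origin the quotient is a difference quotient of `kap` with limit `0`, in agreement with
the convention `kap 0 / 0 = 0`. -/
theorem continuous_kap_div : Continuous (fun y => kap b y / y) := by
  rw [continuous_iff_continuousAt]
  intro y
  rcases eq_or_ne y 0 with rfl | hy
  · rw [← continuousWithinAt_compl_self]
    have h := (hasDerivAt_iff_tendsto_slope.1 hb.deriv_kap_zero)
    unfold ContinuousWithinAt
    simp only [div_zero]
    refine h.congr' ?_
    filter_upwards with x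
    simp [slope_def_field, hb.kap_zero]
  · exact hb.contDiff_kap.continuous.continuousAt.div continuousAt_id hy

theorem hasDerivAt_arc (y : ℝ) : HasDerivAt (arc b) (radA b y) y :=
  intervalIntegral.integral_hasDerivAt_right (hb.contDiff_radA.continuous.intervalIntegrable _ _)
    (hb.contDiff_radA.continuous.stronglyMeasurableAtFilter _ _) hb.contDiff_radA.continuous.continuousAt

theorem hasDerivAt_twist (y : ℝ) : HasDerivAt (twist b) (kap b y / y) y :=
  intervalIntegral.integral_hasDerivAt_right (hb.continuous_kap_div.intervalIntegrable _ _)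
    (hb.continuous_kap_div.stronglyMeasurableAtFilter _ _) hb.continuous_kap_div.continuousAt

omit hb in
theorem arc_zero : arc b 0 = 0 := by simp [arc]

theorem arc_neg (y : ℝ) : arc b (-y) = -arc b y := by
  have h := intervalIntegral.integral_comp_neg (a := 0) (b := y) (fun x => radA b x)
  simp only [hb.radA_neg, neg_zero] at h
  rw [arc, intervalIntegral.integral_symm, ← h, arc]

theorem twist_neg (y : ℝ) : twist b (-y) = twist b y := by
  have h := intervalIntegral.integral_comp_neg (a := 0) (b := y) (fun x => kap b x / x)
  simp only [hb.kap_neg, neg_zero, div_neg, intervalIntegral.integral_neg] at h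
  rw [twist, intervalIntegral.integral_symm, ← h, twist, neg_neg]

theorem strictMono_arc : StrictMono (arc b) :=
  strictMono_of_deriv_pos fun y => by rw [(hb.hasDerivAt_arc y).deriv]; exact hb.radA_pos y

theorem contDiff_arc : ContDiff ℝ (⊤ : ℕ∞) (arc b) := by
  refine contDiff_infty_iff_deriv.2 ⟨fun y => (hb.hasDerivAt_arc y).differentiableAt, ?_⟩
  have : deriv (arc b) = radA b := funext fun y => (hb.hasDerivAt_arc y).deriv
  rw [this]; exact hb.contDiff_radA

theorem continuous_arc : Continuous (arc b) := hb.contDiff_arc.continuous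

theorem continuous_twist : Continuous (twist b) :=
  continuous_iff_continuousAt.2 fun y => (hb.hasDerivAt_twist y).continuousAt

/-- At the origin the integrand `kap y / y` is only known to be continuous, hence the exclusion of
`y = 0` here and in the smoothness of polar coordinates. -/
theorem contDiffAt_twist {y : ℝ} (hy : y ≠ 0) : ContDiffAt ℝ (⊤ : ℕ∞) (twist b) y := by
  have h1 : ContDiffOn ℝ (⊤ : ℕ∞) (twist b) {y | y ≠ 0} := by
    refine (contDiffOn_infty_iff_deriv_of_isOpen isOpen_ne).2
      ⟨fun y _ => (hb.hasDerivAt_twist y).differentiableAt.differentiableWithinAt, ?_⟩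
    have : deriv (twist b) = fun y => kap b y / y := funext fun y => (hb.hasDerivAt_twist y).deriv
    rw [this]
    exact hb.contDiff_kap.contDiffOn.div contDiffOn_id (fun y hy => hy)
  exact h1.contDiffAt (isOpen_ne.mem_nhds hy)

end IsRotForm

end Spindle

/-! ### The geodesic equation and geodesic polar coordinates of a chart. -/

namespace Spindle

/-- The covector `g(∇_v v, ·)` in the flat coordinates, with `a = v'`. -/
noncomputable def eulerLagrange (b : ℂ → LinearMap.BilinForm ℝ ℂ) (c v a w : ℂ) : ℝ :=
  b c a w + fderiv ℝ (fun z => b z v w) c v - (1 / 2 : ℝ) * fderiv ℝ (fun z => b z v v) c w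

/-- The unit speed geodesic equation in a single chart. -/
def ChartGeo (b : ℂ → LinearMap.BilinForm ℝ ℂ) (c v : ℝ → ℂ) (t : ℝ) : Prop :=
  HasDerivAt c (v t) t ∧ b (c t) (v t) (v t) = 1 ∧
    ∃ a : ℂ, HasDerivAt v a t ∧ ∀ w : ℂ, eulerLagrange b (c t) (v t) a w = 0

/-- The inverse of the arclength function. -/
noncomputable def arcInv (b : ℂ → LinearMap.BilinForm ℝ ℂ) : ℝ → ℝ := Function.invFun (arc b)

namespace IsRotForm

variable {b : ℂ → LinearMap.BilinForm ℝ ℂ} (hb : IsRotForm b)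
include hb

theorem arcInv_arc (y : ℝ) : arcInv b (arc b y) = y :=
  Function.leftInverse_invFun hb.strictMono_arc.injective y

omit hb in
theorem arc_arcInv {s : ℝ} (hs : s ∈ Set.range (arc b)) : arc b (arcInv b s) = s :=
  Function.invFun_eq hs

theorem arcInv_zero : arcInv b 0 = 0 := by
  conv_lhs => rw [← arc_zero (b := b), hb.arcInv_arc]

theorem range_neg {s : ℝ} (hs : s ∈ Set.range (arc b)) : -s ∈ Set.range (arc b) := by
  obtain ⟨y, rfl⟩ := hs
  exact ⟨-y, hb.arc_neg y⟩

theorem arcInv_neg {s : ℝ} (hs : s ∈ Set.range (arc b)) : arcInv b (-s) = -arcInv b s := by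
  obtain ⟨y, rfl⟩ := hs
  rw [← hb.arc_neg, hb.arcInv_arc, hb.arcInv_arc]

theorem arcInv_lt {s s' : ℝ} (hs : s ∈ Set.range (arc b)) (hs' : s' ∈ Set.range (arc b))
    (h : s < s') : arcInv b s < arcInv b s' := by
  obtain ⟨y, rfl⟩ := hs
  obtain ⟨y', rfl⟩ := hs'
  rw [hb.arcInv_arc, hb.arcInv_arc]
  exact hb.strictMono_arc.lt_iff_lt.1 h

omit hb in
theorem zero_mem_range : (0 : ℝ) ∈ Set.range (arc b) := ⟨0, arc_zero⟩

theorem arcInv_pos {s : ℝ} (hs : s ∈ Set.range (arc b)) (h : 0 < s) : 0 < arcInv b s := by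
  have := hb.arcInv_lt zero_mem_range hs h
  rwa [hb.arcInv_zero] at this

omit hb in
theorem arcInv_ne {s : ℝ} (hs : s ∈ Set.range (arc b)) (h : s ≠ 0) : arcInv b s ≠ 0 := by
  intro h0
  apply h
  rw [← arc_arcInv hs, h0, arc_zero]

/-- Inverse function theorem, as `arc` has the positive derivative `radA`. Off the range of `arc`
the values of `arcInv` are meaningless, so later statements carry membership in the range, which is
open by the second half. -/
theorem contDiffAt_arcInv_and_mem {s : ℝ} (hs : s ∈ Set.range (arc b)) :
    ContDiffAt ℝ (⊤ : ℕ∞) (arcInv b) s ∧ ∀ᶠ x in 𝓝 s, x ∈ Set.range (arc b) := by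
  obtain ⟨y, rfl⟩ := hs
  have hc : ContDiffAt ℝ (⊤ : ℕ∞) (arc b) y := hb.contDiff_arc.contDiffAt
  have hd : HasFDerivAt (arc b)
      ((ContinuousLinearEquiv.unitsEquivAut ℝ (Units.mk0 _ (hb.radA_pos y).ne') : ℝ ≃L[ℝ] ℝ) :
        ℝ →L[ℝ] ℝ) y := by
    have := (hb.hasDerivAt_arc y).hasFDerivAt
    convert! this using 1
  have h1 := hc.to_localInverse hd (by simp)
  have h2 := (hc.hasStrictFDerivAt' hd (by simp)).eventually_right_inverse
  refine ⟨h1.congr_of_eventuallyEq ?_, ?_⟩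
  · filter_upwards [h2] with x hx
    conv_lhs => rw [← hx]
    rw [hb.arcInv_arc]
    rfl
  · filter_upwards [h2] with x hx
    exact ⟨_, hx⟩

theorem contDiffAt_arcInv {s : ℝ} (hs : s ∈ Set.range (arc b)) :
    ContDiffAt ℝ (⊤ : ℕ∞) (arcInv b) s := (hb.contDiffAt_arcInv_and_mem hs).1

theorem isOpen_range : IsOpen (Set.range (arc b)) :=
  isOpen_iff_mem_nhds.2 fun _ hs => (hb.contDiffAt_arcInv_and_mem hs).2

theorem hasDerivAt_arcInv {s : ℝ} (hs : s ∈ Set.range (arc b)) :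
    HasDerivAt (arcInv b) (radA b (arcInv b s))⁻¹ s := by
  refine HasDerivAt.of_local_left_inverse (hb.contDiffAt_arcInv hs).continuousAt
    (hb.hasDerivAt_arc _) (hb.radA_pos _).ne' ?_
  filter_upwards [hb.isOpen_range.mem_nhds hs] with x hx
  exact arc_arcInv hx

/-- The pullback of the geodesic operator under a map that carries it to `ds² + P(s)² dχ²`. -/
theorem eulerLagrange_pullback {Φ : ℝ × ℝ → ℂ} {x : ℝ × ℝ} (hΦ : ContDiffAt ℝ 2 Φ x)
    {P : ℝ → ℝ} {P' : ℝ} (hP : HasDerivAt P P' x.1)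
    (iso : ∀ᶠ y in 𝓝 x, ∀ u w : ℝ × ℝ, b (Φ y) (fderiv ℝ Φ y u) (fderiv ℝ Φ y w)
      = u.1 * w.1 + P y.1 ^ 2 * u.2 * w.2) (u a w : ℝ × ℝ) :
    eulerLagrange b (Φ x) (fderiv ℝ Φ x u)
      (fderiv ℝ (fderiv ℝ Φ) x u u + fderiv ℝ Φ x a) (fderiv ℝ Φ x w)
      = a.1 * w.1 + P x.1 ^ 2 * a.2 * w.2 + 2 * P x.1 * P' * u.1 * u.2 * w.2
        - P x.1 * P' * u.2 ^ 2 * w.1 := by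
  have hdiff : DifferentiableAt ℝ Φ x := hΦ.differentiableAt (by norm_num)
  have hd2 : DifferentiableAt ℝ (fderiv ℝ Φ) x :=
    (hΦ.fderiv_right (m := 1) (by norm_num)).differentiableAt (by norm_num)
  have line (d : ℝ × ℝ) : HasDerivAt (fun τ : ℝ => x + τ • d) d 0 := by
    simpa using ((hasDerivAt_id (0 : ℝ)).smul_const d).const_add x
  -- The isometry identity is differentiated in the direction `d`, with constant coordinate vectors
  -- `p` and `q`.
  have key (d p q : ℝ × ℝ) :
      fderiv ℝ (fun z => b z (fderiv ℝ Φ x p) (fderiv ℝ Φ x q)) (Φ x) (fderiv ℝ Φ x d)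
        + b (Φ x) (fderiv ℝ (fderiv ℝ Φ) x d p) (fderiv ℝ Φ x q)
        + b (Φ x) (fderiv ℝ Φ x p) (fderiv ℝ (fderiv ℝ Φ) x d q)
      = 2 * P x.1 * P' * d.1 * p.2 * q.2 := by
    have h0 : x + (0 : ℝ) • d = x := by simp
    have hc : HasDerivAt (fun τ : ℝ => Φ (x + τ • d)) (fderiv ℝ Φ x d) 0 := by
      have := HasFDerivAt.comp_hasDerivAt (0 : ℝ) (l := Φ) (f := fun τ : ℝ => x + τ • d)
        (l' := fderiv ℝ Φ x) (by rw [h0]; exact hdiff.hasFDerivAt) (line d)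
      exact this
    have hV (p : ℝ × ℝ) : HasDerivAt (fun τ : ℝ => fderiv ℝ Φ (x + τ • d) p)
        (fderiv ℝ (fderiv ℝ Φ) x d p) 0 := by
      have := HasFDerivAt.comp_hasDerivAt (0 : ℝ) (l := fderiv ℝ Φ) (f := fun τ : ℝ => x + τ • d)
        (l' := fderiv ℝ (fderiv ℝ Φ) x) (by rw [h0]; exact hd2.hasFDerivAt) (line d)
      simpa using this.clm_apply (hasDerivAt_const (0 : ℝ) p)
    have h1 := hb.hasDerivAt_form hc (hV p) (hV q)
    simp only [h0] at h1
    have hP2 : HasDerivAt (fun τ : ℝ => P (x + τ • d).1) (P' * d.1) 0 := by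
      have l1 : HasDerivAt (fun τ : ℝ => (x + τ • d).1) d.1 0 := by
        simpa using ((hasDerivAt_id (0 : ℝ)).mul_const d.1).const_add x.1
      have := HasDerivAt.comp (0 : ℝ) (h₂ := P) (h := fun τ : ℝ => (x + τ • d).1) (h₂' := P')
        (by simpa using hP) l1
      exact this
    have h2 : HasDerivAt (fun τ : ℝ => p.1 * q.1 + P (x + τ • d).1 ^ 2 * p.2 * q.2)
        (2 * P x.1 * P' * d.1 * p.2 * q.2) 0 := by
      have := (((hP2.fun_pow 2).mul_const p.2).mul_const q.2).const_add (p.1 * q.1)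
      convert! this using 1
      simp only [zero_smul, add_zero, Nat.cast_ofNat, Nat.add_one_sub_one, pow_one]
      ring
    refine h1.unique (h2.congr_of_eventuallyEq ?_)
    have ht : Tendsto (fun τ : ℝ => x + τ • d) (𝓝 0) (𝓝 x) := by
      have := (line d).continuousAt.tendsto
      rwa [h0] at this
    filter_upwards [ht.eventually iso] with τ hτ
    exact hτ p q
  have hsymm : fderiv ℝ (fderiv ℝ Φ) x w u = fderiv ℝ (fderiv ℝ Φ) x u w :=
    (hΦ.isSymmSndFDerivAt (by simp)).eq w u
  have k1 := key u u w
  have k2 := key w u u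
  have i0 := iso.self_of_nhds a w
  rw [hsymm, hb.symm (Φ x) (fderiv ℝ (fderiv ℝ Φ) x u w)] at k2
  unfold eulerLagrange
  simp only [map_add, LinearMap.add_apply]
  rw [i0]
  -- As in Koszul's formula: the derivative along `u` minus half of the one along `w`. The terms
  -- with mixed second derivatives of `Φ` cancel by their symmetry.
  linear_combination k1 - k2 / 2

end IsRotForm

/-- Geodesic polar coordinates around the origin (with signed radius), with the twist removed. -/
noncomputable def polarMap (b : ℂ → LinearMap.BilinForm ℝ ℂ) (x : ℝ × ℝ) : ℂ :=
  arcInv b x.1 * Complex.exp ((x.2 - twist b (arcInv b x.1) : ℝ) * Complex.I)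

/-- The tangent vector `p ∂_s + q ∂_χ` at the point with polar coordinates `x`; here `q` is
multiplied with the radius already. -/
noncomputable def polarVec (b : ℂ → LinearMap.BilinForm ℝ ℂ) (x : ℝ × ℝ) (p q : ℝ) : ℂ :=
  Complex.exp ((x.2 - twist b (arcInv b x.1) : ℝ) * Complex.I) *
    (((radA b (arcInv b x.1))⁻¹ * p : ℝ) * (1 - kap b (arcInv b x.1) * Complex.I)
      + (q / Real.sqrt (coefG b (arcInv b x.1)) : ℝ) * Complex.I)

/-- The signed length of the rotation field at distance `s` from the origin. -/
noncomputable def orbRad (b : ℂ → LinearMap.BilinForm ℝ ℂ) (s : ℝ) : ℝ := orb b (arcInv b s)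

namespace IsRotForm

variable {b : ℂ → LinearMap.BilinForm ℝ ℂ} (hb : IsRotForm b)
include hb

theorem contDiffAt_orbRad {s : ℝ} (hs : s ∈ Set.range (arc b)) :
    ContDiffAt ℝ (⊤ : ℕ∞) (orbRad b) s :=
  hb.contDiff_orb.contDiffAt.comp s (hb.contDiffAt_arcInv hs)

theorem hasDerivAt_orbRad {s : ℝ} (hs : s ∈ Set.range (arc b)) :
    HasDerivAt (orbRad b) (deriv (orbRad b) s) s :=
  ((hb.contDiffAt_orbRad hs).differentiableAt (by simp)).hasDerivAt

theorem orbRad_zero : orbRad b 0 = 0 := by rw [orbRad, hb.arcInv_zero, orb_zero]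

theorem orbRad_pos {s : ℝ} (hs : s ∈ Set.range (arc b)) (h : 0 < s) : 0 < orbRad b s :=
  mul_pos (Real.sqrt_pos.2 (hb.coefG_pos _)) (hb.arcInv_pos hs h)

theorem orbRad_ne {s : ℝ} (hs : s ∈ Set.range (arc b)) (h : s ≠ 0) : orbRad b s ≠ 0 :=
  mul_ne_zero (Real.sqrt_pos.2 (hb.coefG_pos _)).ne' (arcInv_ne hs h)

/-- The slope is `√G(0) / radA 0`, and both agree because the form is conformal at the origin. A
chart thus has no cone singularity; the cone angles come from the local groups alone. -/
theorem deriv_orbRad_zero : deriv (orbRad b) 0 = 1 := by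
  have h1 : HasDerivAt (arcInv b) (radA b (arcInv b 0))⁻¹ 0 := hb.hasDerivAt_arcInv zero_mem_range
  have h2 : HasDerivAt (orb b) (Real.sqrt (coefG b 0)) (arcInv b 0) := by
    rw [hb.arcInv_zero]
    have h3 : HasDerivAt (fun y => Real.sqrt (coefG b y))
        (deriv (fun y => Real.sqrt (coefG b y)) 0) 0 :=
      (hb.contDiff_sqrtG.differentiable (by simp)).differentiableAt.hasDerivAt
    have h4 := h3.mul (hasDerivAt_id (0 : ℝ))
    simp only [id, mul_zero, mul_one, zero_add] at h4
    exact h4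
  have h3 := (h2.comp 0 h1).deriv
  rw [hb.arcInv_zero, hb.radA_zero] at h3
  have : orbRad b = orb b ∘ arcInv b := rfl
  rw [this, h3]
  exact mul_inv_cancel₀ (Real.sqrt_pos.2 (hb.coefG_pos 0)).ne'

theorem contDiffAt_polarMap {x : ℝ × ℝ} (hx : x.1 ∈ Set.range (arc b)) (h0 : x.1 ≠ 0) :
    ContDiffAt ℝ (⊤ : ℕ∞) (polarMap b) x := by
  have h1 : ContDiffAt ℝ (⊤ : ℕ∞) (fun x : ℝ × ℝ => arcInv b x.1) x :=
    (hb.contDiffAt_arcInv hx).comp x contDiffAt_fst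
  have h2 : ContDiffAt ℝ (⊤ : ℕ∞) (fun x : ℝ × ℝ => twist b (arcInv b x.1)) x :=
    ContDiffAt.comp (g := twist b) x (hb.contDiffAt_twist (arcInv_ne hx h0)) h1
  unfold polarMap
  refine (Complex.ofRealCLM.contDiff.contDiffAt.comp x h1).mul ?_
  refine ContDiffAt.cexp ?_
  exact (Complex.ofRealCLM.contDiff.contDiffAt.comp x (contDiffAt_snd.sub h2)).mul contDiffAt_const

/-- A directional derivative instead of a full one, so that the origin is included. The frame
`polarVec` stays regular there because the radius is already multiplied into the angular component.
-/
theorem hasFDerivAt_polarMap {x : ℝ × ℝ} (hx : x.1 ∈ Set.range (arc b)) (u : ℝ × ℝ) :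
    HasDerivAt (fun τ : ℝ => polarMap b (x + τ • u)) (polarVec b x u.1 (orbRad b x.1 * u.2)) 0 := by
  have l1 : HasDerivAt (fun τ : ℝ => (x + τ • u).1) u.1 0 := by
    simpa using ((hasDerivAt_id (0 : ℝ)).mul_const u.1).const_add x.1
  have l2 : HasDerivAt (fun τ : ℝ => (x + τ • u).2) u.2 0 := by
    simpa using ((hasDerivAt_id (0 : ℝ)).mul_const u.2).const_add x.2
  have h0 : x + (0 : ℝ) • u = x := by simp
  have hY : HasDerivAt (fun τ : ℝ => arcInv b (x + τ • u).1) ((radA b (arcInv b x.1))⁻¹ * u.1) 0 :=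
    HasDerivAt.comp (0 : ℝ) (h₂ := arcInv b) (h := fun τ : ℝ => (x + τ • u).1)
      (by rw [h0]; exact hb.hasDerivAt_arcInv hx) l1
  have hT : HasDerivAt (fun τ : ℝ => twist b (arcInv b (x + τ • u).1))
      (kap b (arcInv b x.1) / arcInv b x.1 * ((radA b (arcInv b x.1))⁻¹ * u.1)) 0 :=
    HasDerivAt.comp (0 : ℝ) (h₂ := twist b) (h := fun τ : ℝ => arcInv b (x + τ • u).1)
      (by rw [h0]; exact hb.hasDerivAt_twist _) hY
  have h3 := hY.ofReal_comp.mul (((l2.sub hT).ofReal_comp.mul_const Complex.I).cexp)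
  unfold polarMap
  convert! h3 using 1
  simp only [h0, Pi.sub_apply]
  unfold polarVec orbRad orb
  have hG : Real.sqrt (coefG b (arcInv b x.1)) ≠ 0 := (Real.sqrt_pos.2 (hb.coefG_pos _)).ne'
  set G := Real.sqrt (coefG b (arcInv b x.1))
  set Y := arcInv b x.1
  have hq : G * Y * u.2 / G = Y * u.2 := by field_simp
  rw [hq]
  -- Also true for `Y = 0`, because `kap 0 = 0`.
  have hk : (kap b Y : ℂ) = Y * (kap b Y / Y : ℝ) := by
    rcases eq_or_ne Y 0 with h | h
    · rw [h, hb.kap_zero]; simp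
    · have : (Y : ℂ) ≠ 0 := by exact_mod_cast h
      push_cast
      field_simp
  rw [hk]
  push_cast
  ring

theorem fderiv_polarMap {x : ℝ × ℝ} (hx : x.1 ∈ Set.range (arc b)) (h0 : x.1 ≠ 0) (u : ℝ × ℝ) :
    fderiv ℝ (polarMap b) x u = polarVec b x u.1 (orbRad b x.1 * u.2) := by
  have h1 := ((hb.contDiffAt_polarMap hx h0).differentiableAt (by simp)).hasFDerivAt
  have l : HasDerivAt (fun τ : ℝ => x + τ • u) u 0 := by
    simpa using ((hasDerivAt_id (0 : ℝ)).smul_const u).const_add x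
  have h2 := HasFDerivAt.comp_hasDerivAt (0 : ℝ) (l := polarMap b) (f := fun τ : ℝ => x + τ • u)
        (l' := fderiv ℝ (polarMap b) x) (by simpa using h1) l
  exact h2.unique (hb.hasFDerivAt_polarMap hx u)

/-- After rotation to the real axis, `1 - kap I` is orthogonal to `I` and has norm `radA`, while `I`
has norm `√G`; `polarVec` takes components in the normalized frame. -/
theorem form_polar (x : ℝ × ℝ) (p q p' q' : ℝ) :
    b (polarMap b x) (polarVec b x p q) (polarVec b x p' q') = p * p' + q * q' := by
  unfold polarMap polarVec
  set ζ := Complex.exp ((x.2 - twist b (arcInv b x.1) : ℝ) * Complex.I) with hζ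
  set Y := arcInv b x.1
  rw [mul_comm (Y : ℂ) ζ, hb.rot ζ (by rw [hζ]; exact Complex.norm_exp_ofReal_mul_I _), hb.expand]
  have hA := hb.radA_pos Y
  have hA2 := hb.radA_sq Y
  have hG := hb.coefG_pos Y
  have hs : 0 < Real.sqrt (coefG b Y) := Real.sqrt_pos.2 hG
  have hs2 : Real.sqrt (coefG b Y) ^ 2 = coefG b Y := Real.sq_sqrt hG.le
  change coefE b Y * _ * _ + coefF b Y * _ + coefG b Y * _ * _ = _
  unfold kap
  simp
  set A := radA b Y
  set S := Real.sqrt (coefG b Y)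
  have hE : coefE b Y = A ^ 2 + coefF b Y ^ 2 / coefG b Y := by
    rw [hA2]; field_simp; ring
  rw [hE, ← hs2]
  field_simp
  ring

theorem iso_polarMap {x : ℝ × ℝ} (hx : x.1 ∈ Set.range (arc b)) (h0 : x.1 ≠ 0) :
    ∀ᶠ y in 𝓝 x, ∀ u w : ℝ × ℝ, b (polarMap b y) (fderiv ℝ (polarMap b) y u)
      (fderiv ℝ (polarMap b) y w) = u.1 * w.1 + orbRad b y.1 ^ 2 * u.2 * w.2 := by
  have h1 : ∀ᶠ y : ℝ × ℝ in 𝓝 x, y.1 ∈ Set.range (arc b) ∧ y.1 ≠ 0 :=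
    continuousAt_fst.eventually
      (Filter.inter_mem (hb.isOpen_range.mem_nhds hx) (isOpen_ne.mem_nhds h0))
  filter_upwards [h1] with y hy u w
  rw [hb.fderiv_polarMap hy.1 hy.2, hb.fderiv_polarMap hy.1 hy.2, hb.form_polar]
  ring

end IsRotForm

end Spindle

/-! ### Geodesics off the origin in polar coordinates. -/

namespace Spindle

theorem eventually_eq_of_hasDerivAt_zero {f : ℝ → ℝ} {t : ℝ}
    (h : ∀ᶠ τ in 𝓝 t, HasDerivAt f 0 τ) : ∀ᶠ τ in 𝓝 t, f τ = f t := by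
  obtain ⟨ε, hε, hb⟩ := Metric.eventually_nhds_iff_ball.1 h
  refine Metric.eventually_nhds_iff_ball.2 ⟨ε, hε, fun τ hτ => ?_⟩
  exact Metric.isOpen_ball.is_const_of_deriv_eq_zero (convex_ball t ε).isPreconnected
    (fun x hx => (hb x hx).differentiableAt.differentiableWithinAt)
    (fun x hx => (hb x hx).deriv) hτ (Metric.mem_ball_self hε)

theorem hasDerivAt_fst_comp {x : ℝ → ℝ × ℝ} {u : ℝ × ℝ} {t : ℝ} (hx : HasDerivAt x u t) :
    HasDerivAt (fun τ => (x τ).1) u.1 t :=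
  ((ContinuousLinearMap.fst ℝ ℝ ℝ).hasFDerivAt (x := x t)).comp_hasDerivAt t hx

theorem hasDerivAt_snd_comp {x : ℝ → ℝ × ℝ} {u : ℝ × ℝ} {t : ℝ} (hx : HasDerivAt x u t) :
    HasDerivAt (fun τ => (x τ).2) u.2 t :=
  ((ContinuousLinearMap.snd ℝ ℝ ℝ).hasFDerivAt (x := x t)).comp_hasDerivAt t hx

theorem hasDerivAt_fderiv_comp {Φ : ℝ × ℝ → ℂ} {x u : ℝ → ℝ × ℝ} {a : ℝ × ℝ} {t : ℝ}
    (hΦ : ContDiffAt ℝ 2 Φ (x t)) (hx : HasDerivAt x (u t) t) (hu : HasDerivAt u a t) :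
    HasDerivAt (fun τ => fderiv ℝ Φ (x τ) (u τ))
      (fderiv ℝ (fderiv ℝ Φ) (x t) (u t) (u t) + fderiv ℝ Φ (x t) a) t := by
  have hd2 : DifferentiableAt ℝ (fderiv ℝ Φ) (x t) :=
    (hΦ.fderiv_right (m := 1) (by norm_num)).differentiableAt (by norm_num)
  have h := HasFDerivAt.comp_hasDerivAt t (l := fderiv ℝ Φ) (f := x) hd2.hasFDerivAt hx
  simpa using h.clm_apply hu

theorem hasDerivAt_comp_fderiv {Φ : ℝ × ℝ → ℂ} {x : ℝ → ℝ × ℝ} {u : ℝ × ℝ} {t : ℝ}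
    (hΦ : DifferentiableAt ℝ Φ (x t)) (hx : HasDerivAt x u t) :
    HasDerivAt (fun τ => Φ (x τ)) (fderiv ℝ Φ (x t) u) t :=
  HasFDerivAt.comp_hasDerivAt t (l := Φ) (f := x) hΦ.hasFDerivAt hx

namespace IsRotForm

variable {b : ℂ → LinearMap.BilinForm ℝ ℂ} (hb : IsRotForm b)
include hb

theorem exists_polarVec (x : ℝ × ℝ) (w : ℂ) : ∃ p q : ℝ, polarVec b x p q = w := by
  set ζ := Complex.exp ((x.2 - twist b (arcInv b x.1) : ℝ) * Complex.I) with hζ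
  have h0 : ζ ≠ 0 := Complex.exp_ne_zero _
  have hA := (hb.radA_pos (arcInv b x.1)).ne'
  have hG : Real.sqrt (coefG b (arcInv b x.1)) ≠ 0 := (Real.sqrt_pos.2 (hb.coefG_pos _)).ne'
  refine ⟨radA b (arcInv b x.1) * (w / ζ).re, Real.sqrt (coefG b (arcInv b x.1)) *
    ((w / ζ).im + kap b (arcInv b x.1) * (w / ζ).re), ?_⟩
  unfold polarVec
  rw [← hζ, inv_mul_cancel_left₀ hA, mul_div_cancel_left₀ _ hG]
  have : w = ζ * (w / ζ) := by field_simp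
  conv_rhs => rw [this]
  congr 1
  apply Complex.ext
  · simp
  · simp
    ring

theorem exists_fderiv_polarMap {x : ℝ × ℝ} (hx : x.1 ∈ Set.range (arc b)) (h0 : x.1 ≠ 0) (w : ℂ) :
    ∃ u, fderiv ℝ (polarMap b) x u = w := by
  obtain ⟨p, q, h⟩ := hb.exists_polarVec x w
  refine ⟨(p, q / orbRad b x.1), ?_⟩
  rw [hb.fderiv_polarMap hx h0, ← h, mul_div_cancel₀ _ (hb.orbRad_ne hx h0)]

omit hb in
theorem contDiffAt_two {Φ : ℝ × ℝ → ℂ} {x : ℝ × ℝ} (h : ContDiffAt ℝ (⊤ : ℕ∞) Φ x) :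
    ContDiffAt ℝ 2 Φ x := h.of_le (WithTop.coe_le_coe.2 le_top)

/-- Solutions of the geodesic equation of `ds² + ρ(s)² dχ²` are geodesics of the chart. -/
theorem chartGeo_polar {s χ p : ℝ → ℝ} {K t : ℝ} (hs : HasDerivAt s (p t) t)
    (hχ : HasDerivAt χ (K / orbRad b (s t) ^ 2) t)
    (hp : HasDerivAt p (K ^ 2 * deriv (orbRad b) (s t) / orbRad b (s t) ^ 3) t)
    (hE : p t ^ 2 + K ^ 2 / orbRad b (s t) ^ 2 = 1)
    (hmem : s t ∈ Set.range (arc b)) (h0 : s t ≠ 0) :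
    ChartGeo b (fun τ => polarMap b (s τ, χ τ))
      (fun τ => polarVec b (s τ, χ τ) (p τ) (K / orbRad b (s τ))) t := by
  have hρ := hb.orbRad_ne hmem h0
  have hρd : HasDerivAt (fun τ => orbRad b (s τ)) (deriv (orbRad b) (s t) * p t) t :=
    HasDerivAt.comp t (h₂ := orbRad b) (hb.hasDerivAt_orbRad hmem) hs
  have hx : HasDerivAt (fun τ => (s τ, χ τ)) (p t, K / orbRad b (s t) ^ 2) t := hs.prodMk hχ
  -- The acceleration in coordinates; its angular part expresses that `K = ρ² χ'` is constant.
  have hu : HasDerivAt (fun τ => (p τ, K / orbRad b (s τ) ^ 2))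
      (K ^ 2 * deriv (orbRad b) (s t) / orbRad b (s t) ^ 3,
        -(2 * K * deriv (orbRad b) (s t) * p t / orbRad b (s t) ^ 3)) t := by
    refine hp.prodMk ?_
    have := (hasDerivAt_const t K).fun_div (hρd.fun_pow 2) (pow_ne_zero 2 hρ)
    convert! this using 1
    simp only [Nat.cast_ofNat, Nat.add_one_sub_one, pow_one]
    field_simp
    ring
  have hΦ := contDiffAt_two (hb.contDiffAt_polarMap (x := (s t, χ t)) hmem h0)
  have hev : ∀ᶠ τ in 𝓝 t, s τ ∈ Set.range (arc b) ∧ s τ ≠ 0 :=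
    hs.continuousAt.eventually
      (Filter.inter_mem (hb.isOpen_range.mem_nhds hmem) (isOpen_ne.mem_nhds h0))
  have hveq : ∀ τ, s τ ∈ Set.range (arc b) ∧ s τ ≠ 0 →
      polarVec b (s τ, χ τ) (p τ) (K / orbRad b (s τ))
        = fderiv ℝ (polarMap b) (s τ, χ τ) (p τ, K / orbRad b (s τ) ^ 2) := by
    intro τ hτ
    rw [hb.fderiv_polarMap hτ.1 hτ.2]
    have := hb.orbRad_ne hτ.1 hτ.2
    congr 1
    field_simp
  refine ⟨?_, ?_, ?_⟩
  · beta_reduce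
    rw [hveq t ⟨hmem, h0⟩]
    exact hasDerivAt_comp_fderiv (x := fun τ => (s τ, χ τ)) (hΦ.differentiableAt (by norm_num)) hx
  · simp only [hb.form_polar]
    rw [← hE]
    field_simp
  · refine ⟨_, (hasDerivAt_fderiv_comp (x := fun τ => (s τ, χ τ))
      (u := fun τ => (p τ, K / orbRad b (s τ) ^ 2)) hΦ hx hu).congr_of_eventuallyEq ?_, ?_⟩
    · filter_upwards [hev] with τ hτ using hveq τ hτ
    · intro w
      -- Every test vector is the image of a coordinate vector, so the equation can be checked after
      -- pullback, where it reads `s'' = ρ ρ' χ'²` and `(ρ² χ')' = 0`.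
      obtain ⟨w', rfl⟩ := hb.exists_fderiv_polarMap (x := (s t, χ t)) hmem h0 w
      beta_reduce
      rw [hveq t ⟨hmem, h0⟩]
      rw [hb.eulerLagrange_pullback hΦ (hb.hasDerivAt_orbRad hmem)
        (hb.iso_polarMap (x := (s t, χ t)) hmem h0)]
      field_simp
      ring

/-- Geodesics of the chart away from the origin solve the geodesic equation of
`ds² + ρ(s)² dχ²`. -/
theorem exists_polar_of_chartGeo {c v : ℝ → ℂ} {t : ℝ} (h : ∀ᶠ τ in 𝓝 t, ChartGeo b c v τ)
    (h0 : c t ≠ 0) : ∃ (s χ p : ℝ → ℝ) (K : ℝ), ∀ᶠ τ in 𝓝 t,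
      HasDerivAt s (p τ) τ ∧ HasDerivAt χ (K / orbRad b (s τ) ^ 2) τ ∧
      HasDerivAt p (K ^ 2 * deriv (orbRad b) (s τ) / orbRad b (s τ) ^ 3) τ ∧
      p τ ^ 2 + K ^ 2 / orbRad b (s τ) ^ 2 = 1 ∧ s τ ∈ Set.range (arc b) ∧ 0 < s τ ∧
      c τ = polarMap b (s τ, χ τ) ∧ v τ = polarVec b (s τ, χ τ) (p τ) (K / orbRad b (s τ)) := by
  -- The added twist cancels the one subtracted in `polarMap`, so that `x₀` is mapped to `c t`.
  set x₀ : ℝ × ℝ := (arc b ‖c t‖, Complex.arg (c t) + twist b ‖c t‖) with hx₀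
  have hpos : 0 < x₀.1 := by
    have := hb.strictMono_arc (norm_pos_iff.2 h0)
    rwa [arc_zero] at this
  have hmem : x₀.1 ∈ Set.range (arc b) := ⟨_, rfl⟩
  have hc0 : polarMap b x₀ = c t := by
    simp only [polarMap, hx₀, hb.arcInv_arc, add_sub_cancel_right]
    exact Complex.norm_mul_exp_arg_mul_I _
  have hΦ := contDiffAt_two (hb.contDiffAt_polarMap hmem hpos.ne')
  set D : ℝ × ℝ →L[ℝ] ℂ := fderiv ℝ (polarMap b) x₀ with hD
  have hinj : Function.Injective D := by
    rw [injective_iff_map_eq_zero]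
    intro u hu
    have h1 := (hb.iso_polarMap hmem hpos.ne').self_of_nhds u u
    rw [← hD, hu] at h1
    simp only [map_zero] at h1
    have hρ := hb.orbRad_pos hmem hpos
    have h2 : (orbRad b x₀.1 * u.2) ^ 2 + u.1 ^ 2 = 0 := by linarith
    have h3 : u.1 = 0 := by nlinarith [sq_nonneg (orbRad b x₀.1 * u.2), sq_nonneg u.1]
    have h4 : orbRad b x₀.1 * u.2 = 0 := by nlinarith [sq_nonneg (orbRad b x₀.1 * u.2), sq_nonneg u.1]
    exact Prod.ext h3 ((mul_eq_zero.1 h4).resolve_left hρ.ne')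
  have hsurj : Function.Surjective D := hb.exists_fderiv_polarMap hmem hpos.ne'
  set De : (ℝ × ℝ) ≃L[ℝ] ℂ := ContinuousLinearEquiv.ofBijective D
    (LinearMap.ker_eq_bot.2 hinj) (LinearMap.range_eq_top.2 hsurj) with hDe
  have hDe' : HasFDerivAt (polarMap b) (De : ℝ × ℝ →L[ℝ] ℂ) x₀ := by
    have : (De : ℝ × ℝ →L[ℝ] ℂ) = D := by
      ext <;> simp [hDe]
    rw [this]
    exact (hΦ.differentiableAt (by norm_num)).hasFDerivAt
  set Ψ := hΦ.localInverse hDe' (by norm_num) with hΨ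
  have hΨc : ContDiffAt ℝ 2 Ψ (c t) := by
    rw [← hc0]; exact hΦ.to_localInverse hDe' (by norm_num)
  have hright : ∀ᶠ z in 𝓝 (c t), polarMap b (Ψ z) = z := by
    rw [← hc0]; exact (hΦ.hasStrictFDerivAt' hDe' (by norm_num)).eventually_right_inverse
  have hΨ0 : Ψ (c t) = x₀ := by
    rw [← hc0]; exact (hΦ.hasStrictFDerivAt' hDe' (by norm_num)).localInverse_apply_image
  have hcc : ContinuousAt c t := h.self_of_nhds.1.continuousAt
  have e1 : ∀ᶠ z in 𝓝 (c t), ContDiffAt ℝ 2 Ψ z := hΨc.eventually (by simp)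
  have e2 : ∀ᶠ z in 𝓝 (c t), (Ψ z).1 ∈ Set.range (arc b) ∧ 0 < (Ψ z).1 := by
    have : ContinuousAt (fun z => (Ψ z).1) (c t) := hΨc.continuousAt.fst
    refine this.eventually (Filter.inter_mem (hb.isOpen_range.mem_nhds ?_) (isOpen_Ioi.mem_nhds ?_))
    · change (Ψ (c t)).1 ∈ _; rw [hΨ0]; exact hmem
    · change (0:ℝ) < (Ψ (c t)).1; rw [hΨ0]; exact hpos
  have hall := (hcc.eventually (e1.and (e2.and hright.eventually_nhds))).and h.eventually_nhds
  -- the curve in polar coordinates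
  have step : ∀ τ, (ContDiffAt ℝ 2 Ψ (c τ) ∧ ((Ψ (c τ)).1 ∈ Set.range (arc b) ∧ 0 < (Ψ (c τ)).1) ∧
      ∀ᶠ z in 𝓝 (c τ), polarMap b (Ψ z) = z) → (∀ᶠ σ in 𝓝 τ, ChartGeo b c v σ) →
      HasDerivAt (fun σ => Ψ (c σ)) (fderiv ℝ Ψ (c τ) (v τ)) τ ∧
      v τ = fderiv ℝ (polarMap b) (Ψ (c τ)) (fderiv ℝ Ψ (c τ) (v τ)) := by
    intro τ ⟨g1, g2, g3⟩ g4
    have hcτ := g4.self_of_nhds.1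
    have hx : HasDerivAt (fun σ => Ψ (c σ)) (fderiv ℝ Ψ (c τ) (v τ)) τ :=
      HasFDerivAt.comp_hasDerivAt τ (l := Ψ) (g1.differentiableAt (by norm_num)).hasFDerivAt hcτ
    refine ⟨hx, ?_⟩
    have hd := ((hb.contDiffAt_polarMap g2.1 g2.2.ne').differentiableAt (by simp))
    have h1 := hasDerivAt_comp_fderiv (x := fun σ => Ψ (c σ)) hd hx
    refine (hcτ.congr_of_eventuallyEq ?_).unique h1
    filter_upwards [hcτ.continuousAt.eventually g3] with σ hσ using hσ
  set x : ℝ → ℝ × ℝ := fun σ => Ψ (c σ) with hxdef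
  set u : ℝ → ℝ × ℝ := fun σ => fderiv ℝ Ψ (c σ) (v σ) with hudef
  have main : ∀ᶠ τ in 𝓝 t, HasDerivAt x (u τ) τ ∧ v τ = fderiv ℝ (polarMap b) (x τ) (u τ) ∧
      polarMap b (x τ) = c τ ∧ (x τ).1 ∈ Set.range (arc b) ∧ 0 < (x τ).1 ∧
      ∃ a : ℝ × ℝ, HasDerivAt u a τ ∧
        a.1 = orbRad b (x τ).1 * deriv (orbRad b) (x τ).1 * (u τ).2 ^ 2 ∧
        orbRad b (x τ).1 * a.2 = - (2 * deriv (orbRad b) (x τ).1 * (u τ).1 * (u τ).2) ∧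
        (u τ).1 ^ 2 + orbRad b (x τ).1 ^ 2 * (u τ).2 ^ 2 = 1 := by
    filter_upwards [hall.eventually_nhds] with τ hτ
    obtain ⟨⟨g1, g2, g3⟩, g4⟩ := hτ.self_of_nhds
    obtain ⟨hx, hv⟩ := step τ ⟨g1, g2, g3⟩ g4
    obtain ⟨hcτ, hunit, acc, hacc, hel⟩ := g4.self_of_nhds
    refine ⟨hx, hv, g3.self_of_nhds, g2.1, g2.2, ?_⟩
    have hd2 : DifferentiableAt ℝ (fderiv ℝ Ψ) (c τ) :=
      (g1.fderiv_right (m := 1) (by norm_num)).differentiableAt (by norm_num)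
    have hu : HasDerivAt u (fderiv ℝ (fderiv ℝ Ψ) (c τ) (v τ) (v τ) + fderiv ℝ Ψ (c τ) acc) τ := by
      have h1 := HasFDerivAt.comp_hasDerivAt τ (l := fderiv ℝ Ψ) hd2.hasFDerivAt hcτ
      simpa using h1.clm_apply hacc
    set a := fderiv ℝ (fderiv ℝ Ψ) (c τ) (v τ) (v τ) + fderiv ℝ Ψ (c τ) acc
    have hΦτ := contDiffAt_two (hb.contDiffAt_polarMap g2.1 g2.2.ne')
    -- Both sides are the derivative of `v` at `τ`, one given and one computed through the polar
    -- coordinates.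
    have hacc2 : acc = fderiv ℝ (fderiv ℝ (polarMap b)) (x τ) (u τ) (u τ)
        + fderiv ℝ (polarMap b) (x τ) a := by
      refine hacc.unique ((hasDerivAt_fderiv_comp hΦτ hx hu).congr_of_eventuallyEq ?_)
      filter_upwards [hτ] with σ hσ
      exact (step σ hσ.1 hσ.2).2
    have hP := hb.hasDerivAt_orbRad g2.1
    have hiso := hb.iso_polarMap g2.1 g2.2.ne'
    have el (w : ℝ × ℝ) := hb.eulerLagrange_pullback hΦτ hP hiso (u τ) a w
    have hρ := hb.orbRad_ne g2.1 g2.2.ne'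
    have hcx : polarMap b (Ψ (c τ)) = c τ := g3.self_of_nhds
    refine ⟨a, hu, ?_, ?_, ?_⟩
    -- Testing with the two coordinate vectors yields the radial and then the angular equation.
    · have := el (1, 0)
      rw [← hacc2, ← hv, hcx, hel] at this
      simp at this
      simp only [hxdef]
      linarith
    · have := el (0, 1)
      rw [← hacc2, ← hv, hcx, hel] at this
      simp at this
      refine mul_left_cancel₀ hρ ?_
      simp only [hxdef] at this ⊢
      linarith
    · have := hiso.self_of_nhds (u τ) (u τ)
      rw [← hv, hcx, hunit] at this
      simp only [hxdef]
      linarith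
  -- The angular equation says that Clairaut's quantity `ρ² χ'` is locally constant.
  have hK : ∀ᶠ τ in 𝓝 t, orbRad b (x τ).1 ^ 2 * (u τ).2 = orbRad b (x t).1 ^ 2 * (u t).2 := by
    refine eventually_eq_of_hasDerivAt_zero (f := fun τ => orbRad b (x τ).1 ^ 2 * (u τ).2) ?_
    filter_upwards [main] with τ hτ
    obtain ⟨hx, -, -, hm, -, a, ha, -, ha2, -⟩ := hτ
    have hρd : HasDerivAt (fun τ => orbRad b (x τ).1) (deriv (orbRad b) (x τ).1 * (u τ).1) τ :=
      HasDerivAt.comp τ (h₂ := orbRad b) (hb.hasDerivAt_orbRad hm) (hasDerivAt_fst_comp hx)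
    have := (hρd.fun_pow 2).fun_mul (hasDerivAt_snd_comp ha)
    convert! this using 1
    simp only [Nat.cast_ofNat, Nat.add_one_sub_one, pow_one]
    linear_combination (-orbRad b (x τ).1) * ha2
  refine ⟨fun τ => (x τ).1, fun τ => (x τ).2, fun τ => (u τ).1, orbRad b (x t).1 ^ 2 * (u t).2, ?_⟩
  filter_upwards [main, hK] with τ hτ hKτ
  obtain ⟨hx, hv, hc, hm, hp, a, ha, ha1, ha2, hE⟩ := hτ
  have hρ := hb.orbRad_ne hm hp.ne'
  rw [← hKτ]
  have h2 : orbRad b (x τ).1 ^ 2 * (u τ).2 / orbRad b (x τ).1 ^ 2 = (u τ).2 := by field_simp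
  have h3 : orbRad b (x τ).1 ^ 2 * (u τ).2 / orbRad b (x τ).1 = orbRad b (x τ).1 * (u τ).2 := by
    field_simp
  refine ⟨hasDerivAt_fst_comp hx, ?_, ?_, ?_, hm, hp, hc.symm, ?_⟩
  · rw [h2]; exact hasDerivAt_snd_comp hx
  · have := hasDerivAt_fst_comp ha
    convert! this using 1
    rw [ha1]
    field_simp
  · rw [← hE]; field_simp
  · rw [h3, hv, hb.fderiv_polarMap hm hp.ne']

end IsRotForm

end Spindle

/-! ### Clairaut's relation and geodesics through the origin. -/

namespace Spindle

theorem polarMap_add (b : ℂ → LinearMap.BilinForm ℝ ℂ) (s χ a : ℝ) :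
    polarMap b (s, χ + a) = Complex.exp (a * Complex.I) * polarMap b (s, χ) := by
  unfold polarMap
  have : ((χ + a - twist b (arcInv b s) : ℝ) : ℂ) * Complex.I
      = a * Complex.I + ((χ - twist b (arcInv b s) : ℝ) : ℂ) * Complex.I := by
    push_cast; ring
  simp only [this, Complex.exp_add]
  ring

theorem polarVec_add (b : ℂ → LinearMap.BilinForm ℝ ℂ) (s χ a p q : ℝ) :
    polarVec b (s, χ + a) p q = Complex.exp (a * Complex.I) * polarVec b (s, χ) p q := by
  unfold polarVec
  have : ((χ + a - twist b (arcInv b s) : ℝ) : ℂ) * Complex.I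
      = a * Complex.I + ((χ - twist b (arcInv b s) : ℝ) : ℂ) * Complex.I := by
    push_cast; ring
  simp only [this, Complex.exp_add]
  ring

theorem polarVec_neg_neg (b : ℂ → LinearMap.BilinForm ℝ ℂ) (x : ℝ × ℝ) (p q : ℝ) :
    polarVec b x (-p) (-q) = -polarVec b x p q := by
  unfold polarVec
  push_cast
  ring

theorem eulerLagrange_neg (b : ℂ → LinearMap.BilinForm ℝ ℂ) (c v a w : ℂ) :
    eulerLagrange b c (-v) a w = eulerLagrange b c v a w := by
  unfold eulerLagrange
  simp only [map_neg, LinearMap.neg_apply, neg_neg]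
  have : (fun z => -(b z v) w) = -(fun z => b z v w) := rfl
  rw [this, fderiv_neg]
  simp

theorem ChartGeo.shift {b : ℂ → LinearMap.BilinForm ℝ ℂ} {c v : ℝ → ℂ} {t t₀ : ℝ}
    (h : ChartGeo b c v (t - t₀)) : ChartGeo b (fun τ => c (τ - t₀)) (fun τ => v (τ - t₀)) t := by
  obtain ⟨h1, h2, a, h3, h4⟩ := h
  exact ⟨h1.comp_sub_const t t₀, h2, a, h3.comp_sub_const t t₀, h4⟩

theorem ChartGeo.reverse {b : ℂ → LinearMap.BilinForm ℝ ℂ} {c v : ℝ → ℂ} {t t₀ : ℝ}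
    (h : ChartGeo b c v (t₀ - t)) : ChartGeo b (fun τ => c (t₀ - τ)) (fun τ => -v (t₀ - τ)) t := by
  obtain ⟨h1, h2, a, h3, h4⟩ := h
  have r : HasDerivAt (fun τ : ℝ => t₀ - τ) (-1) t := by
    simpa using (hasDerivAt_id t).const_sub t₀
  refine ⟨?_, ?_, a, ?_, ?_⟩
  · have e := h1.scomp t r
    rw [neg_one_smul] at e
    exact e
  · simpa using h2
  · have e := (h3.scomp t r).neg
    rw [neg_one_smul, neg_neg] at e
    exact e
  · intro w
    rw [eulerLagrange_neg]
    exact h4 w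

namespace IsRotForm

variable {b : ℂ → LinearMap.BilinForm ℝ ℂ} (hb : IsRotForm b)
include hb

/-- A negative radius amounts to a half turn, by oddness of `arcInv` and evenness of the twist. -/
theorem polarMap_neg {s : ℝ} (hs : s ∈ Set.range (arc b)) (χ : ℝ) :
    polarMap b (-s, χ) = polarMap b (s, χ + Real.pi) := by
  rw [polarMap_add, Complex.exp_pi_mul_I]
  simp only [polarMap, hb.arcInv_neg hs, hb.twist_neg]
  push_cast
  ring

theorem polarVec_neg {s : ℝ} (hs : s ∈ Set.range (arc b)) (χ p q : ℝ) :
    polarVec b (-s, χ) p q = polarVec b (s, χ + Real.pi) (-p) (-q) := by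
  rw [polarVec_neg_neg, polarVec_add, Complex.exp_pi_mul_I]
  simp only [polarVec, hb.arcInv_neg hs, hb.twist_neg, hb.radA_neg, hb.kap_neg, hb.coefG_neg]
  ring

theorem hasDerivAt_meridian {t : ℝ} (ht : t ∈ Set.range (arc b)) (χ : ℝ) :
    HasDerivAt (fun τ : ℝ => polarMap b (τ, χ)) (polarVec b (t, χ) 1 0) t := by
  have h := hb.hasFDerivAt_polarMap (x := (t, χ)) ht (1, 0)
  simp only [mul_zero] at h
  have h0 : HasDerivAt (fun τ : ℝ => polarMap b ((t, χ) + τ • ((1, 0) : ℝ × ℝ)))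
    (polarVec b (t, χ) 1 0) (t - t) := by rwa [sub_self]
  have h1 := h0.comp_sub_const t t
  convert! h1 using 1
  funext τ
  simp

theorem continuous_fderiv_form (v u : ℂ) :
    Continuous (fun p : ℂ × ℂ => fderiv ℝ (fun z => b z v u) p.1 p.2) :=
  (hb.smooth v u).continuous_fderiv_apply (by simp)

/-- Allows the geodesic equation of a meridian, known off the origin, to pass to the limit at the
origin. -/
theorem continuousAt_eulerLagrange {c v a : ℝ → ℂ} {t : ℝ} (hc : ContinuousAt c t)
    (hv : ContinuousAt v t) (ha : ContinuousAt a t) (w : ℂ) :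
    ContinuousAt (fun τ => eulerLagrange b (c τ) (v τ) (a τ) w) t := by
  have re' {f : ℝ → ℂ} (hf : ContinuousAt f t) : ContinuousAt (fun τ => (f τ).re) t :=
    Complex.continuous_re.continuousAt.comp hf
  have im' {f : ℝ → ℂ} (hf : ContinuousAt f t) : ContinuousAt (fun τ => (f τ).im) t :=
    Complex.continuous_im.continuousAt.comp hf
  have fm (v u : ℂ) : ContinuousAt (fun τ => b (c τ) v u) t :=
    (hb.smooth v u).continuous.continuousAt.comp (f := c) hc
  have fd (v u : ℂ) {f : ℝ → ℂ} (hf : ContinuousAt f t) :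
      ContinuousAt (fun τ => fderiv ℝ (fun z => b z v u) (c τ) (f τ)) t :=
    (hb.continuous_fderiv_form v u).continuousAt.comp (f := fun τ => (c τ, f τ)) (hc.prodMk hf)
  unfold eulerLagrange
  simp only [hb.fderiv_form _ (v _), hb.expand _ (a _) w]
  have wc : ContinuousAt (fun _ : ℝ => w) t := continuousAt_const
  have cr : ContinuousAt (fun _ : ℝ => w.re) t := continuousAt_const
  have ci : ContinuousAt (fun _ : ℝ => w.im) t := continuousAt_const
  refine ContinuousAt.sub (ContinuousAt.add ?_ ?_) (ContinuousAt.mul continuousAt_const ?_)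
  · exact ((((fm _ _).mul (re' ha)).mul cr).add ((fm _ _).mul (((re' ha).mul ci).add
      ((im' ha).mul cr)))).add (((fm _ _).mul (im' ha)).mul ci)
  · exact (((fd _ _ hv).mul ((re' hv).mul cr)).add ((fd _ _ hv).mul (((re' hv).mul ci).add
      ((im' hv).mul cr)))).add ((fd _ _ hv).mul ((im' hv).mul ci))
  · exact (((fd _ _ wc).mul ((re' hv).mul (re' hv))).add ((fd _ _ wc).mul
      (((re' hv).mul (im' hv)).add ((im' hv).mul (re' hv))))).add
      ((fd _ _ wc).mul ((im' hv).mul (im' hv)))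

/-- The curves orthogonal to the orbits are geodesics, also at the origin. -/
theorem chartGeo_meridian {t : ℝ} (ht : t ∈ Set.range (arc b)) (χ : ℝ) :
    ChartGeo b (fun τ => polarMap b (τ, χ)) (fun τ => polarVec b (τ, χ) 1 0) t := by
  have reg : ∀ τ ∈ Set.range (arc b), τ ≠ 0 →
      ChartGeo b (fun τ => polarMap b (τ, χ)) (fun τ => polarVec b (τ, χ) 1 0) τ := by
    intro τ hτ h0
    have := hb.chartGeo_polar (s := fun τ => τ) (χ := fun _ => χ) (p := fun _ => 1) (K := 0) (t := τ)
      (hasDerivAt_id τ) (by simpa using hasDerivAt_const τ χ)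
      (by simpa using hasDerivAt_const τ (1 : ℝ)) (by simp) hτ h0
    simpa using this
  rcases eq_or_ne t 0 with rfl | h0
  swap
  · exact reg t ht h0
  have hnb := hb.isOpen_range.mem_nhds ht
  set m : ℝ → ℂ := fun y => ((radA b y)⁻¹ : ℝ) * (1 - kap b y * Complex.I) with hm
  have hmd : Differentiable ℝ m := by
    have h1 : Differentiable ℝ (fun y => (radA b y)⁻¹) :=
      (hb.contDiff_radA.differentiable (by simp)).inv (fun y => (hb.radA_pos y).ne')
    have h2 : Differentiable ℝ (kap b) := hb.contDiff_kap.differentiable (by simp)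
    exact (Complex.ofRealCLM.differentiable.comp h1).mul
      ((differentiable_const _).sub ((Complex.ofRealCLM.differentiable.comp h2).mul_const _))
  have hmc : Continuous (deriv m) := by
    have h1 : ContDiff ℝ (⊤ : ℕ∞) (fun y => (radA b y)⁻¹) :=
      hb.contDiff_radA.inv (fun y => (hb.radA_pos y).ne')
    have : ContDiff ℝ (⊤ : ℕ∞) m :=
      (Complex.ofRealCLM.contDiff.comp h1).mul
      (contDiff_const.sub ((Complex.ofRealCLM.contDiff.comp hb.contDiff_kap).mul contDiff_const))
    exact this.continuous_deriv (by simp)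
  have hv : (fun τ => polarVec b (τ, χ) 1 0) = fun τ : ℝ =>
      Complex.exp ((χ - twist b (arcInv b τ) : ℝ) * Complex.I) * m (arcInv b τ) := by
    funext τ
    simp [polarVec, hm]
  -- The derivative of the velocity, written with functions that are continuous through the origin.
  set acc : ℝ → ℂ := fun τ =>
    Complex.exp ((χ - twist b (arcInv b τ) : ℝ) * Complex.I) *
      ((-(kap b (arcInv b τ) / arcInv b τ * (radA b (arcInv b τ))⁻¹) : ℝ) * Complex.I)
      * m (arcInv b τ) + Complex.exp ((χ - twist b (arcInv b τ) : ℝ) * Complex.I)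
      * ((radA b (arcInv b τ))⁻¹ • deriv m (arcInv b τ)) with hacc
  have hvd : ∀ τ ∈ Set.range (arc b), HasDerivAt (fun τ => polarVec b (τ, χ) 1 0) (acc τ) τ := by
    intro τ hτ
    rw [hv]
    have hY := hb.hasDerivAt_arcInv hτ
    have hT : HasDerivAt (fun τ => twist b (arcInv b τ)) _ τ :=
      HasDerivAt.comp τ (h₂ := twist b) (hb.hasDerivAt_twist _) hY
    have h1 := (((hT.const_sub χ).ofReal_comp).mul_const Complex.I).cexp
    have h2 : HasDerivAt (fun τ => m (arcInv b τ)) ((radA b (arcInv b τ))⁻¹ • deriv m (arcInv b τ)) τ :=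
      HasDerivAt.scomp τ (g₁ := m) (hmd _).hasDerivAt hY
    exact h1.mul h2
  have hYc : ContinuousAt (arcInv b) 0 := (hb.contDiffAt_arcInv ht).continuousAt
  have hac : ContinuousAt acc 0 := by
    have c1 : ContinuousAt (fun τ => Complex.exp ((χ - twist b (arcInv b τ) : ℝ) * Complex.I)) 0 := by
      have : ContinuousAt (fun τ => twist b (arcInv b τ)) 0 :=
        hb.continuous_twist.continuousAt.comp hYc
      exact Complex.continuous_exp.continuousAt.comp
        ((Complex.continuous_ofReal.continuousAt.comp (continuousAt_const.sub this)).mul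
          continuousAt_const)
    have c2 : ContinuousAt (fun τ => m (arcInv b τ)) 0 :=
      hmd.continuous.continuousAt.comp hYc
    have c3 : ContinuousAt (fun τ => (radA b (arcInv b τ))⁻¹) 0 :=
      (hb.contDiff_radA.continuous.continuousAt.comp hYc).inv₀ (hb.radA_pos _).ne'
    have c4 : ContinuousAt (fun τ => kap b (arcInv b τ) / arcInv b τ) 0 :=
      ContinuousAt.comp (g := fun y => kap b y / y) hb.continuous_kap_div.continuousAt hYc
    have c5 : ContinuousAt (fun τ => deriv m (arcInv b τ)) 0 := hmc.continuousAt.comp hYc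
    exact ((c1.mul ((Complex.continuous_ofReal.continuousAt.comp ((c4.mul c3).neg)).mul
      continuousAt_const)).mul c2).add (c1.mul (c3.smul c5))
  refine ⟨hb.hasDerivAt_meridian ht χ, by simp [hb.form_polar], acc 0, hvd 0 ht, fun w => ?_⟩
  have hcont := hb.continuousAt_eulerLagrange (c := fun τ => polarMap b (τ, χ))
    (hb.hasDerivAt_meridian ht χ).continuousAt (hvd 0 ht).continuousAt hac w
  -- On a punctured neighbourhood of the origin the expression is zero, and it is continuous at the
  -- origin.
  refine tendsto_nhds_unique (hcont.tendsto.mono_left nhdsWithin_le_nhds : Tendsto _ (𝓝[≠] (0 : ℝ)) _)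
    (tendsto_const_nhds.congr' ?_)
  filter_upwards [self_mem_nhdsWithin, nhdsWithin_le_nhds hnb] with τ h1 h2
  obtain ⟨-, -, a, ha, hel⟩ := reg τ h2 h1
  rw [(hvd τ h2).unique ha]
  exact (hel w).symm

/-- Clairaut's relation. -/
theorem hasDerivAt_clairaut {c v : ℝ → ℂ} {t : ℝ} (h : ChartGeo b c v t) :
    HasDerivAt (fun τ => b (c τ) (v τ) (Complex.I * c τ)) 0 t := by
  obtain ⟨hc, -, a, ha, hel⟩ := h
  have h1 := hb.hasDerivAt_form hc ha (hc.const_mul Complex.I)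
  have rotd (z : ℂ) : HasDerivAt (fun φ : ℝ => Complex.exp (φ * Complex.I) * z) (Complex.I * z) 0 := by
    have := (((hasDerivAt_id (0 : ℝ)).ofReal_comp.mul_const Complex.I).cexp).mul_const z
    simpa using this
  -- Rotation invariance differentiated at angle zero: `z ↦ I z` is a Killing field.
  have h2 := hb.hasDerivAt_form (rotd (c t)) (rotd (v t)) (rotd (v t))
  have h3 : (fun φ : ℝ => b (Complex.exp (φ * Complex.I) * c t) (Complex.exp (φ * Complex.I) * v t)
      (Complex.exp (φ * Complex.I) * v t)) = fun _ => b (c t) (v t) (v t) := by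
    funext φ
    exact hb.rot _ (Complex.norm_exp_ofReal_mul_I φ) _ _ _
  rw [h3] at h2
  have h4 := h2.unique (hasDerivAt_const (0 : ℝ) _)
  simp only [Complex.ofReal_zero, zero_mul, Complex.exp_zero, one_mul] at h4
  rw [hb.symm _ (Complex.I * v t)] at h4
  have h5 := hel (Complex.I * c t)
  unfold eulerLagrange at h5
  convert! h1 using 1
  linear_combination -h5 - h4 / 2

theorem clairaut_polar (x : ℝ × ℝ) (p q : ℝ) :
    b (polarMap b x) (polarVec b x p q) (Complex.I * polarMap b x) = q * orbRad b x.1 := by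
  have hG : Real.sqrt (coefG b (arcInv b x.1)) ≠ 0 := (Real.sqrt_pos.2 (hb.coefG_pos _)).ne'
  have : Complex.I * polarMap b x = polarVec b x 0 (orbRad b x.1) := by
    unfold polarMap polarVec orbRad orb
    rw [mul_div_cancel_left₀ _ hG]
    simp
    ring
  rw [this, hb.form_polar]
  ring

theorem norm_polarMap {s : ℝ} (hs : s ∈ Set.range (arc b)) (h0 : 0 ≤ s) (χ : ℝ) :
    ‖polarMap b (s, χ)‖ = arcInv b s := by
  have : 0 ≤ arcInv b s := by
    rcases h0.eq_or_lt with h | h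
    · rw [← h, hb.arcInv_zero]
    · exact (hb.arcInv_pos hs h).le
  unfold polarMap
  rw [norm_mul, Complex.norm_exp_ofReal_mul_I, mul_one, Complex.norm_real, Real.norm_of_nonneg this]

theorem arc_norm_polarMap {s : ℝ} (hs : s ∈ Set.range (arc b)) (h0 : 0 ≤ s) (χ : ℝ) :
    arc b ‖polarMap b (s, χ)‖ = s := by
  rw [hb.norm_polarMap hs h0, arc_arcInv hs]

/-- A geodesic through the origin is a curve orthogonal to the orbits, on the right. -/
theorem exists_right_of_chartGeo_zero {c v : ℝ → ℂ} {t : ℝ} (h : ∀ᶠ τ in 𝓝 t, ChartGeo b c v τ)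
    (h0 : c t = 0) : ∃ χ : ℝ, ∀ᶠ τ in 𝓝[>] t, c τ = polarMap b (τ - t, χ) := by
  have hv0 : v t ≠ 0 := by
    intro hv
    have := h.self_of_nhds.2.1
    simp [hv] at this
  have hne : ∀ᶠ τ in 𝓝[≠] t, c τ ≠ 0 := h.self_of_nhds.1.eventually_ne hv0
  -- The rotation field vanishes at the origin, so Clairaut's constant of this geodesic is zero.
  have hK : ∀ᶠ τ in 𝓝 t, b (c τ) (v τ) (Complex.I * c τ) = 0 := by
    have := eventually_eq_of_hasDerivAt_zero (f := fun τ => b (c τ) (v τ) (Complex.I * c τ))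
      (h.mono fun τ hτ => hb.hasDerivAt_clairaut hτ)
    simpa [h0] using this
  have hall : ∀ᶠ τ in 𝓝 t, ChartGeo b c v τ ∧ b (c τ) (v τ) (Complex.I * c τ) = 0 ∧
      (τ ≠ t → c τ ≠ 0) := h.and (hK.and (eventually_nhdsWithin_iff.1 hne))
  obtain ⟨ε, hε, hball⟩ := Metric.eventually_nhds_iff.1 hall
  -- normalized data on the interval to the right
  set J := Set.Ioo t (t + ε) with hJ
  have hJmem : ∀ τ ∈ J, dist τ t < ε := by
    intro τ hτ
    rw [Real.dist_eq, abs_of_pos (by linarith [hτ.1])]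
    linarith [hτ.2]
  -- `N` is the distance from the origin and `d` the direction with the twist removed. Vanishing of
  -- Clairaut's constant gives `N' = ±1` and `d' = 0` locally.
  set N : ℝ → ℝ := fun τ => arc b ‖c τ‖ with hN
  set d : ℝ → ℂ := fun τ => c τ / ‖c τ‖ * Complex.exp (twist b ‖c τ‖ * Complex.I) with hd
  have loc : ∀ τ ∈ J, ∃ p : ℝ, (p = 1 ∨ p = -1) ∧ HasDerivAt d 0 τ ∧ ∀ᶠ σ in 𝓝 τ, HasDerivAt N p σ := by
    intro τ hτ
    have hevJ : ∀ᶠ σ in 𝓝 τ, σ ∈ J := isOpen_Ioo.mem_nhds hτ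
    have hgeo : ∀ᶠ σ in 𝓝 τ, ChartGeo b c v σ := by
      filter_upwards [hevJ] with σ hσ using (hball (hJmem σ hσ)).1
    obtain ⟨s, χ, p, K, hloc⟩ := hb.exists_polar_of_chartGeo hgeo
      ((hball (hJmem τ hτ)).2.2 hτ.1.ne')
    have hK0 : K = 0 := by
      obtain ⟨-, -, -, -, hm, hp, h1, h2⟩ := hloc.self_of_nhds
      have h3 := (hball (hJmem τ hτ)).2.1
      rw [h1, h2, hb.clairaut_polar] at h3
      simp only at h3
      rwa [div_mul_cancel₀ _ (hb.orbRad_ne hm hp.ne')] at h3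
    subst hK0
    have hpc : ∀ᶠ σ in 𝓝 τ, p σ = p τ :=
      eventually_eq_of_hasDerivAt_zero (hloc.mono fun σ hσ => by simpa using hσ.2.2.1)
    have hχc : ∀ᶠ σ in 𝓝 τ, χ σ = χ τ :=
      eventually_eq_of_hasDerivAt_zero (hloc.mono fun σ hσ => by simpa using hσ.2.1)
    have hNs : ∀ᶠ σ in 𝓝 τ, N σ = s σ := by
      filter_upwards [hloc] with σ hσ
      obtain ⟨-, -, -, -, hm, hp, h1, -⟩ := hσ
      simp only [hN]
      rw [h1, hb.arc_norm_polarMap hm hp.le]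
    refine ⟨p τ, ?_, ?_, ?_⟩
    · have := hloc.self_of_nhds.2.2.2.1
      simp at this
      rcases this with h | h
      · exact Or.inl h
      · exact Or.inr h
    · refine (hasDerivAt_const τ (Complex.exp (χ τ * Complex.I))).congr_of_eventuallyEq ?_
      filter_upwards [hloc, hχc] with σ hσ hχσ
      obtain ⟨-, -, -, -, hm, hp, h1, -⟩ := hσ
      have hY := hb.arcInv_pos hm hp
      have hY' : (arcInv b (s σ) : ℂ) ≠ 0 := by exact_mod_cast hY.ne'
      simp only [hd]
      rw [h1, hb.norm_polarMap hm hp.le, polarMap, hχσ]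
      rw [mul_div_cancel_left₀ _ hY', ← Complex.exp_add]
      congr 1
      push_cast
      ring
    · filter_upwards [hloc, hpc, hNs.eventually_nhds] with σ hσ h1 h2
      rw [← h1]
      exact hσ.1.congr_of_eventuallyEq h2
  choose! P hP1 hP2 hP3 using loc
  -- a base point
  set τ₀ := t + ε / 2 with hτ₀
  have hτ₀J : τ₀ ∈ J := ⟨by linarith, by linarith⟩
  -- The sign of `N'` is locally constant, hence constant on the interval.
  have hderN : ∀ τ ∈ J, HasDerivAt N (deriv N τ₀) τ := by
    have hc : ∀ τ ∈ J, deriv N τ = deriv N τ₀ := by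
      intro τ hτ
      refine isOpen_Ioo.is_const_of_deriv_eq_zero (convex_Ioo _ _).isPreconnected (f := deriv N)
        ?_ ?_ hτ hτ₀J
      all_goals
        intro σ hσ
        have h1 : HasDerivAt (deriv N) 0 σ := by
          refine (hasDerivAt_const σ (P σ)).congr_of_eventuallyEq ?_
          filter_upwards [hP3 σ hσ] with ρ hρ using hρ.deriv
      · exact h1.differentiableAt.differentiableWithinAt
      · exact h1.deriv
    intro τ hτ
    rw [← hc τ hτ, (hP3 τ hτ).self_of_nhds.deriv]
    exact (hP3 τ hτ).self_of_nhds
  have hdc : ∀ τ ∈ J, d τ = d τ₀ := by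
    intro τ hτ
    exact isOpen_Ioo.is_const_of_deriv_eq_zero (convex_Ioo _ _).isPreconnected (f := d)
      (fun σ hσ => (hP2 σ hσ).differentiableAt.differentiableWithinAt)
      (fun σ hσ => (hP2 σ hσ).deriv) hτ hτ₀J
  have hP0 : deriv N τ₀ = 1 ∨ deriv N τ₀ = -1 := by
    rw [(hP3 τ₀ hτ₀J).self_of_nhds.deriv]; exact hP1 τ₀ hτ₀J
  have hNt : N t = 0 := by simp [hN, h0, arc_zero]
  have hNeq : ∀ τ ∈ J, N τ = deriv N τ₀ * (τ - t) := by
    intro τ hτ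
    have hsub : Set.Ioo t τ ⊆ J := fun σ hσ => ⟨hσ.1, hσ.2.trans hτ.2⟩
    have hcont : ContinuousOn N (Set.Icc t τ) := by
      intro σ hσ
      have : dist σ t < ε := by
        rw [Real.dist_eq, abs_of_nonneg (by linarith [hσ.1])]
        linarith [hσ.2, hτ.2]
      exact (hb.continuous_arc.continuousAt.comp
        ((hball this).1.1.continuousAt.norm)).continuousWithinAt
    obtain ⟨σ, hσ, h1⟩ := exists_hasDerivAt_eq_slope N (fun _ => deriv N τ₀) hτ.1 hcont
      (fun σ hσ => hderN σ (hsub hσ))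
    rw [hNt, sub_zero] at h1
    have : τ - t ≠ 0 := by linarith [hτ.1]
    field_simp at h1
    linarith
  -- `N` is zero at `t` and positive to its right, which excludes `-1`.
  have hone : deriv N τ₀ = 1 := by
    rcases hP0 with h1 | h1
    · exact h1
    · exfalso
      have h2 := hNeq τ₀ hτ₀J
      rw [h1] at h2
      have h3 : 0 < N τ₀ := by
        have := hb.strictMono_arc (norm_pos_iff.2 ((hball (hJmem τ₀ hτ₀J)).2.2 hτ₀J.1.ne'))
        rwa [arc_zero] at this
      linarith [hτ₀J.1]
  refine ⟨Complex.arg (d τ₀), ?_⟩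
  have hJev : ∀ᶠ τ in 𝓝[>] t, τ ∈ J := Ioo_mem_nhdsGT (by linarith)
  filter_upwards [hJev] with τ hτ
  have hcne := (hball (hJmem τ hτ)).2.2 hτ.1.ne'
  have hn : arcInv b (τ - t) = ‖c τ‖ := by
    have h1 := hNeq τ hτ
    rw [hone, one_mul] at h1
    rw [← h1, hN]
    exact hb.arcInv_arc _
  have hdn : ‖d τ₀‖ = 1 := by
    rw [← hdc τ hτ]
    simp only [hd]
    rw [norm_mul, Complex.norm_exp_ofReal_mul_I, norm_div, Complex.norm_real, norm_norm,
      div_self (norm_ne_zero_iff.2 hcne), mul_one]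
  have hdarg : Complex.exp (Complex.arg (d τ₀) * Complex.I) = d τ₀ := by
    have := Complex.norm_mul_exp_arg_mul_I (d τ₀)
    rwa [hdn, Complex.ofReal_one, one_mul] at this
  unfold polarMap
  simp only [hn]
  have : ((Complex.arg (d τ₀) - twist b ‖c τ‖ : ℝ) : ℂ) * Complex.I
      = Complex.arg (d τ₀) * Complex.I + (-(twist b ‖c τ‖ * Complex.I)) := by push_cast; ring
  rw [this, Complex.exp_add, hdarg, ← hdc τ hτ, Complex.exp_neg]
  simp only [hd]
  have h1 : (‖c τ‖ : ℂ) ≠ 0 := by exact_mod_cast norm_ne_zero_iff.2 hcne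
  have h2 := Complex.exp_ne_zero (twist b ‖c τ‖ * Complex.I)
  field_simp

/-- A geodesic through the origin is a curve orthogonal to the orbits. -/
theorem exists_meridian_of_chartGeo_zero {c v : ℝ → ℂ} {t : ℝ} (h : ∀ᶠ τ in 𝓝 t, ChartGeo b c v τ)
    (h0 : c t = 0) : ∃ χ : ℝ, ∀ᶠ τ in 𝓝 t, τ - t ∈ Set.range (arc b) ∧
      c τ = polarMap b (τ - t, χ) ∧ v τ = polarVec b (τ - t, χ) 1 0 := by
  obtain ⟨χ, hχ⟩ := hb.exists_right_of_chartGeo_zero h h0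
  have htend : Tendsto (fun τ => 2 * t - τ) (𝓝 t) (𝓝 t) := by
    have : Continuous (fun τ => 2 * t - τ) := by fun_prop
    have := this.tendsto t
    rwa [show 2 * t - t = t by ring] at this
  have hrev : ∀ᶠ τ in 𝓝 t, ChartGeo b (fun τ => c (2 * t - τ)) (fun τ => -v (2 * t - τ)) τ :=
    (htend.eventually h).mono fun τ hτ => hτ.reverse
  -- The left half is the right half of the reversed geodesic.
  obtain ⟨χ', hχ'⟩ := hb.exists_right_of_chartGeo_zero hrev (by
    rw [show 2 * t - t = t by ring]; exact h0)
  have hmem : ∀ᶠ τ in 𝓝 t, τ - t ∈ Set.range (arc b) := by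
    have : Continuous (fun τ => τ - t) := by fun_prop
    refine this.continuousAt.eventually (hb.isOpen_range.mem_nhds ?_)
    change t - t ∈ _; rw [sub_self]; exact zero_mem_range
  have hmer (χ : ℝ) : HasDerivAt (fun τ : ℝ => polarMap b (τ - t, χ)) (polarVec b (0, χ) 1 0) t := by
    have := hb.hasDerivAt_meridian (t := t - t) (by rw [sub_self]; exact zero_mem_range) χ
    have h1 := this.comp_sub_const t t
    rwa [sub_self] at h1
  have hleft : ∀ᶠ τ in 𝓝[<] t, c τ = polarMap b (τ - t, χ' + Real.pi) := by
    have ht2 : Tendsto (fun τ => 2 * t - τ) (𝓝[<] t) (𝓝[>] t) := by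
      refine tendsto_nhdsWithin_iff.2 ⟨htend.mono_left nhdsWithin_le_nhds, ?_⟩
      filter_upwards [self_mem_nhdsWithin] with τ hτ
      have : τ < t := hτ
      change t < 2 * t - τ
      linarith
    filter_upwards [ht2.eventually hχ', nhdsWithin_le_nhds hmem] with τ h1 h2
    simp only [sub_sub_cancel] at h1
    rw [h1, ← hb.polarMap_neg h2]
    congr 2
    ring
  have hz (χ : ℝ) : polarMap b (t - t, χ) = c t := by
    rw [sub_self, h0, polarMap]; simp [hb.arcInv_zero]
  have e1 : v t = polarVec b (0, χ) 1 0 := by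
    refine (uniqueDiffWithinAt_Ioi t).eq_deriv _ h.self_of_nhds.1.hasDerivWithinAt
      ((hmer χ).hasDerivWithinAt.congr_of_eventuallyEq hχ ?_)
    exact (hz χ).symm
  have e2 : v t = polarVec b (0, χ' + Real.pi) 1 0 := by
    refine (uniqueDiffWithinAt_Iio t).eq_deriv _ h.self_of_nhds.1.hasDerivWithinAt
      ((hmer _).hasDerivWithinAt.congr_of_eventuallyEq hleft ?_)
    exact (hz _).symm
  -- Both one-sided derivatives at `t` equal `v t`, so the angles of the two halves agree modulo
  -- `2π`.
  have hexp : Complex.exp (χ * Complex.I) = Complex.exp ((χ' + Real.pi : ℝ) * Complex.I) := by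
    have e3 := e1.symm.trans e2
    rw [← zero_add χ, polarVec_add, ← zero_add (χ' + Real.pi), polarVec_add] at e3
    refine mul_right_cancel₀ ?_ e3
    intro h1
    have := hb.form_polar (0, 0) 1 0 1 0
    rw [h1] at this
    simp at this
  have hpm (s : ℝ) : polarMap b (s, χ' + Real.pi) = polarMap b (s, χ) := by
    have h1 := polarMap_add b s 0 χ
    have h2 := polarMap_add b s 0 (χ' + Real.pi)
    rw [zero_add] at h1 h2
    rw [h1, h2, hexp]
  have hc : ∀ᶠ τ in 𝓝 t, c τ = polarMap b (τ - t, χ) := by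
    have h1 := eventually_nhdsWithin_iff.1 hχ
    have h2 := eventually_nhdsWithin_iff.1 hleft
    filter_upwards [h1, h2] with τ a1 a2
    rcases lt_trichotomy τ t with hlt | heq | hgt
    · rw [a2 hlt, hpm]
    · rw [heq]; exact (hz χ).symm
    · exact a1 hgt
  refine ⟨χ, ?_⟩
  filter_upwards [hmem, hc.eventually_nhds, h] with τ h1 h2 h3
  refine ⟨h1, h2.self_of_nhds, ?_⟩
  have h4 := (hb.hasDerivAt_meridian h1 χ).comp_sub_const τ t
  exact h3.1.unique (h4.congr_of_eventuallyEq h2)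

end IsRotForm

end Spindle

/-! ### Straightened coordinates, continuous through the origin, and the area of a disc. -/

namespace Spindle

/-- The chart point whose straightened polar coordinate is the complex number `ξ`. -/
noncomputable def straightPt (b : ℂ → LinearMap.BilinForm ℝ ℂ) (ξ : ℂ) : ℂ :=
  Complex.exp (-(twist b (arcInv b ‖ξ‖) * Complex.I)) * ((arcInv b ‖ξ‖ / ‖ξ‖ : ℝ) * ξ)

/-- The chart vector at `straightPt b ξ` whose straightened direction is `ν`. -/
noncomputable def straightVec (b : ℂ → LinearMap.BilinForm ℝ ℂ) (ξ ν : ℂ) : ℂ :=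
  Complex.exp (-(twist b (arcInv b ‖ξ‖) * Complex.I)) *
    (ν * ((Real.sqrt (coefG b (arcInv b ‖ξ‖)))⁻¹ : ℝ)
      + (((radA b (arcInv b ‖ξ‖))⁻¹ : ℝ) * (1 - kap b (arcInv b ‖ξ‖) * Complex.I)
        - ((Real.sqrt (coefG b (arcInv b ‖ξ‖)))⁻¹ : ℝ))
      * (((ν * (starRingEnd ℂ) ξ).re / ‖ξ‖ ^ 2 : ℝ) * ξ))

/-- The straightened polar coordinate of a chart point, as a complex number. -/
noncomputable def unstraightPt (b : ℂ → LinearMap.BilinForm ℝ ℂ) (z : ℂ) : ℂ :=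
  Complex.exp (twist b ‖z‖ * Complex.I) * ((arc b ‖z‖ / ‖z‖ : ℝ) * z)

/-- The straightened direction of a chart vector. -/
noncomputable def unstraightVec (b : ℂ → LinearMap.BilinForm ℝ ℂ) (z v : ℂ) : ℂ :=
  Complex.exp (twist b ‖z‖ * Complex.I) *
    (v * (Real.sqrt (coefG b ‖z‖) : ℝ)
      + (radA b ‖z‖ - Real.sqrt (coefG b ‖z‖) + Real.sqrt (coefG b ‖z‖) * kap b ‖z‖ * Complex.I)
      * (((v * (starRingEnd ℂ) z).re / ‖z‖ ^ 2 : ℝ) * z))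

/-- The projection of a vector to the radial direction is bounded by the norm of the vector, so at
the origin the factor `q`, which vanishes there, forces the limit `0`. -/
theorem continuousAt_radialProj {q : ℂ → ℂ} {x : ℂ × ℂ} (hq : ContinuousAt q x.1) (h0 : q 0 = 0) :
    ContinuousAt (fun x : ℂ × ℂ =>
      q x.1 * (((x.2 * (starRingEnd ℂ) x.1).re / ‖x.1‖ ^ 2 : ℝ) * x.1)) x := by
  obtain ⟨ξ, ν⟩ := x
  rcases eq_or_ne ξ 0 with rfl | hξ
  · unfold ContinuousAt
    simp only [h0, zero_mul]
    have hq0 : Tendsto (fun x : ℂ × ℂ => ‖q x.1‖ * ‖x.2‖) (𝓝 (0, ν)) (𝓝 0) := by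
      have h1 : Tendsto (fun x : ℂ × ℂ => q x.1) (𝓝 ((0 : ℂ), ν)) (𝓝 (q 0)) :=
        hq.tendsto.comp (continuous_fst.tendsto ((0 : ℂ), ν))
      have h2 : Tendsto (fun x : ℂ × ℂ => ‖x.2‖) (𝓝 ((0 : ℂ), ν)) (𝓝 ‖ν‖) :=
        (continuous_snd.norm).tendsto _
      have := h1.norm.mul h2
      simpa [h0] using this
    refine squeeze_zero_norm (fun x => ?_) hq0
    rw [norm_mul, norm_mul, Complex.norm_real, Real.norm_eq_abs, abs_div]
    refine mul_le_mul_of_nonneg_left ?_ (norm_nonneg _)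
    rcases eq_or_ne x.1 0 with h | h
    · simp [h]
    · have hp : 0 < ‖x.1‖ := norm_pos_iff.2 h
      have h1 : |(x.2 * (starRingEnd ℂ) x.1).re| ≤ ‖x.2‖ * ‖x.1‖ := by
        refine (Complex.abs_re_le_norm _).trans ?_
        rw [norm_mul, Complex.norm_conj]
      rw [abs_of_pos (pow_pos hp 2), div_mul_eq_mul_div, div_le_iff₀ (pow_pos hp 2)]
      calc _ ≤ (‖x.2‖ * ‖x.1‖) * ‖x.1‖ := mul_le_mul_of_nonneg_right h1 hp.le
        _ = _ := by ring
  · have hn : ‖ξ‖ ^ 2 ≠ 0 := pow_ne_zero 2 (norm_ne_zero_iff.2 hξ)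
    have c1 : ContinuousAt (fun x : ℂ × ℂ => q x.1) (ξ, ν) := ContinuousAt.comp (f := Prod.fst) hq
      continuousAt_fst
    have c2 : ContinuousAt (fun x : ℂ × ℂ => (x.2 * (starRingEnd ℂ) x.1).re) (ξ, ν) := by
      have : Continuous (fun x : ℂ × ℂ => (x.2 * (starRingEnd ℂ) x.1).re) := by
        refine Complex.continuous_re.comp (continuous_snd.mul ?_)
        exact Complex.continuous_conj.comp continuous_fst
      exact this.continuousAt
    have c3 : ContinuousAt (fun x : ℂ × ℂ => ‖x.1‖ ^ 2) (ξ, ν) :=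
      (continuous_fst.norm.pow 2).continuousAt
    exact c1.mul ((Complex.continuous_ofReal.continuousAt.comp (c2.div c3 hn)).mul continuousAt_fst)

theorem continuousAt_radialScale {f : ℂ → ℝ} {ξ : ℂ} (hf : ContinuousAt f ξ) (h0 : f 0 = 0) :
    ContinuousAt (fun ξ => ((f ξ / ‖ξ‖ : ℝ) : ℂ) * ξ) ξ := by
  rcases eq_or_ne ξ 0 with rfl | hξ
  · unfold ContinuousAt
    simp only [mul_zero]
    have hf0 : Tendsto (fun ξ : ℂ => |f ξ|) (𝓝 0) (𝓝 0) := by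
      have := hf.tendsto.abs
      simpa [h0] using this
    refine squeeze_zero_norm (fun x => ?_) hf0
    rw [norm_mul, Complex.norm_real, norm_div, norm_norm, Real.norm_eq_abs]
    rcases eq_or_ne x 0 with h | h
    · simp [h]
    · rw [div_mul_cancel₀ _ (norm_ne_zero_iff.2 h)]
  · exact (Complex.continuous_ofReal.continuousAt.comp
      (hf.div continuous_norm.continuousAt (norm_ne_zero_iff.2 hξ))).mul continuousAt_id

theorem exp_I_mul_conj (a : ℝ) :
    Complex.exp (a * Complex.I) * (starRingEnd ℂ) (Complex.exp (a * Complex.I)) = 1 := by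
  rw [Complex.mul_conj, Complex.normSq_eq_norm_sq, Complex.norm_exp_ofReal_mul_I]
  simp

theorem exp_I_eq (a : ℝ) : Complex.exp (a * Complex.I) = Real.cos a + Real.sin a * Complex.I := by
  rw [Complex.exp_mul_I]; simp

namespace IsRotForm

variable {b : ℂ → LinearMap.BilinForm ℝ ℂ} (hb : IsRotForm b)
include hb

theorem continuousAt_straightPt {ξ : ℂ} (hξ : ‖ξ‖ ∈ Set.range (arc b)) :
    ContinuousAt (straightPt b) ξ := by
  have hY : ContinuousAt (fun ξ : ℂ => arcInv b ‖ξ‖) ξ :=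
    ContinuousAt.comp (g := arcInv b) (hb.contDiffAt_arcInv hξ).continuousAt continuous_norm.continuousAt
  refine ContinuousAt.mul ?_ (continuousAt_radialScale hY (by simp [hb.arcInv_zero]))
  refine Complex.continuous_exp.continuousAt.comp (ContinuousAt.neg (ContinuousAt.mul ?_ continuousAt_const))
  exact Complex.continuous_ofReal.continuousAt.comp (hb.continuous_twist.continuousAt.comp hY)

/-- Only the radial projection is discontinuous at `ξ = 0`, and its coefficient vanishes there since
`kap 0 = 0` and `radA 0 = √G(0)`. -/
theorem continuousAt_straightVec {x : ℂ × ℂ} (hξ : ‖x.1‖ ∈ Set.range (arc b)) :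
    ContinuousAt (fun x : ℂ × ℂ => straightVec b x.1 x.2) x := by
  have hY : ContinuousAt (fun ξ : ℂ => arcInv b ‖ξ‖) x.1 :=
    ContinuousAt.comp (g := arcInv b) (hb.contDiffAt_arcInv hξ).continuousAt continuous_norm.continuousAt
  have ofr {f : ℂ → ℝ} (hf : ContinuousAt f x.1) : ContinuousAt (fun ξ => (f ξ : ℂ)) x.1 :=
    Complex.continuous_ofReal.continuousAt.comp hf
  have cT := ofr (hb.continuous_twist.continuousAt.comp hY)
  have cY {f : ℝ → ℝ} (hf : Continuous f) : ContinuousAt (fun ξ : ℂ => f (arcInv b ‖ξ‖)) x.1 :=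
    ContinuousAt.comp (g := f) hf.continuousAt hY
  have cG : ContinuousAt (fun ξ : ℂ => (Real.sqrt (coefG b (arcInv b ‖ξ‖)))⁻¹) x.1 :=
    (cY hb.contDiff_sqrtG.continuous).inv₀ (Real.sqrt_pos.2 (hb.coefG_pos _)).ne'
  have cA : ContinuousAt (fun ξ : ℂ => (radA b (arcInv b ‖ξ‖))⁻¹) x.1 :=
    (cY hb.contDiff_radA.continuous).inv₀ (hb.radA_pos _).ne'
  have ck : ContinuousAt (fun ξ : ℂ => kap b (arcInv b ‖ξ‖)) x.1 :=
    cY hb.contDiff_kap.continuous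
  have fst {f : ℂ → ℂ} (hf : ContinuousAt f x.1) : ContinuousAt (fun y : ℂ × ℂ => f y.1) x :=
    ContinuousAt.comp (f := Prod.fst) hf continuousAt_fst
  unfold straightVec
  refine ContinuousAt.mul ?_ (ContinuousAt.add ?_ ?_)
  · exact fst (Complex.continuous_exp.continuousAt.comp (cT.mul continuousAt_const).neg)
  · exact continuousAt_snd.mul (fst (ofr cG))
  · refine continuousAt_radialProj (q := fun ξ =>
      (((radA b (arcInv b ‖ξ‖))⁻¹ : ℝ) * (1 - kap b (arcInv b ‖ξ‖) * Complex.I)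
        - ((Real.sqrt (coefG b (arcInv b ‖ξ‖)))⁻¹ : ℝ))) ?_ ?_
    · exact ((ofr cA).mul (continuousAt_const.sub ((ofr ck).mul continuousAt_const))).sub (ofr cG)
    · simp [hb.arcInv_zero, hb.kap_zero, hb.radA_zero]

theorem continuous_unstraightPt : Continuous (unstraightPt b) := by
  rw [continuous_iff_continuousAt]
  intro z
  have hY : Continuous (fun z : ℂ => arc b ‖z‖) := hb.continuous_arc.comp continuous_norm
  refine ContinuousAt.mul ?_ (continuousAt_radialScale hY.continuousAt (by simp [arc_zero]))
  refine Complex.continuous_exp.continuousAt.comp (ContinuousAt.mul ?_ continuousAt_const)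
  exact (Complex.continuous_ofReal.comp (hb.continuous_twist.comp continuous_norm)).continuousAt

theorem continuous_unstraightVec : Continuous (fun x : ℂ × ℂ => unstraightVec b x.1 x.2) := by
  rw [continuous_iff_continuousAt]
  intro x
  have ofr {f : ℝ → ℝ} (hf : Continuous f) : ContinuousAt (fun ξ : ℂ => (f ‖ξ‖ : ℂ)) x.1 :=
    (Complex.continuous_ofReal.comp (hf.comp continuous_norm)).continuousAt
  have fst {f : ℂ → ℂ} (hf : ContinuousAt f x.1) : ContinuousAt (fun y : ℂ × ℂ => f y.1) x :=
    ContinuousAt.comp (f := Prod.fst) hf continuousAt_fst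
  have cG := ofr hb.contDiff_sqrtG.continuous
  unfold unstraightVec
  refine ContinuousAt.mul ?_ (ContinuousAt.add ?_ ?_)
  · exact fst (Complex.continuous_exp.continuousAt.comp
      ((ofr hb.continuous_twist).mul continuousAt_const))
  · exact continuousAt_snd.mul (fst cG)
  · refine continuousAt_radialProj (q := fun z =>
      (radA b ‖z‖ - Real.sqrt (coefG b ‖z‖) + Real.sqrt (coefG b ‖z‖) * kap b ‖z‖ * Complex.I)) ?_ ?_
    · exact ((ofr hb.contDiff_radA.continuous).sub cG).add
        ((cG.mul (ofr hb.contDiff_kap.continuous)).mul continuousAt_const)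
    · simp [hb.kap_zero, hb.radA_zero]

/-- At the origin the polar angle `χ` and the angle `α` against the meridian are not determined by
the tangent vector, but `s exp(χ I)` and `exp((χ + α) I)` are. Writing points and unit vectors in
these terms is what later gives continuity at the poles of maps from and to the unit tangent bundle.
-/
theorem straight_of_nonneg {s : ℝ} (h0 : 0 ≤ s) (χ α : ℝ) :
    straightPt b (s * Complex.exp (χ * Complex.I)) = polarMap b (s, χ) ∧
    straightVec b (s * Complex.exp (χ * Complex.I)) (Complex.exp ((χ + α : ℝ) * Complex.I))
      = polarVec b (s, χ) (Real.cos α) (Real.sin α) := by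
  have hn : ‖(s : ℂ) * Complex.exp (χ * Complex.I)‖ = s := by
    rw [norm_mul, Complex.norm_exp_ofReal_mul_I, mul_one, Complex.norm_real, Real.norm_of_nonneg h0]
  have hexp : Complex.exp ((χ - twist b (arcInv b s) : ℝ) * Complex.I)
      = Complex.exp (χ * Complex.I) * Complex.exp (-(twist b (arcInv b s) * Complex.I)) := by
    rw [← Complex.exp_add]; congr 1; push_cast; ring
  have hexp2 : Complex.exp ((χ + α : ℝ) * Complex.I)
      = Complex.exp (χ * Complex.I) * (Real.cos α + Real.sin α * Complex.I) := by
    rw [← exp_I_eq, ← Complex.exp_add]; congr 1; push_cast; ring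
  have hc := exp_I_mul_conj χ
  constructor
  · simp only [straightPt, polarMap, hn, hexp]
    rcases eq_or_ne s 0 with h | h
    · simp [h, hb.arcInv_zero]
    · have : (s : ℂ) ≠ 0 := by exact_mod_cast h
      push_cast
      field_simp
  · simp only [straightVec, polarVec, hn, hexp, hexp2]
    have h1 : Complex.exp (χ * Complex.I) * (Real.cos α + Real.sin α * Complex.I)
        * (starRingEnd ℂ) (s * Complex.exp (χ * Complex.I))
        = s * (Real.cos α + Real.sin α * Complex.I) := by
      rw [map_mul, Complex.conj_ofReal]
      linear_combination (s * (Real.cos α + Real.sin α * Complex.I)) * hc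
    have h2 : (s * (Real.cos α + Real.sin α * Complex.I) : ℂ).re = s * Real.cos α := by
      rw [Complex.re_ofReal_mul]
      simp [-Complex.ofReal_cos, -Complex.ofReal_sin]
    rw [h1, h2]
    have hG : (Real.sqrt (coefG b (arcInv b s)) : ℂ) ≠ 0 := by
      exact_mod_cast (Real.sqrt_pos.2 (hb.coefG_pos _)).ne'
    rcases eq_or_ne s 0 with h | h
    · simp only [h, hb.arcInv_zero, hb.kap_zero, hb.radA_zero]
      push_cast
      ring
    · have h3 : s * Real.cos α / s ^ 2 = Real.cos α / s := by field_simp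
      have : (s : ℂ) ≠ 0 := by exact_mod_cast h
      rw [h3]
      push_cast
      field_simp
      ring

/-- The data `(s, χ, α)` and `(-s, χ + π, α + π)` describe the same vector, so negative radii reduce
to positive ones. -/
theorem straight_polar {s : ℝ} (hs : s ∈ Set.range (arc b)) (χ α : ℝ) :
    straightPt b (s * Complex.exp (χ * Complex.I)) = polarMap b (s, χ) ∧
    straightVec b (s * Complex.exp (χ * Complex.I)) (Complex.exp ((χ + α : ℝ) * Complex.I))
      = polarVec b (s, χ) (Real.cos α) (Real.sin α) := by
  rcases le_total 0 s with h0 | h0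
  · exact hb.straight_of_nonneg h0 χ α
  · have hs' := hb.range_neg hs
    have h1 := hb.straight_of_nonneg (neg_nonneg.2 h0) (χ + Real.pi) (α + Real.pi)
    have e1 : ((-s : ℝ) : ℂ) * Complex.exp ((χ + Real.pi : ℝ) * Complex.I)
        = s * Complex.exp (χ * Complex.I) := by
      have : ((χ + Real.pi : ℝ) : ℂ) * Complex.I = χ * Complex.I + Real.pi * Complex.I := by
        push_cast; ring
      rw [this, Complex.exp_add, Complex.exp_pi_mul_I]
      push_cast; ring
    have e2 : Complex.exp ((χ + Real.pi + (α + Real.pi) : ℝ) * Complex.I)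
        = Complex.exp ((χ + α : ℝ) * Complex.I) := by
      have : ((χ + Real.pi + (α + Real.pi) : ℝ) : ℂ) * Complex.I
          = ((χ + α : ℝ) : ℂ) * Complex.I + 2 * Real.pi * Complex.I := by
        push_cast; ring
      rw [this, Complex.exp_add, Complex.exp_two_pi_mul_I, mul_one]
    rw [e1, e2, Real.cos_add_pi, Real.sin_add_pi, ← hb.polarMap_neg hs', ← hb.polarVec_neg hs',
      neg_neg] at h1
    exact h1

theorem unstraight_of_nonneg {s : ℝ} (hs : s ∈ Set.range (arc b)) (h0 : 0 ≤ s) (χ α : ℝ) :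
    unstraightPt b (polarMap b (s, χ)) = s * Complex.exp (χ * Complex.I) ∧
    unstraightVec b (polarMap b (s, χ)) (polarVec b (s, χ) (Real.cos α) (Real.sin α))
      = Complex.exp ((χ + α : ℝ) * Complex.I) := by
  have hn := hb.norm_polarMap hs h0 χ
  have hexp : Complex.exp ((χ - twist b (arcInv b s) : ℝ) * Complex.I)
      = Complex.exp (χ * Complex.I) * Complex.exp (-(twist b (arcInv b s) * Complex.I)) := by
    rw [← Complex.exp_add]; congr 1; push_cast; ring
  have hexp2 : Complex.exp ((χ + α : ℝ) * Complex.I)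
      = Complex.exp (χ * Complex.I) * (Real.cos α + Real.sin α * Complex.I) := by
    rw [← exp_I_eq, ← Complex.exp_add]; congr 1; push_cast; ring
  have hinv : Complex.exp (twist b (arcInv b s) * Complex.I)
      * Complex.exp (-(twist b (arcInv b s) * Complex.I)) = 1 := by
    rw [← Complex.exp_add, add_neg_cancel, Complex.exp_zero]
  have hc := exp_I_mul_conj (χ - twist b (arcInv b s))
  rw [hexp] at hc
  constructor
  · simp only [unstraightPt, hn, arc_arcInv hs]
    simp only [polarMap, hexp]
    rcases eq_or_ne s 0 with h | h
    · simp [h]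
    · have : (arcInv b s : ℂ) ≠ 0 := by exact_mod_cast arcInv_ne hs h
      push_cast
      field_simp
      linear_combination (s : ℂ) * hinv
  · simp only [unstraightVec, hn]
    simp only [polarMap, polarVec, hexp, hexp2]
    set ζ := Complex.exp (χ * Complex.I)
    set τ := Complex.exp (-(twist b (arcInv b s) * Complex.I))
    set τ' := Complex.exp (twist b (arcInv b s) * Complex.I)
    set Y := arcInv b s with hYdef
    have hA0 : (radA b Y : ℂ) ≠ 0 := by exact_mod_cast (hb.radA_pos Y).ne'
    have hG : (Real.sqrt (coefG b Y) : ℂ) ≠ 0 := by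
      exact_mod_cast (Real.sqrt_pos.2 (hb.coefG_pos _)).ne'
    set w : ℂ := ((radA b Y)⁻¹ * Real.cos α : ℝ) * (1 - kap b Y * Complex.I)
      + (Real.sin α / Real.sqrt (coefG b Y) : ℝ) * Complex.I with hw
    have h1 : ζ * τ * w * (starRingEnd ℂ) (Y * (ζ * τ)) = Y * w := by
      rw [map_mul, Complex.conj_ofReal]
      linear_combination (Y * w) * hc
    have hwre : w.re = (radA b Y)⁻¹ * Real.cos α := by
      rw [hw, Complex.add_re, Complex.re_ofReal_mul, Complex.re_ofReal_mul]
      simp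
    have h2 : (Y * w : ℂ).re = Y * ((radA b Y)⁻¹ * Real.cos α) := by
      rw [Complex.re_ofReal_mul, hwre]
    rw [h1, h2]
    rcases eq_or_ne s 0 with h | h
    · have hY0 : Y = 0 := by rw [hYdef, h, hb.arcInv_zero]
      rw [hw]
      simp only [hY0, hb.kap_zero, hb.radA_zero] at *
      push_cast
      field_simp
      linear_combination (ζ * (Complex.cos α + Complex.I * Complex.sin α)) * hinv
    · have hY : Y ≠ 0 := arcInv_ne hs h
      have h3 : Y * ((radA b Y)⁻¹ * Real.cos α) / Y ^ 2 = (radA b Y)⁻¹ * Real.cos α / Y := by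
        field_simp
      have hY' : (Y : ℂ) ≠ 0 := by exact_mod_cast hY
      rw [h3, hw]
      push_cast
      field_simp
      linear_combination (ζ * (Complex.cos α + Complex.I * Complex.sin α) * radA b Y) * hinv

theorem unstraight_polar {s : ℝ} (hs : s ∈ Set.range (arc b)) (χ α : ℝ) :
    unstraightPt b (polarMap b (s, χ)) = s * Complex.exp (χ * Complex.I) ∧
    unstraightVec b (polarMap b (s, χ)) (polarVec b (s, χ) (Real.cos α) (Real.sin α))
      = Complex.exp ((χ + α : ℝ) * Complex.I) := by
  rcases le_total 0 s with h0 | h0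
  · exact hb.unstraight_of_nonneg hs h0 χ α
  · have hs' := hb.range_neg hs
    have h1 := hb.unstraight_of_nonneg hs' (neg_nonneg.2 h0) (χ + Real.pi) (α + Real.pi)
    have e1 : ((-s : ℝ) : ℂ) * Complex.exp ((χ + Real.pi : ℝ) * Complex.I)
        = s * Complex.exp (χ * Complex.I) := by
      have : ((χ + Real.pi : ℝ) : ℂ) * Complex.I = χ * Complex.I + Real.pi * Complex.I := by
        push_cast; ring
      rw [this, Complex.exp_add, Complex.exp_pi_mul_I]
      push_cast; ring
    have e2 : Complex.exp ((χ + Real.pi + (α + Real.pi) : ℝ) * Complex.I)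
        = Complex.exp ((χ + α : ℝ) * Complex.I) := by
      have : ((χ + Real.pi + (α + Real.pi) : ℝ) : ℂ) * Complex.I
          = ((χ + α : ℝ) : ℂ) * Complex.I + 2 * Real.pi * Complex.I := by
        push_cast; ring
      rw [this, Complex.exp_add, Complex.exp_two_pi_mul_I, mul_one]
    rw [e1, e2, Real.cos_add_pi, Real.sin_add_pi, ← hb.polarMap_neg hs', ← hb.polarVec_neg hs',
      neg_neg] at h1
    exact h1

/-- The determinant of the metric tensor is radial. -/
theorem det_radial (z : ℂ) : b z 1 1 * b z Complex.I Complex.I - b z 1 Complex.I ^ 2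
    = coefE b ‖z‖ * coefG b ‖z‖ - coefF b ‖z‖ ^ 2 := by
  set ζ : ℂ := Complex.exp (Complex.arg z * Complex.I) with hζ
  have hζn : ‖ζ‖ = 1 := Complex.norm_exp_ofReal_mul_I _
  have hz : ζ * (‖z‖ : ℝ) = z := by
    rw [mul_comm]; exact Complex.norm_mul_exp_arg_mul_I z
  have hcc : ζ * (starRingEnd ℂ) ζ = 1 := exp_I_mul_conj _
  have hr (v u : ℂ) : b z v u = b (‖z‖ : ℝ) ((starRingEnd ℂ) ζ * v) ((starRingEnd ℂ) ζ * u) := by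
    rw [← hb.rot ζ hζn (‖z‖ : ℝ), hz, ← mul_assoc, ← mul_assoc, hcc, one_mul, one_mul]
  have h2 : ζ.re ^ 2 + ζ.im ^ 2 = 1 := by
    have := Complex.sq_norm ζ
    rw [hζn, Complex.normSq_apply] at this
    nlinarith
  rw [hr, hr, hr]
  simp only [hb.expand (‖z‖ : ℝ) ((starRingEnd ℂ) ζ * _)]
  change _ = b (‖z‖ : ℝ) 1 1 * b (‖z‖ : ℝ) Complex.I Complex.I - b (‖z‖ : ℝ) 1 Complex.I ^ 2
  simp
  set e := b (‖z‖ : ℝ) 1 1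
  set f := b (‖z‖ : ℝ) 1 Complex.I
  set h := b (‖z‖ : ℝ) Complex.I Complex.I
  have h3 : ζ.im ^ 2 = 1 - ζ.re ^ 2 := by linarith
  linear_combination ((e * h - f ^ 2) * (ζ.re ^ 2 + ζ.im ^ 2 + 1)) * h2

/-- The area of the closed unit disc. -/
theorem integral_density : ∫ z in Metric.closedBall (0 : ℂ) 1,
    Real.sqrt (b z 1 1 * b z Complex.I Complex.I - b z 1 Complex.I ^ 2)
    = 2 * Real.pi * ∫ s in (0 : ℝ)..arc b 1, orbRad b s := by
  set D : ℝ → ℝ := fun y => Real.sqrt (coefE b y * coefG b y - coefF b y ^ 2) with hD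
  have h1 : ∫ z in Metric.closedBall (0 : ℂ) 1,
      Real.sqrt (b z 1 1 * b z Complex.I Complex.I - b z 1 Complex.I ^ 2)
      = ∫ z : ℂ, (Set.Iic (1 : ℝ)).indicator D ‖z‖ := by
    rw [← MeasureTheory.integral_indicator measurableSet_closedBall]
    congr 1
    funext z
    by_cases hz : ‖z‖ ≤ 1
    · rw [Set.indicator_of_mem (by simpa using hz), Set.indicator_of_mem (by simpa using hz),
        hb.det_radial]
    · rw [Set.indicator_of_notMem (by simpa using hz), Set.indicator_of_notMem (by simpa using hz)]
  rw [h1, MeasureTheory.integral_fun_norm_addHaar]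
  have h2 : ∫ y in Set.Ioi (0 : ℝ), y ^ (Module.finrank ℝ ℂ - 1) • (Set.Iic (1 : ℝ)).indicator D y
      = ∫ y in (0 : ℝ)..1, y * D y := by
    rw [intervalIntegral.integral_of_le zero_le_one, ← MeasureTheory.integral_indicator measurableSet_Ioi,
      ← MeasureTheory.integral_indicator measurableSet_Ioc]
    congr 1
    funext y
    simp only [Set.indicator, Complex.finrank_real_complex, smul_eq_mul]
    by_cases h0 : 0 < y <;> by_cases h1 : y ≤ 1 <;> simp [h0, h1]
  rw [h2]
  -- Substitution `s = arc y`, with `orbRad · radA = √G y · √(det / G) = y √det`.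
  have h3 : ∫ s in (0 : ℝ)..arc b 1, orbRad b s = ∫ y in (0 : ℝ)..1, y * D y := by
    have hsub := intervalIntegral.integral_comp_mul_deriv'' (a := 0) (b := 1) (f := arc b)
      (f' := radA b) (g := orbRad b) hb.continuous_arc.continuousOn
      (fun y _ => (hb.hasDerivAt_arc y).hasDerivWithinAt) hb.contDiff_radA.continuous.continuousOn
      (by
        rintro _ ⟨y, -, rfl⟩
        exact (hb.contDiffAt_orbRad ⟨y, rfl⟩).continuousAt.continuousWithinAt)
    rw [arc_zero] at hsub
    rw [← hsub]
    congr 1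
    funext y
    simp only [Function.comp, orbRad, hb.arcInv_arc, orb, hD, radA]
    have hG := hb.coefG_pos y
    rw [Real.sqrt_div (hb.det_pos y).le]
    have := (Real.sqrt_pos.2 hG).ne'
    field_simp
  rw [h3]
  have hvol : MeasureTheory.volume.real (Metric.ball (0 : ℂ) 1) = Real.pi := by
    simp [MeasureTheory.Measure.real, Complex.volume_ball]
  rw [hvol]
  simp
  ring

end IsRotForm

end Spindle

/-! ### Gluing of the two charts: the profile of the spindle. -/

namespace Spindle

open IsRotForm

namespace Metric

variable {m n : ℕ}

/-- A rotationally symmetric metric on a spindle orbifold with local groups of finite order. -/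
structure RotSym (g : Metric m n) : Prop where
  hm : 0 < m
  hn : 0 < n
  rot : g.IsRotationallySymmetric

/-- The distance of the two poles. -/
noncomputable def len (g : Metric m n) : ℝ := arc (g.form false) 1 + arc (g.form true) 1

/-- The angular offset of the second chart. -/
noncomputable def phase (g : Metric m n) : ℝ :=
  (m * twist (g.form false) 1 + n * twist (g.form true) 1) / n

/-- The profile: the length of the orbits, divided by `2π`, as a function of the distance from the
first pole, extended smoothly beyond the poles. -/
noncomputable def prof (g : Metric m n) (s : ℝ) : ℝ :=
  if s ≤ g.len / 2 then orbRad (g.form false) s / m else orbRad (g.form true) (g.len - s) / n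

end Metric

/-- The radius in the second chart of a point with radius `y` in the first one. -/
noncomputable def glueRad (m n : ℕ) (y : ℝ) : ℝ := y ^ (-(m / n : ℝ))

namespace Metric.RotSym

variable {m n : ℕ} {g : Metric m n} (hg : g.RotSym)
include hg

theorem isRotForm (i : Bool) : IsRotForm (g.form i) where
  smooth := g.smooth i
  symm := g.symm i
  pos := g.pos i
  rot := hg.rot i

theorem m_pos : (0 : ℝ) < m := Nat.cast_pos.2 hg.hm
theorem n_pos : (0 : ℝ) < n := Nat.cast_pos.2 hg.hn

theorem m_ne : (m : ℂ) ≠ 0 := by exact_mod_cast hg.hm.ne'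
theorem n_ne : (n : ℂ) ≠ 0 := by exact_mod_cast hg.hn.ne'

/-- Between positive real points the gluing has the derivative `-(m y' / (n y))`. Since `compat`
only concerns lengths of vectors, the bilinear form is recovered by polarization. -/
theorem form_compat {y y' : ℝ} (hy : 0 < y) (hyy : y ^ m * y' ^ n = 1) (v u : ℂ) :
    g.form false y v u = (m * y' / (n * y)) ^ 2 * g.form true y' v u := by
  have hy0 : (y : ℂ) ≠ 0 := by exact_mod_cast hy.ne'
  have quad (v : ℂ) : g.form false y v v = (m * y' / (n * y)) ^ 2 * g.form true y' v v := by
    have h1 := g.compat (false, y, v) (true, y', -((m * y' / (n * y) : ℝ) • v)) (by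
      refine ⟨?_, ?_⟩
      · simp only [order]
        exact_mod_cast hyy
      · simp only [order, Complex.real_smul]
        have := hg.n_ne
        push_cast
        field_simp
        ring)
    simp only at h1
    rw [h1]
    simp only [map_neg, map_smul, LinearMap.neg_apply, LinearMap.smul_apply, smul_eq_mul]
    ring
  have h1 := quad (v + u)
  simp only [map_add, LinearMap.add_apply] at h1
  rw [g.symm false y u v, g.symm true y' u v, quad v, quad u] at h1
  linarith

omit hg in
theorem glueRad_pos {y : ℝ} (hy : 0 < y) : 0 < glueRad m n y := Real.rpow_pos_of_pos hy _

theorem pow_glueRad {y : ℝ} (hy : 0 < y) : y ^ m * glueRad m n y ^ n = 1 := by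
  unfold glueRad
  rw [← Real.rpow_natCast, ← Real.rpow_natCast (y ^ _), ← Real.rpow_mul hy.le, ← Real.rpow_add hy]
  have := hg.n_pos.ne'
  have h : (m : ℝ) + -(m / n) * n = 0 := by field_simp; ring
  rw [h, Real.rpow_zero]

theorem hasDerivAt_glueRad {y : ℝ} (hy : 0 < y) :
    HasDerivAt (glueRad m n) (-(m * glueRad m n y / (n * y))) y := by
  have h := Real.hasDerivAt_rpow_const (x := y) (p := -(m / n : ℝ)) (Or.inl hy.ne')
  convert! h using 1
  rw [Real.rpow_sub_one hy.ne']
  unfold glueRad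
  have := hg.n_pos.ne'
  field_simp

theorem factor_pos {y : ℝ} (hy : 0 < y) : 0 < m * glueRad m n y / (n * y) :=
  div_pos (mul_pos hg.m_pos (glueRad_pos hy)) (mul_pos hg.n_pos hy)

theorem coefG_glue {y : ℝ} (hy : 0 < y) : coefG (g.form false) y
    = (m * glueRad m n y / (n * y)) ^ 2 * coefG (g.form true) (glueRad m n y) :=
  hg.form_compat hy (hg.pow_glueRad hy) _ _

theorem coefF_glue {y : ℝ} (hy : 0 < y) : coefF (g.form false) y
    = (m * glueRad m n y / (n * y)) ^ 2 * coefF (g.form true) (glueRad m n y) :=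
  hg.form_compat hy (hg.pow_glueRad hy) _ _

theorem coefE_glue {y : ℝ} (hy : 0 < y) : coefE (g.form false) y
    = (m * glueRad m n y / (n * y)) ^ 2 * coefE (g.form true) (glueRad m n y) :=
  hg.form_compat hy (hg.pow_glueRad hy) _ _

theorem sqrtG_glue {y : ℝ} (hy : 0 < y) : Real.sqrt (coefG (g.form false) y)
    = m * glueRad m n y / (n * y) * Real.sqrt (coefG (g.form true) (glueRad m n y)) := by
  rw [hg.coefG_glue hy, Real.sqrt_mul (sq_nonneg _), Real.sqrt_sq (hg.factor_pos hy).le]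

theorem kap_glue {y : ℝ} (hy : 0 < y) :
    kap (g.form false) y = kap (g.form true) (glueRad m n y) := by
  unfold kap
  rw [hg.coefG_glue hy, hg.coefF_glue hy, mul_div_mul_left _ _ (pow_pos (hg.factor_pos hy) 2).ne']

theorem radA_glue {y : ℝ} (hy : 0 < y) : radA (g.form false) y
    = m * glueRad m n y / (n * y) * radA (g.form true) (glueRad m n y) := by
  unfold radA
  have h1 := ((hg.isRotForm true).coefG_pos (glueRad m n y)).ne'
  have h2 := (hg.factor_pos hy).ne'
  rw [hg.coefG_glue hy, hg.coefF_glue hy, hg.coefE_glue hy]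
  set μ := (m : ℝ) * glueRad m n y / (n * y)
  set E := coefE (g.form true) (glueRad m n y)
  set F := coefF (g.form true) (glueRad m n y)
  set G := coefG (g.form true) (glueRad m n y)
  have : (μ ^ 2 * E * (μ ^ 2 * G) - (μ ^ 2 * F) ^ 2) / (μ ^ 2 * G) = μ ^ 2 * ((E * G - F ^ 2) / G) := by
    field_simp
  rw [this, Real.sqrt_mul (sq_nonneg _), Real.sqrt_sq (hg.factor_pos hy).le]

omit hg in
theorem eq_of_hasDerivAt_zero {f : ℝ → ℝ} (h : ∀ y, 0 < y → HasDerivAt f 0 y) {y : ℝ} (hy : 0 < y) :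
    f y = f 1 :=
  isOpen_Ioi.is_const_of_deriv_eq_zero (convex_Ioi (0 : ℝ)).isPreconnected
    (fun x hx => (h x hx).differentiableAt.differentiableWithinAt)
    (fun x hx => (h x hx).deriv) hy (Set.mem_Ioi.2 zero_lt_one)

omit hg in
theorem glueRad_one : glueRad m n 1 = 1 := Real.one_rpow _

/-- `radA` scales by the factor `m y' / (n y)`, and minus this factor is the derivative of the glued
radius `y'`, so the sum is constant. Its value is read off at `y = 1`, which is glued to `1`. -/
theorem arc_glue {y : ℝ} (hy : 0 < y) :
    arc (g.form false) y + arc (g.form true) (glueRad m n y) = g.len := by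
  have h : ∀ y, 0 < y →
      HasDerivAt (fun y => arc (g.form false) y + arc (g.form true) (glueRad m n y)) 0 y := by
    intro y hy
    have h1 : HasDerivAt (fun y => arc (g.form true) (glueRad m n y)) _ y :=
      ((hg.isRotForm true).hasDerivAt_arc (glueRad m n y)).comp y (hg.hasDerivAt_glueRad hy)
    have h2 := ((hg.isRotForm false).hasDerivAt_arc y).fun_add h1
    convert! h2 using 1
    rw [hg.radA_glue hy]
    ring
  have := eq_of_hasDerivAt_zero h hy
  simp only [glueRad_one] at this
  exact this

/-- `kap` is invariant under the gluing and glued radii satisfy `m dy / y + n dy' / y' = 0`, so the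
weighted sum is constant. The constant is the offset that aligns the meridians of the two charts. -/
theorem twist_glue {y : ℝ} (hy : 0 < y) :
    m * twist (g.form false) y + n * twist (g.form true) (glueRad m n y) = n * g.phase := by
  have h : ∀ y, 0 < y →
      HasDerivAt (fun y => m * twist (g.form false) y + n * twist (g.form true) (glueRad m n y)) 0 y := by
    intro y hy
    have h1 : HasDerivAt (fun y => twist (g.form true) (glueRad m n y)) _ y :=
      ((hg.isRotForm true).hasDerivAt_twist (glueRad m n y)).comp y (hg.hasDerivAt_glueRad hy)
    have h2 := (((hg.isRotForm false).hasDerivAt_twist y).const_mul (m : ℝ)).fun_add (h1.const_mul (n : ℝ))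
    convert! h2 using 1
    rw [hg.kap_glue hy]
    have := (glueRad_pos (m := m) (n := n) hy).ne'
    have := hg.n_pos.ne'
    field_simp
    ring
  have := eq_of_hasDerivAt_zero h hy
  simp only [glueRad_one] at this
  rw [this, phase, mul_div_cancel₀ _ hg.n_pos.ne']

theorem tendsto_glueRad : Tendsto (glueRad m n) atTop (𝓝 0) :=
  tendsto_rpow_neg_atTop (div_pos hg.m_pos hg.n_pos)

theorem tendsto_glueRad_zero : Tendsto (glueRad m n) (𝓝[>] 0) atTop :=
  tendsto_rpow_neg_nhdsGT_zero (by linarith [div_pos hg.m_pos hg.n_pos])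

theorem tendsto_arc_false : Tendsto (arc (g.form false)) atTop (𝓝 g.len) := by
  have h1 : Tendsto (fun y => arc (g.form true) (glueRad m n y)) atTop (𝓝 0) := by
    have := ((hg.isRotForm true).continuous_arc.tendsto 0).comp hg.tendsto_glueRad
    rwa [arc_zero] at this
  have h2 : Tendsto (fun y => g.len - arc (g.form true) (glueRad m n y)) atTop (𝓝 g.len) := by
    simpa using tendsto_const_nhds.sub h1
  refine h2.congr' ?_
  filter_upwards [eventually_gt_atTop 0] with y hy
  linarith [hg.arc_glue hy]

theorem arc_pos (i : Bool) {y : ℝ} (hy : 0 < y) : 0 < arc (g.form i) y := by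
  have := (hg.isRotForm i).strictMono_arc hy
  rwa [arc_zero] at this

theorem len_pos : 0 < g.len := add_pos (hg.arc_pos _ one_pos) (hg.arc_pos _ one_pos)

/-- Intermediate values: towards infinity in one chart the glued radius in the other chart tends to
`0`, so arclength tends to the distance of the poles. -/
theorem mem_range_of_Ioo {i : Bool} {s : ℝ} (h0 : 0 < s) (h1 : s < g.len) :
    s ∈ Set.range (arc (g.form i)) := by
  cases i
  · have h2 := (hg.tendsto_arc_false.eventually (isOpen_Ioi.mem_nhds (show s < g.len from h1))).exists
    obtain ⟨y, hy⟩ := h2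
    have hcont := (hg.isRotForm false).continuous_arc
    exact mem_range_of_exists_le_of_exists_ge hcont ⟨0, by rw [arc_zero]; exact h0.le⟩
      ⟨y, le_of_lt hy⟩
  · have h2 : Tendsto (fun y => g.len - arc (g.form true) (glueRad m n y)) (𝓝[>] 0) (𝓝 0) := by
      have h3 : Tendsto (arc (g.form false)) (𝓝[>] 0) (𝓝 0) := by
        have := ((hg.isRotForm false).continuous_arc.tendsto 0)
        rw [arc_zero] at this
        exact this.mono_left nhdsWithin_le_nhds
      refine h3.congr' ?_
      filter_upwards [self_mem_nhdsWithin] with y hy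
      linarith [hg.arc_glue hy]
    obtain ⟨y, hy⟩ := (h2.eventually (isOpen_Iio.mem_nhds (show (0 : ℝ) < g.len - s by linarith))).exists
    have hy' : g.len - arc (g.form true) (glueRad m n y) < g.len - s := hy
    exact mem_range_of_exists_le_of_exists_ge (hg.isRotForm true).continuous_arc
      ⟨0, by rw [arc_zero]; exact h0.le⟩ ⟨glueRad m n y, by linarith⟩

theorem mem_range {i : Bool} {s : ℝ} (h0 : -g.len < s) (h1 : s < g.len) :
    s ∈ Set.range (arc (g.form i)) := by
  rcases lt_trichotomy s 0 with h | h | h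
  · have := (hg.isRotForm i).range_neg (hg.mem_range_of_Ioo (i := i) (neg_pos.2 h) (by linarith))
    rwa [neg_neg] at this
  · exact ⟨0, by rw [arc_zero, h]⟩
  · exact hg.mem_range_of_Ioo h h1

theorem lt_len_of_mem_range {i : Bool} {s : ℝ} (hs : s ∈ Set.range (arc (g.form i))) :
    s < g.len := by
  obtain ⟨y, rfl⟩ := hs
  rcases le_or_gt y 0 with hy | hy
  · have := (hg.isRotForm i).strictMono_arc.monotone hy
    rw [arc_zero] at this
    exact this.trans_lt hg.len_pos
  · cases i
    · linarith [hg.arc_glue hy, hg.arc_pos true (glueRad_pos (m := m) (n := n) hy)]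
    · by_contra hcon
      push Not at hcon
      have h2 : Tendsto (fun y => glueRad m n y) (𝓝[>] 0) atTop := hg.tendsto_glueRad_zero
      obtain ⟨x, hx, hx0⟩ := ((h2.eventually (eventually_ge_atTop y)).and self_mem_nhdsWithin).exists
      have h3 := (hg.isRotForm true).strictMono_arc.monotone hx
      linarith [hg.arc_glue hx0, hg.arc_pos false hx0]

theorem arcInv_glue {s : ℝ} (h0 : 0 < s) (h1 : s < g.len) :
    arcInv (g.form true) (g.len - s) = glueRad m n (arcInv (g.form false) s) := by
  have hs := hg.mem_range_of_Ioo (i := false) h0 h1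
  have hy := (hg.isRotForm false).arcInv_pos hs h0
  have h2 := hg.arc_glue hy
  rw [arc_arcInv hs] at h2
  rw [← h2, add_sub_cancel_left, (hg.isRotForm true).arcInv_arc]

/-- Both quotients measure the same circle of the orbifold, which a chart circle covers `order`
times. Therefore `prof` does not depend on the place where its two formulas meet. -/
theorem orbRad_glue {s : ℝ} (h0 : 0 < s) (h1 : s < g.len) :
    orbRad (g.form false) s / m = orbRad (g.form true) (g.len - s) / n := by
  have hy := (hg.isRotForm false).arcInv_pos (hg.mem_range_of_Ioo h0 h1) h0
  unfold orbRad orb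
  rw [hg.arcInv_glue h0 h1, hg.sqrtG_glue hy]
  have := hg.m_pos.ne'
  have := hg.n_pos.ne'
  field_simp

theorem phase_eq {s : ℝ} (h0 : 0 < s) (h1 : s < g.len) :
    m * twist (g.form false) (arcInv (g.form false) s)
      + n * twist (g.form true) (arcInv (g.form true) (g.len - s)) = n * g.phase := by
  rw [hg.arcInv_glue h0 h1]
  exact hg.twist_glue ((hg.isRotForm false).arcInv_pos (hg.mem_range_of_Ioo h0 h1) h0)

/-- The meridian labelled `ψ` has angle `ψ / m` in the first chart and `phase - ψ / n` in the second
one. Both frame vectors are reversed, since the origins are exchanged and the gluing inverts angles.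
-/
theorem tangentRel_polar {s : ℝ} (h0 : 0 < s) (h1 : s < g.len) (ψ p q : ℝ) :
    TangentRel m n
      (false, polarMap (g.form false) (s, ψ / m), polarVec (g.form false) (s, ψ / m) p q)
      (true, polarMap (g.form true) (g.len - s, g.phase - ψ / n),
        polarVec (g.form true) (g.len - s, g.phase - ψ / n) (-p) (-q)) := by
  have hs := hg.mem_range_of_Ioo (i := false) h0 h1
  have hy := (hg.isRotForm false).arcInv_pos hs h0
  have hph := hg.phase_eq h0 h1
  have hglue := hg.arcInv_glue h0 h1
  set y := arcInv (g.form false) s with hydef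
  have hy' := glueRad_pos (m := m) (n := n) hy
  refine ⟨?_, ?_⟩
  · simp only [polarMap, order, mul_pow, ← Complex.exp_nat_mul]
    rw [mul_mul_mul_comm, ← Complex.exp_add, hglue]
    have e1 : ((y : ℂ) ^ m * (glueRad m n y : ℂ) ^ n) = 1 := by exact_mod_cast hg.pow_glueRad hy
    rw [← hydef, e1, one_mul]
    rw [hglue] at hph
    have e2 : (m : ℂ) * (((ψ / m - twist (g.form false) y : ℝ) : ℂ) * Complex.I)
        + (n : ℂ) * (((g.phase - ψ / n - twist (g.form true) (glueRad m n y) : ℝ) : ℂ) * Complex.I)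
        = ((n * g.phase - (m * twist (g.form false) y
          + n * twist (g.form true) (glueRad m n y)) : ℝ) : ℂ) * Complex.I := by
      push_cast
      have := hg.m_ne
      have := hg.n_ne
      field_simp
      ring
    rw [e2, hph, sub_self]
    simp
  · simp only [polarMap, polarVec, order, ← hydef, hglue]
    rw [← hg.kap_glue hy]
    have hA : (radA (g.form true) (glueRad m n y))⁻¹ = m * glueRad m n y / (n * y) *
        (radA (g.form false) y)⁻¹ := by
      rw [hg.radA_glue hy, mul_inv, mul_inv_cancel_left₀ (hg.factor_pos hy).ne']
    have hG (q : ℝ) : q / Real.sqrt (coefG (g.form true) (glueRad m n y))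
        = m * glueRad m n y / (n * y) * (q / Real.sqrt (coefG (g.form false) y)) := by
      rw [hg.sqrtG_glue hy]
      have h4 := (hg.factor_pos hy).ne'
      have h5 := (Real.sqrt_pos.2 ((hg.isRotForm true).coefG_pos (glueRad m n y))).ne'
      generalize (m : ℝ) * glueRad m n y / (n * y) = μ at h4 ⊢
      field_simp
    rw [hA, hG (-q)]
    have h1 := hg.m_ne
    have h2 := hg.n_ne
    have h3 : (y : ℂ) ≠ 0 := by exact_mod_cast hy.ne'
    push_cast
    field_simp
    ring

/-- Each of the two formulas is valid on the whole overlap and, by the signed radius, past its own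
pole. Smoothness of the profile at the poles thus follows from smoothness in the charts. -/
theorem prof_eq_false {s : ℝ} (h0 : -g.len < s) (h1 : s < g.len) :
    g.prof =ᶠ[𝓝 s] fun x => orbRad (g.form false) x / m := by
  filter_upwards [isOpen_Ioo.mem_nhds (⟨h0, h1⟩ : s ∈ Set.Ioo (-g.len) g.len)] with x hx
  unfold prof
  split_ifs with h
  · rfl
  · rw [hg.orbRad_glue (by linarith [hg.len_pos]) hx.2]

theorem prof_eq_true {s : ℝ} (h0 : 0 < s) (h1 : s < 2 * g.len) :
    g.prof =ᶠ[𝓝 s] fun x => orbRad (g.form true) (g.len - x) / n := by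
  filter_upwards [isOpen_Ioo.mem_nhds (⟨h0, h1⟩ : s ∈ Set.Ioo 0 (2 * g.len))] with x hx
  unfold prof
  split_ifs with h
  · rw [hg.orbRad_glue hx.1 (by linarith [hg.len_pos])]
  · rfl

theorem contDiffAt_prof {s : ℝ} (h0 : -g.len < s) (h1 : s < 2 * g.len) :
    ContDiffAt ℝ (⊤ : ℕ∞) g.prof s := by
  rcases lt_or_ge s g.len with h | h
  · exact (((hg.isRotForm false).contDiffAt_orbRad (hg.mem_range h0 h)).div_const _).congr_of_eventuallyEq
      (hg.prof_eq_false h0 h)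
  · have h3 : 0 < s := hg.len_pos.trans_le h
    have h4 : g.len - s ∈ Set.range (arc (g.form true)) := hg.mem_range (by linarith) (by linarith)
    exact ((((hg.isRotForm true).contDiffAt_orbRad h4).comp s
      (contDiffAt_const.sub contDiffAt_id)).div_const _).congr_of_eventuallyEq (hg.prof_eq_true h3 h1)

theorem deriv_prof_false {s : ℝ} (h0 : -g.len < s) (h1 : s < g.len) :
    deriv g.prof s = deriv (orbRad (g.form false)) s / m := by
  rw [(hg.prof_eq_false h0 h1).deriv_eq, deriv_div_const]

theorem deriv_prof_true {s : ℝ} (h0 : 0 < s) (h1 : s < 2 * g.len) :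
    deriv g.prof s = -deriv (orbRad (g.form true)) (g.len - s) / n := by
  rw [(hg.prof_eq_true h0 h1).deriv_eq, deriv_div_const, deriv_comp_const_sub]

theorem prof_zero : g.prof 0 = 0 := by
  refine (hg.prof_eq_false (by linarith [hg.len_pos]) hg.len_pos).self_of_nhds.trans ?_
  beta_reduce
  rw [(hg.isRotForm false).orbRad_zero, zero_div]

theorem prof_len : g.prof g.len = 0 := by
  refine (hg.prof_eq_true hg.len_pos (by linarith [hg.len_pos])).self_of_nhds.trans ?_
  beta_reduce
  rw [sub_self,
    (hg.isRotForm true).orbRad_zero, zero_div]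

theorem prof_pos {s : ℝ} (h0 : 0 < s) (h1 : s < g.len) : 0 < g.prof s := by
  rw [(hg.prof_eq_false (by linarith) h1).self_of_nhds]
  exact div_pos ((hg.isRotForm false).orbRad_pos (hg.mem_range_of_Ioo h0 h1) h0) hg.m_pos

theorem deriv_prof_zero : deriv g.prof 0 = 1 / m := by
  rw [hg.deriv_prof_false (by linarith [hg.len_pos]) hg.len_pos,
    (hg.isRotForm false).deriv_orbRad_zero]

theorem deriv_prof_len : deriv g.prof g.len = -1 / n := by
  rw [hg.deriv_prof_true hg.len_pos (by linarith [hg.len_pos]), sub_self,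
    (hg.isRotForm true).deriv_orbRad_zero]

/-- The factor `1 / order` in the area is the one in the profile, so the two discs contribute
integrals of the same profile over adjacent intervals. -/
theorem area_eq : g.area = 2 * Real.pi * ∫ s in (0 : ℝ)..g.len, g.prof s := by
  have hL := hg.len_pos
  have hm := hg.m_pos.ne'
  have hn := hg.n_pos.ne'
  have a0 := hg.arc_pos false one_pos
  have a1 := hg.arc_pos true one_pos
  have hlen : g.len = arc (g.form false) 1 + arc (g.form true) 1 := rfl
  have hc : ContinuousOn g.prof (Set.Icc 0 g.len) := fun s hs =>
    (hg.contDiffAt_prof (by linarith [hs.1]) (by linarith [hs.2])).continuousAt.continuousWithinAt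
  have hint {a b : ℝ} (ha : 0 ≤ a) (hab : a ≤ b) (hb : b ≤ g.len) :
      IntervalIntegrable g.prof MeasureTheory.volume a b := by
    refine (hc.mono ?_).intervalIntegrable
    rw [Set.uIcc_of_le hab]
    exact Set.Icc_subset_Icc ha hb
  unfold area
  simp only [Fintype.sum_bool, areaDensity]
  rw [(hg.isRotForm true).integral_density, (hg.isRotForm false).integral_density]
  rw [← intervalIntegral.integral_add_adjacent_intervals (b := arc (g.form false) 1)
    (hint le_rfl a0.le (by linarith)) (hint a0.le (by linarith) le_rfl)]
  have e1 : ∫ s in (0 : ℝ)..arc (g.form false) 1, g.prof s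
      = (∫ s in (0 : ℝ)..arc (g.form false) 1, orbRad (g.form false) s) / m := by
    rw [← intervalIntegral.integral_div]
    refine intervalIntegral.integral_congr fun s hs => ?_
    rw [Set.uIcc_of_le a0.le] at hs
    exact (hg.prof_eq_false (by linarith [hs.1]) (by linarith [hs.2])).self_of_nhds
  -- The second disc is measured from the other pole, whence the reflection `s ↦ len - s`.
  have e2 : ∫ s in arc (g.form false) 1..g.len, g.prof s
      = (∫ s in (0 : ℝ)..arc (g.form true) 1, orbRad (g.form true) s) / n := by
    have h3 : ∫ s in arc (g.form false) 1..g.len, g.prof s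
        = ∫ s in arc (g.form false) 1..g.len, orbRad (g.form true) (g.len - s) / n := by
      refine intervalIntegral.integral_congr fun s hs => ?_
      rw [Set.uIcc_of_le (by linarith)] at hs
      exact (hg.prof_eq_true (by linarith [hs.1]) (by linarith [hs.2])).self_of_nhds
    rw [h3, intervalIntegral.integral_div, intervalIntegral.integral_comp_sub_left, sub_self, hlen,
      add_sub_cancel_left]
  rw [e1, e2]
  simp only [order]
  field_simp
  ring

end Metric.RotSym

end Spindle

/-! ### The punctured plane and its quotient by roots of unity. -/

namespace Spindle

/-- The complex plane `ℂ²` without the origin. -/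
def Punct : Type := {x : ℂ × ℂ // x ≠ 0}

instance : TopologicalSpace Punct := inferInstanceAs (TopologicalSpace {x : ℂ × ℂ // x ≠ 0})
instance : T2Space Punct := inferInstanceAs (T2Space {x : ℂ × ℂ // x ≠ 0})
instance : LocallyCompactSpace Punct :=
  (isOpen_ne (x := (0 : ℂ × ℂ))).isOpenEmbedding_subtypeVal.locallyCompactSpace

instance (N : ℕ) : MulAction (rootsOfUnity N ℂ) Punct where
  smul ζ x := ⟨(((ζ : ℂˣ) : ℂ) * x.1.1, ((ζ : ℂˣ) : ℂ) * x.1.2), fun h => x.2 (by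
    have h1 := congrArg Prod.fst h
    have h2 := congrArg Prod.snd h
    simp only [Prod.fst_zero, Prod.snd_zero, mul_eq_zero, Units.ne_zero, false_or] at h1 h2
    exact Prod.ext h1 h2)⟩
  one_smul x := Subtype.ext (Prod.ext (by change _ * _ = _; simp) (by change _ * _ = _; simp))
  mul_smul a b x := Subtype.ext (Prod.ext
    (by change _ * _ = _ * (_ * _); simp [mul_assoc]) (by change _ * _ = _ * (_ * _); simp [mul_assoc]))

instance (N : ℕ) : ContinuousConstSMul (rootsOfUnity N ℂ) Punct where
  continuous_const_smul ζ := by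
    refine Continuous.subtype_mk ?_ _
    have h : Continuous (fun x : Punct => x.1) := continuous_subtype_val
    exact (continuous_const.mul h.fst).prodMk (continuous_const.mul h.snd)

instance (N : ℕ) : IsCancelSMul (rootsOfUnity N ℂ) Punct where
  left_cancel' a x y h := by
    have := congrArg (fun z => a⁻¹ • z) h
    simpa using this
  right_cancel' a b x h := by
    have h1 : ((a : ℂˣ) : ℂ) * x.1.1 = ((b : ℂˣ) : ℂ) * x.1.1 := congrArg (fun z : Punct => z.1.1) h
    have h2 : ((a : ℂˣ) : ℂ) * x.1.2 = ((b : ℂˣ) : ℂ) * x.1.2 := congrArg (fun z : Punct => z.1.2) h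
    apply Subtype.ext
    apply Units.ext
    by_cases hx : x.1.1 = 0
    · have hx2 : x.1.2 ≠ 0 := fun h0 => x.2 (Prod.ext hx h0)
      exact mul_right_cancel₀ hx2 h2
    · exact mul_right_cancel₀ hx h1

/-- The quotient of the punctured plane by the `N`-th roots of unity. -/
def Lens (N : ℕ) : Type := Quotient (MulAction.orbitRel (rootsOfUnity N ℂ) Punct)

instance (N : ℕ) : TopologicalSpace (Lens N) :=
  inferInstanceAs (TopologicalSpace (Quotient (MulAction.orbitRel (rootsOfUnity N ℂ) Punct)))

/-- The class of a point of the punctured plane. -/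
def Lens.mk (N : ℕ) : Punct → Lens N := Quotient.mk (MulAction.orbitRel (rootsOfUnity N ℂ) Punct)

theorem Lens.continuous_mk (N : ℕ) : Continuous (Lens.mk N) := continuous_quotient_mk'

/-- A free action of a finite group on a locally compact Hausdorff space is a covering space action;
freeness is `IsCancelSMul` above. -/
theorem Lens.isQuotientCoveringMap (N : ℕ) [NeZero N] :
    IsQuotientCoveringMap (Lens.mk N) (rootsOfUnity N ℂ) :=
  isQuotientCoveringMap_quotientMk_of_properlyDiscontinuousSMul

theorem Lens.isCoveringMap (N : ℕ) [NeZero N] : IsCoveringMap (Lens.mk N) :=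
  (Lens.isQuotientCoveringMap N).isCoveringMap

theorem Lens.mk_eq_iff {N : ℕ} [NeZero N] {x y : Punct} :
    Lens.mk N x = Lens.mk N y ↔ ∃ ζ : ℂ, ζ ^ N = 1 ∧ x.1.1 = ζ * y.1.1 ∧ x.1.2 = ζ * y.1.2 := by
  rw [(Lens.isQuotientCoveringMap N).apply_eq_iff_mem_orbit]
  constructor
  · rintro ⟨ζ, rfl⟩
    refine ⟨((ζ : ℂˣ) : ℂ), ?_, rfl, rfl⟩
    have := congrArg Units.val ((mem_rootsOfUnity N (ζ : ℂˣ)).1 ζ.2)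
    rwa [Units.val_pow_eq_pow_val, Units.val_one] at this
  · rintro ⟨ζ, h1, h2, h3⟩
    exact ⟨rootsOfUnity.mkOfPowEq ζ h1, Subtype.ext (Prod.ext h2.symm h3.symm)⟩

/-- Every lift of a nullhomotopic loop is closed. -/
theorem Lens.periodic_of_nullhomotopic {N : ℕ} [NeZero N] {ℓ : ℝ} {F : C(AddCircle ℓ, Lens N)}
    (hF : F.Nullhomotopic) {Λ : ℝ → Punct} (hΛ : Continuous Λ)
    (h : ∀ t : ℝ, F (t : AddCircle ℓ) = Lens.mk N (Λ t)) (t : ℝ) : Λ (t + ℓ) = Λ t := by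
  have cov := Lens.isCoveringMap N
  obtain ⟨y, hy⟩ := hF
  obtain ⟨H⟩ := hy.symm
  obtain ⟨e, he⟩ := Quotient.exists_rep y
  have he : Lens.mk N e = y := he
  set q : C(ℝ, AddCircle ℓ) := ⟨fun t => (t : AddCircle ℓ), AddCircle.continuous_mk' ℓ⟩ with hq
  set H' : C(unitInterval × ℝ, Lens N) :=
    H.toContinuousMap.comp ((ContinuousMap.id unitInterval).prodMap q) with hH'
  have h0 : ∀ a, H' (0, a) = Lens.mk N ((ContinuousMap.const ℝ e) a) := by
    intro a
    have : H (0, (a : AddCircle ℓ)) = y := H.apply_zero _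
    rw [ContinuousMap.const_apply, he]
    exact this
  -- The contraction, pulled back to `ℝ`, is lifted starting from its constant end.
  set K := cov.liftHomotopy H' (ContinuousMap.const ℝ e) h0 with hK
  have hKl (s : unitInterval) (a : ℝ) : Lens.mk N (K (s, a)) = H (s, (a : AddCircle ℓ)) :=
    congrFun (cov.liftHomotopy_lifts H' (ContinuousMap.const ℝ e) h0) (s, a)
  -- The homotopy paths over `a + ℓ` and `a` have the same projection and the same starting point,
  -- so they coincide up to their ends.
  have hper (a : ℝ) : K (1, a + ℓ) = K (1, a) := by
    have := cov.eq_of_comp_eq (g₁ := fun s : unitInterval => K (s, a + ℓ))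
      (g₂ := fun s : unitInterval => K (s, a)) (by fun_prop) (by fun_prop)
      (by
        funext s
        simp only [Function.comp, hKl]
        congr 2
        simp) 0
      (by
        have e1 := cov.liftHomotopy_zero H' (ContinuousMap.const ℝ e) h0 (a + ℓ)
        have e2 := cov.liftHomotopy_zero H' (ContinuousMap.const ℝ e) h0 a
        exact e1.trans e2.symm)
    exact congrFun this 1
  have hK1 (a : ℝ) : Lens.mk N (K (1, a)) = Lens.mk N (Λ a) := by
    rw [hKl, H.apply_one, h]
  -- Two lifts of one curve differ by a deck transformation, so periodicity passes from `K (1, ·)`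
  -- to `Λ`.
  obtain ⟨ζ, hζ⟩ := (Lens.isQuotientCoveringMap N).apply_eq_iff_mem_orbit.1 (hK1 0).symm
  have hζ : ζ • K (1, 0) = Λ 0 := hζ
  have hall := cov.eq_of_comp_eq (g₁ := Λ) (g₂ := fun a => ζ • K (1, a)) hΛ
    ((continuous_const_smul ζ).comp (by fun_prop : Continuous fun a : ℝ => K (1, a)))
    (by
      funext a
      simp only [Function.comp]
      rw [(Lens.isQuotientCoveringMap N).map_smul, hK1]) 0 hζ.symm
  rw [hall]
  simp only [hper]

/-- Two maps to the punctured plane are homotopic if the segments between them avoid the origin. -/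
theorem Punct.homotopic_of_segment {X : Type*} [TopologicalSpace X] {f g : C(X, Punct)}
    (h : ∀ t : ℝ, 0 ≤ t → t ≤ 1 → ∀ x, ((1 - t : ℝ) : ℂ) * (f x).1.1 + t * (g x).1.1 = 0 →
      ((1 - t : ℝ) : ℂ) * (f x).1.2 + t * (g x).1.2 = 0 → False) : f.Homotopic g := by
  have hv : Continuous (fun x : Punct => x.1) := continuous_subtype_val
  have hf : Continuous (fun x : unitInterval × X => (f x.2).1) :=
    hv.comp (f.continuous.comp continuous_snd)
  have hg : Continuous (fun x : unitInterval × X => (g x.2).1) :=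
    hv.comp (g.continuous.comp continuous_snd)
  have ht : Continuous (fun x : unitInterval × X => ((x.1 : ℝ) : ℂ)) :=
    Complex.continuous_ofReal.comp (continuous_subtype_val.comp continuous_fst)
  have ht' : Continuous (fun x : unitInterval × X => ((1 - (x.1 : ℝ) : ℝ) : ℂ)) :=
    Complex.continuous_ofReal.comp (continuous_const.sub (continuous_subtype_val.comp continuous_fst))
  refine ⟨{ toFun := fun x => ⟨(((1 - (x.1 : ℝ) : ℝ) : ℂ) * (f x.2).1.1 + ((x.1 : ℝ) : ℂ) * (g x.2).1.1,
      ((1 - (x.1 : ℝ) : ℝ) : ℂ) * (f x.2).1.2 + ((x.1 : ℝ) : ℂ) * (g x.2).1.2), fun h0 =>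
        h x.1 x.1.2.1 x.1.2.2 x.2 (congrArg Prod.fst h0) (congrArg Prod.snd h0)⟩
            continuous_toFun := ?_
            map_zero_left := ?_
            map_one_left := ?_ }⟩
  · exact Continuous.subtype_mk (((ht'.mul hf.fst).add (ht.mul hg.fst)).prodMk
      ((ht'.mul hf.snd).add (ht.mul hg.snd))) _
  · intro x
    apply Subtype.ext
    simp
  · intro x
    apply Subtype.ext
    simp

/-- The first coordinate is moved to `1` while the second one avoids zero; then the second one is
contracted to `0` while the first one stays `1`. -/
theorem Punct.nullhomotopic_of_snd_ne {X : Type*} [TopologicalSpace X] {f : C(X, Punct)}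
    (h : ∀ x, (f x).1.2 ≠ 0) : f.Nullhomotopic := by
  have hv : Continuous (fun x : X => (f x).1) := continuous_subtype_val.comp f.continuous
  set g : C(X, Punct) := ⟨fun x => ⟨(1, (f x).1.2), fun h0 => by
    have := congrArg Prod.fst h0
    simp at this⟩, Continuous.subtype_mk (continuous_const.prodMk hv.snd) _⟩ with hg
  refine ⟨⟨(1, 0), fun h0 => by
    have := congrArg Prod.fst h0
    simp at this⟩, (Punct.homotopic_of_segment (g := g) ?_).trans (Punct.homotopic_of_segment ?_)⟩
  · intro t _ _ x _ h2
    apply h x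
    have hg2 : (g x).1.2 = (f x).1.2 := rfl
    rw [hg2] at h2
    push_cast at h2
    linear_combination h2
  · intro t _ _ x h1 _
    have hg1 : (g x).1.1 = 1 := rfl
    rw [hg1] at h1
    have h1 : ((1 - t : ℝ) : ℂ) * 1 + t * 1 = 0 := h1
    push_cast at h1
    have : (1 : ℂ) = 0 := by linear_combination h1
    exact one_ne_zero this

end Spindle

/-! ### Unit tangent vectors in synchronized coordinates of both charts. -/

namespace Spindle

open IsRotForm

/-- The unit complex number of angle `a`. -/
noncomputable def cis (a : ℝ) : ℂ := Complex.exp (a * Complex.I)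

theorem cis_add (a b : ℝ) : cis (a + b) = cis a * cis b := by
  unfold cis; rw [← Complex.exp_add]; congr 1; push_cast; ring
theorem cis_zero : cis 0 = 1 := by simp [cis]
theorem norm_cis (a : ℝ) : ‖cis a‖ = 1 := Complex.norm_exp_ofReal_mul_I a
theorem cis_ne_zero (a : ℝ) : cis a ≠ 0 := Complex.exp_ne_zero _
theorem cis_neg (a : ℝ) : cis (-a) = (cis a)⁻¹ := by
  refine eq_inv_of_mul_eq_one_left ?_
  rw [← cis_add, neg_add_cancel, cis_zero]
theorem cis_sub (a b : ℝ) : cis (a - b) = cis a / cis b := by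
  rw [sub_eq_add_neg, cis_add, cis_neg, div_eq_mul_inv]
theorem cis_pow (a : ℝ) (k : ℕ) : cis a ^ k = cis (k * a) := by
  unfold cis; rw [← Complex.exp_nat_mul]; congr 1; push_cast; ring
theorem cis_pi : cis Real.pi = -1 := Complex.exp_pi_mul_I
theorem conj_cis (a : ℝ) : (starRingEnd ℂ) (cis a) = cis (-a) := by
  rw [cis_neg]
  refine eq_inv_of_mul_eq_one_right ?_
  exact exp_I_mul_conj a
theorem continuous_cis : Continuous cis :=
  Complex.continuous_exp.comp (Complex.continuous_ofReal.mul continuous_const)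
theorem cis_arg {z : ℂ} (hz : ‖z‖ = 1) : cis (Complex.arg z) = z := by
  have := Complex.norm_mul_exp_arg_mul_I z
  rwa [hz, Complex.ofReal_one, one_mul] at this
theorem cis_eq (a : ℝ) : cis a = Real.cos a + Real.sin a * Complex.I := exp_I_eq a
theorem cis_eq_one_iff {a : ℝ} : cis a = 1 ↔ ∃ k : ℤ, a = 2 * Real.pi * k := by
  unfold cis
  rw [Complex.exp_eq_one_iff]
  refine exists_congr fun k => ?_
  constructor
  · intro h
    have h1 : (a : ℂ) = 2 * Real.pi * k := by
      refine mul_right_cancel₀ Complex.I_ne_zero ?_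
      rw [h]; ring
    exact_mod_cast h1
  · rintro rfl
    push_cast; ring

/-- Division by `w₀` moves the cut of the argument to `-w₀`, away from the point where continuity is
needed. -/
theorem exists_rootBranch {N : ℕ} (hN : N ≠ 0) {w₀ : ℂ} (hw₀ : ‖w₀‖ = 1) :
    ∃ ρ : ℂ → ℂ, ContinuousAt ρ w₀ ∧ ∀ w, ‖w‖ = 1 → ρ w ^ N = w := by
  have hw0 : w₀ ≠ 0 := by intro h; simp [h] at hw₀
  have hN' : (N : ℝ) ≠ 0 := Nat.cast_ne_zero.2 hN
  refine ⟨fun w => cis (Complex.arg w₀ / N) * cis (Complex.arg (w / w₀) / N), ?_, ?_⟩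
  · refine continuousAt_const.mul (continuous_cis.continuousAt.comp ?_)
    refine ContinuousAt.div_const ?_ _
    refine ContinuousAt.comp (g := Complex.arg) ?_ (continuousAt_id.div_const w₀)
    refine Complex.continuousAt_arg ?_
    simp [hw0]
  · intro w hw
    have h1 : ‖w / w₀‖ = 1 := by rw [norm_div, hw, hw₀, div_one]
    rw [mul_pow, cis_pow, cis_pow, mul_div_cancel₀ _ hN', mul_div_cancel₀ _ hN', cis_arg hw₀,
      cis_arg h1, mul_div_cancel₀ _ hw0]

namespace Metric

variable {m n : ℕ} (g : Metric m n)

/-- Unit length is only known near `x₀`. Where it fails, the auxiliary map to `UnitVector` takes its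
value at `x₀`, which does not affect continuity there. -/
theorem continuousAt_mk {X : Type*} [TopologicalSpace X] {x₀ : X} {Γ : X → g.UnitTangentBundle}
    {i : Bool} {z v : X → ℂ} (hz : ContinuousAt z x₀) (hv : ContinuousAt v x₀)
    (h : ∀ᶠ x in 𝓝 x₀, ∃ hu, Γ x = UnitTangentBundle.mk g i (z x) (v x) hu) : ContinuousAt Γ x₀ := by
  classical
  obtain ⟨hu₀, -⟩ := h.self_of_nhds
  set f : X → g.UnitVector := fun x =>
    if hu : g.form i (z x) (v x) (v x) = 1 then ⟨(i, z x, v x), hu⟩ else ⟨(i, z x₀, v x₀), hu₀⟩ with hf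
  have hfx (x : X) (hu : g.form i (z x) (v x) (v x) = 1) : f x = ⟨(i, z x, v x), hu⟩ := dif_pos hu
  have hfc : ContinuousAt f x₀ := by
    refine Topology.IsInducing.subtypeVal.continuousAt_iff.2 ?_
    refine (continuousAt_const.prodMk (hz.prodMk hv) :
      ContinuousAt (fun x => (i, z x, v x)) x₀).congr ?_
    filter_upwards [h] with x ⟨hu, _⟩
    exact (congrArg Subtype.val (hfx x hu)).symm
  refine ContinuousAt.congr (f := fun x => (Quot.mk _ (f x) : g.UnitTangentBundle)) ?_ ?_
  · exact ContinuousAt.comp (g := fun y : g.UnitVector => (Quot.mk _ y : g.UnitTangentBundle))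
      continuous_quot_mk.continuousAt hfc
  · filter_upwards [h] with x ⟨hu, hx⟩
    rw [hx]
    exact congrArg (Quot.mk _) (hfx x hu)

theorem mk_eq_of_rel {i j : Bool} {z v w u : ℂ} (h : g.form i z v v = 1)
    (hrel : TangentRel m n (i, z, v) (j, w, u)) :
    ∃ h', UnitTangentBundle.mk g i z v h = UnitTangentBundle.mk g j w u h' :=
  ⟨(g.compat _ _ hrel).symm.trans h, Quot.sound hrel⟩

/-- The angle in the chart `i` of the meridian `ψ`. -/
noncomputable def chartAng (i : Bool) (ψ : ℝ) : ℝ :=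
  match i with
  | false => ψ / m
  | true => g.phase - ψ / n

/-- The point on the meridian `ψ` at distance `s` from the origin of the chart `i`. -/
noncomputable def chartPt (i : Bool) (s ψ : ℝ) : ℂ := polarMap (g.form i) (s, g.chartAng i ψ)

/-- The unit vector in chart `i` whose direction makes the angle `α` with the meridian, oriented
from the first pole to the second one in both charts. -/
noncomputable def chartVec (i : Bool) (s ψ p q : ℝ) : ℂ :=
  match i with
  | false => polarVec (g.form false) (s, g.chartAng false ψ) p q
  | true => polarVec (g.form true) (s, g.chartAng true ψ) (-p) q

/-- Straightened coordinates of the chart `i`, synchronized between the two charts. -/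
noncomputable def adPt (i : Bool) (ξ : ℂ) : ℂ :=
  match i with
  | false => straightPt (g.form false) ξ
  | true => straightPt (g.form true) (cis g.phase * (starRingEnd ℂ) ξ)

/-- The tangent vectors in synchronized straightened coordinates. -/
noncomputable def adVec (i : Bool) (ξ ν : ℂ) : ℂ :=
  match i with
  | false => straightVec (g.form false) ξ ν
  | true => straightVec (g.form true) (cis g.phase * (starRingEnd ℂ) ξ)
      (-(cis g.phase * (starRingEnd ℂ) ν))

/-- The inverse of `adPt`. -/
noncomputable def unadPt (i : Bool) (z : ℂ) : ℂ :=
  match i with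
  | false => unstraightPt (g.form false) z
  | true => cis g.phase * (starRingEnd ℂ) (unstraightPt (g.form true) z)

/-- The inverse of `adVec`. -/
noncomputable def unadVec (i : Bool) (z v : ℂ) : ℂ :=
  match i with
  | false => unstraightVec (g.form false) z v
  | true => -(cis g.phase * (starRingEnd ℂ) (unstraightVec (g.form true) z v))

end Metric

theorem straightPt_mul {b : ℂ → LinearMap.BilinForm ℝ ℂ} {ζ : ℂ} (hζ : ‖ζ‖ = 1) (z : ℂ) :
    straightPt b (ζ * z) = ζ * straightPt b z := by
  unfold straightPt
  rw [norm_mul, hζ, one_mul]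
  ring

theorem straightVec_mul {b : ℂ → LinearMap.BilinForm ℝ ℂ} {ζ : ℂ} (hζ : ‖ζ‖ = 1) (z v : ℂ) :
    straightVec b (ζ * z) (ζ * v) = ζ * straightVec b z v := by
  unfold straightVec
  have h1 : ζ * v * (starRingEnd ℂ) (ζ * z) = v * (starRingEnd ℂ) z := by
    have : ζ * (starRingEnd ℂ) ζ = 1 := by
      rw [Complex.mul_conj, Complex.normSq_eq_norm_sq, hζ]; simp
    rw [map_mul]
    linear_combination (v * (starRingEnd ℂ) z) * this
  rw [norm_mul, hζ, one_mul, h1]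
  ring

namespace Metric.RotSym

variable {m n : ℕ} {g : Metric m n} (hg : g.RotSym)
include hg

theorem order_pos (i : Bool) : 0 < order m n i := by
  cases i
  exacts [hg.hm, hg.hn]

omit hg in
theorem order_add (i : Bool) : order m n i + order m n (!i) = m + n := by
  cases i
  exacts [rfl, add_comm _ _]

theorem order_pos' (i : Bool) : (0 : ℝ) < order m n i := Nat.cast_pos.2 (hg.order_pos i)

theorem chartVec_unit (i : Bool) (s ψ p q : ℝ) (h : p ^ 2 + q ^ 2 = 1) :
    g.form i (g.chartPt i s ψ) (g.chartVec i s ψ p q) (g.chartVec i s ψ p q) = 1 := by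
  cases i <;> simp only [chartPt, chartVec, (hg.isRotForm _).form_polar] <;> linarith

/-- `chartVec` orients the meridian component from the first to the second pole in both charts, so
only the component along the orbits changes sign. -/
theorem overlap (i : Bool) {s : ℝ} (h0 : 0 < s) (h1 : s < g.len) (ψ p q : ℝ) :
    TangentRel m n (i, g.chartPt i s ψ, g.chartVec i s ψ p q)
      (!i, g.chartPt (!i) (g.len - s) ψ, g.chartVec (!i) (g.len - s) ψ p (-q)) := by
  cases i
  · exact hg.tangentRel_polar h0 h1 ψ p q
  · have h := hg.tangentRel_polar (s := g.len - s) (by linarith) (by linarith) ψ p (-q)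
    rw [sub_sub_cancel, neg_neg] at h
    refine ⟨?_, ?_⟩
    · rw [mul_comm]; exact h.1
    · rw [add_comm]; exact h.2

/-- In the second chart the meridian angle is `phase - ψ / n`; the conjugation and the phase in
`adPt` undo this, so that both charts obey one formula with `ψ / order`. -/
theorem ad_polar (i : Bool) {s : ℝ} (h0 : -g.len < s) (h1 : s < g.len) (ψ α : ℝ) :
    g.adPt i (s * cis (ψ / order m n i)) = g.chartPt i s ψ ∧
    g.adVec i (s * cis (ψ / order m n i)) (cis (ψ / order m n i + α))
      = g.chartVec i s ψ (Real.cos α) (Real.sin α) := by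
  have hs := hg.mem_range (i := i) h0 h1
  cases i
  · exact (hg.isRotForm false).straight_polar hs _ _
  · have h := (hg.isRotForm true).straight_polar hs (g.phase - ψ / n) (Real.pi - α)
    have e1 : cis g.phase * (starRingEnd ℂ) (s * cis (ψ / n)) = s * cis (g.phase - ψ / n) := by
      rw [map_mul, Complex.conj_ofReal, conj_cis, cis_neg, cis_sub]; ring
    have e2 : -(cis g.phase * (starRingEnd ℂ) (cis (ψ / n + α)))
        = cis (g.phase - ψ / n + (Real.pi - α)) := by
      rw [conj_cis, cis_neg, cis_add, cis_add, cis_sub, cis_sub, cis_pi]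
      have := cis_ne_zero (ψ / n)
      have := cis_ne_zero α
      field_simp
    rw [Real.cos_pi_sub, Real.sin_pi_sub] at h
    simp only [adPt, adVec, order, e1, e2]
    exact h

theorem unad_polar (i : Bool) {s : ℝ} (h0 : -g.len < s) (h1 : s < g.len) (ψ α : ℝ) :
    g.unadPt i (g.chartPt i s ψ) = s * cis (ψ / order m n i) ∧
    g.unadVec i (g.chartPt i s ψ) (g.chartVec i s ψ (Real.cos α) (Real.sin α))
      = cis (ψ / order m n i + α) := by
  have hs := hg.mem_range (i := i) h0 h1
  cases i
  · exact (hg.isRotForm false).unstraight_polar hs _ _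
  · have h := (hg.isRotForm true).unstraight_polar hs (g.phase - ψ / n) (Real.pi - α)
    rw [Real.cos_pi_sub, Real.sin_pi_sub] at h
    simp only [unadPt, unadVec, chartPt, chartVec, chartAng, order]
    rw [h.1, h.2]
    change cis g.phase * (starRingEnd ℂ) (s * cis (g.phase - ψ / n)) = _ ∧
      -(cis g.phase * (starRingEnd ℂ) (cis (g.phase - ψ / n + (Real.pi - α)))) = _
    have h3 := cis_ne_zero (ψ / n)
    have h4 := cis_ne_zero α
    have h5 := cis_ne_zero g.phase
    constructor
    · rw [map_mul, Complex.conj_ofReal, conj_cis, neg_sub, cis_sub]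
      field_simp
    · rw [conj_cis, cis_neg, cis_add, cis_add, cis_sub, cis_sub, cis_pi]
      field_simp

omit hg in
theorem ad_mul (i : Bool) {ζ : ℂ} (hζ : ‖ζ‖ = 1) (h : ζ ^ order m n i = 1) (ξ ν : ℂ) :
    TangentRel m n (i, g.adPt i ξ, g.adVec i ξ ν) (i, g.adPt i (ζ * ξ), g.adVec i (ζ * ξ) (ζ * ν)) := by
  have hc : ‖(starRingEnd ℂ) ζ‖ = 1 := by rw [Complex.norm_conj, hζ]
  cases i
  · simp only [TangentRel, if_true]
    exact ⟨ζ, h, straightPt_mul hζ _, straightVec_mul hζ _ _⟩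
  · simp only [TangentRel, if_true]
    refine ⟨(starRingEnd ℂ) ζ, by rw [← map_pow, h, map_one], ?_, ?_⟩
    · simp only [adPt]
      rw [← straightPt_mul hc, map_mul, mul_left_comm]
    · simp only [adVec]
      rw [← straightVec_mul hc, map_mul, map_mul]
      congr 1 <;> ring

theorem continuousAt_adPt (i : Bool) {ξ : ℂ} (h : ‖ξ‖ < g.len) : ContinuousAt (g.adPt i) ξ := by
  have hm {ξ : ℂ} (h : ‖ξ‖ < g.len) : ‖ξ‖ ∈ Set.range (arc (g.form i)) :=
    hg.mem_range (by linarith [norm_nonneg ξ, hg.len_pos]) h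
  cases i
  · exact (hg.isRotForm false).continuousAt_straightPt (hm h)
  · have h1 : ContinuousAt (straightPt (g.form true)) (cis g.phase * (starRingEnd ℂ) ξ) := by
      refine (hg.isRotForm true).continuousAt_straightPt (hm ?_)
      rwa [norm_mul, norm_cis, one_mul, Complex.norm_conj]
    exact ContinuousAt.comp (f := fun ξ => cis g.phase * (starRingEnd ℂ) ξ) h1
      (continuous_const.mul Complex.continuous_conj).continuousAt

theorem continuousAt_adVec (i : Bool) {x : ℂ × ℂ} (h : ‖x.1‖ < g.len) :
    ContinuousAt (fun x : ℂ × ℂ => g.adVec i x.1 x.2) x := by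
  have hm {ξ : ℂ} (h : ‖ξ‖ < g.len) : ‖ξ‖ ∈ Set.range (arc (g.form i)) :=
    hg.mem_range (by linarith [norm_nonneg ξ, hg.len_pos]) h
  cases i
  · exact (hg.isRotForm false).continuousAt_straightVec (hm h)
  · have h1 : ContinuousAt (fun x : ℂ × ℂ => straightVec (g.form true) x.1 x.2)
        (cis g.phase * (starRingEnd ℂ) x.1, -(cis g.phase * (starRingEnd ℂ) x.2)) := by
      refine (hg.isRotForm true).continuousAt_straightVec (hm ?_)
      simp only
      rwa [norm_mul, norm_cis, one_mul, Complex.norm_conj]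
    refine ContinuousAt.comp (f := fun x : ℂ × ℂ =>
      (cis g.phase * (starRingEnd ℂ) x.1, -(cis g.phase * (starRingEnd ℂ) x.2))) h1 ?_
    exact ((continuous_const.mul (Complex.continuous_conj.comp continuous_fst)).prodMk
      (continuous_const.mul (Complex.continuous_conj.comp continuous_snd)).neg).continuousAt

theorem continuous_unadPt (i : Bool) : Continuous (g.unadPt i) := by
  have := (hg.isRotForm i).continuous_unstraightPt
  cases i
  · exact this
  · exact continuous_const.mul (Complex.continuous_conj.comp this)

theorem continuous_unadVec (i : Bool) : Continuous (fun x : ℂ × ℂ => g.unadVec i x.1 x.2) := by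
  have := (hg.isRotForm i).continuous_unstraightVec
  cases i
  · exact this
  · exact (continuous_const.mul (Complex.continuous_conj.comp this)).neg

/-- Polar coordinates of a unit tangent vector. -/
theorem exists_chart_polar (i : Bool) {z v : ℂ} (h : g.form i z v v = 1) :
    ∃ s ψ α : ℝ, 0 ≤ s ∧ s < g.len ∧ (z ≠ 0 → 0 < s) ∧ z = g.chartPt i s ψ ∧
      v = g.chartVec i s ψ (Real.cos α) (Real.sin α) := by
  have hb := hg.isRotForm i
  set s := arc (g.form i) ‖z‖ with hs
  have hsr : s ∈ Set.range (arc (g.form i)) := ⟨_, rfl⟩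
  set χ := Complex.arg z + twist (g.form i) ‖z‖ with hχ
  have hz : polarMap (g.form i) (s, χ) = z := by
    simp only [polarMap, hs, hχ, hb.arcInv_arc, add_sub_cancel_right]
    exact Complex.norm_mul_exp_arg_mul_I _
  obtain ⟨p, q, hpq⟩ := hb.exists_polarVec (s, χ) v
  have hu : p * p + q * q = 1 := by
    rw [← hb.form_polar (s, χ) p q p q, hz, hpq, h]
  have h0 : 0 ≤ s := by
    have := hb.strictMono_arc.monotone (norm_nonneg z)
    rwa [arc_zero] at this
  have hpos : z ≠ 0 → 0 < s := fun hz => hg.arc_pos i (norm_pos_iff.2 hz)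
  have ang (p q : ℝ) (hu : p * p + q * q = 1) : ∃ α, p = Real.cos α ∧ q = Real.sin α := by
    have hn : ‖(⟨p, q⟩ : ℂ)‖ = 1 := by
      have h1 := Complex.sq_norm (⟨p, q⟩ : ℂ)
      rw [Complex.normSq_mk, hu] at h1
      exact (pow_eq_one_iff_of_nonneg (norm_nonneg _) two_ne_zero).1 h1
    have h1 := cis_arg hn
    rw [cis_eq] at h1
    refine ⟨Complex.arg ⟨p, q⟩, ?_, ?_⟩
    · have := congrArg Complex.re h1
      simpa [-Complex.ofReal_cos, -Complex.ofReal_sin] using this.symm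
    · have := congrArg Complex.im h1
      simpa [-Complex.ofReal_cos, -Complex.ofReal_sin] using this.symm
  have hm := hg.m_pos.ne'
  have hn := hg.n_pos.ne'
  cases i
  · obtain ⟨α, rfl, rfl⟩ := ang p q hu
    refine ⟨s, m * χ, α, h0, hg.lt_len_of_mem_range hsr, hpos, ?_, ?_⟩
    · simp only [chartPt, chartAng, mul_div_cancel_left₀ _ hm, hz]
    · simp only [chartVec, chartAng, mul_div_cancel_left₀ _ hm, hpq]
  · obtain ⟨α, hp, rfl⟩ := ang (-p) q (by linarith)
    refine ⟨s, n * (g.phase - χ), α, h0, hg.lt_len_of_mem_range hsr, hpos, ?_, ?_⟩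
    · simp only [chartPt, chartAng, mul_div_cancel_left₀ _ hn, sub_sub_cancel, hz]
    · simp only [chartVec, chartAng, mul_div_cancel_left₀ _ hn, sub_sub_cancel, ← hp, neg_neg, hpq]

end Metric.RotSym

end Spindle

/-! ### The map from the unit tangent bundle to the lens space. -/

namespace Spindle

open IsRotForm

namespace Punct

/-- The coordinate of the punctured plane that does not vanish over the chart `i`. -/
def own (i : Bool) (x : Punct) : ℂ :=
  match i with
  | false => x.1.1
  | true => x.1.2

/-- The point with given coordinates, in the order determined by the chart `i`. -/
def ofOwn (i : Bool) (a b : ℂ) (h : a ≠ 0 ∨ b ≠ 0) : Punct :=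
  match i with
  | false => ⟨(a, b), fun h0 => h.elim (fun ha => ha (congrArg Prod.fst h0))
      (fun hb => hb (congrArg Prod.snd h0))⟩
  | true => ⟨(b, a), fun h0 => h.elim (fun ha => ha (congrArg Prod.snd h0))
      (fun hb => hb (congrArg Prod.fst h0))⟩

theorem own_ofOwn (i : Bool) (a b : ℂ) (h : a ≠ 0 ∨ b ≠ 0) : own i (ofOwn i a b h) = a := by
  cases i <;> rfl

theorem own_not_ofOwn (i : Bool) (a b : ℂ) (h : a ≠ 0 ∨ b ≠ 0) : own (!i) (ofOwn i a b h) = b := by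
  cases i <;> rfl

theorem ext_own (i : Bool) {x y : Punct} (h1 : own i x = own i y) (h2 : own (!i) x = own (!i) y) :
    x = y := by
  cases i
  · exact Subtype.ext (Prod.ext h1 h2)
  · exact Subtype.ext (Prod.ext h2 h1)

theorem continuous_own (i : Bool) : Continuous (own i) := by
  have h : Continuous (fun x : Punct => x.1) := continuous_subtype_val
  cases i
  exacts [h.fst, h.snd]

theorem own_ne (i : Bool) (x : Punct) : own i x ≠ 0 ∨ own (!i) x ≠ 0 := by
  by_contra h
  push Not at h
  apply x.2
  cases i
  exacts [Prod.ext h.1 h.2, Prod.ext h.2 h.1]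

end Punct

open Punct

theorem Lens.mk_eq_own {N : ℕ} [NeZero N] (i : Bool) {x y : Punct} (ζ : ℂ) (h : ζ ^ N = 1)
    (h1 : own i x = ζ * own i y) (h2 : own (!i) x = ζ * own (!i) y) :
    Lens.mk N x = Lens.mk N y := by
  rw [Lens.mk_eq_iff]
  cases i
  · exact ⟨ζ, h, h1, h2⟩
  · exact ⟨ζ, h, h2, h1⟩

theorem Lens.continuousAt_of {N : ℕ} {X : Type*} [TopologicalSpace X] {x₀ : X} {Θ : X → Lens N}
    {i : Bool} {a b : X → ℂ} (ha : ContinuousAt a x₀) (hb : ContinuousAt b x₀)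
    (h : ∀ᶠ x in 𝓝 x₀, ∃ h, Θ x = Lens.mk N (ofOwn i (a x) (b x) h)) : ContinuousAt Θ x₀ := by
  classical
  obtain ⟨h₀, -⟩ := h.self_of_nhds
  set f : X → Punct := fun x => if hu : a x ≠ 0 ∨ b x ≠ 0 then ofOwn i (a x) (b x) hu
    else ofOwn i (a x₀) (b x₀) h₀ with hf
  have hfx (x : X) (hu : a x ≠ 0 ∨ b x ≠ 0) : f x = ofOwn i (a x) (b x) hu := dif_pos hu
  have hfc : ContinuousAt f x₀ := by
    refine Topology.IsInducing.subtypeVal.continuousAt_iff.2 ?_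
    cases i
    · refine (ha.prodMk hb : ContinuousAt (fun x => (a x, b x)) x₀).congr ?_
      filter_upwards [h] with x ⟨hu, _⟩
      exact (congrArg Subtype.val (hfx x hu)).symm
    · refine (hb.prodMk ha : ContinuousAt (fun x => (b x, a x)) x₀).congr ?_
      filter_upwards [h] with x ⟨hu, _⟩
      exact (congrArg Subtype.val (hfx x hu)).symm
  refine ContinuousAt.congr (f := fun x => Lens.mk N (f x)) ?_ ?_
  · exact ContinuousAt.comp (Lens.continuous_mk N).continuousAt hfc
  · filter_upwards [h] with x ⟨hu, hx⟩
    rw [hx, hfx x hu]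

/-- The point of the unit sphere at colatitude `s` (seen from chart `i`), scaled to `[0, L]`. -/
noncomputable def clPt (L : ℝ) (i : Bool) (s β β' : ℝ) : Punct :=
  ofOwn i (Real.cos (Real.pi * s / (2 * L)) * cis β) (Real.sin (Real.pi * s / (2 * L)) * cis β') (by
    by_contra h
    push Not at h
    have h1 : Real.cos (Real.pi * s / (2 * L)) = 0 := by
      exact_mod_cast (mul_eq_zero.1 h.1).resolve_right (cis_ne_zero _)
    have h2 : Real.sin (Real.pi * s / (2 * L)) = 0 := by
      exact_mod_cast (mul_eq_zero.1 h.2).resolve_right (cis_ne_zero _)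
    have := Real.sin_sq_add_cos_sq (Real.pi * s / (2 * L))
    rw [h1, h2] at this
    norm_num at this)

theorem own_clPt (L : ℝ) (i : Bool) (s β β' : ℝ) :
    own i (clPt L i s β β') = Real.cos (Real.pi * s / (2 * L)) * cis β := own_ofOwn _ _ _ _
theorem own_not_clPt (L : ℝ) (i : Bool) (s β β' : ℝ) :
    own (!i) (clPt L i s β β') = Real.sin (Real.pi * s / (2 * L)) * cis β' := own_not_ofOwn _ _ _ _

theorem clPt_not {L : ℝ} (hL : 0 < L) (i : Bool) (s β β' : ℝ) :
    clPt L (!i) (L - s) β' β = clPt L i s β β' := by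
  have h : Real.pi * (L - s) / (2 * L) = Real.pi / 2 - Real.pi * s / (2 * L) := by field_simp
  apply ext_own i
  · have := own_not_clPt L (!i) (L - s) β' β
    rw [Bool.not_not] at this
    rw [this, own_clPt, h, Real.sin_pi_div_two_sub]
  · rw [own_clPt, own_not_clPt, h, Real.cos_pi_div_two_sub]

/-- Passing both poles leads to the antipode, which is why a meridian closes up in the punctured
plane only after `4 L`. -/
theorem clPt_add_two_mul {L : ℝ} (hL : 0 < L) (i : Bool) (s β β' : ℝ) :
    clPt L i (s + 2 * L) β β' = clPt L i s (β + Real.pi) (β' + Real.pi) := by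
  have h : Real.pi * (s + 2 * L) / (2 * L) = Real.pi * s / (2 * L) + Real.pi := by field_simp
  apply ext_own i
  · rw [own_clPt, own_clPt, h, Real.cos_add_pi, cis_add, cis_pi]
    push_cast; ring
  · rw [own_not_clPt, own_not_clPt, h, Real.sin_add_pi, cis_add, cis_pi]
    push_cast; ring

namespace Metric.RotSym

variable {m n : ℕ} {g : Metric m n} (hg : g.RotSym)
include hg

theorem neZero : NeZero (m + n) := ⟨by have := hg.hm; omega⟩

omit hg in
theorem order_add' (i : Bool) : (order m n i : ℝ) + order m n (!i) = (m + n : ℕ) := by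
  rw [← order_add i]; push_cast; rfl

theorem total_pos : (0 : ℝ) < (m + n : ℕ) := by
  have := hg.hm
  exact_mod_cast (by omega : 0 < m + n)

theorem half_angle {s : ℝ} (h0 : -g.len < s) (h1 : s < g.len) :
    0 < Real.cos (Real.pi * s / (2 * g.len)) := by
  have hL := hg.len_pos
  refine Real.cos_pos_of_mem_Ioo ⟨?_, ?_⟩
  · rw [lt_div_iff₀ (by linarith)]; nlinarith [Real.pi_pos]
  · rw [div_lt_iff₀ (by linarith)]; nlinarith [Real.pi_pos]

/-- The coordinates of the class in the lens space do not depend on the choice of the root. -/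
theorem lens_root [NeZero (m + n)] (i : Bool) {s : ℝ} (h0 : -g.len < s) (h1 : s < g.len)
    (ψ α : ℝ) {l ξ : ℂ} (hl : l ^ (m + n) = cis (ψ / order m n i + α))
    (hξ : ξ = s * cis (ψ / order m n i)) :
    ∃ h, Lens.mk (m + n) (ofOwn i (Real.cos (Real.pi * ‖ξ‖ / (2 * g.len)) * l ^ order m n i)
      (((Real.sin (Real.pi * ‖ξ‖ / (2 * g.len)) / ‖ξ‖ : ℝ) * ξ) * (l ^ order m n (!i))⁻¹) h)
      = Lens.mk (m + n) (clPt g.len i s ((ψ + order m n i * α) / (m + n : ℕ))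
          ((ψ - order m n (!i) * α) / (m + n : ℕ))) := by
  have hN := hg.total_pos
  have ho := hg.order_pos' i
  have hl0 : l ≠ 0 := by
    intro h
    rw [h, zero_pow (NeZero.ne _)] at hl
    exact cis_ne_zero _ hl.symm
  have hnorm : ‖ξ‖ = |s| := by
    rw [hξ, norm_mul, norm_cis, mul_one, Complex.norm_real, Real.norm_eq_abs]
  have hcos : Real.cos (Real.pi * ‖ξ‖ / (2 * g.len)) = Real.cos (Real.pi * s / (2 * g.len)) := by
    rw [hnorm]
    rcases abs_choice s with h | h
    · rw [h]
    · rw [h, mul_neg, neg_div, Real.cos_neg]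
  -- The quotient is even in `s`, so the sign of the radius is irrelevant.
  have hsin : ((Real.sin (Real.pi * ‖ξ‖ / (2 * g.len)) / ‖ξ‖ : ℝ) * ξ : ℂ)
      = Real.sin (Real.pi * s / (2 * g.len)) * cis (ψ / order m n i) := by
    rw [hnorm, hξ]
    rcases eq_or_ne s 0 with h | h
    · simp [h]
    · have h' : (s : ℂ) ≠ 0 := by exact_mod_cast h
      rcases abs_choice s with h2 | h2
      · rw [h2]; push_cast; field_simp
      · rw [h2, mul_neg, neg_div, Real.sin_neg, neg_div_neg_eq]; push_cast; field_simp
  have hpos := hg.half_angle h0 h1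
  set l₀ := cis ((ψ / order m n i + α) / (m + n : ℕ)) with hl₀
  have hl₀0 : l₀ ≠ 0 := cis_ne_zero _
  have hl₀N : l₀ ^ (m + n) = cis (ψ / order m n i + α) := by
    rw [hl₀, cis_pow, mul_div_cancel₀ _ hN.ne']
  set ε := l / l₀ with hε
  have hεN : ε ^ (m + n) = 1 := by rw [hε, div_pow, hl, hl₀N, div_self (cis_ne_zero _)]
  have hlε : l = ε * l₀ := by rw [hε, div_mul_cancel₀ _ hl₀0]
  have hε0 : ε ≠ 0 := div_ne_zero hl0 hl₀0
  -- Two roots of degree `m + n` differ by `ε` with `ε ^ (m + n) = 1`. As the two orders add up to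
  -- `m + n`, both coordinates get multiplied by the same root of unity.
  have hεo : ε ^ order m n i = (ε ^ order m n (!i))⁻¹ := by
    refine eq_inv_of_mul_eq_one_left ?_
    rw [← pow_add, order_add, hεN]
  refine ⟨Or.inl (mul_ne_zero ?_ (pow_ne_zero _ hl0)), ?_⟩
  · rw [hcos]; exact_mod_cast hpos.ne'
  · refine Lens.mk_eq_own i (ε ^ order m n i) (by rw [← pow_mul, mul_comm, pow_mul, hεN, one_pow])
      ?_ ?_
    · rw [own_ofOwn, own_clPt, hcos, hlε, mul_pow]
      have : l₀ ^ order m n i = cis ((ψ + order m n i * α) / (m + n : ℕ)) := by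
        rw [hl₀, cis_pow]; congr 1; field_simp
      rw [this]; ring
    · rw [own_not_ofOwn, own_not_clPt, hsin, hlε, mul_pow, mul_inv, ← hεo]
      have : cis (ψ / order m n i) * (l₀ ^ order m n (!i))⁻¹
          = cis ((ψ - order m n (!i) * α) / (m + n : ℕ)) := by
        rw [hl₀, cis_pow, ← cis_neg, ← cis_add]
        congr 1
        have := order_add' (m := m) (n := n) i
        field_simp
        rw [← this]
        ring
      rw [← this]
      ring

/-- The class in the lens space of a unit tangent vector of a chart. -/
noncomputable def chartLens (x : g.UnitVector) : Lens (m + n) :=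
  let h := hg.exists_chart_polar x.1.1 x.2
  Lens.mk (m + n) (clPt g.len x.1.1 h.choose
    ((h.choose_spec.choose + order m n x.1.1 * h.choose_spec.choose_spec.choose) / (m + n : ℕ))
    ((h.choose_spec.choose - order m n (!x.1.1) * h.choose_spec.choose_spec.choose) / (m + n : ℕ)))

/-- Replaces the arbitrarily chosen polar data by the continuous `unadPt` and `unadVec`; any root
`l` serves, by `lens_root`. Continuity is proved in this form. -/
theorem chartLens_root [NeZero (m + n)] (x : g.UnitVector) {l : ℂ}
    (hl : l ^ (m + n) = g.unadVec x.1.1 x.1.2.1 x.1.2.2) :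
    ∃ h, hg.chartLens x = Lens.mk (m + n) (ofOwn x.1.1
      (Real.cos (Real.pi * ‖g.unadPt x.1.1 x.1.2.1‖ / (2 * g.len)) * l ^ order m n x.1.1)
      (((Real.sin (Real.pi * ‖g.unadPt x.1.1 x.1.2.1‖ / (2 * g.len)) / ‖g.unadPt x.1.1 x.1.2.1‖ : ℝ)
        * g.unadPt x.1.1 x.1.2.1) * (l ^ order m n (!x.1.1))⁻¹) h) := by
  have key : ∀ s ψ α : ℝ, (0 ≤ s ∧ s < g.len ∧ (x.1.2.1 ≠ 0 → 0 < s) ∧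
      x.1.2.1 = g.chartPt x.1.1 s ψ ∧
      x.1.2.2 = g.chartVec x.1.1 s ψ (Real.cos α) (Real.sin α)) → ∃ h, Lens.mk (m + n)
        (clPt g.len x.1.1 s ((ψ + order m n x.1.1 * α) / (m + n : ℕ))
          ((ψ - order m n (!x.1.1) * α) / (m + n : ℕ))) = Lens.mk (m + n) (ofOwn x.1.1
      (Real.cos (Real.pi * ‖g.unadPt x.1.1 x.1.2.1‖ / (2 * g.len)) * l ^ order m n x.1.1)
      (((Real.sin (Real.pi * ‖g.unadPt x.1.1 x.1.2.1‖ / (2 * g.len)) / ‖g.unadPt x.1.1 x.1.2.1‖ : ℝ)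
        * g.unadPt x.1.1 x.1.2.1) * (l ^ order m n (!x.1.1))⁻¹) h) := by
    rintro s ψ α ⟨h0, h1, -, h2, h3⟩
    have h4 := hg.unad_polar x.1.1 (by linarith [hg.len_pos]) h1 ψ α
    rw [← h2, ← h3] at h4
    rw [h4.2] at hl
    obtain ⟨h5, h6⟩ := hg.lens_root x.1.1 (by linarith [hg.len_pos]) h1 ψ α hl h4.1
    exact ⟨h5, h6.symm⟩
  have h := hg.exists_chart_polar x.1.1 x.2
  exact key _ _ _ h.choose_spec.choose_spec.choose_spec

theorem chartLens_polar [NeZero (m + n)] (x : g.UnitVector) {s : ℝ} (h0 : -g.len < s)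
    (h1 : s < g.len) {ψ α : ℝ} (hz : x.1.2.1 = g.chartPt x.1.1 s ψ)
    (hv : x.1.2.2 = g.chartVec x.1.1 s ψ (Real.cos α) (Real.sin α)) :
    hg.chartLens x = Lens.mk (m + n) (clPt g.len x.1.1 s
      ((ψ + order m n x.1.1 * α) / (m + n : ℕ)) ((ψ - order m n (!x.1.1) * α) / (m + n : ℕ))) := by
  have h4 := hg.unad_polar x.1.1 h0 h1 ψ α
  rw [← hz, ← hv] at h4
  have hl : cis ((ψ / order m n x.1.1 + α) / (m + n : ℕ)) ^ (m + n)
      = cis (ψ / order m n x.1.1 + α) := by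
    rw [cis_pow, mul_div_cancel₀ _ hg.total_pos.ne']
  obtain ⟨h5, h6⟩ := hg.lens_root x.1.1 h0 h1 ψ α hl h4.1
  obtain ⟨h7, h8⟩ := hg.chartLens_root x (hl.trans h4.2.symm)
  rw [h8, ← h6]

/-- The local group shifts the meridian label by a multiple of `2π`, hence both phases by the same
multiple of `2π / (m + n)`, which is the action of a root of unity. -/
theorem chartLens_same [NeZero (m + n)] {i : Bool} {z v w u : ℂ} (h : g.form i z v v = 1)
    (h' : g.form i w u u = 1) (hrel : TangentRel m n (i, z, v) (i, w, u)) :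
    hg.chartLens ⟨(i, z, v), h⟩ = hg.chartLens ⟨(i, w, u), h'⟩ := by
  simp only [TangentRel, if_true] at hrel
  obtain ⟨ζ, hζ, rfl, rfl⟩ := hrel
  obtain ⟨s, ψ, α, h0, h1, -, h2, h3⟩ := hg.exists_chart_polar i h
  have hζn : ‖ζ‖ = 1 := Complex.norm_eq_one_of_pow_eq_one hζ (hg.order_pos i).ne'
  set a := Complex.arg ζ with ha
  have hcis : cis a = ζ := cis_arg hζn
  obtain ⟨k, hk⟩ : ∃ k : ℤ, order m n i * a = 2 * Real.pi * k := by
    rw [← cis_eq_one_iff, ← cis_pow, hcis, hζ]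
  have key : ∃ k' : ℤ, ζ * z = g.chartPt i s (ψ + 2 * Real.pi * k') ∧
      ζ * v = g.chartVec i s (ψ + 2 * Real.pi * k') (Real.cos α) (Real.sin α) := by
    cases i
    · refine ⟨k, ?_⟩
      have : g.chartAng false (ψ + 2 * Real.pi * k) = g.chartAng false ψ + a := by
        have := hg.m_pos.ne'
        simp only [chartAng, ← hk, order]; field_simp
      simp only [chartPt, chartVec, this, polarMap_add, polarVec_add] at h2 h3 ⊢
      rw [h2, h3]
      rw [← hcis]
      exact ⟨rfl, rfl⟩
    · refine ⟨-k, ?_⟩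
      have : g.chartAng true (ψ + 2 * Real.pi * (-k : ℤ)) = g.chartAng true ψ + a := by
        have := hg.n_pos.ne'
        push_cast
        rw [mul_neg, ← hk]
        simp only [chartAng, order]; field_simp; ring
      simp only [chartPt, chartVec, this, polarMap_add, polarVec_add] at h2 h3 ⊢
      rw [h2, h3]
      rw [← hcis]
      exact ⟨rfl, rfl⟩
  obtain ⟨k', hz, hv⟩ := key
  rw [hg.chartLens_polar ⟨(i, z, v), h⟩ (by linarith [hg.len_pos]) h1 h2 h3,
    hg.chartLens_polar ⟨(i, ζ * z, ζ * v), h'⟩ (by linarith [hg.len_pos]) h1 hz hv]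
  have hN := hg.total_pos.ne'
  refine Lens.mk_eq_own i (cis (-(2 * Real.pi * k') / (m + n : ℕ))) ?_ ?_ ?_
  · rw [cis_pow, mul_div_cancel₀ _ hN, cis_eq_one_iff]
    exact ⟨-k', by push_cast; ring⟩
  · rw [own_clPt, own_clPt, mul_left_comm, ← cis_add]
    congr 2
    field_simp
    ring
  · rw [own_not_clPt, own_not_clPt, mul_left_comm, ← cis_add]
    congr 2
    field_simp
    ring

omit hg in
-- Comparing the two gluing equations shows that `w' / w` is the required element of the local
-- group.
theorem tangentRel_of_cross {i : Bool} {z v w u w' u' : ℂ} (hm : 0 < m) (hn : 0 < n)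
    (h1 : TangentRel m n (i, z, v) (!i, w, u)) (h2 : TangentRel m n (i, z, v) (!i, w', u')) :
    TangentRel m n (!i, w, u) (!i, w', u') := by
  have hii : ¬ (i = !i) := by cases i <;> simp
  simp only [TangentRel, if_true, if_neg hii] at h1 h2 ⊢
  obtain ⟨a1, a2⟩ := h1
  obtain ⟨b1, b2⟩ := h2
  have hoi : order m n (!i) ≠ 0 := by cases i; exacts [hn.ne', hm.ne']
  have hz : z ≠ 0 := by
    rintro rfl
    have : order m n i ≠ 0 := by cases i; exacts [hm.ne', hn.ne']
    rw [zero_pow this, zero_mul] at a1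
    exact zero_ne_one a1
  have hw : w ≠ 0 := by
    rintro rfl
    rw [zero_pow hoi, mul_zero] at a1
    exact zero_ne_one a1
  have hw' : w' ≠ 0 := by
    rintro rfl
    rw [zero_pow hoi, mul_zero] at b1
    exact zero_ne_one b1
  have ho : (order m n (!i) : ℂ) ≠ 0 := Nat.cast_ne_zero.2 hoi
  refine ⟨w' / w, ?_, by field_simp, ?_⟩
  · rw [div_pow, div_eq_one_iff_eq (pow_ne_zero _ hw)]
    refine mul_left_cancel₀ (pow_ne_zero (order m n i) hz) ?_
    rw [a1, b1]
  · rw [div_mul_eq_mul_div, eq_div_iff hw]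
    refine mul_left_cancel₀ ho (mul_left_cancel₀ hz ?_)
    linear_combination w * b2 - w' * a2

/-- Any representative in the other chart differs by the local group from the one of `overlap`. For
the latter, `s ↦ len - s` and `α ↦ -α` just exchange sine and cosine together with the two
coordinates. -/
theorem chartLens_rel [NeZero (m + n)] {x y : g.UnitVector} (hrel : TangentRel m n x.1 y.1) :
    hg.chartLens x = hg.chartLens y := by
  obtain ⟨⟨i, z, v⟩, hx⟩ := x
  obtain ⟨⟨j, w, u⟩, hy⟩ := y
  by_cases hij : i = j
  · subst hij
    exact hg.chartLens_same hx hy hrel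
  · obtain rfl : j = !i := by
      cases i <;> cases j <;> simp at hij ⊢
    obtain ⟨s, ψ, α, h0, h1, hz0, h2, h3⟩ := hg.exists_chart_polar i hx
    have hz : z ≠ 0 := by
      rintro rfl
      have hii : ¬ (i = !i) := by cases i <;> simp
      simp only [TangentRel, if_neg hii] at hrel
      rw [zero_pow (hg.order_pos i).ne', zero_mul] at hrel
      exact zero_ne_one hrel.1
    have hs := hz0 hz
    have hov := hg.overlap i hs h1 ψ (Real.cos α) (Real.sin α)
    rw [← h2, ← h3, ← Real.sin_neg, ← Real.cos_neg α] at hov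
    obtain ⟨hu, -⟩ := g.mk_eq_of_rel hx hov
    have e1 := hg.chartLens_same hy hu (tangentRel_of_cross hg.hm hg.hn hrel hov)
    have e2 := hg.chartLens_polar ⟨(i, z, v), hx⟩ (by linarith) h1 h2 h3
    have e3 := hg.chartLens_polar ⟨(!i, _, _), hu⟩ (s := g.len - s) (by linarith) (by linarith)
      (ψ := ψ) (α := -α) rfl rfl
    refine e2.trans (Eq.trans ?_ (e1.trans e3).symm)
    simp only [Bool.not_not]
    rw [← clPt_not hg.len_pos]
    congr 2 <;> ring

/-- The map from the unit tangent bundle to the quotient of the punctured plane by the roots of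
unity. -/
noncomputable def toLens [NeZero (m + n)] : g.UnitTangentBundle → Lens (m + n) :=
  Quot.lift hg.chartLens fun _ _ h => hg.chartLens_rel h

theorem continuous_chartLens [NeZero (m + n)] : Continuous hg.chartLens := by
  rw [continuous_iff_continuousAt]
  intro x₀
  have hL := hg.len_pos
  set i := x₀.1.1 with hi
  have hv : Continuous (fun x : g.UnitVector => x.1) := continuous_subtype_val
  have hν : Continuous (fun x : g.UnitVector => g.unadVec i x.1.2.1 x.1.2.2) :=
    (hg.continuous_unadVec i).comp hv.snd
  have hξ : Continuous (fun x : g.UnitVector => g.unadPt i x.1.2.1) :=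
    (hg.continuous_unadPt i).comp hv.snd.fst
  have hev : ∀ᶠ x : g.UnitVector in 𝓝 x₀, x.1.1 = i :=
    hv.fst.continuousAt.eventually ((isOpen_discrete {i}).mem_nhds rfl)
  have hnorm (x : g.UnitVector) (hx : x.1.1 = i) : ‖g.unadVec i x.1.2.1 x.1.2.2‖ = 1 := by
    have hxu := x.2
    rw [hx] at hxu
    obtain ⟨s, ψ, α, h0, h1, -, h2, h3⟩ := hg.exists_chart_polar i hxu
    have h4 := (hg.unad_polar i (by linarith) h1 ψ α).2
    rw [← h2, ← h3] at h4
    rw [h4, norm_cis]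
  -- A root of the direction that is continuous at `x₀`; the class does not depend on the root.
  obtain ⟨ρ, hρ, hρN⟩ := exists_rootBranch (NeZero.ne (m + n)) (hnorm x₀ hi.symm)
  have hρc : ContinuousAt (fun x : g.UnitVector => ρ (g.unadVec i x.1.2.1 x.1.2.2)) x₀ :=
    ContinuousAt.comp (g := ρ) hρ hν.continuousAt
  have hρ0 : ρ (g.unadVec i x₀.1.2.1 x₀.1.2.2) ≠ 0 := by
    intro h
    have := hρN _ (hnorm x₀ hi.symm)
    rw [h, zero_pow (NeZero.ne _)] at this
    have h2 := hnorm x₀ hi.symm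
    rw [← this, norm_zero] at h2
    exact zero_ne_one h2
  have hcos : Continuous (fun x : g.UnitVector =>
      ((Real.cos (Real.pi * ‖g.unadPt i x.1.2.1‖ / (2 * g.len)) : ℝ) : ℂ)) :=
    Complex.continuous_ofReal.comp (Real.continuous_cos.comp
      ((continuous_const.mul hξ.norm).div_const _))
  have hsin : Continuous (fun ξ : ℂ => ((Real.sin (Real.pi * ‖ξ‖ / (2 * g.len)) / ‖ξ‖ : ℝ) * ξ : ℂ)) := by
    rw [continuous_iff_continuousAt]
    intro ξ
    refine continuousAt_radialScale ?_ (by simp)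
    exact (Real.continuous_sin.comp ((continuous_const.mul continuous_norm).div_const _)).continuousAt
  refine Lens.continuousAt_of (i := i) (hcos.continuousAt.mul (hρc.pow (order m n i)))
    ((hsin.comp hξ).continuousAt.mul ((hρc.pow (order m n (!i))).inv₀ (pow_ne_zero _ hρ0))) ?_
  filter_upwards [hev] with x hx
  have h5 : ρ (g.unadVec i x.1.2.1 x.1.2.2) ^ (m + n) = g.unadVec x.1.1 x.1.2.1 x.1.2.2 := by
    rw [hρN _ (hnorm x hx), hx]
  have := hg.chartLens_root x h5
  rw [hx] at this
  exact this

theorem continuous_toLens [NeZero (m + n)] : Continuous hg.toLens :=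
  continuous_quot_lift _ hg.continuous_chartLens

theorem toLens_mk [NeZero (m + n)] (i : Bool) {s : ℝ} (h0 : -g.len < s)
    (h1 : s < g.len) (ψ α : ℝ) (hu) :
    hg.toLens (UnitTangentBundle.mk g i (g.chartPt i s ψ)
        (g.chartVec i s ψ (Real.cos α) (Real.sin α)) hu)
      = Lens.mk (m + n) (clPt g.len i s
      ((ψ + order m n i * α) / (m + n : ℕ)) ((ψ - order m n (!i) * α) / (m + n : ℕ))) :=
  hg.chartLens_polar ⟨(i, _, _), hu⟩ h0 h1 rfl rfl

end Metric.RotSym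

end Spindle

/-! ### The covering of the unit tangent bundle by the punctured plane. -/

namespace Spindle

open IsRotForm Punct

/-- The colatitude of a point of the punctured plane as seen from the chart `i`, scaled to
`[0, L]`. -/
noncomputable def colat (L : ℝ) (i : Bool) (x : Punct) : ℝ :=
  2 * L / Real.pi * Complex.arg (⟨‖own i x‖, ‖own (!i) x‖⟩ : ℂ)

theorem colat_eq {L : ℝ} (hL : 0 < L) {i : Bool} {x : Punct} {R s : ℝ} (hR : 0 < R) (h0 : 0 ≤ s)
    (h1 : s ≤ L) (e1 : ‖own i x‖ = R * Real.cos (Real.pi * s / (2 * L)))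
    (e2 : ‖own (!i) x‖ = R * Real.sin (Real.pi * s / (2 * L))) : colat L i x = s := by
  have hpi := Real.pi_pos
  have h : (⟨‖own i x‖, ‖own (!i) x‖⟩ : ℂ) = R * (Complex.cos (Real.pi * s / (2 * L) : ℝ)
      + Complex.sin (Real.pi * s / (2 * L) : ℝ) * Complex.I) := by
    apply Complex.ext
    · simp [e1, ← Complex.ofReal_cos, ← Complex.ofReal_sin, -Complex.ofReal_div, -Complex.ofReal_mul]
    · simp [e2, ← Complex.ofReal_cos, ← Complex.ofReal_sin, -Complex.ofReal_div, -Complex.ofReal_mul]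
  rw [colat, h, Complex.arg_mul_cos_add_sin_mul_I hR]
  · field_simp
  · constructor
    · have : 0 ≤ Real.pi * s / (2 * L) := by positivity
      linarith
    · rw [div_le_iff₀ (by linarith)]; nlinarith

theorem exists_colat {L : ℝ} (hL : 0 < L) (i : Bool) (x : Punct) : ∃ R > 0, 0 ≤ colat L i x ∧
    colat L i x ≤ L ∧ ‖own i x‖ = R * Real.cos (Real.pi * colat L i x / (2 * L)) ∧
    ‖own (!i) x‖ = R * Real.sin (Real.pi * colat L i x / (2 * L)) := by
  have hpi := Real.pi_pos
  set w : ℂ := ⟨‖own i x‖, ‖own (!i) x‖⟩ with hw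
  have hw0 : w ≠ 0 := by
    intro h
    rcases own_ne i x with h1 | h1
    · have := congrArg Complex.re h
      exact h1 (norm_eq_zero.1 this)
    · have := congrArg Complex.im h
      exact h1 (norm_eq_zero.1 this)
  have harg : Real.pi * colat L i x / (2 * L) = Complex.arg w := by
    rw [colat, ← hw]; field_simp
  refine ⟨‖w‖, norm_pos_iff.2 hw0, ?_, ?_, ?_, ?_⟩
  · have : 0 ≤ Complex.arg w := Complex.arg_nonneg_iff.2 (norm_nonneg _)
    rw [colat, ← hw]; positivity
  · have : Complex.arg w ≤ Real.pi / 2 :=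
      Complex.arg_le_pi_div_two_iff.2 (Or.inl (norm_nonneg _))
    rw [colat, ← hw]
    calc 2 * L / Real.pi * Complex.arg w ≤ 2 * L / Real.pi * (Real.pi / 2) := by gcongr
      _ = L := by field_simp
  · rw [harg, Complex.norm_mul_cos_arg]
  · rw [harg, Complex.norm_mul_sin_arg]

theorem colat_not {L : ℝ} (hL : 0 < L) (i : Bool) (x : Punct) :
    colat L (!i) x = L - colat L i x := by
  obtain ⟨R, hR, h0, h1, h2, h3⟩ := exists_colat hL i x
  have h : Real.pi * (L - colat L i x) / (2 * L) = Real.pi / 2 - Real.pi * colat L i x / (2 * L) := by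
    field_simp
  refine colat_eq hL hR (by linarith) (by linarith) ?_ ?_
  · rw [h, Real.cos_pi_div_two_sub, h3]
  · rw [h, Real.sin_pi_div_two_sub, Bool.not_not, h2]

theorem colat_lt {L : ℝ} (hL : 0 < L) {i : Bool} {x : Punct} (h : own i x ≠ 0) :
    colat L i x < L := by
  obtain ⟨R, hR, h0, h1, h2, h3⟩ := exists_colat hL i x
  refine lt_of_le_of_ne h1 fun h4 => h ?_
  rw [h4, show Real.pi * L / (2 * L) = Real.pi / 2 by field_simp, Real.cos_pi_div_two, mul_zero] at h2
  exact norm_eq_zero.1 h2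

theorem colat_pos {L : ℝ} (hL : 0 < L) {i : Bool} {x : Punct} (h : own (!i) x ≠ 0) :
    0 < colat L i x := by
  have := colat_lt hL h
  rw [colat_not hL] at this
  linarith

theorem colat_zero {L : ℝ} (hL : 0 < L) {i : Bool} {x : Punct} (h : own (!i) x = 0) :
    colat L i x = 0 := by
  have h1 : own i x ≠ 0 := (own_ne i x).resolve_right (not_not.2 h)
  refine colat_eq hL (norm_pos_iff.2 h1) le_rfl hL.le (by simp) (by simp [h])

theorem continuous_colat (L : ℝ) (i : Bool) : Continuous (colat L i) := by
  rw [continuous_iff_continuousAt]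
  intro x
  refine ContinuousAt.mul continuousAt_const ?_
  have hc : Continuous (fun x : Punct => (⟨‖own i x‖, ‖own (!i) x‖⟩ : ℂ)) := by
    have : (fun x : Punct => (⟨‖own i x‖, ‖own (!i) x‖⟩ : ℂ))
        = fun x : Punct => ((‖own i x‖ : ℝ) : ℂ) + ((‖own (!i) x‖ : ℝ) : ℂ) * Complex.I := by
      funext x
      apply Complex.ext <;> simp
    rw [this]
    exact (Complex.continuous_ofReal.comp (continuous_own i).norm).add
      ((Complex.continuous_ofReal.comp (continuous_own (!i)).norm).mul continuous_const)
  refine ContinuousAt.comp (g := Complex.arg) (Complex.continuousAt_arg ?_) hc.continuousAt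
  rcases own_ne i x with h | h
  · exact Or.inl (norm_pos_iff.2 h)
  · exact Or.inr (norm_pos_iff.2 h).ne'

theorem cis_arg_eq_div {z : ℂ} (hz : z ≠ 0) : cis (Complex.arg z) = z / ‖z‖ := by
  have h1 : (‖z‖ : ℂ) ≠ 0 := by exact_mod_cast norm_ne_zero_iff.2 hz
  rw [eq_div_iff h1, mul_comm]
  exact Complex.norm_mul_exp_arg_mul_I z

theorem Metric.exists_mk_congr {m n : ℕ} (g : Metric m n) {i : Bool} {z v z' v' : ℂ}
    {X : g.UnitTangentBundle} (hz : z = z') (hv : v = v')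
    (h : ∃ hu, X = UnitTangentBundle.mk g i z v hu) :
    ∃ hu, X = UnitTangentBundle.mk g i z' v' hu := by
  subst hz hv
  exact h

namespace Metric.RotSym

variable {m n : ℕ} {g : Metric m n} (hg : g.RotSym)
include hg

/-- The meridian angle of a point of the punctured plane. -/
noncomputable def ptAng (_ : g.RotSym) (x : Punct) : ℝ :=
  n * Complex.arg (own false x) + m * Complex.arg (own true x)

/-- The covering of the unit tangent bundle by the punctured plane. -/
noncomputable def hopf (x : Punct) : g.UnitTangentBundle :=
  if colat g.len false x < g.len then
    UnitTangentBundle.mk g false (g.chartPt false (colat g.len false x) (hg.ptAng x))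
      (g.chartVec false (colat g.len false x) (hg.ptAng x)
        (Real.cos (Complex.arg (own false x) - Complex.arg (own true x)))
        (Real.sin (Complex.arg (own false x) - Complex.arg (own true x))))
      (hg.chartVec_unit _ _ _ _ _ (Real.cos_sq_add_sin_sq _))
  else
    UnitTangentBundle.mk g true (g.chartPt true (colat g.len true x) (hg.ptAng x))
      (g.chartVec true (colat g.len true x) (hg.ptAng x)
        (Real.cos (Complex.arg (own true x) - Complex.arg (own false x)))
        (Real.sin (Complex.arg (own true x) - Complex.arg (own false x))))
      (hg.chartVec_unit _ _ _ _ _ (Real.cos_sq_add_sin_sq _))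

/-- The definition of `hopf` prefers the first chart; over the overlap the expression of the second
chart agrees, by `overlap`. -/
theorem hopf_chart (i : Bool) {x : Punct} (hx : own i x ≠ 0) : ∃ hu,
    hg.hopf x = UnitTangentBundle.mk g i (g.chartPt i (colat g.len i x) (hg.ptAng x))
      (g.chartVec i (colat g.len i x) (hg.ptAng x)
        (Real.cos (Complex.arg (own i x) - Complex.arg (own (!i) x)))
        (Real.sin (Complex.arg (own i x) - Complex.arg (own (!i) x)))) hu := by
  have hL := hg.len_pos
  refine ⟨hg.chartVec_unit _ _ _ _ _ (Real.cos_sq_add_sin_sq _), ?_⟩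
  cases i
  · rw [hopf, if_pos (colat_lt hL hx)]
    rfl
  · by_cases h : colat g.len false x < g.len
    · rw [hopf, if_pos h]
      have h0 := colat_pos (i := false) hL hx
      obtain ⟨hu, h1⟩ := g.mk_eq_of_rel (hg.chartVec_unit false (colat g.len false x) (hg.ptAng x) _ _
        (Real.cos_sq_add_sin_sq (Complex.arg (own false x) - Complex.arg (own true x))))
        (hg.overlap false h0 h (hg.ptAng x) _ _)
      rw [h1]
      have e1 : colat g.len true x = g.len - colat g.len false x := colat_not hL false x
      simp only [Bool.not_false, Bool.not_true, ← Real.sin_neg, ← e1, neg_sub]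
      congr 2
      rw [← Real.cos_neg, neg_sub]
    · rw [hopf, if_neg h]
      rfl

/-- The argument used in `hopf` jumps. Any root `l` of the direction may replace it, because two
roots differ by an element of the local group; a continuous choice of `l` then shows continuity of
`hopf`. -/
theorem hopf_root (i : Bool) {x : Punct} (hx : own i x ≠ 0) {l : ℂ}
    (hl : l ^ order m n i = own i x / ‖own i x‖) : ∃ hu,
    hg.hopf x = UnitTangentBundle.mk g i
      (g.adPt i (colat g.len i x * l ^ order m n (!i) * (own (!i) x / ‖own (!i) x‖)))
      (g.adVec i (colat g.len i x * l ^ order m n (!i) * (own (!i) x / ‖own (!i) x‖))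
        (l ^ (m + n))) hu := by
  have hL := hg.len_pos
  have ho := hg.order_pos' i
  obtain ⟨R, hR, h0, -, -, -⟩ := exists_colat hL i x
  have hlt := colat_lt hL hx
  have hex := hg.hopf_chart i hx
  set β := Complex.arg (own i x) with hβ
  set β' := Complex.arg (own (!i) x) with hβ'
  have hψ : hg.ptAng x = order m n (!i) * β + order m n i * β' := by
    cases i
    · rfl
    · exact add_comm _ _
  set s := colat g.len i x with hs
  set l₀ := cis (β / order m n i) with hl₀
  have hl₀o : l₀ ^ order m n i = own i x / ‖own i x‖ := by
    rw [hl₀, cis_pow, mul_div_cancel₀ _ ho.ne', cis_arg_eq_div hx]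
  set ε := l / l₀ with hε
  have hn0 : own i x / ‖own i x‖ ≠ 0 :=
    div_ne_zero hx (by exact_mod_cast norm_ne_zero_iff.2 hx)
  have hεo : ε ^ order m n i = 1 := by rw [hε, div_pow, hl, hl₀o, div_self hn0]
  have hlε : l = ε * l₀ := by rw [hε, div_mul_cancel₀ _ (cis_ne_zero _)]
  set ζ := ε ^ order m n (!i) with hζ
  have hζo : ζ ^ order m n i = 1 := by rw [hζ, ← pow_mul, mul_comm, pow_mul, hεo, one_pow]
  have hζn : ‖ζ‖ = 1 := Complex.norm_eq_one_of_pow_eq_one hζo (hg.order_pos i).ne'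
  have hpol := hg.ad_polar i (by linarith) hlt (hg.ptAng x) (β - β')
  have e1 : (s * l ^ order m n (!i) * (own (!i) x / ‖own (!i) x‖) : ℂ)
      = ζ * (s * cis (hg.ptAng x / order m n i)) := by
    by_cases h : own (!i) x = 0
    · have : s = 0 := colat_zero hL h
      rw [this]; simp
    · rw [← cis_arg_eq_div h, ← hβ', hψ, hlε, mul_pow, ← hζ, hl₀, cis_pow]
      have : cis ((order m n (!i) * β + order m n i * β') / order m n i)
          = cis (order m n (!i) * (β / order m n i)) * cis β' := by
        rw [← cis_add]; congr 1; field_simp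
      rw [this]; ring
  have e2 : l ^ (m + n) = ζ * cis (hg.ptAng x / order m n i + (β - β')) := by
    rw [hlε, mul_pow, ← order_add i, pow_add ε, hεo, one_mul, ← hζ, hl₀, cis_pow, hψ]
    congr 2
    push_cast
    field_simp
    ring
  obtain ⟨hu', h1⟩ := g.exists_mk_congr hpol.1.symm hpol.2.symm hex
  obtain ⟨hu2, h2⟩ := g.mk_eq_of_rel hu' (ad_mul i hζn hζo _ _)
  rw [e1, e2]
  exact ⟨hu2, h1.trans h2⟩

/-- The angles change by `ψ = order (!i) β + order i β'`, `α = β - β'`, also for negative `s`. This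
inverts the change of angles in `chartLens` because the orders add up to `m + n`. -/
theorem hopf_clPt (i : Bool) {s : ℝ} (h0 : -g.len < s) (h1 : s < g.len) (β β' : ℝ) : ∃ hu,
    hg.hopf (clPt g.len i s β β') = UnitTangentBundle.mk g i
      (g.chartPt i s (order m n (!i) * β + order m n i * β'))
      (g.chartVec i s (order m n (!i) * β + order m n i * β') (Real.cos (β - β'))
        (Real.sin (β - β'))) hu := by
  have hL := hg.len_pos
  have ho := hg.order_pos' i
  have hcos := hg.half_angle h0 h1
  have hown := own_clPt g.len i s β β'
  have hoth := own_not_clPt g.len i s β β'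
  have hc : ((Real.cos (Real.pi * s / (2 * g.len)) : ℝ) : ℂ) ≠ 0 := by exact_mod_cast hcos.ne'
  have hx : own i (clPt g.len i s β β') ≠ 0 := by
    rw [hown]; exact mul_ne_zero hc (cis_ne_zero _)
  have hnorm : ‖own i (clPt g.len i s β β')‖ = Real.cos (Real.pi * s / (2 * g.len)) := by
    rw [hown, norm_mul, norm_cis, mul_one, Complex.norm_real, Real.norm_of_nonneg hcos.le]
  have hl : cis (β / order m n i) ^ order m n i
      = own i (clPt g.len i s β β') / ‖own i (clPt g.len i s β β')‖ := by
    rw [cis_pow, mul_div_cancel₀ _ ho.ne', hnorm, hown]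
    field_simp
  have h2 := hg.hopf_root i hx hl
  have hab : |s| ≤ g.len := abs_le.2 ⟨h0.le, h1.le⟩
  have hsin0 : 0 ≤ Real.sin (Real.pi * |s| / (2 * g.len)) := by
    refine Real.sin_nonneg_of_nonneg_of_le_pi (by positivity) ?_
    rw [div_le_iff₀ (by linarith)]; nlinarith [Real.pi_pos]
  have hcol : colat g.len i (clPt g.len i s β β') = |s| := by
    refine colat_eq hL one_pos (abs_nonneg s) hab ?_ ?_
    · rw [hnorm, one_mul]
      rcases abs_choice s with h | h
      · rw [h]
      · rw [h, mul_neg, neg_div, Real.cos_neg]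
    · rw [hoth, norm_mul, norm_cis, mul_one, Complex.norm_real, Real.norm_eq_abs, one_mul]
      rcases abs_choice s with h | h
      · rw [h] at hsin0 ⊢; exact abs_of_nonneg hsin0
      · rw [h, mul_neg, neg_div, Real.sin_neg] at hsin0 ⊢; exact abs_of_nonpos (by linarith)
  have e1 : (colat g.len i (clPt g.len i s β β') * cis (β / order m n i) ^ order m n (!i)
      * (own (!i) (clPt g.len i s β β') / ‖own (!i) (clPt g.len i s β β')‖) : ℂ)
      = s * cis ((order m n (!i) * β + order m n i * β') / order m n i) := by
    have hang : cis ((order m n (!i) * β + order m n i * β') / order m n i)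
        = cis (β / order m n i) ^ order m n (!i) * cis β' := by
      rw [cis_pow, ← cis_add]; congr 1; field_simp
    rw [hcol, hang]
    rcases eq_or_ne s 0 with h | h
    · simp [h]
    · have hsin : 0 < Real.sin (Real.pi * |s| / (2 * g.len)) := by
        refine Real.sin_pos_of_pos_of_lt_pi (by positivity) ?_
        rw [div_lt_iff₀ (by linarith)]; nlinarith [Real.pi_pos]
      rw [hoth, norm_mul, norm_cis, mul_one, Complex.norm_real, Real.norm_eq_abs]
      rcases abs_choice s with h2 | h2
      · rw [h2] at hsin ⊢
        rw [abs_of_pos hsin]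
        have : ((Real.sin (Real.pi * s / (2 * g.len)) : ℝ) : ℂ) ≠ 0 := by exact_mod_cast hsin.ne'
        field_simp
      · rw [h2, mul_neg, neg_div, Real.sin_neg] at hsin
        rw [h2, abs_of_neg (by linarith)]
        have : ((Real.sin (Real.pi * s / (2 * g.len)) : ℝ) : ℂ) ≠ 0 := by
          exact_mod_cast (by linarith : Real.sin (Real.pi * s / (2 * g.len)) < 0).ne
        generalize Real.sin (Real.pi * s / (2 * g.len)) = S at *
        push_cast
        field_simp
  have e2 : cis (β / order m n i) ^ (m + n)
      = cis ((order m n (!i) * β + order m n i * β') / order m n i + (β - β')) := by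
    rw [cis_pow, ← order_add i]
    congr 1
    push_cast
    field_simp
    ring
  have hpol := hg.ad_polar i h0 h1 (order m n (!i) * β + order m n i * β') (β - β')
  rw [e1, e2] at h2
  exact g.exists_mk_congr hpol.1 hpol.2 h2

theorem toLens_hopf_clPt [NeZero (m + n)] (i : Bool) {s : ℝ} (h0 : -g.len < s) (h1 : s < g.len)
    (β β' : ℝ) : hg.toLens (hg.hopf (clPt g.len i s β β')) = Lens.mk (m + n) (clPt g.len i s β β') := by
  obtain ⟨hu, h⟩ := hg.hopf_clPt i h0 h1 β β'
  rw [h, hg.toLens_mk i h0 h1]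
  have hN := hg.total_pos.ne'
  have := order_add' (m := m) (n := n) i
  congr 2
  · rw [div_eq_iff hN, ← this]; ring
  · rw [div_eq_iff hN, ← this]; ring

theorem continuous_hopf : Continuous hg.hopf := by
  have hL := hg.len_pos
  have key (i : Bool) (x₀ : Punct) (hx₀ : own i x₀ ≠ 0) : ContinuousAt hg.hopf x₀ := by
    have hdir : ContinuousAt (fun x : Punct => own i x / ‖own i x‖) x₀ :=
      (continuous_own i).continuousAt.div
        (Complex.continuous_ofReal.comp (continuous_own i).norm).continuousAt
        (by exact_mod_cast norm_ne_zero_iff.2 hx₀)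
    have hdn {x : Punct} (hx : own i x ≠ 0) : ‖own i x / ‖own i x‖‖ = 1 := by
      rw [norm_div, Complex.norm_real, norm_norm, div_self (norm_ne_zero_iff.2 hx)]
    obtain ⟨ρ, hρ, hρN⟩ := exists_rootBranch (hg.order_pos i).ne' (hdn hx₀)
    have hρc : ContinuousAt (fun x : Punct => ρ (own i x / ‖own i x‖)) x₀ :=
      ContinuousAt.comp (g := ρ) hρ hdir
    have hcol : ContinuousAt (fun x : Punct => ((colat g.len i x : ℝ) : ℂ)) x₀ :=
      (Complex.continuous_ofReal.comp (continuous_colat g.len i)).continuousAt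
    have hξ : ContinuousAt (fun x : Punct => (colat g.len i x
        * ρ (own i x / ‖own i x‖) ^ order m n (!i) * (own (!i) x / ‖own (!i) x‖) : ℂ)) x₀ := by
      by_cases h : own (!i) x₀ = 0
      · have h0 : colat g.len i x₀ = 0 := colat_zero hL h
        unfold ContinuousAt
        beta_reduce
        rw [h]
        simp only [zero_div, mul_zero]
        have h1 : Tendsto (fun x : Punct => ‖(colat g.len i x
            * ρ (own i x / ‖own i x‖) ^ order m n (!i) : ℂ)‖) (𝓝 x₀) (𝓝 0) := by
          have := (hcol.mul (hρc.pow (order m n (!i)))).norm.tendsto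
          simpa [h0] using this
        refine squeeze_zero_norm (fun x => ?_) h1
        rw [norm_mul]
        refine mul_le_of_le_one_right (norm_nonneg _) ?_
        rw [norm_div, Complex.norm_real, norm_norm]
        exact div_self_le_one _
      · exact (hcol.mul (hρc.pow _)).mul ((continuous_own (!i)).continuousAt.div
          (Complex.continuous_ofReal.comp (continuous_own (!i)).norm).continuousAt
          (by exact_mod_cast norm_ne_zero_iff.2 h))
    have hlt : ‖(colat g.len i x₀ * ρ (own i x₀ / ‖own i x₀‖) ^ order m n (!i)
        * (own (!i) x₀ / ‖own (!i) x₀‖) : ℂ)‖ < g.len := by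
      obtain ⟨-, -, h0, -⟩ := exists_colat hL i x₀
      have hρ1 : ‖ρ (own i x₀ / ‖own i x₀‖)‖ = 1 := by
        have h1 := congrArg norm (hρN _ (hdn hx₀))
        rw [norm_pow, hdn hx₀] at h1
        exact (pow_eq_one_iff_of_nonneg (norm_nonneg _) (hg.order_pos i).ne').1 h1
      rw [norm_mul, norm_mul, norm_pow, hρ1, one_pow, mul_one, Complex.norm_real,
        Real.norm_of_nonneg h0, norm_div, Complex.norm_real, norm_norm]
      exact (mul_le_of_le_one_right h0 (div_self_le_one _)).trans_lt (colat_lt hL hx₀)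
    refine g.continuousAt_mk (i := i) (ContinuousAt.comp (g := g.adPt i)
      (hg.continuousAt_adPt i hlt) hξ) (ContinuousAt.comp (g := fun x : ℂ × ℂ => g.adVec i x.1 x.2)
        (f := fun x : Punct => ((colat g.len i x * ρ (own i x / ‖own i x‖) ^ order m n (!i)
        * (own (!i) x / ‖own (!i) x‖) : ℂ), ρ (own i x / ‖own i x‖) ^ (m + n)))
        (hg.continuousAt_adVec i hlt) (hξ.prodMk (hρc.pow _))) ?_
    filter_upwards [(continuous_own i).continuousAt.eventually_ne hx₀] with x hx
    exact hg.hopf_root i hx (hρN _ (hdn hx))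
  rw [continuous_iff_continuousAt]
  intro x
  rcases own_ne false x with h | h
  exacts [key _ x h, key _ x h]

theorem hopf_mul {x y : Punct} {ζ : ℂ} (h : ζ ^ (m + n) = 1) (i : Bool)
    (h1 : own i x = ζ * own i y) (h2 : own (!i) x = ζ * own (!i) y) : hg.hopf x = hg.hopf y := by
  have hL := hg.len_pos
  have key (i : Bool) (h1 : own i x = ζ * own i y) (h2 : own (!i) x = ζ * own (!i) y)
      (hy : own i y ≠ 0) : hg.hopf x = hg.hopf y := by
    have hζn : ‖ζ‖ = 1 := Complex.norm_eq_one_of_pow_eq_one h hg.neZero.out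
    have hζ0 : ζ ≠ 0 := by intro h; simp [h] at hζn
    have hn (i : Bool) (h1 : own i x = ζ * own i y) : ‖own i x‖ = ‖own i y‖ := by
      rw [h1, norm_mul, hζn, one_mul]
    have hcol : colat g.len i x = colat g.len i y := by
      unfold colat
      rw [hn i h1, hn (!i) h2]
    have hy' : ‖own i y / ‖own i y‖‖ = 1 := by
      rw [norm_div, Complex.norm_real, norm_norm, div_self (norm_ne_zero_iff.2 hy)]
    obtain ⟨ρ, -, hρN⟩ := exists_rootBranch (hg.order_pos i).ne' hy'
    obtain ⟨ρ', -, hρN'⟩ := exists_rootBranch (hg.order_pos i).ne' hζn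
    set l := ρ (own i y / ‖own i y‖)
    set e := ρ' ζ
    obtain ⟨hu, e1⟩ := hg.hopf_root i hy (hρN _ hy')
    have hx : own i x ≠ 0 := by rw [h1]; exact mul_ne_zero hζ0 hy
    have e2 := hg.hopf_root i hx (l := e * l) (by
      rw [mul_pow, hρN _ hy', hρN' _ hζn, hn i h1, h1, mul_div_assoc])
    have heo : e ^ order m n i = ζ := hρN' _ hζn
    have e3 : ((colat g.len i x : ℂ) * (e * l) ^ order m n (!i) * (own (!i) x / ‖own (!i) x‖))
        = e ^ (m + n) * ((colat g.len i y : ℂ) * l ^ order m n (!i) * (own (!i) y / ‖own (!i) y‖)) := by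
      rw [hcol, hn (!i) h2, h2, mul_pow, ← order_add i, pow_add e, heo]
      ring
    -- The straightened coordinates get multiplied by `e ^ (m + n)`, which lies in the local group
    -- because `e ^ order i = ζ` and `ζ ^ (m + n) = 1`.
    have heN : (e ^ (m + n)) ^ order m n i = 1 := by rw [← pow_mul, mul_comm, pow_mul, heo, h]
    have heNn := Complex.norm_eq_one_of_pow_eq_one heN (hg.order_pos i).ne'
    rw [e3, mul_pow] at e2
    obtain ⟨hu', e2⟩ := e2
    obtain ⟨hu2, e4⟩ := g.mk_eq_of_rel hu (ad_mul i heNn heN _ _)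
    rw [e1, e4, e2]
  rcases own_ne i y with hy | hy
  · exact key i h1 h2 hy
  · exact key (!i) h2 (by rw [Bool.not_not]; exact h1) hy

end Metric.RotSym

end Spindle

/-! ### Geodesics of a profile that avoid the poles: uniqueness and completeness. -/

namespace Spindle

/-- A bounded Lipschitz vector field is complete. -/
theorem exists_global_solution {E : Type*} [NormedAddCommGroup E] [NormedSpace ℝ E]
    [CompleteSpace E] {f : E → E} {K M : NNReal} (hf : LipschitzWith K f) (hM : ∀ x, ‖f x‖ ≤ M)
    (x₀ : E) : ∃ α : ℝ → E, α 0 = x₀ ∧ ∀ t, HasDerivAt α (f (α t)) t := by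
  -- Picard–Lindelöf on `[-(k + 1), k + 1]`: the bound `M` keeps the solution within distance `M (k
  -- + 1)`.
  have h (k : ℕ) : ∃ α : ℝ → E, α 0 = x₀ ∧ ∀ t ∈ Set.Ioo (-(k + 1 : ℝ)) (k + 1),
      HasDerivAt α (f (α t)) t := by
    have hk : (0 : ℝ) ∈ Set.Icc (-(k + 1 : ℝ)) (k + 1) :=
      ⟨neg_nonpos.2 (by positivity), by positivity⟩
    have hp : IsPicardLindelof (fun _ : ℝ => f) ⟨0, hk⟩ x₀ (M * (k + 1)) 0 M K := by
      refine IsPicardLindelof.of_time_independent (fun x _ => hM x) hf.lipschitzOnWith ?_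
      simp
    obtain ⟨α, h0, h1⟩ := hp.exists_eq_forall_mem_Icc_hasDerivWithinAt₀
    exact ⟨α, h0, fun t ht => (h1 t ⟨ht.1.le, ht.2.le⟩).hasDerivAt (Icc_mem_nhds ht.1 ht.2)⟩
  choose α h0 h1 using h
  have huniq {k l : ℕ} (hkl : k ≤ l) {t : ℝ} (ht : |t| < k + 1) : α k t = α l t := by
    have hkl' : (k : ℝ) ≤ l := by exact_mod_cast hkl
    refine ODE_solution_unique_of_mem_Ioo (v := fun _ => f) (s := fun _ => Set.univ)
      (a := -(k + 1 : ℝ)) (b := k + 1) (t₀ := 0) (fun _ _ => hf.lipschitzOnWith)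
      ⟨by linarith [(Nat.cast_nonneg k : (0 : ℝ) ≤ k)], by positivity⟩
      (fun t ht => ⟨h1 k t ht, trivial⟩)
      (fun t ht => ⟨h1 l t ⟨by linarith [ht.1], by linarith [ht.2]⟩, trivial⟩)
      ((h0 k).trans (h0 l).symm) (abs_lt.1 ht)
  refine ⟨fun t => α ⌈|t|⌉₊ t, h0 _, fun t => ?_⟩
  -- Near `t` all the indices `⌈|τ|⌉₊` are at most `N`, so the solutions used there all agree with
  -- `α N`.
  set N := ⌈|t|⌉₊ + 1 with hN
  have hev : (fun τ => α ⌈|τ|⌉₊ τ) =ᶠ[𝓝 t] α N := by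
    have : ∀ᶠ τ in 𝓝 t, |τ| < |t| + 1 :=
      continuous_abs.continuousAt.eventually_lt_const (by linarith)
    filter_upwards [this] with τ hτ
    refine huniq ?_ ?_
    · rw [Nat.ceil_le, hN]
      push_cast
      linarith [Nat.le_ceil |t|]
    · linarith [Nat.le_ceil |τ|]
  have ht : t ∈ Set.Ioo (-(N + 1 : ℝ)) (N + 1) := by
    rw [Set.mem_Ioo, ← abs_lt, hN]
    push_cast
    linarith [Nat.le_ceil |t|]
  have := (h1 N t ht).congr_of_eventuallyEq hev
  rwa [← hev.self_of_nhds] at this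

/-- The profile of a rotationally symmetric metric `ds² + r(s)² dψ²` on a sphere with two conical
singularities. -/
structure IsProfile (r : ℝ → ℝ) (L a b : ℝ) : Prop where
  len_pos : 0 < L
  a_pos : 0 < a
  b_pos : 0 < b
  smooth : ∀ s, 0 ≤ s → s ≤ L → ContDiffAt ℝ (⊤ : ℕ∞) r s
  zero : r 0 = 0
  len : r L = 0
  pos : ∀ s, 0 < s → s < L → 0 < r s
  deriv_zero : deriv r 0 = a
  deriv_len : deriv r L = -b

/-- At time `t`, the functions describe a unit speed geodesic with Clairaut constant `K` outside
the poles. -/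
structure RegAt (r : ℝ → ℝ) (L K : ℝ) (s p ψ : ℝ → ℝ) (t : ℝ) : Prop where
  pos : 0 < s t
  lt : s t < L
  hs : HasDerivAt s (p t) t
  hp : HasDerivAt p (K ^ 2 * deriv r (s t) / r (s t) ^ 3) t
  hψ : HasDerivAt ψ (K / r (s t) ^ 2) t
  energy : p t ^ 2 + (K / r (s t)) ^ 2 = 1

/-- A complete unit speed geodesic with Clairaut constant `K` that avoids the poles. -/
def RegSol (r : ℝ → ℝ) (L K : ℝ) (s p ψ : ℝ → ℝ) : Prop := ∀ t, RegAt r L K s p ψ t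

namespace IsProfile

variable {r : ℝ → ℝ} {L a b : ℝ} (hr : IsProfile r L a b)
include hr

theorem hasDerivAt {s : ℝ} (h0 : 0 ≤ s) (h1 : s ≤ L) : HasDerivAt r (deriv r s) s :=
  ((hr.smooth s h0 h1).differentiableAt (by simp)).hasDerivAt

theorem continuousAt {s : ℝ} (h0 : 0 ≤ s) (h1 : s ≤ L) : ContinuousAt r s :=
  (hr.smooth s h0 h1).continuousAt

theorem contDiffAt_deriv {s : ℝ} (h0 : 0 ≤ s) (h1 : s ≤ L) : ContDiffAt ℝ 1 (deriv r) s := by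
  have h := (hr.smooth s h0 h1).fderiv_right (m := 1)
    (WithTop.coe_le_coe.2 (le_top : (1 + 1 : ℕ∞) ≤ ⊤))
  have : deriv r = fun x => fderiv ℝ r x 1 := by funext x; simp
  rw [this]
  exact h.clm_apply contDiffAt_const

theorem contDiffAt_one {s : ℝ} (h0 : 0 ≤ s) (h1 : s ≤ L) : ContDiffAt ℝ 1 r s :=
  (hr.smooth s h0 h1).of_le (by exact_mod_cast (le_top : (1 : ℕ∞) ≤ ⊤))

/-- `s` and `p` solve an autonomous system that is `C¹` off the poles. The angle does not enter it
and is recovered by integration. -/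
theorem eventually_eq_of_regAt {K t : ℝ} {s p ψ s' p' ψ' : ℝ → ℝ}
    (h1 : ∀ᶠ τ in 𝓝 t, RegAt r L K s p ψ τ) (h2 : ∀ᶠ τ in 𝓝 t, RegAt r L K s' p' ψ' τ)
    (hs : s t = s' t) (hp : p t = p' t) : ∀ᶠ τ in 𝓝 t, s τ = s' τ ∧ p τ = p' τ := by
  obtain ⟨h0, hL⟩ := And.intro h1.self_of_nhds.pos h1.self_of_nhds.lt
  have hv : ContDiffAt ℝ 1 (fun x : ℝ × ℝ => (x.2, K ^ 2 * deriv r x.1 / r x.1 ^ 3)) (s t, p t) := by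
    refine contDiffAt_snd.prodMk ((contDiffAt_const.mul ?_).div (ContDiffAt.pow ?_ 3) ?_)
    · exact ContDiffAt.comp (g := deriv r) (f := Prod.fst) (s t, p t)
        (hr.contDiffAt_deriv h0.le hL.le) contDiffAt_fst
    · exact ContDiffAt.comp (g := r) (f := Prod.fst) (s t, p t)
        (hr.contDiffAt_one h0.le hL.le) contDiffAt_fst
    · exact pow_ne_zero _ (hr.pos _ h0 hL).ne'
  obtain ⟨C, U, hU, hl⟩ := hv.exists_lipschitzOnWith
  have key {s p ψ : ℝ → ℝ} (h : ∀ᶠ τ in 𝓝 t, RegAt r L K s p ψ τ) (hU : U ∈ 𝓝 (s t, p t)) :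
      ∀ᶠ τ in 𝓝 t, HasDerivAt (fun τ => (s τ, p τ))
        ((fun x : ℝ × ℝ => (x.2, K ^ 2 * deriv r x.1 / r x.1 ^ 3)) (s τ, p τ)) τ ∧ (s τ, p τ) ∈ U := by
    have hc : ContinuousAt (fun τ => (s τ, p τ)) t :=
      h.self_of_nhds.hs.continuousAt.prodMk h.self_of_nhds.hp.continuousAt
    filter_upwards [h, hc.eventually_mem hU] with τ hτ hτU
    exact ⟨hτ.hs.prodMk hτ.hp, hτU⟩
  have := ODE_solution_unique_of_eventually (v := fun _ => _) (s := fun _ => U)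
    (Eventually.of_forall fun _ => hl) (key h1 hU) (key h2 (by rwa [← hs, ← hp]))
    (Prod.ext hs hp)
  filter_upwards [this] with τ hτ
  exact ⟨congrArg Prod.fst hτ, congrArg Prod.snd hτ⟩

theorem eq_of_regSol {K t : ℝ} {s p ψ s' p' ψ' : ℝ → ℝ} (h1 : RegSol r L K s p ψ)
    (h2 : RegSol r L K s' p' ψ') (hs : s t = s' t) (hp : p t = p' t) : s = s' ∧ p = p' := by
  have hset : {τ | s τ = s' τ ∧ p τ = p' τ} = Set.univ := by
    refine IsClopen.eq_univ ⟨?_, ?_⟩ ⟨t, hs, hp⟩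
    · exact (isClosed_eq (continuous_iff_continuousAt.2 fun τ => (h1 τ).hs.continuousAt)
        (continuous_iff_continuousAt.2 fun τ => (h2 τ).hs.continuousAt)).inter
        (isClosed_eq (continuous_iff_continuousAt.2 fun τ => (h1 τ).hp.continuousAt)
        (continuous_iff_continuousAt.2 fun τ => (h2 τ).hp.continuousAt))
    · rw [isOpen_iff_mem_nhds]
      intro τ hτ
      exact hr.eventually_eq_of_regAt (Eventually.of_forall h1) (Eventually.of_forall h2) hτ.1 hτ.2
  have hall (τ : ℝ) : s τ = s' τ ∧ p τ = p' τ := by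
    have : τ ∈ {τ | s τ = s' τ ∧ p τ = p' τ} := hset ▸ Set.mem_univ τ
    exact this
  exact ⟨funext fun τ => (hall τ).1, funext fun τ => (hall τ).2⟩

omit hr in
theorem angle_sub_const {K : ℝ} {s p ψ p' ψ' : ℝ → ℝ} (h1 : RegSol r L K s p ψ)
    (h2 : RegSol r L K s p' ψ') (t t' : ℝ) : ψ t - ψ' t = ψ t' - ψ' t' := by
  have h (t : ℝ) : HasDerivAt (fun t => ψ t - ψ' t) 0 t := by
    have := (h1 t).hψ.sub (h2 t).hψ
    rwa [sub_self] at this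
  exact is_const_of_deriv_eq_zero (fun t => (h t).differentiableAt) (fun t => (h t).deriv) t t'

/-- Near the poles there are points with small radius on which the profile is monotone. -/
theorem exists_left {c s : ℝ} (hc : 0 < c) (hs : 0 < s) :
    ∃ x, 0 < x ∧ x < s ∧ x < L ∧ r x < c ∧ 0 < deriv r x := by
  have hL := hr.len_pos
  have h1 : ∀ᶠ x in 𝓝 (0 : ℝ), r x < c :=
    (hr.continuousAt le_rfl hL.le).eventually_lt_const (by rwa [hr.zero])
  have h2 : ∀ᶠ x in 𝓝 (0 : ℝ), 0 < deriv r x :=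
    (hr.contDiffAt_deriv le_rfl hL.le).continuousAt.eventually_const_lt
      (by rw [hr.deriv_zero]; exact hr.a_pos)
  have h3 : ∀ᶠ x in 𝓝[>] (0 : ℝ), x < s ∧ x < L :=
    ((eventually_lt_nhds hs).and (eventually_lt_nhds hL)).filter_mono nhdsWithin_le_nhds
  obtain ⟨x, ⟨h4, h5⟩, ⟨h6, h7⟩, h8⟩ := (((h1.and h2).filter_mono nhdsWithin_le_nhds).and
    (h3.and self_mem_nhdsWithin)).exists
  exact ⟨x, h8, h6, h7, h4, h5⟩

/-- The profile as seen from the other pole. -/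
theorem reflect : IsProfile (fun s => r (L - s)) L b a where
  len_pos := hr.len_pos
  a_pos := hr.b_pos
  b_pos := hr.a_pos
  smooth s h0 h1 := ContDiffAt.comp (g := r) s (hr.smooth _ (by linarith) (by linarith))
    (contDiffAt_const.sub contDiffAt_id)
  zero := by rw [sub_zero, hr.len]
  len := by rw [sub_self, hr.zero]
  pos s h0 h1 := hr.pos _ (by linarith) (by linarith)
  deriv_zero := by rw [deriv_comp_const_sub, sub_zero, hr.deriv_len, neg_neg]
  deriv_len := by rw [deriv_comp_const_sub, sub_self, hr.deriv_zero]

theorem exists_right {c s : ℝ} (hc : 0 < c) (hs : s < L) :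
    ∃ x, 0 < x ∧ s < x ∧ x < L ∧ r x < c ∧ deriv r x < 0 := by
  obtain ⟨x, h0, h1, h2, h3, h4⟩ := hr.reflect.exists_left hc (sub_pos.2 hs)
  rw [deriv_comp_const_sub] at h4
  exact ⟨L - x, by linarith, by linarith, by linarith, h3, by linarith⟩

/-- With `p = cos θ` and `K / r = sin θ` the equations become `s' = cos θ` and `θ' = -sin θ · r'(s)
/ r(s)`. Freezing `r' / r` outside an interval `[x, y]` gives a bounded Lipschitz field with global
solutions. The conserved quantity `exp(U) sin θ`, where `U` is a primitive of the frozen function,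
confines `s` to `(x, y)`, where nothing was changed. -/
theorem exists_regSol {K s₀ p₀ : ℝ} (hK : K ≠ 0) (h0 : 0 < s₀) (h1 : s₀ < L)
    (hE : p₀ ^ 2 + (K / r s₀) ^ 2 = 1) (ψ₀ : ℝ) :
    ∃ s p ψ, RegSol r L K s p ψ ∧ s 0 = s₀ ∧ p 0 = p₀ ∧ ψ 0 = ψ₀ := by
  have hr0 := hr.pos _ h0 h1
  -- Barriers: at `x` and `y` the profile is below `|K|` and decreasing towards the respective pole.
  obtain ⟨x, hx0, hxs, hxL, hxr, hxd⟩ := hr.exists_left (abs_pos.2 hK) h0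
  obtain ⟨y, hy0, hys, hyL, hyr, hyd⟩ := hr.exists_right (abs_pos.2 hK) h1
  have hxy : x ≤ y := by linarith
  have hpos {u : ℝ} (hu : u ∈ Set.Icc x y) : 0 < r u := hr.pos u (by linarith [hu.1]) (by linarith [hu.2])
  have hC1 {u : ℝ} (hu : u ∈ Set.Icc x y) : ContDiffAt ℝ 1 (fun u => deriv r u / r u) u :=
    (hr.contDiffAt_deriv (by linarith [hu.1]) (by linarith [hu.2])).div
      (hr.contDiffAt_one (by linarith [hu.1]) (by linarith [hu.2])) (hpos hu).ne'
  obtain ⟨C, hC⟩ := LocallyLipschitzOn.exists_lipschitzOnWith_of_compact (s := Set.Icc x y)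
    (f := fun u => deriv r u / r u) isCompact_Icc (fun u hu => by
      obtain ⟨C, U, hU, hl⟩ := (hC1 hu).exists_lipschitzOnWith
      exact ⟨C, U, mem_nhdsWithin_of_mem_nhds hU, hl⟩)
  set ρ : ℝ → ℝ := Set.IccExtend hxy ((Set.Icc x y).domRestrict fun u => deriv r u / r u) with hρ
  have hρL : LipschitzWith C ρ := by
    have := (lipschitzOnWith_iff_restrict.1 hC).comp (LipschitzWith.projIcc hxy)
    rwa [mul_one] at this
  have hρeq {u : ℝ} (hu : u ∈ Set.Icc x y) : ρ u = deriv r u / r u := by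
    rw [hρ, Set.IccExtend_of_mem hxy _ hu]; rfl
  obtain ⟨B, hB⟩ : ∃ B : NNReal, ∀ u, |ρ u| ≤ B := by
    obtain ⟨B, hB⟩ := isCompact_Icc.exists_bound_of_continuousOn (s := Set.Icc x y)
      (f := fun u => deriv r u / r u) (fun u hu => (hC1 hu).continuousAt.continuousWithinAt)
    refine ⟨B.toNNReal, fun u => ?_⟩
    exact (hB _ (Set.projIcc x y hxy u).2).trans (Real.le_coe_toNNReal B)
  have hF : LipschitzWith (1 + (B + C)) (fun z : ℝ × ℝ => (Real.cos z.2, -(Real.sin z.2 * ρ z.1))) := by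
    refine LipschitzWith.of_dist_le_mul fun z w => ?_
    have e1 : |Real.cos z.2 - Real.cos w.2| ≤ |z.2 - w.2| := by
      simpa [Real.dist_eq] using Real.lipschitzWith_cos.dist_le_mul z.2 w.2
    have e2 : |Real.sin z.2 - Real.sin w.2| ≤ |z.2 - w.2| := by
      simpa [Real.dist_eq] using Real.lipschitzWith_sin.dist_le_mul z.2 w.2
    have e3 : |ρ z.1 - ρ w.1| ≤ C * |z.1 - w.1| := by
      simpa [Real.dist_eq] using hρL.dist_le_mul z.1 w.1
    have d1 : |z.1 - w.1| ≤ dist z w := by rw [← Real.dist_eq]; exact le_max_left _ _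
    have d2 : |z.2 - w.2| ≤ dist z w := by rw [← Real.dist_eq]; exact le_max_right _ _
    have hd : 0 ≤ dist z w := dist_nonneg
    have hB0 : (0 : ℝ) ≤ B := B.2
    have hC0 : (0 : ℝ) ≤ C := C.2
    rw [Prod.dist_eq, max_le_iff, Real.dist_eq, Real.dist_eq]
    push_cast
    constructor
    · nlinarith
    · have e4 : -(Real.sin z.2 * ρ z.1) - -(Real.sin w.2 * ρ w.1)
          = -((Real.sin z.2 - Real.sin w.2) * ρ z.1 + Real.sin w.2 * (ρ z.1 - ρ w.1)) := by ring
      rw [e4, abs_neg]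
      calc |(Real.sin z.2 - Real.sin w.2) * ρ z.1 + Real.sin w.2 * (ρ z.1 - ρ w.1)|
          ≤ |Real.sin z.2 - Real.sin w.2| * |ρ z.1| + |Real.sin w.2| * |ρ z.1 - ρ w.1| := by
            rw [← abs_mul, ← abs_mul]; exact abs_add_le _ _
        _ ≤ dist z w * B + 1 * (C * dist z w) := by
            gcongr
            · exact e2.trans d2
            · exact hB _
            · exact Real.abs_sin_le_one _
            · exact e3.trans (by gcongr)
        _ ≤ (1 + (B + C)) * dist z w := by nlinarith
  have hFB (z : ℝ × ℝ) : ‖(Real.cos z.2, -(Real.sin z.2 * ρ z.1))‖ ≤ (1 + B : NNReal) := by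
    have hB0 : (0 : ℝ) ≤ B := B.2
    rw [Prod.norm_def, max_le_iff, Real.norm_eq_abs, Real.norm_eq_abs, abs_neg, abs_mul]
    push_cast
    constructor
    · linarith [Real.abs_cos_le_one z.2]
    · have := mul_le_mul (Real.abs_sin_le_one z.2) (hB z.1) (abs_nonneg _) zero_le_one
      linarith
  set w : ℂ := ⟨p₀, K / r s₀⟩ with hw
  have hwn : ‖w‖ = 1 := by
    rw [Complex.norm_eq_sqrt_sq_add_sq, hw, hE, Real.sqrt_one]
  have hcis := cis_arg hwn
  have hcos : Real.cos (Complex.arg w) = p₀ := by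
    have := congrArg Complex.re hcis
    rw [cis_eq] at this
    simpa [← Complex.ofReal_cos, ← Complex.ofReal_sin] using this
  have hsin : Real.sin (Complex.arg w) = K / r s₀ := by
    have := congrArg Complex.im hcis
    rw [cis_eq] at this
    simpa [← Complex.ofReal_cos, ← Complex.ofReal_sin] using this
  obtain ⟨z, hz0, hz⟩ := exists_global_solution hF hFB (s₀, Complex.arg w)
  have hz1 (t : ℝ) := hasDerivAt_fst_comp (hz t)
  have hz2 (t : ℝ) := hasDerivAt_snd_comp (hz t)
  set U : ℝ → ℝ := fun u => ∫ v in s₀..u, ρ v with hU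
  have hUd (u : ℝ) : HasDerivAt U (ρ u) u :=
    (hρL.continuous.integral_hasStrictDerivAt s₀ u).hasDerivAt
  have hcons (t : ℝ) : Real.exp (U (z t).1) * Real.sin (z t).2 = K / r s₀ := by
    have hd (t : ℝ) : HasDerivAt (fun t => Real.exp (U (z t).1) * Real.sin (z t).2) 0 t := by
      have h1 : HasDerivAt (fun t => U (z t).1) (ρ (z t).1 * Real.cos (z t).2) t :=
        HasDerivAt.comp (h₂ := U) (h := fun t => (z t).1) t (hUd _) (hz1 t)
      convert! h1.exp.fun_mul (hz2 t).sin using 1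
      ring
    have := is_const_of_deriv_eq_zero (fun t => (hd t).differentiableAt) (fun t => (hd t).deriv) t 0
    beta_reduce at this
    rw [this, hz0, ← hsin, hU]
    simp
  have hUin {u : ℝ} (hu : u ∈ Set.Icc x y) : Real.exp (U u) = r u / r s₀ := by
    have hsub : Set.uIcc s₀ u ⊆ Set.Icc x y := Set.uIcc_subset_Icc ⟨hxs.le, hys.le⟩ hu
    have : U u = Real.log (r u) - Real.log (r s₀) := by
      refine intervalIntegral.integral_eq_sub_of_hasDerivAt (f := fun v => Real.log (r v)) (fun v hv => ?_)
        (hρL.continuous.intervalIntegrable _ _)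
      have hv' := hsub hv
      rw [hρeq hv']
      exact (hr.hasDerivAt (by linarith [hv'.1]) (by linarith [hv'.2])).log (hpos hv').ne'
    rw [this, Real.exp_sub, Real.exp_log (hpos hu), Real.exp_log hr0]
  have hlow {u : ℝ} (h : Real.exp (U u) ≤ r x / r s₀ ∨ Real.exp (U u) ≤ r y / r s₀) :
      Real.exp (U u) < |K| / r s₀ := by
    rcases h with h | h
    · exact h.trans_lt (by gcongr)
    · exact h.trans_lt (by gcongr)
  have hle (t : ℝ) : |K| / r s₀ ≤ Real.exp (U (z t).1) := by
    rw [← abs_of_pos hr0, ← abs_div, ← hcons t, abs_mul, abs_of_pos (Real.exp_pos _)]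
    exact mul_le_of_le_one_right (Real.exp_pos _).le (Real.abs_sin_le_one _)
  -- Beyond a barrier `U` is monotone, so `exp(U)` stays below `|K| / r s₀`, against `|sin θ| ≤ 1`.
  have hmem (t : ℝ) : x < (z t).1 ∧ (z t).1 < y := by
    constructor
    · by_contra! h
      refine absurd (hle t) (not_le.2 (hlow (Or.inl ?_)))
      rw [← hUin ⟨le_rfl, hxy⟩]
      refine Real.exp_le_exp.2 ?_
      have : U x - U (z t).1 = ∫ v in (z t).1..x, ρ v :=
        intervalIntegral.integral_interval_sub_left (hρL.continuous.intervalIntegrable _ _)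
          (hρL.continuous.intervalIntegrable _ _)
      have h2 : 0 ≤ ∫ v in (z t).1..x, ρ v := by
        refine intervalIntegral.integral_nonneg h fun v hv => ?_
        rw [hρ, Set.IccExtend_of_le_left hxy _ hv.2]
        exact (div_pos hxd (hpos ⟨le_rfl, hxy⟩)).le
      linarith
    · by_contra! h
      refine absurd (hle t) (not_le.2 (hlow (Or.inr ?_)))
      rw [← hUin ⟨hxy, le_rfl⟩]
      refine Real.exp_le_exp.2 ?_
      have : U (z t).1 - U y = ∫ v in y..(z t).1, ρ v :=
        intervalIntegral.integral_interval_sub_left (hρL.continuous.intervalIntegrable _ _)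
          (hρL.continuous.intervalIntegrable _ _)
      have h2 : 0 ≤ ∫ v in y..(z t).1, -ρ v := by
        refine intervalIntegral.integral_nonneg h fun v hv => ?_
        rw [hρ, Set.IccExtend_of_right_le hxy _ hv.1]
        exact neg_nonneg.2 (div_neg_of_neg_of_pos hyd (hpos ⟨hxy, le_rfl⟩)).le
      rw [intervalIntegral.integral_neg] at h2
      linarith
  have hIcc (t : ℝ) : (z t).1 ∈ Set.Icc x y := ⟨(hmem t).1.le, (hmem t).2.le⟩
  have hrK (t : ℝ) : Real.sin (z t).2 = K / r (z t).1 := by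
    have h := hcons t
    rw [hUin (hIcc t)] at h
    have := (hpos (hIcc t)).ne'
    field_simp at h ⊢
    linarith
  have hint : Continuous fun t => K / r (z t).1 ^ 2 := by
    rw [continuous_iff_continuousAt]
    intro t
    refine continuousAt_const.div (ContinuousAt.pow (ContinuousAt.comp (g := r) (f := fun t => (z t).1)
      (hr.continuousAt (by linarith [(hmem t).1]) (by linarith [(hmem t).2])) (hz1 t).continuousAt) 2)
      (pow_ne_zero _ (hpos (hIcc t)).ne')
  refine ⟨fun t => (z t).1, fun t => Real.cos (z t).2, fun t => ψ₀ + ∫ τ in (0 : ℝ)..t, K / r (z τ).1 ^ 2,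
    fun t => ⟨by linarith [(hmem t).1], by linarith [(hmem t).2], hz1 t, ?_, ?_, ?_⟩, ?_, ?_, ?_⟩
  · convert! (hz2 t).cos using 1
    rw [hrK, hρeq (hIcc t)]
    have := (hpos (hIcc t)).ne'
    field_simp
  · exact (hint.integral_hasStrictDerivAt 0 t).hasDerivAt.const_add ψ₀
  · rw [← hrK]; exact Real.cos_sq_add_sin_sq _
  · simp [hz0]
  · simp [hz0, hcos]
  · simp

end IsProfile

end Spindle

/-! ### Flow lines of the geodesic flow in the unit tangent bundle. -/

namespace Spindle

open IsRotForm Punct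

namespace Metric.RotSym

variable {m n : ℕ} {g : Metric m n} (hg : g.RotSym)
include hg

theorem order_ne (i : Bool) : order m n i ≠ 0 := (hg.order_pos i).ne'

theorem tangentRel_symm {x y : Bool × ℂ × ℂ} (h : TangentRel m n x y) : TangentRel m n y x := by
  obtain ⟨i, z, v⟩ := x
  obtain ⟨j, w, u⟩ := y
  by_cases hij : i = j
  · subst hij
    simp only [TangentRel, if_true] at h ⊢
    obtain ⟨ζ, h1, rfl, rfl⟩ := h
    have hζ : ζ ≠ 0 := by
      rintro rfl
      rw [zero_pow (hg.order_ne i)] at h1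
      exact zero_ne_one h1
    exact ⟨ζ⁻¹, by rw [inv_pow, h1, inv_one], by field_simp, by field_simp⟩
  · simp only [TangentRel, if_neg hij, if_neg (Ne.symm hij)] at h ⊢
    exact ⟨by rw [mul_comm]; exact h.1, by rw [add_comm]; exact h.2⟩

theorem tangentRel_trans {x y z : Bool × ℂ × ℂ} (h1 : TangentRel m n x y)
    (h2 : TangentRel m n y z) : TangentRel m n x z := by
  obtain ⟨i, a, v⟩ := x
  obtain ⟨j, b, u⟩ := y
  obtain ⟨k, c, w⟩ := z
  by_cases hij : i = j
  · subst hij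
    by_cases hik : i = k
    · subst hik
      simp only [TangentRel, if_true] at h1 h2 ⊢
      obtain ⟨ζ, h1, rfl, rfl⟩ := h1
      obtain ⟨ξ, h2, rfl, rfl⟩ := h2
      exact ⟨ξ * ζ, by rw [mul_pow, h1, h2, one_mul], by ring, by ring⟩
    · simp only [TangentRel, if_true, if_neg hik] at h1 h2 ⊢
      obtain ⟨ζ, h1, rfl, rfl⟩ := h1
      have hζ : ζ ≠ 0 := by
        rintro rfl
        rw [zero_pow (hg.order_ne i)] at h1
        exact zero_ne_one h1
      rw [mul_pow, h1, one_mul] at h2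
      exact ⟨h2.1, mul_left_cancel₀ hζ (by linear_combination h2.2)⟩
  · obtain rfl : j = !i := by cases i <;> cases j <;> simp at hij ⊢
    by_cases hik : i = k
    · subst hik
      have h1' := hg.tangentRel_symm h1
      have := tangentRel_of_cross (i := !i) (z := b) (v := u) (w := a) (u := v) (w' := c) (u' := w)
        hg.hm hg.hn (by rw [Bool.not_not]; exact h1') (by rw [Bool.not_not]; exact h2)
      rwa [Bool.not_not] at this
    · obtain rfl : k = !i := by cases i <;> cases k <;> simp at hik ⊢
      simp only [TangentRel, if_true, if_neg hij] at h1 h2 ⊢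
      obtain ⟨ζ, h2, rfl, rfl⟩ := h2
      rw [mul_pow, h2, one_mul]
      exact ⟨h1.1, by linear_combination ζ * h1.2⟩

omit hg in
theorem tangentRel_refl (x : Bool × ℂ × ℂ) : TangentRel m n x x := by
  simp only [TangentRel, if_true]
  exact ⟨1, by simp, by simp, by simp⟩

/-- `TangentRel` is an equivalence relation, so the quotient identifies related vectors only. -/
theorem mk_eq_iff {i j : Bool} {z v w u : ℂ} (h : g.form i z v v = 1) (h' : g.form j w u u = 1) :
    UnitTangentBundle.mk g i z v h = UnitTangentBundle.mk g j w u h'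
      ↔ TangentRel m n (i, z, v) (j, w, u) := by
  refine ⟨fun H => ?_, fun H => Quot.sound H⟩
  have he : Equivalence fun x y : g.UnitVector => TangentRel m n x.1 y.1 :=
    ⟨fun x => tangentRel_refl _, fun h => hg.tangentRel_symm h,
      fun h1 h2 => hg.tangentRel_trans h1 h2⟩
  exact he.eqvGen_iff.1 (Quot.eqvGen_exact H)

omit hg in
-- Zero vectors transfer the axioms of an equivalence relation from tangent vectors to points.
theorem pointRel_iff (x y : Bool × ℂ) :
    PointRel m n x y ↔ TangentRel m n (x.1, x.2, 0) (y.1, y.2, 0) := by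
  unfold PointRel TangentRel
  by_cases h : x.1 = y.1 <;> simp [h]

theorem space_mk_eq_iff {i j : Bool} {z w : ℂ} :
    Space.mk m n i z = Space.mk m n j w ↔ PointRel m n (i, z) (j, w) := by
  refine ⟨fun H => ?_, fun H => Quot.sound H⟩
  have he : Equivalence (PointRel m n) := by
    refine ⟨fun x => ?_, fun {x y} h => ?_, fun {x y z} h1 h2 => ?_⟩
    · rw [pointRel_iff]; exact tangentRel_refl _
    · rw [pointRel_iff] at h ⊢; exact hg.tangentRel_symm h
    · rw [pointRel_iff] at h1 h2 ⊢; exact hg.tangentRel_trans h1 h2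
  exact he.eqvGen_iff.1 (Quot.eqvGen_exact H)

omit hg in
theorem pointRel_of_tangentRel {i j : Bool} {z v w u : ℂ}
    (h : TangentRel m n (i, z, v) (j, w, u)) : PointRel m n (i, z) (j, w) := by
  unfold TangentRel at h
  unfold PointRel
  by_cases hij : i = j
  · simp only [hij, if_true] at h ⊢
    obtain ⟨ζ, h1, h2, -⟩ := h
    exact ⟨ζ, h1, h2⟩
  · simp only [if_neg hij] at h ⊢
    exact h.1

/-- The base point of a unit tangent vector. -/
def _root_.Spindle.Metric.proj (g : Metric m n) : g.UnitTangentBundle → Space m n :=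
  Quot.lift (fun x : g.UnitVector => Space.mk m n x.1.1 x.1.2.1)
    fun _ _ h => Quot.sound (pointRel_of_tangentRel h)

/-- Around the time `t`, the curve is the velocity of a geodesic in a chart. -/
def _root_.Spindle.Metric.FlowAt (g : Metric m n) (Γ : ℝ → g.UnitTangentBundle) (t : ℝ) : Prop :=
  ∃ (i : Bool) (c v : ℝ → ℂ), ∀ᶠ τ in 𝓝 t, ChartGeo (g.form i) c v τ ∧
    ∃ h, Γ τ = UnitTangentBundle.mk g i (c τ) (v τ) h

/-- Trajectories of the geodesic flow. -/
def _root_.Spindle.Metric.IsFlowLine (g : Metric m n) (Γ : ℝ → g.UnitTangentBundle) : Prop :=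
  ∀ t, g.FlowAt Γ t

omit hg in
theorem isTangentLift_iff {γ : ℝ → Space m n} {Γ : ℝ → g.UnitTangentBundle} :
    g.IsTangentLift γ Γ ↔ g.IsFlowLine Γ ∧ γ = g.proj ∘ Γ := by
  constructor
  · intro h
    refine ⟨fun t => ?_, funext fun t => ?_⟩
    · obtain ⟨i, c, v, h1, h2⟩ := h t
      exact ⟨i, c, v, (h1.and h2).mono fun τ hτ => ⟨hτ.1.1, hτ.2⟩⟩
    · obtain ⟨i, c, v, h1, h2⟩ := h t
      obtain ⟨hu, h3⟩ := h2.self_of_nhds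
      rw [h1.self_of_nhds.2, Function.comp, h3]
      rfl
  · rintro ⟨h, rfl⟩ t
    obtain ⟨i, c, v, h1⟩ := h t
    refine ⟨i, c, v, h1.mono fun τ hτ => ⟨hτ.1, ?_⟩, h1.mono fun τ hτ => hτ.2⟩
    obtain ⟨hu, h3⟩ := hτ.2
    rw [Function.comp, h3]
    rfl

omit hg in
theorem isGeodesic_proj {Γ : ℝ → g.UnitTangentBundle} (h : g.IsFlowLine Γ) :
    g.IsGeodesic (g.proj ∘ Γ) := fun t => by
  obtain ⟨i, c, v, h1, -⟩ := (isTangentLift_iff.2 ⟨h, rfl⟩ : g.IsTangentLift _ _) t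
  exact ⟨i, c, v, h1⟩

omit hg in
theorem flowAt_continuousAt {Γ : ℝ → g.UnitTangentBundle} {t : ℝ} (h : g.FlowAt Γ t) :
    ContinuousAt Γ t := by
  obtain ⟨i, c, v, h1⟩ := h
  obtain ⟨hc, -, a, ha, -⟩ := h1.self_of_nhds.1
  exact g.continuousAt_mk hc.continuousAt ha.continuousAt (h1.mono fun τ hτ => hτ.2)

omit hg in
theorem continuous_of_isFlowLine {Γ : ℝ → g.UnitTangentBundle} (h : g.IsFlowLine Γ) :
    Continuous Γ := continuous_iff_continuousAt.2 fun t => flowAt_continuousAt (h t)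

omit hg in
theorem flowAt_shift {Γ : ℝ → g.UnitTangentBundle} {t t₀ : ℝ} (h : g.FlowAt Γ (t - t₀)) :
    g.FlowAt (fun τ => Γ (τ - t₀)) t := by
  obtain ⟨i, c, v, h1⟩ := h
  have hc : Tendsto (fun τ : ℝ => τ - t₀) (𝓝 t) (𝓝 (t - t₀)) :=
    (continuous_id.sub continuous_const).continuousAt
  exact ⟨i, fun τ => c (τ - t₀), fun τ => v (τ - t₀), (hc.eventually h1).mono fun τ hτ =>
    ⟨hτ.1.shift, hτ.2⟩⟩

omit hg in
theorem flowAt_congr {Γ Γ' : ℝ → g.UnitTangentBundle} {t : ℝ} (h : g.FlowAt Γ t)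
    (he : Γ' =ᶠ[𝓝 t] Γ) : g.FlowAt Γ' t := by
  obtain ⟨i, c, v, h1⟩ := h
  exact ⟨i, c, v, (h1.and he).mono fun τ hτ => ⟨hτ.1.1, by rw [hτ.2]; exact hτ.1.2⟩⟩

theorem exists_hopf (X : g.UnitTangentBundle) : ∃ s β β' : ℝ, 0 ≤ s ∧ s ≤ g.len ∧
    X = hg.hopf (clPt g.len false s β β') := by
  obtain ⟨⟨⟨i, z, v⟩, h⟩, rfl⟩ := Quot.exists_rep X
  obtain ⟨s, ψ, α, h0, h1, -, h2, h3⟩ := hg.exists_chart_polar i h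
  have hN := hg.total_pos.ne'
  have hsum := order_add' (m := m) (n := n) i
  have h4 := hg.hopf_clPt i (s := s) (by linarith) h1 ((ψ + order m n i * α) / (m + n : ℕ))
    ((ψ - order m n (!i) * α) / (m + n : ℕ))
  have e1 : order m n (!i) * ((ψ + order m n i * α) / (m + n : ℕ))
      + order m n i * ((ψ - order m n (!i) * α) / (m + n : ℕ)) = ψ := by
    field_simp
    rw [← hsum]; ring
  have e2 : (ψ + order m n i * α) / (m + n : ℕ) - (ψ - order m n (!i) * α) / (m + n : ℕ) = α := by
    field_simp
    rw [← hsum]; ring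
  have h5 : Quot.mk _ (⟨(i, z, v), h⟩ : g.UnitVector) = hg.hopf (clPt g.len i s
      ((ψ + order m n i * α) / (m + n : ℕ)) ((ψ - order m n (!i) * α) / (m + n : ℕ))) := by
    obtain ⟨hu, h4⟩ := g.exists_mk_congr (h2.symm) (h3.symm) (by rw [e1, e2] at h4; exact h4)
    exact h4.symm
  cases i
  · exact ⟨s, _, _, h0, h1.le, h5⟩
  · rw [← clPt_not hg.len_pos] at h5
    exact ⟨g.len - s, _, _, by linarith, by linarith, h5⟩

theorem toLens_hopf [NeZero (m + n)] {s : ℝ} (h0 : 0 ≤ s) (h1 : s ≤ g.len) (β β' : ℝ) :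
    hg.toLens (hg.hopf (clPt g.len false s β β')) = Lens.mk (m + n) (clPt g.len false s β β') := by
  have hL := hg.len_pos
  rcases lt_or_eq_of_le h1 with h | h
  · exact hg.toLens_hopf_clPt false (by linarith) h β β'
  · rw [← clPt_not hL]
    exact hg.toLens_hopf_clPt _ (by linarith) (by linarith) _ _

/-- `hopf` is onto and invariant under the roots of unity, and `toLens` undoes it up to these. -/
theorem toLens_injective [NeZero (m + n)] : Function.Injective hg.toLens := by
  intro X Y h
  obtain ⟨s, β, β', h0, h1, rfl⟩ := hg.exists_hopf X
  obtain ⟨t, δ, δ', h0', h1', rfl⟩ := hg.exists_hopf Y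
  rw [hg.toLens_hopf h0 h1, hg.toLens_hopf h0' h1'] at h
  obtain ⟨ζ, h2, h3, h4⟩ := Lens.mk_eq_iff.1 h
  exact hg.hopf_mul h2 false h3 h4

/-- The Hausdorff property is pulled back from the lens space by the continuous injection `toLens`;
it makes the agreement set of two flow lines closed. -/
theorem t2Space : T2Space g.UnitTangentBundle := by
  have := hg.neZero
  have h : T2Space (Lens (m + n)) :=
    inferInstanceAs (T2Space (Quotient (MulAction.orbitRel (rootsOfUnity (m + n) ℂ) Punct)))
  exact T2Space.of_injective_continuous hg.toLens_injective hg.continuous_toLens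

theorem isProfile : IsProfile g.prof g.len (1 / m) (1 / n) where
  len_pos := hg.len_pos
  a_pos := one_div_pos.2 hg.m_pos
  b_pos := one_div_pos.2 hg.n_pos
  smooth s h0 h1 := hg.contDiffAt_prof (by linarith [hg.len_pos]) (by linarith [hg.len_pos])
  zero := hg.prof_zero
  len := hg.prof_len
  pos s h0 h1 := hg.prof_pos h0 h1
  deriv_zero := hg.deriv_prof_zero
  deriv_len := by rw [hg.deriv_prof_len, neg_div]

/-- The geodesic in the unit tangent bundle, described by the functions of `RegAt`. -/
def _root_.Spindle.Metric.RepAt (g : Metric m n) (Γ : ℝ → g.UnitTangentBundle) (K : ℝ)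
    (s p ψ : ℝ → ℝ) (τ : ℝ) : Prop :=
  ∃ hu, Γ τ = UnitTangentBundle.mk g false (g.chartPt false (s τ) (ψ τ))
    (g.chartVec false (s τ) (ψ τ) (p τ) (K / g.prof (s τ))) hu

theorem orbRad_false {s : ℝ} (h0 : 0 < s) (h1 : s < g.len) :
    orbRad (g.form false) s = m * g.prof s := by
  rw [(hg.prof_eq_false (by linarith) h1).self_of_nhds]
  have := hg.m_pos
  field_simp

theorem deriv_orbRad_false {s : ℝ} (h0 : 0 < s) (h1 : s < g.len) :
    deriv (orbRad (g.form false)) s = m * deriv g.prof s := by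
  rw [hg.deriv_prof_false (by linarith) h1]
  have := hg.m_pos
  field_simp

theorem orbRad_true {s : ℝ} (h0 : 0 < s) (h1 : s < g.len) :
    orbRad (g.form true) s = n * g.prof (g.len - s) := by
  rw [(hg.prof_eq_true (by linarith) (by linarith)).self_of_nhds]
  have := hg.n_pos
  beta_reduce
  rw [sub_sub_cancel]
  field_simp

theorem deriv_orbRad_true {s : ℝ} (h0 : 0 < s) (h1 : s < g.len) :
    deriv (orbRad (g.form true)) s = -(n * deriv g.prof (g.len - s)) := by
  rw [hg.deriv_prof_true (by linarith) (by linarith), sub_sub_cancel]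
  have := hg.n_pos
  field_simp

/-- The chart angle is `ψ / m` and the chart orbit length is `m` times the profile, so Clairaut's
constant in the chart is `m K`. -/
theorem flowAt_of_regAt {Γ : ℝ → g.UnitTangentBundle} {K t : ℝ} {s p ψ : ℝ → ℝ}
    (h1 : ∀ᶠ τ in 𝓝 t, RegAt g.prof g.len K s p ψ τ) (h2 : ∀ᶠ τ in 𝓝 t, g.RepAt Γ K s p ψ τ) :
    g.FlowAt Γ t := by
  have hm := hg.m_pos
  refine ⟨false, fun τ => polarMap (g.form false) (s τ, ψ τ / m),
    fun τ => polarVec (g.form false) (s τ, ψ τ / m) (p τ) (m * K / orbRad (g.form false) (s τ)), ?_⟩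
  filter_upwards [h1, h2] with τ hτ hτ'
  have hr := hg.prof_pos hτ.pos hτ.lt
  have e1 := hg.orbRad_false hτ.pos hτ.lt
  constructor
  · refine (hg.isRotForm false).chartGeo_polar (χ := fun τ => ψ τ / m) (K := m * K) hτ.hs ?_ ?_ ?_
      (hg.mem_range (by linarith [hτ.pos, hg.len_pos]) hτ.lt) hτ.pos.ne'
    · convert! hτ.hψ.div_const (m : ℝ) using 1
      rw [e1]; field_simp
    · convert! hτ.hp using 1
      rw [e1, hg.deriv_orbRad_false hτ.pos hτ.lt]; field_simp
    · rw [← hτ.energy, e1]; field_simp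
  · refine g.exists_mk_congr rfl ?_ hτ'
    unfold chartVec chartAng
    rw [e1]
    field_simp

/-- In the second chart the poles are exchanged, so the data become `len - s`, `-p` and `-(K / n)`.
-/
theorem exists_regAt_of_flowAt {Γ : ℝ → g.UnitTangentBundle} {t : ℝ} {i : Bool} {c v : ℝ → ℂ}
    (h : ∀ᶠ τ in 𝓝 t, ChartGeo (g.form i) c v τ ∧
      ∃ h, Γ τ = UnitTangentBundle.mk g i (c τ) (v τ) h) (h0 : c t ≠ 0) :
    ∃ (K : ℝ) (s p ψ : ℝ → ℝ), ∀ᶠ τ in 𝓝 t, RegAt g.prof g.len K s p ψ τ ∧ g.RepAt Γ K s p ψ τ := by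
  have hm := hg.m_pos
  have hn := hg.n_pos
  obtain ⟨s, χ, p, K, hex⟩ := (hg.isRotForm i).exists_polar_of_chartGeo (h.mono fun _ hτ => hτ.1) h0
  cases i
  · refine ⟨K / m, s, p, fun τ => m * χ τ, ?_⟩
    filter_upwards [h, hex] with τ hτ ⟨h1, h2, h3, h4, h5, h6, h7, h8⟩
    have hL := hg.lt_len_of_mem_range h5
    have e1 := hg.orbRad_false h6 hL
    have hr := hg.prof_pos h6 hL
    refine ⟨⟨h6, hL, h1, ?_, ?_, ?_⟩, ?_⟩
    · convert! h3 using 1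
      rw [e1, hg.deriv_orbRad_false h6 hL]; field_simp
    · convert! h2.const_mul (m : ℝ) using 1
      rw [e1]; field_simp
    · rw [← h4, e1]; field_simp
    · have e2 : m * χ τ / m = χ τ := by field_simp
      refine g.exists_mk_congr ?_ ?_ hτ.2
      · rw [h7, chartPt, chartAng, e2]
      · rw [h8, chartVec, chartAng, e2, e1, div_div]
  · refine ⟨-(K / n), fun τ => g.len - s τ, fun τ => -p τ, fun τ => n * (g.phase - χ τ), ?_⟩
    filter_upwards [h, hex] with τ hτ ⟨h1, h2, h3, h4, h5, h6, h7, h8⟩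
    have hL := hg.lt_len_of_mem_range h5
    have e1 := hg.orbRad_true h6 hL
    have hr := hg.prof_pos (s := g.len - s τ) (by linarith) (by linarith)
    have e2 : g.phase - n * (g.phase - χ τ) / n = χ τ := by field_simp; ring
    refine ⟨⟨by linarith, by linarith, h1.const_sub _, ?_, ?_, ?_⟩, ?_⟩
    · convert! h3.fun_neg using 1
      rw [e1, hg.deriv_orbRad_true h6 hL]; field_simp
    · convert! (h2.const_sub g.phase).const_mul (n : ℝ) using 1
      rw [e1]; field_simp
    · rw [← h4, e1]; field_simp
    · obtain ⟨hu, h9⟩ := g.exists_mk_congr (z' := g.chartPt true (s τ) (n * (g.phase - χ τ)))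
        (v' := g.chartVec true (s τ) (n * (g.phase - χ τ)) (-p τ) (K / orbRad (g.form true) (s τ)))
        (by rw [h7, chartPt, chartAng, e2]) (by rw [h8, chartVec, chartAng, e2, neg_neg]) hτ.2
      obtain ⟨hu', h10⟩ := g.mk_eq_of_rel hu (hg.overlap true h6 hL _ _ _)
      refine g.exists_mk_congr rfl ?_ ⟨hu', h9.trans h10⟩
      congr 1
      rw [e1]; field_simp

end Metric.RotSym

end Spindle

/-! ### Uniqueness and classification of flow lines. -/

namespace Spindle

open IsRotForm Punct

theorem polarMap_eq_cis (b : ℂ → LinearMap.BilinForm ℝ ℂ) (s χ : ℝ) :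
    polarMap b (s, χ) = cis χ * polarMap b (s, 0) := by
  have := polarMap_add b s 0 χ
  rwa [zero_add] at this

theorem polarVec_eq_cis (b : ℂ → LinearMap.BilinForm ℝ ℂ) (s χ p q : ℝ) :
    polarVec b (s, χ) p q = cis χ * polarVec b (s, 0) p q := by
  have := polarVec_add b s 0 χ p q
  rwa [zero_add] at this

theorem IsRotForm.polarMap_inj {b : ℂ → LinearMap.BilinForm ℝ ℂ} (hb : IsRotForm b)
    {s s' χ χ' : ℝ} {ζ : ℂ} (hs : s ∈ Set.range (arc b)) (hs' : s' ∈ Set.range (arc b)) (h0 : 0 < s)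
    (h0' : 0 < s') (hζ : ‖ζ‖ = 1) (h : polarMap b (s', χ') = ζ * polarMap b (s, χ)) :
    s' = s ∧ cis χ' = ζ * cis χ := by
  have e1 := hb.arc_norm_polarMap hs' h0'.le χ'
  rw [h, norm_mul, hζ, one_mul, hb.arc_norm_polarMap hs h0.le] at e1
  subst e1
  refine ⟨rfl, ?_⟩
  rw [polarMap_eq_cis b s χ', polarMap_eq_cis b s χ, ← mul_assoc] at h
  refine mul_right_cancel₀ ?_ h
  intro h1
  have := hb.arc_norm_polarMap hs h0.le 0
  rw [h1, norm_zero, arc_zero] at this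
  exact h0.ne this

theorem IsRotForm.polarVec_inj {b : ℂ → LinearMap.BilinForm ℝ ℂ} (hb : IsRotForm b)
    {s χ p q p' q' : ℝ} (h : polarVec b (s, χ) p q = polarVec b (s, χ) p' q') : p = p' ∧ q = q' := by
  have e1 := hb.form_polar (s, χ) p q 1 0
  have e2 := hb.form_polar (s, χ) p q 0 1
  rw [h, hb.form_polar] at e1 e2
  constructor <;> linarith

theorem clPt_add_int {L : ℝ} (hL : 0 < L) (i : Bool) (s β β' : ℝ) (k : ℤ) :
    clPt L i (s + 2 * L * k) β β' = clPt L i s (β + Real.pi * k) (β' + Real.pi * k) := by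
  induction k using Int.induction_on generalizing β β' s with
  | zero => simp
  | succ k ih =>
    have := ih s (β + Real.pi) (β' + Real.pi)
    rw [← clPt_add_two_mul hL] at this
    push_cast at this ⊢
    convert this using 2 <;> ring
  | pred k ih =>
    have := ih (s - 2 * L) β β'
    have h2 := clPt_add_two_mul hL i (s - 2 * L) (β + Real.pi * (-k - 1)) (β' + Real.pi * (-k - 1))
    push_cast at this h2 ⊢
    rw [sub_add_cancel] at h2
    rw [h2]
    convert this using 2 <;> ring

theorem clPt_congr (L : ℝ) {s s' β β' γ γ' : ℝ}
    (h1 : Real.cos (Real.pi * s / (2 * L)) * cis β = Real.cos (Real.pi * s' / (2 * L)) * cis γ)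
    (h2 : Real.sin (Real.pi * s / (2 * L)) * cis β' = Real.sin (Real.pi * s' / (2 * L)) * cis γ') :
    clPt L false s β β' = clPt L false s' γ γ' :=
  ext_own false (by rw [own_clPt, own_clPt, h1]) (by rw [own_not_clPt, own_not_clPt, h2])

namespace Metric.RotSym

variable {m n : ℕ} {g : Metric m n} (hg : g.RotSym)
include hg

theorem angle_eq {ζ : ℂ} {ψ ψ' : ℝ} (hζ : ζ ^ m = 1) (h : cis (ψ' / m) = ζ * cis (ψ / m)) :
    ∃ k : ℤ, ψ' = ψ + 2 * Real.pi * k := by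
  have hm := hg.m_pos
  have h1 := congrArg (fun z => z ^ m) h
  beta_reduce at h1
  rw [mul_pow, hζ, one_mul, cis_pow, cis_pow, mul_div_cancel₀ _ hm.ne', mul_div_cancel₀ _ hm.ne'] at h1
  have h2 : cis (ψ' - ψ) = 1 := by rw [cis_sub, h1, div_self (cis_ne_zero _)]
  obtain ⟨k, hk⟩ := cis_eq_one_iff.1 h2
  exact ⟨k, by linarith⟩

theorem eq_of_pointRel {s s' ψ ψ' : ℝ} (h0 : 0 < s) (h1 : s < g.len) (h0' : 0 < s')
    (h1' : s' < g.len)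
    (h : PointRel m n (false, g.chartPt false s ψ) (false, g.chartPt false s' ψ')) :
    s' = s ∧ ∃ k : ℤ, ψ' = ψ + 2 * Real.pi * k := by
  have hL := hg.len_pos
  simp only [PointRel, if_true] at h
  obtain ⟨ζ, h2, h3⟩ := h
  obtain ⟨h4, h5⟩ := (hg.isRotForm false).polarMap_inj (hg.mem_range (by linarith) h1)
    (hg.mem_range (by linarith) h1') h0 h0'
    (Complex.norm_eq_one_of_pow_eq_one h2 (hg.order_ne false)) h3
  exact ⟨h4, hg.angle_eq h2 h5⟩

/-- The norm determines the radius, the angle is determined up to the local group, that is `ψ` up to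
`2πℤ`, and the frame then determines the components. -/
theorem eq_of_tangentRel {s s' ψ ψ' p q p' q' : ℝ} (h0 : 0 < s) (h1 : s < g.len) (h0' : 0 < s')
    (h1' : s' < g.len)
    (h : TangentRel m n (false, g.chartPt false s ψ, g.chartVec false s ψ p q)
      (false, g.chartPt false s' ψ', g.chartVec false s' ψ' p' q')) :
    s' = s ∧ p' = p ∧ q' = q ∧ ∃ k : ℤ, ψ' = ψ + 2 * Real.pi * k := by
  have hL := hg.len_pos
  simp only [TangentRel, if_true] at h
  obtain ⟨ζ, h2, h3, h4⟩ := h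
  obtain ⟨rfl, h5⟩ := (hg.isRotForm false).polarMap_inj (hg.mem_range (by linarith) h1)
    (hg.mem_range (by linarith) h1') h0 h0'
    (Complex.norm_eq_one_of_pow_eq_one h2 (hg.order_ne false)) h3
  refine ⟨rfl, ?_⟩
  unfold chartVec at h4
  have h6 : polarVec (g.form false) (s', g.chartAng false ψ') p' q'
      = polarVec (g.form false) (s', g.chartAng false ψ') p q := by
    refine h4.trans ?_
    rw [polarVec_eq_cis _ _ (g.chartAng false ψ), polarVec_eq_cis _ _ (g.chartAng false ψ'), h5,
      mul_assoc]
  obtain ⟨h7, h8⟩ := (hg.isRotForm false).polarVec_inj h6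
  exact ⟨h7, h8, hg.angle_eq h2 h5⟩

theorem tangentRel_add (s ψ p q : ℝ) (k : ℤ) :
    TangentRel m n (false, g.chartPt false s ψ, g.chartVec false s ψ p q)
      (false, g.chartPt false s (ψ + 2 * Real.pi * k),
        g.chartVec false s (ψ + 2 * Real.pi * k) p q) := by
  have hm := hg.m_pos
  have e : cis ((ψ + 2 * Real.pi * k) / m) = cis (2 * Real.pi * k / m) * cis (ψ / m) := by
    rw [← cis_add]; congr 1; ring
  simp only [TangentRel, if_true]
  refine ⟨cis (2 * Real.pi * k / m), ?_, ?_, ?_⟩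
  · refine (cis_pow _ m).trans ?_
    rw [mul_div_cancel₀ _ hm.ne']
    exact cis_eq_one_iff.2 ⟨k, rfl⟩
  · unfold chartPt chartAng
    rw [polarMap_eq_cis _ s (ψ / m), polarMap_eq_cis, e, mul_assoc]
  · unfold chartVec chartAng
    rw [polarVec_eq_cis _ s (ψ / m), polarVec_eq_cis, e, mul_assoc]

/-- Off the poles this is uniqueness for the profile equations and integration of the angle. At a
pole both curves are meridians, and a meridian is determined by its velocity there. -/
theorem eventually_eq_of_flowAt {Γ Γ' : ℝ → g.UnitTangentBundle} {t : ℝ} (h : g.FlowAt Γ t)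
    (h' : g.FlowAt Γ' t) (he : Γ t = Γ' t) : Γ =ᶠ[𝓝 t] Γ' := by
  obtain ⟨i, c, v, h1⟩ := h
  obtain ⟨j, c', v', h1'⟩ := h'
  obtain ⟨h2, hu, h3⟩ := h1.self_of_nhds
  obtain ⟨h2', hu', h3'⟩ := h1'.self_of_nhds
  have hrel := (hg.mk_eq_iff hu hu').1 (by rw [← h3, ← h3', he])
  by_cases h0 : c t = 0
  · by_cases hij : i = j
    · subst hij
      simp only [TangentRel, if_true] at hrel
      obtain ⟨ζ, hζ, h4, h5⟩ := hrel
      have h0' : c' t = 0 := by rw [h4, h0, mul_zero]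
      obtain ⟨χ, h6⟩ := (hg.isRotForm i).exists_meridian_of_chartGeo_zero (h1.mono fun _ h => h.1) h0
      obtain ⟨χ', h6'⟩ :=
        (hg.isRotForm i).exists_meridian_of_chartGeo_zero (h1'.mono fun _ h => h.1) h0'
      have hv : v t ≠ 0 := by
        intro hv
        rw [hv] at hu
        simp at hu
      have h7 := h6.self_of_nhds.2.2
      have h7' := h6'.self_of_nhds.2.2
      rw [polarVec_eq_cis] at h7 h7'
      have hcis : cis χ' = ζ * cis χ := by
        refine mul_right_cancel₀ (b := polarVec (g.form i) (t - t, 0) 1 0) ?_ ?_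
        · intro h8
          rw [h8, mul_zero] at h7
          exact hv h7
        · rw [← h7', h5, h7, mul_assoc]
      filter_upwards [h1, h1', h6, h6'] with τ ⟨_, hu1, e1⟩ ⟨_, hu1', e1'⟩ ⟨_, e2, e3⟩ ⟨_, e2', e3'⟩
      rw [e1, e1', hg.mk_eq_iff]
      simp only [TangentRel, if_true]
      refine ⟨ζ, hζ, ?_, ?_⟩
      · rw [e2, e2', polarMap_eq_cis, hcis, polarMap_eq_cis _ _ χ, mul_assoc]
      · rw [e3, e3', polarVec_eq_cis, hcis, polarVec_eq_cis _ _ χ, mul_assoc]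
    · simp only [TangentRel, if_neg hij, h0, zero_pow (hg.order_ne i), zero_mul] at hrel
      exact absurd hrel.1 zero_ne_one
  · have h0' : c' t ≠ 0 := by
      intro h0'
      by_cases hij : i = j
      · simp only [TangentRel, if_pos hij, h0'] at hrel
        obtain ⟨ζ, hζ, h4, -⟩ := hrel
        rcases mul_eq_zero.1 h4.symm with h5 | h5
        · rw [h5, zero_pow (hg.order_ne i)] at hζ
          exact zero_ne_one hζ
        · exact h0 h5
      · simp only [TangentRel, if_neg hij, h0', zero_pow (hg.order_ne j), mul_zero] at hrel
        exact absurd hrel.1 zero_ne_one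
    obtain ⟨K, s, p, ψ, h4⟩ := hg.exists_regAt_of_flowAt h1 h0
    obtain ⟨K', s', p', ψ', h4'⟩ := hg.exists_regAt_of_flowAt h1' h0'
    obtain ⟨h5, hu1, h6⟩ := h4.self_of_nhds
    obtain ⟨h5', hu1', h6'⟩ := h4'.self_of_nhds
    obtain ⟨e1, e2, e3, k, e4⟩ := hg.eq_of_tangentRel h5.pos h5.lt h5'.pos h5'.lt
      ((hg.mk_eq_iff hu1 hu1').1 (by rw [← h6, ← h6', he]))
    have hr := (hg.prof_pos h5.pos h5.lt).ne'
    obtain rfl : K' = K := by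
      rw [e1] at e3
      exact (div_left_inj' hr).1 e3
    have h7 := hg.isProfile.eventually_eq_of_regAt (h4.mono fun _ h => h.1) (h4'.mono fun _ h => h.1)
      e1.symm e2.symm
    have h8 : ∀ᶠ τ in 𝓝 t, ψ' τ - ψ τ = ψ' t - ψ t := by
      refine eventually_eq_of_hasDerivAt_zero (f := fun τ => ψ' τ - ψ τ) ?_
      filter_upwards [h4, h4', h7] with τ h9 h9' h10
      have := h9'.1.hψ.sub h9.1.hψ
      rwa [h10.1, sub_self] at this
    filter_upwards [h4, h4', h7, h8] with τ ⟨_, hu2, e5⟩ ⟨_, hu2', e5'⟩ ⟨e6, e7⟩ e8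
    rw [e5, e5', hg.mk_eq_iff]
    have e9 : ψ' τ = ψ τ + 2 * Real.pi * k := by linarith
    rw [e9, ← e6, ← e7]
    exact hg.tangentRel_add _ _ _ _ k

theorem flow_unique {Γ Γ' : ℝ → g.UnitTangentBundle} {t : ℝ} (h : g.IsFlowLine Γ)
    (h' : g.IsFlowLine Γ') (he : Γ t = Γ' t) : Γ = Γ' := by
  have := hg.t2Space
  have hset : {τ | Γ τ = Γ' τ} = Set.univ := by
    refine IsClopen.eq_univ ⟨isClosed_eq (continuous_of_isFlowLine h) (continuous_of_isFlowLine h'),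
      ?_⟩ ⟨t, he⟩
    rw [isOpen_iff_mem_nhds]
    exact fun τ hτ => hg.eventually_eq_of_flowAt (h τ) (h' τ) hτ
  funext τ
  have : τ ∈ {τ | Γ τ = Γ' τ} := hset ▸ Set.mem_univ τ
  exact this

/-- The geodesics through the poles. -/
noncomputable def merid (β x : ℝ) : g.UnitTangentBundle := hg.hopf (clPt g.len false x β β)

theorem merid_add (β x : ℝ) (k : ℤ) :
    hg.merid β (x + 2 * g.len * k) = hg.merid (β + Real.pi * k) x :=
  congrArg hg.hopf (clPt_add_int hg.len_pos false x β β k)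

theorem isFlowLine_merid (β : ℝ) : g.IsFlowLine (hg.merid β) := by
  have hL := hg.len_pos
  -- One circuit `[0, 2 len)`: the first chart serves before the second pole, the second chart with
  -- signed radius `len - τ` from there on.
  have h1 (β : ℝ) {x : ℝ} (h0 : 0 ≤ x) (h1 : x < 2 * g.len) : g.FlowAt (hg.merid β) x := by
    rcases lt_or_ge x g.len with h | h
    · refine ⟨false, fun τ => g.chartPt false τ (n * β + m * β),
        fun τ => g.chartVec false τ (n * β + m * β) 1 0, ?_⟩
      filter_upwards [eventually_lt_nhds h, eventually_gt_nhds (by linarith : -g.len < x)] with τ h2 h3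
      refine ⟨(hg.isRotForm false).chartGeo_meridian (hg.mem_range h3 h2) _, ?_⟩
      have := hg.hopf_clPt false h3 h2 β β
      rw [sub_self, Real.cos_zero, Real.sin_zero] at this
      exact this
    · refine ⟨true, fun τ => g.chartPt true (g.len - τ) (m * β + n * β),
        fun τ => g.chartVec true (g.len - τ) (m * β + n * β) 1 0, ?_⟩
      filter_upwards [eventually_lt_nhds h1, eventually_gt_nhds (by linarith : 0 < x)] with τ h2 h3
      constructor
      · have := ((hg.isRotForm true).chartGeo_meridian (t := g.len - τ)
          (hg.mem_range (by linarith) (by linarith)) (g.chartAng true (m * β + n * β))).reverse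
        have e (τ : ℝ) : g.chartVec true (g.len - τ) (m * β + n * β) 1 0
            = -polarVec (g.form true) (g.len - τ, g.chartAng true (m * β + n * β)) 1 0 := by
          rw [← polarVec_neg_neg, neg_zero]; rfl
        simp only [e]
        exact this
      · have := hg.hopf_clPt true (s := g.len - τ) (by linarith) (by linarith) β β
        rw [sub_self, Real.cos_zero, Real.sin_zero] at this
        have e := clPt_not hL false τ β β
        unfold merid
        rw [← e]
        exact this
  intro x
  have hfl := Int.floor_le (x / (2 * g.len))
  have hfl' := Int.lt_floor_add_one (x / (2 * g.len))
  rw [le_div_iff₀ (by linarith)] at hfl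
  rw [div_lt_iff₀ (by linarith)] at hfl'
  -- A shift by a multiple of `2 len` only changes the phase `β`, so one circuit suffices.
  have := flowAt_shift (t := x) (t₀ := 2 * g.len * ⌊x / (2 * g.len)⌋)
    (h1 (β + Real.pi * ⌊x / (2 * g.len)⌋) (x := x - 2 * g.len * ⌊x / (2 * g.len)⌋)
    (by linarith) (by linarith))
  refine flowAt_congr this (Eventually.of_forall fun τ => ?_)
  beta_reduce
  rw [← hg.merid_add, sub_add_cancel]

/-- The trajectory of the geodesic flow given by a geodesic that avoids the poles. -/
noncomputable def regFlow {K : ℝ} {s p ψ : ℝ → ℝ} (h : RegSol g.prof g.len K s p ψ) (t : ℝ) :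
    g.UnitTangentBundle :=
  UnitTangentBundle.mk g false (g.chartPt false (s t) (ψ t))
    (g.chartVec false (s t) (ψ t) (p t) (K / g.prof (s t))) (hg.chartVec_unit _ _ _ _ _ (h t).energy)

theorem isFlowLine_regFlow {K : ℝ} {s p ψ : ℝ → ℝ} (h : RegSol g.prof g.len K s p ψ) :
    g.IsFlowLine (hg.regFlow h) := fun _ =>
  hg.flowAt_of_regAt (Eventually.of_forall h) (Eventually.of_forall fun _ => ⟨_, rfl⟩)

/-- Every unit tangent vector is the velocity of a meridian or of a geodesic that avoids the
poles. -/
theorem exists_flow (X : g.UnitTangentBundle) : ∃ Γ, g.IsFlowLine Γ ∧ Γ 0 = X ∧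
    ((∃ β x₀, Γ = fun t => hg.merid β (t - x₀)) ∨
    ∃ (K : ℝ) (s p ψ : ℝ → ℝ), K ≠ 0 ∧ ∃ h : RegSol g.prof g.len K s p ψ, Γ = hg.regFlow h) := by
  have hL := hg.len_pos
  have hmer {β x : ℝ} (h : X = hg.merid β x) : ∃ Γ, g.IsFlowLine Γ ∧ Γ 0 = X ∧
      ((∃ β x₀, Γ = fun t => hg.merid β (t - x₀)) ∨
      ∃ (K : ℝ) (s p ψ : ℝ → ℝ), K ≠ 0 ∧ ∃ h : RegSol g.prof g.len K s p ψ, Γ = hg.regFlow h) := by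
    refine ⟨fun t => hg.merid β (t - -x), fun t => flowAt_shift (hg.isFlowLine_merid β _), ?_,
      Or.inl ⟨β, -x, rfl⟩⟩
    rw [h]
    beta_reduce
    rw [sub_neg_eq_add, zero_add]
  obtain ⟨s, β, β', h0, h1, h2⟩ := hg.exists_hopf X
  -- At a pole one of the phases is multiplied by zero and may be set equal to the other.
  rcases h0.eq_or_lt with rfl | h0
  · refine hmer (β := β) (x := 0) (h2.trans (congrArg _ (clPt_congr _ rfl ?_)))
    simp
  rcases h1.eq_or_lt with rfl | h1
  · refine hmer (β := β') (x := g.len) (h2.trans (congrArg _ (clPt_congr _ ?_ rfl)))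
    rw [show Real.pi * g.len / (2 * g.len) = Real.pi / 2 by field_simp]
    simp
  -- The vector points along its meridian or against it; the second case is a meridian at the
  -- parameter `-s`.
  by_cases hs : Real.sin (β - β') = 0
  · obtain ⟨k, hk⟩ := Real.sin_eq_zero_iff.1 hs
    have hsq : cis (β - β') ^ 2 = 1 := by
      rw [cis_pow, cis_eq_one_iff]
      exact ⟨k, by rw [← hk]; push_cast; ring⟩
    have hβ : cis β = cis (β - β') * cis β' := by rw [← cis_add, sub_add_cancel]
    rcases mul_self_eq_one_iff.1 ((sq _).symm.trans hsq) with h | h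
    · refine hmer (β := β') (x := s) (h2.trans (congrArg _ (clPt_congr _ ?_ rfl)))
      rw [hβ, h, one_mul]
    · refine hmer (β := β) (x := -s) (h2.trans (congrArg _ (clPt_congr _ ?_ ?_)))
      · rw [mul_neg, neg_div, Real.cos_neg]
      · rw [mul_neg, neg_div, Real.sin_neg, hβ, h]
        push_cast
        ring
  · have hr := hg.prof_pos h0 h1
    obtain ⟨s', p, ψ, h3, h4, h5, h6⟩ := hg.isProfile.exists_regSol (K := g.prof s * Real.sin (β - β'))
      (mul_ne_zero hr.ne' hs) h0 h1 (p₀ := Real.cos (β - β'))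
      (by rw [mul_div_cancel_left₀ _ hr.ne']; exact Real.cos_sq_add_sin_sq _) (n * β + m * β')
    refine ⟨hg.regFlow h3, hg.isFlowLine_regFlow h3, ?_,
      Or.inr ⟨_, s', p, ψ, mul_ne_zero hr.ne' hs, h3, rfl⟩⟩
    obtain ⟨hu, h7⟩ := g.exists_mk_congr (z' := g.chartPt false (s' 0) (ψ 0))
      (v' := g.chartVec false (s' 0) (ψ 0) (p 0) (g.prof s * Real.sin (β - β') / g.prof (s' 0)))
      (by rw [h4, h6]; rfl) (by rw [h4, h5, h6, mul_div_cancel_left₀ _ hr.ne']; rfl)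
      (hg.hopf_clPt false (by linarith) h1 β β')
    exact (h2.trans h7).symm

theorem flow_cases {Γ : ℝ → g.UnitTangentBundle} (hΓ : g.IsFlowLine Γ) :
    (∃ β x₀, Γ = fun t => hg.merid β (t - x₀)) ∨
    ∃ (K : ℝ) (s p ψ : ℝ → ℝ), K ≠ 0 ∧ ∃ h : RegSol g.prof g.len K s p ψ, Γ = hg.regFlow h := by
  obtain ⟨Γ', h1, h2, h3⟩ := hg.exists_flow (Γ 0)
  rwa [hg.flow_unique h1 hΓ h2] at h3

end Metric.RotSym

end Spindle

/-! ### Closed geodesics and contractible lifts. -/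

namespace Spindle

open IsRotForm Punct

theorem continuous_clPt {X : Type*} [TopologicalSpace X] (L : ℝ) {s β β' : X → ℝ}
    (hs : Continuous s) (hβ : Continuous β) (hβ' : Continuous β') :
    Continuous fun x => clPt L false (s x) (β x) (β' x) := by
  refine Topology.IsInducing.subtypeVal.continuous_iff.2 ?_
  have h1 : Continuous fun x => own false (clPt L false (s x) (β x) (β' x)) := by
    simp only [own_clPt]
    exact (Complex.continuous_ofReal.comp (Real.continuous_cos.comp
      ((continuous_const.mul hs).div_const _))).mul (continuous_cis.comp hβ)
  have h2 : Continuous fun x => own (!false) (clPt L false (s x) (β x) (β' x)) := by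
    simp only [own_not_clPt]
    exact (Complex.continuous_ofReal.comp (Real.continuous_sin.comp
      ((continuous_const.mul hs).div_const _))).mul (continuous_cis.comp hβ')
  exact h1.prodMk h2

namespace Metric.RotSym

variable {m n : ℕ} {g : Metric m n} (hg : g.RotSym)
include hg

/-- A curve of points of the orbifold determines the velocities outside of the poles. -/
theorem tangentRel_of_pointRel {i j : Bool} {c v c' v' : ℝ → ℂ} {t : ℝ} (hc : HasDerivAt c (v t) t)
    (hc' : HasDerivAt c' (v' t) t) (h : ∀ᶠ τ in 𝓝 t, PointRel m n (i, c τ) (j, c' τ))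
    (h0 : c t ≠ 0) : TangentRel m n (i, c t, v t) (j, c' t, v' t) := by
  have ho : (order m n i : ℂ) ≠ 0 := Nat.cast_ne_zero.2 (hg.order_ne i)
  have hpow {c v : ℝ → ℂ} (hc : HasDerivAt c (v t) t) (k : ℕ) :
      HasDerivAt (fun τ => c τ ^ k) (k * c t ^ (k - 1) * v t) t := hc.fun_pow k
  by_cases hij : i = j
  · subst hij
    simp only [PointRel, TangentRel, if_true] at h ⊢
    obtain ⟨ζ, h1, h2⟩ := h.self_of_nhds
    refine ⟨ζ, h1, h2, ?_⟩
    -- The element of the local group may depend on `τ`, but the power `c ^ order` does not see it,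
    -- and its derivative determines the velocity.
    have he : (fun τ => c τ ^ order m n i) =ᶠ[𝓝 t] fun τ => c' τ ^ order m n i := by
      filter_upwards [h] with τ ⟨ξ, h3, h4⟩
      rw [h4, mul_pow, h3, one_mul]
    have h3 := (hpow hc (order m n i)).unique ((hpow hc' (order m n i)).congr_of_eventuallyEq he)
    rw [h2] at h3
    obtain ⟨k, hk⟩ := Nat.exists_eq_succ_of_ne_zero (hg.order_ne i)
    rw [hk, Nat.succ_eq_add_one, Nat.add_sub_cancel, ← Nat.succ_eq_add_one, ← hk, mul_pow] at h3
    have h4 : v t = ζ ^ k * v' t := by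
      refine mul_left_cancel₀ (mul_ne_zero ho (pow_ne_zero k h0)) ?_
      linear_combination h3
    rw [hk, pow_succ'] at h1
    rw [h4, ← mul_assoc, h1, one_mul]
  · simp only [PointRel, TangentRel, if_neg hij] at h ⊢
    have h1 := h.self_of_nhds
    refine ⟨h1, ?_⟩
    have he : (fun τ => c τ ^ order m n i * c' τ ^ order m n j) =ᶠ[𝓝 t] fun _ => 1 := h
    have h2 := ((hpow hc (order m n i)).fun_mul (hpow hc' (order m n j))).unique
      ((hasDerivAt_const t (1 : ℂ)).congr_of_eventuallyEq he)
    obtain ⟨k, hk⟩ := Nat.exists_eq_succ_of_ne_zero (hg.order_ne i)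
    obtain ⟨l, hl⟩ := Nat.exists_eq_succ_of_ne_zero (hg.order_ne j)
    have e1 : c t ^ order m n i = c t * c t ^ (order m n i - 1) := by
      rw [hk, Nat.succ_eq_add_one, Nat.add_sub_cancel, pow_succ']
    have e2 : c' t ^ order m n j = c' t * c' t ^ (order m n j - 1) := by
      rw [hl, Nat.succ_eq_add_one, Nat.add_sub_cancel, pow_succ']
    have e3 : (c t ^ order m n i * c' t ^ order m n j)
        * (order m n i * c' t * v t + order m n j * c t * v' t) = 0 := by
      linear_combination c t * c' t * h2 + order m n i * v t * c' t * c' t ^ order m n j * e1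
        + order m n j * v' t * c t * c t ^ order m n i * e2
    rwa [h1, one_mul] at e3

/-- A unit speed curve cannot stay at the origin of a chart, so arbitrarily close to `t` there is a
time at which the points determine the velocity. One common vector suffices. -/
theorem flow_eq_of_proj {Γ Γ' : ℝ → g.UnitTangentBundle} (h : g.IsFlowLine Γ)
    (h' : g.IsFlowLine Γ') {t : ℝ} (he : g.proj ∘ Γ =ᶠ[𝓝 t] g.proj ∘ Γ') : Γ = Γ' := by
  obtain ⟨i, c, v, h1⟩ := h t
  obtain ⟨j, c', v', h1'⟩ := h' t
  have hfreq : ∃ᶠ τ in 𝓝 t, c τ ≠ 0 := by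
    intro hev
    obtain ⟨⟨hd, -⟩, hu, -⟩ := h1.self_of_nhds
    have h0 : c =ᶠ[𝓝 t] fun _ => 0 := hev.mono fun τ hτ => not_not.1 hτ
    have hv := hd.unique ((hasDerivAt_const t (0 : ℂ)).congr_of_eventuallyEq h0)
    rw [hv] at hu
    simp at hu
  have hrel : ∀ᶠ τ in 𝓝 t, PointRel m n (i, c τ) (j, c' τ) := by
    filter_upwards [h1, h1', he] with τ ⟨_, hu, e1⟩ ⟨_, hu', e1'⟩ e2
    rw [Function.comp, Function.comp, e1, e1'] at e2
    exact hg.space_mk_eq_iff.1 e2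
  obtain ⟨τ, h0, hrelτ, ⟨hd, hu, e1⟩, ⟨hd', hu', e1'⟩⟩ :=
    (hfreq.and_eventually (hrel.eventually_nhds.and (h1.and h1'))).exists
  refine hg.flow_unique (t := τ) h h' ?_
  rw [e1, e1', hg.mk_eq_iff]
  exact hg.tangentRel_of_pointRel hd.1 hd'.1 hrelτ h0

/-- Every geodesic has a lift to the unit tangent bundle. -/
theorem exists_flow_of_isGeodesic {γ : ℝ → Space m n} (hγ : g.IsGeodesic γ) :
    ∃ Γ, g.IsFlowLine Γ ∧ γ = g.proj ∘ Γ := by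
  classical
  have hloc (t : ℝ) : ∃ Γ, g.IsFlowLine Γ ∧ γ =ᶠ[𝓝 t] g.proj ∘ Γ := by
    obtain ⟨i, c, v, h⟩ := hγ t
    have hu₀ : g.form i (c t) (v t) (v t) = 1 := h.self_of_nhds.1.2.1
    set Γ₁ : ℝ → g.UnitTangentBundle := fun τ => if hu : g.form i (c τ) (v τ) (v τ) = 1 then
      UnitTangentBundle.mk g i (c τ) (v τ) hu else UnitTangentBundle.mk g i (c t) (v t) hu₀ with hΓ₁
    have hΓ (τ : ℝ) (hu : g.form i (c τ) (v τ) (v τ) = 1) :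
      Γ₁ τ = UnitTangentBundle.mk g i (c τ) (v τ) hu := dif_pos hu
    have hfl : g.FlowAt Γ₁ t := ⟨i, c, v, h.mono fun τ hτ => ⟨hτ.1, hτ.1.2.1, hΓ τ hτ.1.2.1⟩⟩
    obtain ⟨Γ, h1, h2, -⟩ := hg.exists_flow (Γ₁ t)
    have hev := hg.eventually_eq_of_flowAt hfl (flowAt_shift (t₀ := t) (h1 _))
      (by rw [sub_self, h2])
    refine ⟨fun τ => Γ (τ - t), fun τ => flowAt_shift (h1 _), ?_⟩
    filter_upwards [h, hev] with τ hτ hτ'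
    exact hτ.2.trans (congrArg g.proj ((hΓ τ hτ.1.2.1).symm.trans hτ'))
  choose Γ h1 h2 using hloc
  -- The local lifts are complete flow lines that coincide when they overlap, so the set on which
  -- the lift chosen at time `0` works is open and closed.
  have hset : {t | γ =ᶠ[𝓝 t] g.proj ∘ Γ 0} = Set.univ := by
    refine IsClopen.eq_univ ⟨?_, ?_⟩ ⟨0, h2 0⟩
    · rw [← isOpen_compl_iff, isOpen_iff_mem_nhds]
      intro t ht
      filter_upwards [(h2 t).eventually_nhds] with τ hτ hτ'
      refine ht ?_
      rw [Set.mem_ofPred_eq, ← hg.flow_eq_of_proj (h1 t) (h1 0) (t := τ)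
        (EventuallyEq.trans (EventuallyEq.symm hτ) hτ')]
      exact h2 t
    · rw [isOpen_iff_mem_nhds]
      exact fun t ht => ht.eventually_nhds
  refine ⟨Γ 0, h1 0, funext fun t => ?_⟩
  have : t ∈ {t | γ =ᶠ[𝓝 t] g.proj ∘ Γ 0} := hset ▸ Set.mem_univ t
  exact Eventually.self_of_nhds (p := fun τ => γ τ = (g.proj ∘ Γ 0) τ) this

/-- A null homotopy in the punctured plane is pushed down by the continuous map `hopf`. -/
theorem mem_contractibleLengths {ℓ : ℝ} (hℓ : 0 < ℓ) {G : C(AddCircle ℓ, Punct)}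
    (hG : G.Nullhomotopic) (hflow : g.IsFlowLine fun t : ℝ => hg.hopf (G (t : AddCircle ℓ))) :
    ℓ ∈ g.contractibleLengths := by
  refine ⟨g.proj ∘ fun t : ℝ => hg.hopf (G (t : AddCircle ℓ)), ⟨hℓ, isGeodesic_proj hflow, fun t => ?_⟩,
    (⟨hg.hopf, hg.continuous_hopf⟩ : C(Punct, g.UnitTangentBundle)).comp G,
    isTangentLift_iff.2 ⟨hflow, rfl⟩, hG.comp_right _⟩
  simp only [Function.comp]
  rw [AddCircle.coe_add_period]

/-- The angle between a geodesic and the meridians. -/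
noncomputable def dirAng (_ : g.RotSym) (K : ℝ) (s p : ℝ → ℝ) (t : ℝ) : ℝ :=
  Complex.arg ⟨p t, K / g.prof (s t)⟩

omit hg in
theorem cos_sin_dirAng (hg : g.RotSym) {K : ℝ} {s p ψ : ℝ → ℝ} (h : RegSol g.prof g.len K s p ψ)
    (t : ℝ) : Real.cos (hg.dirAng K s p t) = p t ∧
      Real.sin (hg.dirAng K s p t) = K / g.prof (s t) := by
  have hwn : ‖(⟨p t, K / g.prof (s t)⟩ : ℂ)‖ = 1 := by
    rw [Complex.norm_eq_sqrt_sq_add_sq, (h t).energy, Real.sqrt_one]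
  have hcis := cis_arg hwn
  constructor
  · have := congrArg Complex.re hcis
    rw [cis_eq] at this
    simpa [dirAng, ← Complex.ofReal_cos, ← Complex.ofReal_sin] using this
  · have := congrArg Complex.im hcis
    rw [cis_eq] at this
    simpa [dirAng, ← Complex.ofReal_cos, ← Complex.ofReal_sin] using this

/-- The lift of a geodesic to the punctured plane. -/
noncomputable def regLift (K : ℝ) (s p ψ : ℝ → ℝ) (t : ℝ) : Punct :=
  clPt g.len false (s t) ((ψ t + m * hg.dirAng K s p t) / (m + n : ℕ))
    ((ψ t - n * hg.dirAng K s p t) / (m + n : ℕ))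

theorem hopf_regLift {K : ℝ} {s p ψ : ℝ → ℝ} (h : RegSol g.prof g.len K s p ψ) (t : ℝ) :
    hg.hopf (hg.regLift K s p ψ t) = hg.regFlow h t := by
  obtain ⟨h1, h2⟩ := hg.cos_sin_dirAng h t
  have hN := hg.total_pos.ne'
  set α := hg.dirAng K s p t with hα
  have h3 := hg.hopf_clPt false (by linarith [(h t).pos, hg.len_pos]) (h t).lt
    ((ψ t + m * α) / (m + n : ℕ)) ((ψ t - n * α) / (m + n : ℕ))
  have e1 : (order m n (!false) : ℝ) * ((ψ t + m * α) / (m + n : ℕ))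
      + order m n false * ((ψ t - n * α) / (m + n : ℕ)) = ψ t := by
    change (n : ℝ) * _ + m * _ = _
    field_simp
    push_cast
    ring
  have e2 : (ψ t + m * α) / (m + n : ℕ) - (ψ t - n * α) / (m + n : ℕ) = α := by
    field_simp
    push_cast
    ring
  rw [e1, e2, h1, h2] at h3
  obtain ⟨hu, h4⟩ := h3
  exact h4

/-- `K ≠ 0` keeps the direction `(p, K / r)` off the real axis, so its argument is continuous. -/
theorem continuous_regLift {K : ℝ} {s p ψ : ℝ → ℝ} (hK : K ≠ 0) (h : RegSol g.prof g.len K s p ψ) :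
    Continuous (hg.regLift K s p ψ) := by
  have hs : Continuous s := continuous_iff_continuousAt.2 fun t => (h t).hs.continuousAt
  have hp : Continuous p := continuous_iff_continuousAt.2 fun t => (h t).hp.continuousAt
  have hψ : Continuous ψ := continuous_iff_continuousAt.2 fun t => (h t).hψ.continuousAt
  have hr : Continuous fun t => K / g.prof (s t) := by
    refine continuous_const.div (continuous_iff_continuousAt.2 fun t => ?_)
      fun t => (hg.prof_pos (h t).pos (h t).lt).ne'
    exact ContinuousAt.comp (g := g.prof) (hg.isProfile.continuousAt (h t).pos.le (h t).lt.le)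
      hs.continuousAt
  have hα : Continuous (hg.dirAng K s p) := by
    have hz : Continuous fun t => (⟨p t, K / g.prof (s t)⟩ : ℂ) := by
      have : (fun t => (⟨p t, K / g.prof (s t)⟩ : ℂ))
          = fun t => ((p t : ℝ) : ℂ) + ((K / g.prof (s t) : ℝ) : ℂ) * Complex.I := by
        funext t
        apply Complex.ext <;> simp
      rw [this]
      exact (Complex.continuous_ofReal.comp hp).add
        ((Complex.continuous_ofReal.comp hr).mul continuous_const)
    refine continuous_iff_continuousAt.2 fun t => ?_
    exact ContinuousAt.comp (g := Complex.arg) (Complex.continuousAt_arg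
      (Or.inr (div_ne_zero hK (hg.prof_pos (h t).pos (h t).lt).ne'))) hz.continuousAt
  exact continuous_clPt _ hs ((hψ.add (continuous_const.mul hα)).div_const _)
    ((hψ.sub (continuous_const.mul hα)).div_const _)

omit hg in
theorem deriv_periodic {s p : ℝ → ℝ} {ℓ : ℝ} (hs : ∀ t, HasDerivAt s (p t) t)
    (h : ∀ t, s (t + ℓ) = s t) (t : ℝ) : p (t + ℓ) = p t := by
  have h1 : HasDerivAt (fun τ => s (τ + ℓ)) (p (t + ℓ)) t := (hs (t + ℓ)).comp_add_const t ℓ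
  rw [funext h] at h1
  exact h1.unique (hs t)

/-- A rotation by `2π (m + n) k` shifts both phases by `2π k`, so the lift closes up in the
punctured plane. Its second coordinate never vanishes because the geodesic avoids the first pole,
hence it is null homotopic. -/
theorem mem_contractibleLengths_of_regSol {K ℓ : ℝ} {s p ψ : ℝ → ℝ} (hK : K ≠ 0) (hℓ : 0 < ℓ)
    (h : RegSol g.prof g.len K s p ψ) (hs : ∀ t, s (t + ℓ) = s t) (k : ℤ)
    (hψ : ∀ t, ψ (t + ℓ) = ψ t + 2 * Real.pi * (m + n : ℕ) * k) : ℓ ∈ g.contractibleLengths := by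
  have hL := hg.len_pos
  have hN := hg.total_pos.ne'
  have hp := deriv_periodic (fun t => (h t).hs) hs
  have hcis (a : ℝ) : cis (a + 2 * Real.pi * k) = cis a := by
    rw [cis_add, cis_eq_one_iff.2 ⟨k, rfl⟩, mul_one]
  have hper : Function.Periodic (hg.regLift K s p ψ) ℓ := by
    intro t
    have hα : hg.dirAng K s p (t + ℓ) = hg.dirAng K s p t := by
      unfold dirAng; rw [hs, hp]
    unfold regLift
    rw [hs, hψ, hα]
    refine clPt_congr _ ?_ ?_
    · rw [← hcis ((ψ t + m * hg.dirAng K s p t) / (m + n : ℕ))]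
      congr 2
      field_simp
      ring
    · rw [← hcis ((ψ t - n * hg.dirAng K s p t) / (m + n : ℕ))]
      congr 2
      field_simp
      ring
  refine hg.mem_contractibleLengths hℓ (G := ⟨hper.lift,
    (hg.continuous_regLift hK h).quotient_liftOn' _⟩) (Punct.nullhomotopic_of_snd_ne fun x => ?_) ?_
  · obtain ⟨t, rfl⟩ := QuotientAddGroup.mk_surjective x
    change own (!false) (hg.regLift K s p ψ t) ≠ 0
    unfold regLift
    rw [own_not_clPt]
    refine mul_ne_zero ?_ (cis_ne_zero _)
    have : 0 < Real.sin (Real.pi * s t / (2 * g.len)) := by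
      have h1 := (h t).pos
      have h2 := (h t).lt
      refine Real.sin_pos_of_pos_of_lt_pi (by positivity) ?_
      rw [div_lt_iff₀ (by linarith)]; nlinarith [Real.pi_pos]
    exact_mod_cast this.ne'
  · have : (fun t : ℝ => hg.hopf (hper.lift (t : AddCircle ℓ))) = hg.regFlow h :=
      funext fun t => hg.hopf_regLift h t
    exact this ▸ hg.isFlowLine_regFlow h

/-- The meridian circuit lifts to the real circle `(cos, sin)`. Adding `I` to the second coordinate
makes this coordinate nonzero, and during the motion the real parts `cos` and `sin` do not vanish
simultaneously. -/
theorem four_mul_len_mem : 4 * g.len ∈ g.contractibleLengths := by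
  have hL := hg.len_pos
  have hper : Function.Periodic (fun x => clPt g.len false x 0 0) (4 * g.len) := by
    intro x
    have e : Real.pi * (x + 4 * g.len) / (2 * g.len) = Real.pi * x / (2 * g.len) + 2 * Real.pi := by
      field_simp; ring
    refine clPt_congr _ ?_ ?_ <;> rw [e]
    · rw [Real.cos_add_two_pi]
    · rw [Real.sin_add_two_pi]
  set G : C(AddCircle (4 * g.len), Punct) := ⟨hper.lift,
    (continuous_clPt g.len continuous_id continuous_const continuous_const).quotient_liftOn' _⟩ with hG
  have hG1 (t : ℝ) : (G (t : AddCircle (4 * g.len))).1.1 = Real.cos (Real.pi * t / (2 * g.len)) := by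
    have := own_clPt g.len false t 0 0
    rw [cis_zero, mul_one] at this
    exact this
  have hG2 (t : ℝ) : (G (t : AddCircle (4 * g.len))).1.2 = Real.sin (Real.pi * t / (2 * g.len)) := by
    have := own_not_clPt g.len false t 0 0
    rw [cis_zero, mul_one] at this
    exact this
  have hne (x : AddCircle (4 * g.len)) : (G x).1.2 + Complex.I ≠ 0 := by
    obtain ⟨t, rfl⟩ := QuotientAddGroup.mk_surjective x
    intro h
    have := congrArg Complex.im ((congrArg (· + Complex.I) (hG2 t)).symm.trans h)
    simp [-Complex.ofReal_sin, -Complex.ofReal_cos, -Complex.ofReal_div, -Complex.ofReal_mul] at this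
  set G' : C(AddCircle (4 * g.len), Punct) := ⟨fun x => ⟨((G x).1.1, (G x).1.2 + Complex.I),
    fun h => hne x (congrArg Prod.snd h)⟩, by
      have hv : Continuous fun x => (G x).1 := continuous_subtype_val.comp G.continuous
      exact Continuous.subtype_mk (hv.fst.prodMk (hv.snd.add continuous_const)) _⟩ with hG'
  have hhom : G.Homotopic G' := by
    refine Punct.homotopic_of_segment fun t h0 h1 x e1 e2 => ?_
    obtain ⟨y, rfl⟩ := QuotientAddGroup.mk_surjective x
    have e3 : ((1 - t : ℝ) : ℂ) * Real.cos (Real.pi * y / (2 * g.len))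
        + t * Real.cos (Real.pi * y / (2 * g.len)) = 0 := by rw [← hG1]; exact e1
    have e4 : ((1 - t : ℝ) : ℂ) * Real.sin (Real.pi * y / (2 * g.len))
        + t * (Real.sin (Real.pi * y / (2 * g.len)) + Complex.I) = 0 := by rw [← hG2]; exact e2
    have e5 : Real.cos (Real.pi * y / (2 * g.len)) = 0 := by
      have : (Real.cos (Real.pi * y / (2 * g.len)) : ℂ) = 0 := by
        push_cast at e3 ⊢
        linear_combination e3
      exact_mod_cast this
    have e6 : Real.sin (Real.pi * y / (2 * g.len)) = 0 := by
      have := congrArg Complex.re e4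
      simp [-Complex.ofReal_sin, -Complex.ofReal_cos, -Complex.ofReal_div, -Complex.ofReal_mul] at this
      linarith
    have := Real.sin_sq_add_cos_sq (Real.pi * y / (2 * g.len))
    rw [e5, e6] at this
    norm_num at this
  have hnull : G.Nullhomotopic := by
    obtain ⟨y, hy⟩ := Punct.nullhomotopic_of_snd_ne (f := G') hne
    exact ⟨y, hhom.trans hy⟩
  exact hg.mem_contractibleLengths (by linarith) hnull (hg.isFlowLine_merid 0)

theorem toLens_merid [NeZero (m + n)] (β x : ℝ) :
    hg.toLens (hg.merid β x) = Lens.mk (m + n) (clPt g.len false x β β) := by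
  have hL := hg.len_pos
  have key (β : ℝ) {x : ℝ} (h0 : 0 ≤ x) (h1 : x < 2 * g.len) :
      hg.toLens (hg.merid β x) = Lens.mk (m + n) (clPt g.len false x β β) := by
    rcases lt_or_ge x g.len with h | h
    · exact hg.toLens_hopf_clPt false (by linarith) h β β
    · have e := clPt_not hL false x β β
      unfold merid
      rw [← e]
      exact hg.toLens_hopf_clPt true (by linarith) (by linarith) β β
  have hfl := Int.floor_le (x / (2 * g.len))
  have hfl' := Int.lt_floor_add_one (x / (2 * g.len))
  rw [le_div_iff₀ (by linarith)] at hfl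
  rw [div_lt_iff₀ (by linarith)] at hfl'
  have := key (β + Real.pi * ⌊x / (2 * g.len)⌋) (x := x - 2 * g.len * ⌊x / (2 * g.len)⌋)
    (by linarith) (by linarith)
  rwa [← hg.merid_add, ← clPt_add_int hL, sub_add_cancel] at this

/-- The modulus of the first coordinate gives `s`. The phases give `ψ` and the direction angle up to
full turns, and as the latter is an argument in `(-π, π]`, both phases change by the same multiple
of `2π`; this forces the factor `m + n`. -/
theorem regLift_eq {K t t' : ℝ} {s p ψ : ℝ → ℝ} (h : RegSol g.prof g.len K s p ψ)
    (he : hg.regLift K s p ψ t' = hg.regLift K s p ψ t) :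
    s t' = s t ∧ ∃ k : ℤ, ψ t' = ψ t + 2 * Real.pi * (m + n : ℕ) * k := by
  have hL := hg.len_pos
  have hN := hg.total_pos.ne'
  have e1 := congrArg (own false) he
  have e2 := congrArg (own (!false)) he
  unfold regLift at e1 e2
  rw [own_clPt, own_clPt] at e1
  rw [own_not_clPt, own_not_clPt] at e2
  have hc (t : ℝ) := hg.half_angle (s := s t) (by linarith [(h t).pos]) (h t).lt
  have hcos : Real.cos (Real.pi * s t' / (2 * g.len)) = Real.cos (Real.pi * s t / (2 * g.len)) := by
    have := congrArg norm e1
    rwa [norm_mul, norm_mul, norm_cis, norm_cis, mul_one, mul_one, Complex.norm_real,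
      Complex.norm_real, Real.norm_of_nonneg (hc t').le, Real.norm_of_nonneg (hc t).le] at this
  have hmem (t : ℝ) : Real.pi * s t / (2 * g.len) ∈ Set.Icc 0 Real.pi := by
    have h1 := (h t).pos
    have h2 := (h t).lt
    constructor
    · positivity
    · rw [div_le_iff₀ (by linarith)]; nlinarith [Real.pi_pos]
  have hs : s t' = s t := by
    have := Real.injOn_cos (hmem t') (hmem t) hcos
    have hpi := Real.pi_pos
    field_simp at this
    linarith
  have hsin : 0 < Real.sin (Real.pi * s t / (2 * g.len)) := by
    have h1 := (h t).pos
    have h2 := (h t).lt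
    refine Real.sin_pos_of_pos_of_lt_pi (by positivity) ?_
    rw [div_lt_iff₀ (by linarith)]; nlinarith [Real.pi_pos]
  refine ⟨hs, ?_⟩
  have cancel {c a a' : ℝ} (hc : c ≠ 0) (h : (c : ℂ) * cis a' = c * cis a) :
      ∃ k : ℤ, a' = a + 2 * Real.pi * k := by
    have h1 := mul_left_cancel₀ (by exact_mod_cast hc) h
    obtain ⟨k, hk⟩ := cis_eq_one_iff.1 (show cis (a' - a) = 1 by
      rw [cis_sub, h1, div_self (cis_ne_zero _)])
    exact ⟨k, by linarith⟩
  rw [hs] at e1 e2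
  obtain ⟨j, hj⟩ := cancel (hc t).ne' e1
  obtain ⟨l, hl⟩ := cancel hsin.ne' e2
  have h1 := Complex.arg_le_pi ⟨p t', K / g.prof (s t')⟩
  have h2 := Complex.neg_pi_lt_arg ⟨p t', K / g.prof (s t')⟩
  have h3 := Complex.arg_le_pi ⟨p t, K / g.prof (s t)⟩
  have h4 := Complex.neg_pi_lt_arg ⟨p t, K / g.prof (s t)⟩
  change hg.dirAng K s p t' ≤ Real.pi at h1
  change -Real.pi < hg.dirAng K s p t' at h2
  change hg.dirAng K s p t ≤ Real.pi at h3
  change -Real.pi < hg.dirAng K s p t at h4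
  have hα : hg.dirAng K s p t' = hg.dirAng K s p t + 2 * Real.pi * (j - l) := by
    have : ((m + n : ℕ) : ℝ) * hg.dirAng K s p t'
        = (m + n : ℕ) * (hg.dirAng K s p t + 2 * Real.pi * (j - l)) := by
      field_simp at hj hl
      push_cast at hj hl ⊢
      linarith
    exact mul_left_cancel₀ hN this
  have hjl : j = l := by
    have hpi := Real.pi_pos
    have a1 : (j - l : ℝ) < 1 := by
      by_contra! h; nlinarith
    have a2 : (-1 : ℝ) < j - l := by
      by_contra! h; nlinarith
    have b1 : j - l < 1 := by exact_mod_cast a1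
    have b2 : -1 < j - l := by exact_mod_cast a2
    omega
  refine ⟨j, ?_⟩
  rw [hjl, sub_self, mul_zero, add_zero] at hα
  rw [hα] at hj
  field_simp at hj
  linarith

/-- A contractible lift maps to a null homotopic loop of the lens space, whose lift to the punctured
plane is closed. For a meridian this makes `ℓ` a multiple of `4 len`; for the other geodesics
`regLift_eq` applies. -/
theorem le_or_exists_of_mem {ℓ : ℝ} (h : ℓ ∈ g.contractibleLengths) : 0 < ℓ ∧ (4 * g.len ≤ ℓ ∨
    ∃ (K : ℝ) (s p ψ : ℝ → ℝ), K ≠ 0 ∧ RegSol g.prof g.len K s p ψ ∧ ∀ t, s (t + ℓ) = s t ∧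
      ∃ k : ℤ, ψ (t + ℓ) = ψ t + 2 * Real.pi * (m + n : ℕ) * k) := by
  have hL := hg.len_pos
  have := hg.neZero
  obtain ⟨γ, ⟨hℓ, -, -⟩, Γ, hΓ, hnull⟩ := h
  refine ⟨hℓ, ?_⟩
  obtain ⟨hflow, -⟩ := isTangentLift_iff.1 hΓ
  have hnull' := hnull.comp_right (⟨hg.toLens, hg.continuous_toLens⟩ : C(_, Lens (m + n)))
  rcases hg.flow_cases hflow with ⟨β, x₀, h⟩ | ⟨K, s, p, ψ, hK, h, h'⟩
  · left
    have hlift := Lens.periodic_of_nullhomotopic hnull' (Λ := fun t => clPt g.len false (t - x₀) β β)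
      (continuous_clPt _ (continuous_id.sub continuous_const) continuous_const continuous_const)
      (fun t => by
        rw [← hg.toLens_merid]
        exact congrArg hg.toLens (congrFun h t)) x₀
    have e1 := congrArg (own false) hlift
    beta_reduce at e1
    rw [own_clPt, own_clPt] at e1
    have e2 := mul_right_cancel₀ (cis_ne_zero β) e1
    rw [add_sub_cancel_left, sub_self, mul_zero, zero_div, Real.cos_zero] at e2
    obtain ⟨k, hk⟩ := (Real.cos_eq_one_iff _).1 (by exact_mod_cast e2)
    have hpi := Real.pi_pos
    have e3 : ℓ = 4 * g.len * k := by
      field_simp at hk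
      linarith
    have hk0 : (0 : ℝ) < k := by
      by_contra! h; nlinarith
    have hk1 : (1 : ℝ) ≤ k := by
      have : 0 < k := by exact_mod_cast hk0
      exact_mod_cast this
    nlinarith
  · right
    refine ⟨K, s, p, ψ, hK, h, fun t => hg.regLift_eq h ?_⟩
    refine Lens.periodic_of_nullhomotopic hnull' (hg.continuous_regLift hK h) (fun t => ?_) t
    exact (congrArg hg.toLens ((congrFun h' t).trans (hg.hopf_regLift h t).symm)).trans
      (hg.toLens_hopf (h t).pos.le (h t).lt.le _ _)

theorem closed_of_isBesse (hB : g.IsBesse) {K : ℝ} {s p ψ : ℝ → ℝ}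
    (h : RegSol g.prof g.len K s p ψ) : ∃ ℓ > 0, ∀ t, s (t + ℓ) = s t ∧
      ∃ k : ℤ, ψ (t + ℓ) = ψ t + 2 * Real.pi * k := by
  obtain ⟨ℓ, hℓ, -, hper⟩ := hB _ (isGeodesic_proj (hg.isFlowLine_regFlow h))
  exact ⟨ℓ, hℓ, fun t => hg.eq_of_pointRel (h t).pos (h t).lt (h (t + ℓ)).pos (h (t + ℓ)).lt
    (hg.space_mk_eq_iff.1 (hper t).symm)⟩

/-- Meridians always close up after `4 len`, so only the geodesics avoiding the poles need a
hypothesis. -/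
theorem isBesse_of_closed (H : ∀ (K : ℝ) (s p ψ : ℝ → ℝ), K ≠ 0 → RegSol g.prof g.len K s p ψ →
    ∃ ℓ > 0, ∀ t, s (t + ℓ) = s t ∧ ∃ k : ℤ, ψ (t + ℓ) = ψ t + 2 * Real.pi * k) : g.IsBesse := by
  have hL := hg.len_pos
  intro γ hγ
  obtain ⟨Γ, hΓ, rfl⟩ := hg.exists_flow_of_isGeodesic hγ
  rcases hg.flow_cases hΓ with ⟨β, x₀, rfl⟩ | ⟨K, s, p, ψ, hK, h, rfl⟩
  · refine ⟨4 * g.len, by linarith, hγ, fun t => ?_⟩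
    simp only [Function.comp]
    congr 1
    unfold merid
    have e : Real.pi * (t + 4 * g.len - x₀) / (2 * g.len)
        = Real.pi * (t - x₀) / (2 * g.len) + 2 * Real.pi := by field_simp; ring
    refine congrArg _ (clPt_congr _ ?_ ?_) <;> rw [e]
    · rw [Real.cos_add_two_pi]
    · rw [Real.sin_add_two_pi]
  · obtain ⟨ℓ, hℓ, h1⟩ := H K s p ψ hK h
    refine ⟨ℓ, hℓ, hγ, fun t => ?_⟩
    obtain ⟨h2, k, h3⟩ := h1 t
    have h4 := pointRel_of_tangentRel (hg.tangentRel_add (s t) (ψ t) 0 0 k)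
    rw [← h3, ← h2] at h4
    have h5 := (hg.space_mk_eq_iff.2 h4).symm
    rw [h2] at h5
    refine Eq.trans ?_ h5
    exact congrArg (fun x => Space.mk m n false (g.chartPt false x (ψ (t + ℓ)))) h2

end Metric.RotSym

end Spindle

/-! ### Critical values of the profile and level sets below the smallest one. -/

namespace Spindle

/-- The value `c` is the smallest critical value of the profile, attained at `σ`, and all critical
points lie between `A` and `B`. -/
structure CritData (r : ℝ → ℝ) (L c A B σ : ℝ) : Prop where
  A_pos : 0 < A
  A_le : A ≤ σ
  le_B : σ ≤ B
  B_lt : B < L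
  c_pos : 0 < c
  inc : ∀ s, 0 ≤ s → s < A → 0 < deriv r s
  dec : ∀ s, B < s → s ≤ L → deriv r s < 0
  le : ∀ s, A ≤ s → s ≤ B → c ≤ r s
  val : r σ = c
  crit : deriv r σ = 0

namespace CritData

variable {r : ℝ → ℝ} {L c A B σ : ℝ} (hc : CritData r L c A B σ)

include hc

theorem reflect : CritData (fun s => r (L - s)) L c (L - B) (L - A) (L - σ) := by
  have hd (s : ℝ) : deriv (fun s => r (L - s)) s = -deriv r (L - s) := deriv_comp_const_sub r L s
  refine ⟨by linarith [hc.B_lt], by linarith [hc.le_B], by linarith [hc.A_le],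
    by linarith [hc.A_pos], hc.c_pos, fun s h0 h1 => ?_, fun s h0 h1 => ?_, fun s h0 h1 => ?_, ?_,
    ?_⟩
  · rw [hd]; linarith [hc.dec (L - s) (by linarith) (by linarith)]
  · rw [hd]; linarith [hc.inc (L - s) (by linarith) (by linarith)]
  · exact hc.le _ (by linarith) (by linarith)
  · rw [sub_sub_cancel, hc.val]
  · rw [hd, sub_sub_cancel, hc.crit, neg_zero]

theorem deriv_ne_zero {s : ℝ} (h0 : 0 ≤ s) (h1 : s ≤ L) (h : r s < c) : deriv r s ≠ 0 := by
  rcases lt_or_ge s A with hA | hA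
  · exact (hc.inc s h0 hA).ne'
  rcases le_or_gt s B with hB | hB
  · linarith [hc.le s hA hB]
  · exact (hc.dec s hB h1).ne

end CritData

namespace IsProfile

variable {r : ℝ → ℝ} {L a b : ℝ} (hr : IsProfile r L a b)

include hr

theorem continuousOn : ContinuousOn r (Set.Icc 0 L) := fun _ hs =>
  (hr.continuousAt hs.1 hs.2).continuousWithinAt

theorem continuousOn_deriv : ContinuousOn (deriv r) (Set.Icc 0 L) := fun _ hs =>
  (hr.contDiffAt_deriv hs.1 hs.2).continuousAt.continuousWithinAt

theorem nonneg {s : ℝ} (h0 : 0 ≤ s) (h1 : s ≤ L) : 0 ≤ r s := by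
  rcases h0.eq_or_lt with rfl | h0
  · exact hr.zero.ge
  rcases h1.eq_or_lt with rfl | h1
  · exact hr.len.ge
  exact (hr.pos s h0 h1).le

/-- The critical set is compact, nonempty by Rolle's theorem, and does not meet the poles. `A` and
`B` are its extreme points and `σ` minimizes the profile on it. Outside `[A, B]` the sign of `r'` is
the one at the pole, and a minimum of `r` on `[A, B]` is critical wherever it lies. -/
theorem exists_critData : ∃ c A B σ, CritData r L c A B σ := by
  have hL := hr.len_pos
  set C := Set.Icc 0 L ∩ deriv r ⁻¹' {0} with hC
  have hCc : IsCompact C :=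
    isCompact_Icc.of_isClosed_subset (hr.continuousOn_deriv.preimage_isClosed_of_isClosed
      isClosed_Icc isClosed_singleton) Set.inter_subset_left
  have hCn : C.Nonempty := by
    obtain ⟨x, hx, hx'⟩ := exists_deriv_eq_zero hL hr.continuousOn (hr.zero.trans hr.len.symm)
    exact ⟨x, ⟨hx.1.le, hx.2.le⟩, hx'⟩
  have hd0 : 0 < deriv r 0 := hr.deriv_zero ▸ hr.a_pos
  have hdL : deriv r L < 0 := by rw [hr.deriv_len]; linarith [hr.b_pos]
  have hmem {s : ℝ} (h : s ∈ C) : 0 < s ∧ s < L := by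
    refine ⟨h.1.1.lt_of_ne ?_, h.1.2.lt_of_ne ?_⟩
    · rintro rfl; exact hd0.ne' h.2
    · rintro rfl; exact hdL.ne h.2
  obtain ⟨A, hA, hAm⟩ := hCc.exists_isLeast hCn
  obtain ⟨B, hB, hBm⟩ := hCc.exists_isGreatest hCn
  obtain ⟨σ, hσ, hσm⟩ := hCc.exists_isMinOn hCn (hr.continuousOn.mono Set.inter_subset_left)
  refine ⟨r σ, A, B, σ, (hmem hA).1, hAm hσ, hBm hσ, (hmem hB).2,
    hr.pos _ (hmem hσ).1 (hmem hσ).2, fun s h0 h1 => ?_, fun s h0 h1 => ?_, fun s h0 h1 => ?_, rfl,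
    hσ.2⟩
  · by_contra! h
    obtain ⟨x, hx, hx'⟩ := intermediate_value_Icc' h0
      (hr.continuousOn_deriv.mono (Set.Icc_subset_Icc_right (h1.le.trans hA.1.2))) ⟨h, hd0.le⟩
    linarith [hAm (a := x) ⟨⟨hx.1, hx.2.trans (h1.le.trans hA.1.2)⟩, hx'⟩, hx.2]
  · by_contra! h
    obtain ⟨x, hx, hx'⟩ := intermediate_value_Icc' h1
      (hr.continuousOn_deriv.mono (Set.Icc_subset_Icc_left (hB.1.1.trans h0.le))) ⟨hdL.le, h⟩
    linarith [hBm (a := x) ⟨⟨(hB.1.1.trans h0.le).trans hx.1, hx.2⟩, hx'⟩, hx.1]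
  · obtain ⟨x, hx, hxm⟩ := isCompact_Icc.exists_isMinOn (Set.nonempty_Icc.2 (h0.trans h1))
      (hr.continuousOn.mono (Set.Icc_subset_Icc hA.1.1 hB.1.2))
    refine le_trans ?_ (hxm ⟨h0, h1⟩)
    rcases hx.1.eq_or_lt with rfl | hx0
    · exact hσm hA
    rcases hx.2.eq_or_lt with rfl | hx1
    · exact hσm hB
    · exact hσm ⟨⟨hA.1.1.trans hx.1, hx.2.trans hB.1.2⟩,
        (hxm.isLocalMin (Icc_mem_nhds hx0 hx1)).deriv_eq_zero⟩

section

variable {c A B σ : ℝ} (hc : CritData r L c A B σ)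

include hc

theorem strictMonoOn : StrictMonoOn r (Set.Icc 0 A) := by
  have := hc.A_le.trans hc.le_B
  have := hc.B_lt
  refine strictMonoOn_of_deriv_pos (convex_Icc _ _)
    (hr.continuousOn.mono (Set.Icc_subset_Icc_right (by linarith))) fun s hs => ?_
  rw [interior_Icc] at hs
  exact hc.inc s hs.1.le hs.2

theorem exists_level {K : ℝ} (h0 : 0 < K) (h1 : K < c) : ∃ u, 0 < u ∧ u < A ∧ r u = K ∧
    (∀ s, 0 ≤ s → s < u → r s < K) ∧ ∀ s, u < s → s ≤ B → K < r s := by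
  have hA := hc.A_pos
  have := hc.A_le.trans hc.le_B
  have := hc.B_lt
  have hrA := hc.le A le_rfl (hc.A_le.trans hc.le_B)
  have hm := hr.strictMonoOn hc
  obtain ⟨u, hu, hu'⟩ := intermediate_value_Icc hA.le
    (hr.continuousOn.mono (Set.Icc_subset_Icc_right (by linarith)))
    (show K ∈ Set.Icc (r 0) (r A) from ⟨by rw [hr.zero]; exact h0.le, by linarith⟩)
  refine ⟨u, hu.1.lt_of_ne ?_, hu.2.lt_of_ne ?_, hu', fun s hs hsu => ?_, fun s hs hsB => ?_⟩
  · rintro rfl; rw [hr.zero] at hu'; linarith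
  · rintro rfl; linarith
  · rw [← hu']; exact hm ⟨hs, hsu.le.trans hu.2⟩ hu hsu
  · rcases le_or_gt s A with h | h
    · rw [← hu']; exact hm hu ⟨hu.1.trans hs.le, h⟩ hs
    · linarith [hc.le s h.le hsB]

/-- Below `c` the profile is strictly monotone next to each pole, so a level is attained exactly
twice. These are the turning points of the geodesics with this Clairaut constant. -/
theorem exists_levels {K : ℝ} (h0 : 0 < K) (h1 : K < c) : ∃ u v, 0 < u ∧ u < A ∧ B < v ∧ v < L ∧
    r u = K ∧ r v = K ∧ (∀ s, 0 ≤ s → s < u → r s < K) ∧ (∀ s, u < s → s < v → K < r s) ∧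
    ∀ s, v < s → s ≤ L → r s < K := by
  have hAB := hc.A_le.trans hc.le_B
  obtain ⟨u, hu0, huA, hu, hu1, hu2⟩ := hr.exists_level hc h0 h1
  obtain ⟨v, hv0, hvB, hv, hv1, hv2⟩ := hr.reflect.exists_level hc.reflect h0 h1
  refine ⟨u, L - v, hu0, huA, by linarith, by linarith, hu, hv, hu1, fun s h2 h3 => ?_,
    fun s h2 h3 => ?_⟩
  · rcases le_or_gt s B with h | h
    · exact hu2 s h2 h
    · simpa using hv2 (L - s) (by linarith) (by linarith)
  · simpa using hv1 (L - s) (by linarith) (by linarith)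

/-- A cutoff of the vector field `1 / r'` to the region where `r` is small. -/
theorem exists_cutoff {c' : ℝ} (h0 : 0 < c') (h1 : c' < c) : ∃ w η : ℝ → ℝ,
    (∀ s, 0 ≤ s → s ≤ L → ContinuousAt w s ∧ ContDiffAt ℝ 1 η s ∧ w s + deriv r s * η s = 1 ∧
      (w s ≠ 0 → c' < r s)) ∧ η 0 = 1 / a ∧ η L = -(1 / b) := by
  obtain ⟨d, hd0, hd1⟩ := exists_between h1
  -- `χ` is `1` up to `c'` and `0` from `d < c` on, so dividing `χ(r)` by `r'` is harmless: `r'` has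
  -- no zeros where `r < c`.
  set χ : ℝ → ℝ := fun x => Real.smoothTransition ((d - x) / (d - c')) with hχ
  have hdc : 0 < d - c' := sub_pos.2 hd0
  have hχs : ContDiff ℝ 1 χ := Real.smoothTransition.contDiff.comp
    ((contDiff_const.sub contDiff_id).div_const _)
  have hχ0 {x : ℝ} (hx : d ≤ x) : χ x = 0 :=
    Real.smoothTransition.zero_of_nonpos (div_nonpos_of_nonpos_of_nonneg (by linarith) hdc.le)
  have hχ1 {x : ℝ} (hx : x ≤ c') : χ x = 1 :=
    Real.smoothTransition.one_of_one_le ((one_le_div hdc).2 (by linarith))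
  refine ⟨fun s => 1 - χ (r s), fun s => χ (r s) / deriv r s, fun s hs0 hs1 => ⟨?_, ?_, ?_, ?_⟩,
    ?_, ?_⟩
  · exact continuousAt_const.sub
      (hχs.continuous.continuousAt.comp (f := r) (hr.continuousAt hs0 hs1))
  · rcases lt_or_ge (r s) c with h | h
    · exact (hχs.contDiffAt.comp s (hr.contDiffAt_one hs0 hs1)).div (hr.contDiffAt_deriv hs0 hs1)
        (hc.deriv_ne_zero hs0 hs1 h)
    · refine (contDiffAt_const (c := (0 : ℝ))).congr_of_eventuallyEq ?_
      filter_upwards [(hr.continuousAt hs0 hs1).eventually (lt_mem_nhds (hd1.trans_le h))] with x hx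
      rw [hχ0 (le_of_lt hx), zero_div]
  · rcases lt_or_ge (r s) c with h | h
    · have := hc.deriv_ne_zero hs0 hs1 h
      beta_reduce
      field_simp
      ring
    · simp [hχ0 (hd1.le.trans h)]
  · intro h
    by_contra! h2
    beta_reduce at h
    exact h (by rw [hχ1 h2, sub_self])
  · simp [hr.zero, hr.deriv_zero, hχ1 h0.le]
  · simp [hr.len, hr.deriv_len, hχ1 h0.le, div_neg]

end

end IsProfile

end Spindle

/-! ### The action and its derivative. -/

namespace Spindle

open MeasureTheory

theorem ae_of_forall_Ioo {a b : ℝ} (hab : a ≤ b) {P : ℝ → Prop}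
    (h : ∀ s, a < s → s < b → P s) : ∀ᵐ s, s ∈ Set.uIoc a b → P s := by
  filter_upwards [Measure.ae_ne volume b] with s hs hs'
  rw [Set.uIoc_of_le hab] at hs'
  exact h s hs'.1 (hs'.2.lt_of_ne hs)

theorem intervalIntegrable_of_bounded {f : ℝ → ℝ} {a b M : ℝ} (hab : a ≤ b)
    (hf : ∀ s, a < s → s < b → ContinuousAt f s) (hb : ∀ s, a < s → s < b → |f s| ≤ M) :
    IntervalIntegrable f volume a b := by
  rw [intervalIntegrable_iff_integrableOn_Ioo_of_le hab]
  have hm : AEStronglyMeasurable f (volume.restrict (Set.Ioo a b)) :=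
    ContinuousOn.aestronglyMeasurable (fun s hs => (hf s hs.1 hs.2).continuousWithinAt)
      measurableSet_Ioo
  refine ⟨hm, HasFiniteIntegral.restrict_of_bounded M (by simp) ?_⟩
  exact (ae_restrict_iff' measurableSet_Ioo).2 (ae_of_all _ fun s hs => hb s hs.1 hs.2)

theorem aestronglyMeasurable_of_continuousAt {f : ℝ → ℝ} {a b : ℝ} (hab : a ≤ b)
    (hf : ∀ s, a < s → s < b → ContinuousAt f s) :
    AEStronglyMeasurable f (volume.restrict (Set.uIoc a b)) := by
  rw [Set.uIoc_of_le hab, ← restrict_Ioo_eq_restrict_Ioc]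
  exact ContinuousOn.aestronglyMeasurable (fun s hs => (hf s hs.1 hs.2).continuousWithinAt)
    measurableSet_Ioo

/-- The primitive of `-arccos` that vanishes on `[1, ∞)`. -/
noncomputable def arcPrim (y : ℝ) : ℝ := ∫ t in y..1, Real.arccos t

theorem hasDerivAt_arcPrim (y : ℝ) : HasDerivAt arcPrim (-Real.arccos y) y :=
  intervalIntegral.integral_hasDerivAt_left (Real.continuous_arccos.intervalIntegrable _ _)
    (Real.continuous_arccos.stronglyMeasurableAtFilter _ _) Real.continuous_arccos.continuousAt

/-- For `y > 1` both sides vanish by the conventions for `arccos` and the square root, which lets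
integrals run over all of `[0, L]` instead of the region `K < r`. -/
theorem arcPrim_eq {y : ℝ} (hy : 0 ≤ y) : arcPrim y = √(1 - y ^ 2) - y * Real.arccos y := by
  rcases le_or_gt y 1 with h | h
  · have := intervalIntegral.integral_eq_sub_of_hasDerivAt_of_le
      (f := fun x => x * Real.arccos x - √(1 - x ^ 2)) (f' := Real.arccos) h
      (by fun_prop) (fun x hx => ?_) (Real.continuous_arccos.intervalIntegrable _ _)
    · rw [arcPrim, this]; simp
    · have h1 : 0 < 1 - x ^ 2 := by nlinarith [hx.1, hx.2]
      have h2 := Real.hasDerivAt_arccos (x := x) (by linarith [hx.1]) hx.2.ne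
      have h3 := ((hasDerivAt_id x).fun_pow 2).const_sub 1
      convert! ((hasDerivAt_id x).fun_mul h2).fun_sub (h3.sqrt h1.ne') using 1
      simp only [id]
      have := Real.sqrt_pos.2 h1
      field_simp
      ring
  · rw [Real.arccos_of_one_le h.le, Real.sqrt_eq_zero_of_nonpos (by nlinarith), mul_zero, sub_zero,
      arcPrim]
    refine intervalIntegral.integral_zero_ae (ae_of_all _ fun x hx => ?_)
    rw [Set.uIoc_of_ge h.le] at hx
    exact Real.arccos_of_one_le hx.1.le

theorem abs_arcPrim_le {y : ℝ} (hy : 0 ≤ y) : |arcPrim y| ≤ 1 + Real.pi := by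
  rw [arcPrim_eq hy]
  have h1 : √(1 - y ^ 2) ≤ 1 := Real.sqrt_le_one.2 (by nlinarith)
  have h2 := Real.sqrt_nonneg (1 - y ^ 2)
  have h3 := Real.arccos_nonneg y
  have h4 := Real.arccos_le_pi y
  rw [abs_le]
  rcases le_or_gt y 1 with h | h
  · constructor <;> nlinarith
  · rw [Real.arccos_of_one_le h.le]
    constructor <;> nlinarith

/-- The action of the geodesics with Clairaut constant `K` over one period. -/
noncomputable def act (r : ℝ → ℝ) (L K : ℝ) : ℝ := 2 * ∫ s in (0 : ℝ)..L, √(1 - (K / r s) ^ 2)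

/-- A cutoff `η` of the vector field `1 / r'` to the region where `r` is small. -/
structure IsCutoff (r : ℝ → ℝ) (L a b c' : ℝ) (w η : ℝ → ℝ) : Prop where
  pos : 0 < c'
  cont : ∀ s, 0 ≤ s → s ≤ L → ContinuousAt w s
  contDiff : ∀ s, 0 ≤ s → s ≤ L → ContDiffAt ℝ 1 η s
  add : ∀ s, 0 ≤ s → s ≤ L → w s + deriv r s * η s = 1
  lt : ∀ s, 0 ≤ s → s ≤ L → w s ≠ 0 → c' < r s
  zero : η 0 = 1 / a
  len : η L = -(1 / b)

/-- The derivative of half of the action with respect to the Clairaut constant, up to sign. -/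
noncomputable def rotDensity (r : ℝ → ℝ) (c' : ℝ) (w η : ℝ → ℝ) (K s : ℝ) : ℝ :=
  w s * (K / max (r s) c' ^ 2 / √(1 - (K / max (r s) c') ^ 2)) - Real.arccos (K / r s) * deriv η s

namespace IsProfile

variable {r : ℝ → ℝ} {L a b : ℝ} (hr : IsProfile r L a b)

include hr

theorem continuousAt_ratio (K : ℝ) {s : ℝ} (h0 : 0 < s) (h1 : s < L) :
    ContinuousAt (fun s => K / r s) s :=
  continuousAt_const.div (hr.continuousAt h0.le h1.le) (hr.pos s h0 h1).ne'

theorem intervalIntegrable_sqrt (K : ℝ) :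
    IntervalIntegrable (fun s => √(1 - (K / r s) ^ 2)) volume 0 L := by
  refine intervalIntegrable_of_bounded (M := 1) hr.len_pos.le (fun s h0 h1 => ?_) fun s _ _ => ?_
  · exact (continuousAt_const.sub ((hr.continuousAt_ratio K h0 h1).pow 2)).sqrt
  · rw [abs_of_nonneg (Real.sqrt_nonneg _), Real.sqrt_le_one]
    linarith [sq_nonneg (K / r s)]

theorem continuous_act : Continuous (act r L) := by
  refine continuous_const.mul (intervalIntegral.continuous_of_dominated_interval
    (bound := fun _ => 1) (fun K => ?_) (fun K => ?_) intervalIntegrable_const ?_)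
  · exact aestronglyMeasurable_of_continuousAt hr.len_pos.le fun s h0 h1 =>
      (continuousAt_const.sub ((hr.continuousAt_ratio K h0 h1).pow 2)).sqrt
  · refine ae_of_all _ fun s _ => ?_
    rw [Real.norm_of_nonneg (Real.sqrt_nonneg _), Real.sqrt_le_one]
    linarith [sq_nonneg (K / r s)]
  · exact ae_of_all _ fun s _ => by fun_prop

omit hr in
-- Replacing `r` by `max r c'` in `rotDensity` keeps the root away from zero for `|K| < c'`. Nothing
-- is lost, because `w` vanishes where `r ≤ c'`.
theorem sqrt_pos_of_abs_lt {K c x : ℝ} (h : |K| < c) : 0 < √(1 - (K / max x c) ^ 2) := by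
  have h0 : 0 < c := (abs_nonneg K).trans_lt h
  have h1 : 0 < max x c := lt_max_of_lt_right h0
  refine Real.sqrt_pos.2 (sub_pos.2 ((sq_lt_one_iff_abs_lt_one _).2 ?_))
  rw [abs_div, abs_of_pos h1, div_lt_one h1]
  exact h.trans_le (le_max_right _ _)

section

variable {c' : ℝ} {w η : ℝ → ℝ} (hw : IsCutoff r L a b c' w η)

include hw

omit hr in
theorem continuousAt_deriv_cutoff {s : ℝ} (h0 : 0 ≤ s) (h1 : s ≤ L) :
    ContinuousAt (deriv η) s := by
  have := ((hw.contDiff s h0 h1).fderiv_right (m := 0) le_rfl).continuousAt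
  exact (this.clm_apply continuousAt_const : ContinuousAt (fun x => fderiv ℝ η x 1) s)

theorem continuousAt_max {s : ℝ} (h0 : 0 ≤ s) (h1 : s ≤ L) :
    ContinuousAt (fun s => max (r s) c') s ∧ max (r s) c' ≠ 0 :=
  ⟨(hr.continuousAt h0 h1).max continuousAt_const, (lt_max_of_lt_right hw.pos).ne'⟩

theorem continuousAt_rotDensity {K s : ℝ} (hK : |K| < c') (h0 : 0 < s) (h1 : s < L) :
    ContinuousAt (rotDensity r c' w η K) s := by
  obtain ⟨h2, h3⟩ := hr.continuousAt_max hw h0.le h1.le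
  refine ((hw.cont s h0.le h1.le).mul (ContinuousAt.div ?_ ?_ (sqrt_pos_of_abs_lt hK).ne')).sub
    (ContinuousAt.mul ?_ (continuousAt_deriv_cutoff hw h0.le h1.le))
  · exact continuousAt_const.div (h2.pow 2) (pow_ne_zero 2 h3)
  · exact (continuousAt_const.sub ((continuousAt_const.div h2 h3).pow 2)).sqrt
  · exact Real.continuous_arccos.continuousAt.comp (f := fun s => K / r s)
      (hr.continuousAt_ratio K h0 h1)

omit hr in
theorem abs_rotDensity_le {K d s : ℝ} (hK : |K| ≤ d) (hd : d < c') :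
    |rotDensity r c' w η K s| ≤ |w s| * (d / c' ^ 2 / √(1 - (d / c') ^ 2))
      + Real.pi * |deriv η s| := by
  have hc := hw.pos
  have hd0 := (abs_nonneg K).trans hK
  have h1 : 0 < 1 - (d / c') ^ 2 := by
    rw [sub_pos, sq_lt_one_iff₀ (by positivity), div_lt_one hc]; exact hd
  have h2 : c' ≤ max (r s) c' := le_max_right _ _
  refine (abs_sub _ _).trans (add_le_add ?_ ?_)
  · rw [abs_mul, abs_div, abs_div, abs_of_nonneg (Real.sqrt_nonneg _),
      abs_of_nonneg (sq_nonneg (max (r s) c')), ← sq_abs (K / max (r s) c'), abs_div K,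
      abs_of_pos (hc.trans_le h2)]
    gcongr
  · rw [abs_mul, abs_of_nonneg (Real.arccos_nonneg _)]
    gcongr
    exact Real.arccos_le_pi _

theorem intervalIntegrable_bound (x : ℝ) :
    IntervalIntegrable (fun s => |w s| * x + Real.pi * |deriv η s|) volume 0 L := by
  refine ContinuousOn.intervalIntegrable_of_Icc hr.len_pos.le fun s hs => ?_
  exact (((hw.cont s hs.1 hs.2).abs.mul continuousAt_const).add
    (continuousAt_const.mul (continuousAt_deriv_cutoff hw hs.1 hs.2).abs)).continuousWithinAt

theorem intervalIntegrable_rotDensity {K : ℝ} (hK : |K| < c') :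
    IntervalIntegrable (rotDensity r c' w η K) volume 0 L := by
  refine (hr.intervalIntegrable_bound hw (|K| / c' ^ 2 / √(1 - (|K| / c') ^ 2))).mono_fun'
    (aestronglyMeasurable_of_continuousAt hr.len_pos.le fun s h0 h1 =>
      hr.continuousAt_rotDensity hw hK h0 h1) (ae_of_all _ fun s => ?_)
  exact abs_rotDensity_le hw le_rfl hK

theorem continuousAt_integral_rotDensity {K : ℝ} (hK : |K| < c') :
    ContinuousAt (fun K => ∫ s in (0 : ℝ)..L, rotDensity r c' w η K s) K := by
  obtain ⟨d, hd0, hd1⟩ := exists_between hK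
  have hev : ∀ᶠ x in 𝓝 K, |x| < d := continuous_abs.continuousAt.eventually_lt_const hd0
  refine intervalIntegral.continuousAt_of_dominated_interval
    (bound := fun s => |w s| * (d / c' ^ 2 / √(1 - (d / c') ^ 2)) + Real.pi * |deriv η s|)
    ?_ ?_ (hr.intervalIntegrable_bound hw _) (ae_of_all _ fun s _ => ?_)
  · filter_upwards [hev] with x hx
    exact aestronglyMeasurable_of_continuousAt hr.len_pos.le fun s h0 h1 =>
      hr.continuousAt_rotDensity hw (hx.trans hd1) h0 h1
  · filter_upwards [hev] with x hx
    exact ae_of_all _ fun s _ => abs_rotDensity_le hw hx.le hd1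
  · unfold rotDensity
    have h : √(1 - (K / max (r s) c') ^ 2) ≠ 0 := (sqrt_pos_of_abs_lt hK).ne'
    fun_prop (disch := exact h)

/-- At `K = 0` the arccosine is `π / 2`, and what remains is the total change of `η`, which the
slopes of the profile at the poles determine. -/
theorem integral_rotDensity_zero :
    ∫ s in (0 : ℝ)..L, rotDensity r c' w η 0 s = Real.pi / 2 * (1 / a + 1 / b) := by
  have h (s : ℝ) : rotDensity r c' w η 0 s = -(Real.pi / 2) * deriv η s := by
    simp [rotDensity]
  simp_rw [h]
  rw [intervalIntegral.integral_const_mul, intervalIntegral.integral_eq_sub_of_hasDerivAt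
    (f := η) ?_ ?_, hw.zero, hw.len]
  · ring
  · intro s hs
    rw [Set.uIcc_of_le hr.len_pos.le] at hs
    exact ((hw.contDiff s hs.1 hs.2).differentiableAt one_ne_zero).hasDerivAt
  · exact ContinuousOn.intervalIntegrable_of_Icc hr.len_pos.le fun s hs =>
      (continuousAt_deriv_cutoff hw hs.1 hs.2).continuousWithinAt

/-- The integrand is split by `w + r' η = 1`. Since `r' √(1 - (K / r)²)` is the derivative of `r
arcPrim(K / r)`, integration by parts moves the derivative to `η`, and the boundary terms vanish
with `r`. The purpose is differentiation in `K`: the derivative of the root itself is singular at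
the turning points. -/
theorem act_eq {K : ℝ} (h0 : 0 < K) : act r L K = 2 * ∫ s in (0 : ℝ)..L,
    (w s * √(1 - (K / max (r s) c') ^ 2) - r s * arcPrim (K / r s) * deriv η s) := by
  have hL := hr.len_pos
  have hsub {g : ℝ → ℝ} (hg : ∀ s, 0 ≤ s → s ≤ L → ContinuousAt g s) :
      ContinuousOn g (Set.uIcc 0 L) := fun s hs => by
    rw [Set.uIcc_of_le hL.le] at hs
    exact (hg s hs.1 hs.2).continuousWithinAt
  have hη : ∀ s, 0 ≤ s → s ≤ L → ContinuousAt η s := fun s hs hs' =>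
    (hw.contDiff s hs hs').continuousAt
  have hGcont : ContinuousOn (fun s => r s * arcPrim (K / r s)) (Set.Icc 0 L) := by
    have hz {s : ℝ} (hs : s ∈ Set.Icc 0 L) (h : r s = 0) :
        ContinuousWithinAt (fun s => r s * arcPrim (K / r s)) (Set.Icc 0 L) s := by
      have h2 : Tendsto (fun x => r x * (1 + Real.pi)) (𝓝[Set.Icc 0 L] s) (𝓝 0) := by
        have := (hr.continuousOn s hs).mul_const (1 + Real.pi)
        rwa [ContinuousWithinAt, h, zero_mul] at this
      rw [ContinuousWithinAt, h, zero_mul]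
      refine squeeze_zero_norm' ?_ h2
      filter_upwards [self_mem_nhdsWithin] with x hx
      have h3 := hr.nonneg hx.1 hx.2
      rw [norm_mul, Real.norm_of_nonneg h3]
      exact mul_le_mul_of_nonneg_left (abs_arcPrim_le (div_nonneg h0.le h3)) h3
    intro s hs
    rcases hs.1.eq_or_lt with h | hs0
    · exact hz hs (h ▸ hr.zero)
    rcases hs.2.eq_or_lt with h | hs1
    · exact hz hs (h ▸ hr.len)
    exact ((hr.continuousAt hs.1 hs.2).mul ((hasDerivAt_arcPrim _).continuousAt.comp
      (f := fun s => K / r s) (hr.continuousAt_ratio K hs0 hs1))).continuousWithinAt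
  have hGη : IntervalIntegrable (fun s => r s * arcPrim (K / r s) * deriv η s) volume 0 L :=
    (hGcont.intervalIntegrable_of_Icc hL.le).mul_continuousOn
      (hsub fun s hs hs' => continuousAt_deriv_cutoff hw hs hs')
  have hF : IntervalIntegrable (fun s => deriv r s * √(1 - (K / r s) ^ 2) * η s) volume 0 L :=
    ((hr.intervalIntegrable_sqrt K).continuousOn_mul (hsub fun s hs hs' =>
      (hr.contDiffAt_deriv hs hs').continuousAt)).mul_continuousOn (hsub hη)
  have hw' : IntervalIntegrable (fun s => w s * √(1 - (K / max (r s) c') ^ 2)) volume 0 L :=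
    (hsub fun s hs hs' => (hw.cont s hs hs').mul (continuousAt_const.sub ((continuousAt_const.div
      (hr.continuousAt_max hw hs hs').1 (hr.continuousAt_max hw hs hs').2).pow 2)).sqrt
      ).intervalIntegrable
  have key := intervalIntegral.integral_eq_sub_of_hasDerivAt_of_le
    (f := fun s => r s * arcPrim (K / r s) * η s) (f' := fun s => deriv r s * √(1 - (K / r s) ^ 2)
      * η s + r s * arcPrim (K / r s) * deriv η s) hL.le
    (hGcont.mul fun s hs => (hη s hs.1 hs.2).continuousWithinAt) (fun s hs => ?_) (hF.add hGη)
  · rw [hr.len, hr.zero] at key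
    simp only [zero_mul, sub_zero] at key
    have e := intervalIntegral.integral_add (hw'.sub hGη) (hF.add hGη)
    rw [key, add_zero] at e
    rw [act, ← e]
    congr 1
    refine intervalIntegral.integral_congr fun s hs => ?_
    rw [Set.uIcc_of_le hL.le] at hs
    have e1 := hw.add s hs.1 hs.2
    have e2 : w s * √(1 - (K / max (r s) c') ^ 2) = w s * √(1 - (K / r s) ^ 2) := by
      by_cases h : w s = 0
      · simp [h]
      · rw [max_eq_left (hw.lt s hs.1 hs.2 h).le]
    rw [e2]
    linear_combination -√(1 - (K / r s) ^ 2) * e1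
  · have hp := hr.pos s hs.1 hs.2
    have d1 := hr.hasDerivAt hs.1.le hs.2.le
    have d2 := ((hasDerivAt_const s K).fun_div d1 hp.ne')
    have d3 := (hasDerivAt_arcPrim (K / r s)).comp s d2
    have d4 := ((hw.contDiff s hs.1.le hs.2.le).differentiableAt one_ne_zero).hasDerivAt
    convert! (d1.fun_mul d3).fun_mul d4 using 1
    simp only [Function.comp]
    rw [arcPrim_eq (div_pos h0 hp).le]
    field_simp
    ring

/-- Differentiation under the integral in the form of `act_eq`, with the bound of
`abs_rotDensity_le` for all parameters up to some `d < c'`. -/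
theorem hasDerivAt_act {K : ℝ} (h0 : 0 < K) (h1 : K < c') :
    HasDerivAt (act r L) (-(2 * ∫ s in (0 : ℝ)..L, rotDensity r c' w η K s)) K := by
  obtain ⟨d, hd0, hd1⟩ := exists_between h1
  have hL := hr.len_pos
  have habs {x : ℝ} (hx : x ∈ Set.Ioo 0 d) : |x| ≤ d := (abs_of_pos hx.1).trans_le hx.2.le
  have hF (x : ℝ) (s : ℝ) (hs0 : 0 < s) (hs1 : s < L) : ContinuousAt (fun s =>
      w s * √(1 - (x / max (r s) c') ^ 2) - r s * arcPrim (x / r s) * deriv η s) s := by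
    obtain ⟨h2, h3⟩ := hr.continuousAt_max hw hs0.le hs1.le
    refine ((hw.cont s hs0.le hs1.le).mul (continuousAt_const.sub
      ((continuousAt_const.div h2 h3).pow 2)).sqrt).sub (((hr.continuousAt hs0.le hs1.le).mul
      ((hasDerivAt_arcPrim _).continuousAt.comp (f := fun s => x / r s)
        (hr.continuousAt_ratio x hs0 hs1))).mul (continuousAt_deriv_cutoff hw hs0.le hs1.le))
  have key := (intervalIntegral.hasDerivAt_integral_of_dominated_loc_of_deriv_le (μ := volume)
    (s := Set.Ioo 0 d) (x₀ := K) (a := 0) (b := L)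
    (bound := fun s => |w s| * (d / c' ^ 2 / √(1 - (d / c') ^ 2)) + Real.pi * |deriv η s|)
    (F := fun K s => w s * √(1 - (K / max (r s) c') ^ 2) - r s * arcPrim (K / r s) * deriv η s)
    (F' := fun K s => -rotDensity r c' w η K s) (Ioo_mem_nhds h0 hd0)
    (Eventually.of_forall fun x => aestronglyMeasurable_of_continuousAt hL.le (hF x)) ?_
    (aestronglyMeasurable_of_continuousAt hL.le fun s hs0 hs1 =>
      (hr.continuousAt_rotDensity hw ((abs_of_pos h0).trans_lt h1) hs0 hs1).neg)
    (ae_of_all _ fun s _ x hx => ?_) (hr.intervalIntegrable_bound hw _)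
    (ae_of_forall_Ioo hL.le fun s hs0 hs1 x hx => ?_)).2.const_mul 2
  · rw [intervalIntegral.integral_neg, mul_neg] at key
    refine key.congr_of_eventuallyEq ?_
    filter_upwards [lt_mem_nhds h0] with x hx
    exact hr.act_eq hw hx
  · obtain ⟨C, hC⟩ := isCompact_Icc.exists_bound_of_continuousOn
      (f := fun s => |w s| + r s * (1 + Real.pi) * |deriv η s|) (s := Set.Icc 0 L) (fun s hs =>
      ((hw.cont s hs.1 hs.2).abs.add (((hr.continuousAt hs.1 hs.2).mul continuousAt_const).mul
        (continuousAt_deriv_cutoff hw hs.1 hs.2).abs)).continuousWithinAt)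
    refine intervalIntegrable_of_bounded (M := C) hL.le (hF K) fun s hs0 hs1 => ?_
    have hp := hr.pos s hs0 hs1
    refine le_trans ?_ ((le_abs_self _).trans (hC s ⟨hs0.le, hs1.le⟩))
    refine (abs_sub _ _).trans (add_le_add ?_ ?_)
    · rw [abs_mul, abs_of_nonneg (Real.sqrt_nonneg _)]
      refine mul_le_of_le_one_right (abs_nonneg _) (Real.sqrt_le_one.2 ?_)
      linarith [sq_nonneg (K / max (r s) c')]
    · rw [abs_mul, abs_mul, abs_of_pos hp]
      gcongr
      exact abs_arcPrim_le (div_pos h0 hp).le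
  · rw [norm_neg]
    exact abs_rotDensity_le hw (habs hx) hd1
  · have hp := hr.pos s hs0 hs1
    have hx' : |x| < c' := (habs hx).trans_lt hd1
    have h2 := (hr.continuousAt_max hw hs0.le hs1.le).2
    have h3 := sqrt_pos_of_abs_lt (x := r s) hx'
    have d1 := (((hasDerivAt_id x).div_const (max (r s) c')).fun_pow 2).const_sub 1
    have d2 := (d1.sqrt (Real.sqrt_pos.1 h3).ne').const_mul (w s)
    have d3 := (((hasDerivAt_arcPrim (x / r s)).comp x
      ((hasDerivAt_id x).div_const (r s))).const_mul (r s)).mul_const (deriv η s)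
    convert! d2.fun_sub d3 using 1
    simp only [rotDensity, id, Nat.add_one_sub_one, pow_one]
    revert h2 h3
    generalize max (r s) c' = M
    intro h2 h3
    revert h3
    generalize √(1 - (x / M) ^ 2) = q
    intro h3
    have := h3.ne'
    field_simp
    ring

end

end IsProfile

end Spindle

/-! ### The integral of the action, and integrals along half a period. -/

namespace Spindle

open MeasureTheory

namespace IsProfile

variable {r : ℝ → ℝ} {L a b : ℝ} (hr : IsProfile r L a b)

theorem act_nonneg (hL : 0 ≤ L) (K : ℝ) : 0 ≤ act r L K :=
  mul_nonneg two_pos.le (intervalIntegral.integral_nonneg hL fun _ _ => Real.sqrt_nonneg _)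

theorem act_zero : act r L 0 = 2 * L := by simp [act]

include hr

theorem act_pos {K s : ℝ} (hK : 0 ≤ K) (h0 : 0 < s) (h1 : s < L) (h : K < r s) :
    0 < act r L K := by
  have hp : 0 < ∫ x in (s / 2)..((s + L) / 2), √(1 - (K / r x) ^ 2) := by
    refine intervalIntegral.integral_pos (by linarith) (fun x hx => ?_)
      (fun _ _ => Real.sqrt_nonneg _) ⟨s, ⟨by linarith, by linarith⟩, Real.sqrt_pos.2 ?_⟩
    · exact (continuousAt_const.sub ((hr.continuousAt_ratio K (by linarith [hx.1])
        (by linarith [hx.2])).pow 2)).sqrt.continuousWithinAt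
    · rw [sub_pos, sq_lt_one_iff₀ (div_nonneg hK (hK.trans h.le)), div_lt_one (hK.trans_lt h)]
      exact h
  refine mul_pos two_pos (hp.trans_le ?_)
  exact intervalIntegral.integral_mono_interval (by linarith) (by linarith) (by linarith)
    (ae_of_all _ fun _ => Real.sqrt_nonneg _) (hr.intervalIntegrable_sqrt K)

theorem sqrt_eq_zero {K s : ℝ} (h0 : 0 < s) (h1 : s < L) (h : r s ≤ K) :
    √(1 - (K / r s) ^ 2) = 0 := by
  have := (one_le_div (hr.pos s h0 h1)).2 h
  exact Real.sqrt_eq_zero_of_nonpos (by nlinarith)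

theorem act_eq_zero {K : ℝ} (hK : ∀ s, 0 < s → s < L → r s ≤ K) : act r L K = 0 := by
  rw [act, intervalIntegral.integral_zero_ae (ae_of_forall_Ioo hr.len_pos.le fun s h0 h1 =>
    hr.sqrt_eq_zero h0 h1 (hK s h0 h1)), mul_zero]

omit hr in
-- The area of a quarter of the unit disc, scaled by `x`; beyond `K = x` the root is zero.
theorem integral_sqrt_one_sub_sq_ratio {x R : ℝ} (h0 : 0 < x) (h1 : x ≤ R) :
    ∫ K in (0 : ℝ)..R, √(1 - (K / x) ^ 2) = Real.pi / 4 * x := by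
  have hi (a b : ℝ) : IntervalIntegrable (fun y : ℝ => √(1 - y ^ 2)) volume a b :=
    Continuous.intervalIntegrable (by fun_prop) _ _
  rw [intervalIntegral.integral_comp_div (fun y => √(1 - y ^ 2)) h0.ne', zero_div,
    ← intervalIntegral.integral_add_adjacent_intervals (hi 0 1) (hi 1 _)]
  have e1 := intervalIntegral.integral_add_adjacent_intervals (hi (-1) 0) (hi 0 1)
  have e2 := intervalIntegral.integral_comp_neg (a := 0) (b := 1) (fun y : ℝ => √(1 - y ^ 2))
  simp only [neg_sq, neg_zero] at e2
  rw [← e2, integral_sqrt_one_sub_sq] at e1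
  have e3 : ∫ y in (1 : ℝ)..(R / x), √(1 - y ^ 2) = 0 := by
    refine intervalIntegral.integral_zero_ae (ae_of_all _ fun y hy => ?_)
    rw [Set.uIoc_of_le ((one_le_div h0).2 h1)] at hy
    exact Real.sqrt_eq_zero_of_nonpos (by nlinarith [hy.1])
  rw [e3, smul_eq_mul]
  linear_combination x / 2 * e1

/-- Fubini, with the quarter disc as inner integral. Together with `area_eq` this expresses the area
by the action. -/
theorem integral_act {R : ℝ} (hR : ∀ s, 0 < s → s < L → r s ≤ R) :
    ∫ K in (0 : ℝ)..R, act r L K = Real.pi / 2 * ∫ s in (0 : ℝ)..L, r s := by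
  have hL := hr.len_pos
  have hR0 : 0 ≤ R := (hr.pos (L / 2) (by linarith) (by linarith)).le.trans
    (hR _ (by linarith) (by linarith))
  -- A continuous extension of `r` to the line, for joint measurability.
  set f : ℝ → ℝ := Set.IccExtend hL.le (Set.domRestrict (Set.Icc 0 L) r) with hf
  have hfc : Continuous f := (hr.continuousOn.domRestrict).Icc_extend'
  have hfr {s : ℝ} (hs : s ∈ Set.Icc 0 L) : f s = r s := by
    rw [hf, Set.IccExtend_of_mem _ _ hs]; rfl
  have e1 (K : ℝ) : act r L K = 2 * ∫ s in (0 : ℝ)..L, √(1 - (K / f s) ^ 2) := by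
    rw [act]
    congr 1
    refine intervalIntegral.integral_congr fun s hs => ?_
    rw [Set.uIcc_of_le hL.le] at hs
    rw [hfr hs]
  simp_rw [e1]
  rw [intervalIntegral.integral_const_mul, intervalIntegral_intervalIntegral_swap]
  · rw [← intervalIntegral.integral_const_mul, ← intervalIntegral.integral_const_mul]
    refine intervalIntegral.integral_congr_ae (ae_of_forall_Ioo hL.le fun s h0 h1 => ?_)
    rw [hfr ⟨h0.le, h1.le⟩, integral_sqrt_one_sub_sq_ratio (hr.pos s h0 h1) (hR s h0 h1)]
    ring
  · refine ⟨Measurable.aestronglyMeasurable ?_, HasFiniteIntegral.restrict_of_bounded 1 ?_ ?_⟩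
    · have := hfc.measurable
      unfold Function.uncurry
      fun_prop
    · rw [Measure.volume_eq_prod, Measure.prod_prod, Set.uIoc_of_le hR0, Set.uIoc_of_le hL.le]
      simpa using ENNReal.mul_lt_top ENNReal.ofReal_lt_top ENNReal.ofReal_lt_top
    · refine ae_of_all _ fun x => ?_
      rw [Function.uncurry, Real.norm_of_nonneg (Real.sqrt_nonneg _), Real.sqrt_le_one]
      linarith [sq_nonneg (x.1 / f x.2)]

end IsProfile

namespace RegSol

variable {r : ℝ → ℝ} {L K : ℝ} {s p ψ : ℝ → ℝ} (h : RegSol r L K s p ψ)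

include h

theorem sq_eq (t : ℝ) : 1 - (K / r (s t)) ^ 2 = p t ^ 2 := by
  linarith [(h t).energy]

end RegSol

namespace IsProfile

variable {r : ℝ → ℝ} {L a b c A B σ : ℝ} (hr : IsProfile r L a b) (hc : CritData r L c A B σ)
  {K t₀ t₁ : ℝ} {s p ψ : ℝ → ℝ}

include hr

theorem eq_of_turning (h : RegSol r L K s p ψ) (hK : 0 < K) {t : ℝ} (ht : p t = 0) :
    r (s t) = K := by
  have h1 := h.sq_eq t
  have h2 := hr.pos _ (h t).pos (h t).lt
  rw [ht] at h1
  have h3 : K / r (s t) = 1 := by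
    rw [← sq_eq_sq₀ (by positivity) one_pos.le]; linarith
  rw [div_eq_one_iff_eq h2.ne'] at h3
  exact h3.symm

include hc

/-- On a half period `s` increases from one point of level `K` to the other and can serve as the
variable of integration. The rest of `[0, L]` does not contribute, as `g` vanishes where `r < K`. -/
theorem integral_along (h : RegSol r L K s p ψ) (hK : 0 < K) (hKc : K < c) (ht : t₀ < t₁)
    (h0 : p t₀ = 0) (h1 : p t₁ = 0) (hp : ∀ t ∈ Set.Ioo t₀ t₁, 0 < p t) {g H : ℝ → ℝ}
    (hg : ∀ x, 0 < x → x < L → ContinuousAt g x) (hgi : IntervalIntegrable g volume 0 L)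
    (hg0 : ∀ x, 0 < x → x < L → r x < K → g x = 0)
    (hH : ∀ t ∈ Set.Icc t₀ t₁, HasDerivAt H (g (s t) * p t) t) :
    H t₁ - H t₀ = ∫ x in (0 : ℝ)..L, g x := by
  obtain ⟨u, v, hu0, huA, hBv, hvL, hu, hv, hlt1, hgt, hlt2⟩ := hr.exists_levels hc hK hKc
  have hsc : Continuous s := continuous_iff_continuousAt.2 fun t => (h t).hs.continuousAt
  have hpc : Continuous p := continuous_iff_continuousAt.2 fun t => (h t).hp.continuousAt
  have huv {x : ℝ} (hx0 : 0 < x) (hxL : x < L) (hx : r x = K) : x = u ∨ x = v := by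
    rcases lt_trichotomy x u with h2 | h2 | h2
    · linarith [hlt1 x hx0.le h2]
    · exact Or.inl h2
    rcases lt_trichotomy x v with h3 | h3 | h3
    · linarith [hgt x h2 h3]
    · exact Or.inr h3
    · linarith [hlt2 x h3 hxL.le]
  have hlt : s t₀ < s t₁ := strictMonoOn_of_deriv_pos (convex_Icc t₀ t₁) hsc.continuousOn
    (fun t ht => by rw [interior_Icc] at ht; rw [(h t).hs.deriv]; exact hp t ht)
    (Set.left_mem_Icc.2 ht.le) (Set.right_mem_Icc.2 ht.le) ht
  have hAB := hc.A_le.trans hc.le_B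
  obtain ⟨e0, e1⟩ : s t₀ = u ∧ s t₁ = v := by
    rcases huv (h t₀).pos (h t₀).lt (hr.eq_of_turning h hK h0) with h2 | h2 <;>
      rcases huv (h t₁).pos (h t₁).lt (hr.eq_of_turning h hK h1) with h3 | h3 <;>
      first | exact ⟨h2, h3⟩ | linarith
  have hg' : ContinuousOn g (Set.Icc u v) := fun x hx =>
    (hg x (hu0.trans_le hx.1) (hx.2.trans_lt hvL)).continuousWithinAt
  have hgs : Continuous fun t => g (s t) := continuous_iff_continuousAt.2 fun t =>
    (hg _ (h t).pos (h t).lt).comp (h t).hs.continuousAt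
  have key := intervalIntegral.integral_eq_sub_of_hasDerivAt (a := t₀) (b := t₁) (f := H)
    (by rwa [Set.uIcc_of_le ht.le]) (hgs.mul hpc).continuousOn.intervalIntegrable
  rw [← key]
  have key2 := intervalIntegral.integral_comp_mul_deriv'' (a := t₀) (b := t₁) (f := s) (f' := p)
    (g := g) hsc.continuousOn (fun t _ => (h t).hs.hasDerivWithinAt) hpc.continuousOn (by
      rintro _ ⟨t, -, rfl⟩
      exact (hg _ (h t).pos (h t).lt).continuousWithinAt)
  refine key2.trans ?_
  rw [e0, e1]
  have hi {x y : ℝ} (h0x : 0 ≤ x) (hxy : x ≤ y) (hy : y ≤ L) : IntervalIntegrable g volume x y := by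
    refine hgi.mono_set ?_
    rw [Set.uIcc_of_le hxy, Set.uIcc_of_le hr.len_pos.le]
    exact Set.Icc_subset_Icc h0x hy
  have huv' : u ≤ v := by linarith
  rw [← intervalIntegral.integral_add_adjacent_intervals (hi le_rfl hu0.le (huv'.trans hvL.le))
    (hi hu0.le (huv'.trans hvL.le) le_rfl), ← intervalIntegral.integral_add_adjacent_intervals
    (hi hu0.le huv' hvL.le) (hi (hu0.le.trans huv') hvL.le le_rfl),
    intervalIntegral.integral_zero_ae (ae_of_forall_Ioo hu0.le fun x h2 h3 =>
      hg0 x h2 (by linarith) (hlt1 x h2.le h3)),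
    intervalIntegral.integral_zero_ae (a := v) (ae_of_forall_Ioo hvL.le fun x h2 h3 =>
      hg0 x (by linarith) h3 (hlt2 x h2 h3.le)), zero_add, add_zero]

omit hr hc in
theorem nonneg_of_mem_Icc (h0 : p t₀ = 0) (h1 : p t₁ = 0) (hp : ∀ t ∈ Set.Ioo t₀ t₁, 0 < p t)
    {t : ℝ} (ht : t ∈ Set.Icc t₀ t₁) : 0 ≤ p t := by
  rcases ht.1.eq_or_lt with rfl | h2
  · exact h0.ge
  rcases ht.2.eq_or_lt with rfl | h3
  · exact h1.ge
  exact (hp t ⟨h2, h3⟩).le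

/-- From `1 - K ψ' = 1 - (K / r)² = p²` and `p = √(1 - (K / r)²)`, the function `t - K ψ` is a
primitive along the geodesic of the integrand of the action. -/
theorem half_period_eq (h : RegSol r L K s p ψ) (hK : 0 < K) (hKc : K < c) (ht : t₀ < t₁)
    (h0 : p t₀ = 0) (h1 : p t₁ = 0) (hp : ∀ t ∈ Set.Ioo t₀ t₁, 0 < p t) :
    2 * (t₁ - t₀) = act r L K + K * (2 * (ψ t₁ - ψ t₀)) := by
  have := hr.integral_along hc h hK hKc ht h0 h1 hp (g := fun x => √(1 - (K / r x) ^ 2))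
    (H := fun t => t - K * ψ t)
    (fun x hx hx' => (continuousAt_const.sub ((hr.continuousAt_ratio K hx hx').pow 2)).sqrt)
    (hr.intervalIntegrable_sqrt K) (fun x hx hx' hxK => hr.sqrt_eq_zero hx hx' hxK.le)
    (fun t ht => by
      rw [h.sq_eq, Real.sqrt_sq (nonneg_of_mem_Icc h0 h1 hp ht), ← pow_two, ← h.sq_eq]
      convert! (hasDerivAt_id t).fun_sub ((h t).hψ.const_mul K) using 1
      ring)
  rw [act, ← this]
  ring

/-- The angle corrected by `arcsin p · η(s)` is a primitive of `rotDensity` along the geodesic, as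
`arccos (K / r) = arcsin p`. The correction vanishes at turning points. -/
theorem half_angle_eq {c' : ℝ} {w η : ℝ → ℝ} (hw : IsCutoff r L a b c' w η)
    (h : RegSol r L K s p ψ) (hK : 0 < K) (hKc' : K < c') (hKc : K < c) (ht : t₀ < t₁)
    (h0 : p t₀ = 0) (h1 : p t₁ = 0) (hp : ∀ t ∈ Set.Ioo t₀ t₁, 0 < p t) :
    ψ t₁ - ψ t₀ = ∫ x in (0 : ℝ)..L, rotDensity r c' w η K x := by
  have hK' : |K| < c' := (abs_of_pos hK).trans_lt hKc'
  have := hr.integral_along hc h hK hKc ht h0 h1 hp (g := rotDensity r c' w η K)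
    (H := fun t => ψ t - Real.arcsin (p t) * η (s t))
    (fun x hx hx' => hr.continuousAt_rotDensity hw hK' hx hx')
    (hr.intervalIntegrable_rotDensity hw hK') (fun x hx hx' hxK => ?_) (fun t ht => ?_)
  · rw [← this, h0, h1]; simp
  · rw [rotDensity, Real.arccos_of_one_le ((one_le_div (hr.pos x hx hx')).2 hxK.le)]
    have : w x = 0 := by
      by_contra hne
      linarith [hw.lt x hx.le hx'.le hne]
    rw [this]; ring
  · have hp0 := nonneg_of_mem_Icc h0 h1 hp ht
    have hrp := hr.pos _ (h t).pos (h t).lt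
    have hy : 0 < K / r (s t) := div_pos hK hrp
    have hsq := h.sq_eq t
    have hpl : p t < 1 := by nlinarith
    have d1 := (Real.hasDerivAt_arcsin (x := p t) (by linarith) hpl.ne).comp t (h t).hp
    have d2 := (((hw.contDiff _ (h t).pos.le (h t).lt.le).differentiableAt
      one_ne_zero).hasDerivAt).comp t (h t).hs
    convert! (h t).hψ.fun_sub (d1.fun_mul d2) using 1
    have e1 : √(1 - p t ^ 2) = K / r (s t) := by
      rw [← hsq, sub_sub_cancel, Real.sqrt_sq hy.le]
    have e2 : Real.arccos (K / r (s t)) = Real.arcsin (p t) := by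
      rw [Real.arccos_eq_arcsin hy.le, hsq, Real.sqrt_sq hp0]
    have e3 := hw.add _ (h t).pos.le (h t).lt.le
    simp only [rotDensity, Function.comp]
    rw [e1, e2]
    -- Where `w = 0` the term with the root drops out; where `w ≠ 0` one has `r > c' > K`, so `p ≠
    -- 0` can be cancelled.
    by_cases hne : w (s t) = 0
    · rw [hne, zero_add] at e3
      rw [hne, zero_mul]
      field_simp
      linear_combination K * e3
    · have e4 := hw.lt _ (h t).pos.le (h t).lt.le hne
      have hp1 : p t ≠ 0 := by
        intro h2
        linarith [hr.eq_of_turning h hK h2]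
      rw [max_eq_left e4.le, hsq, Real.sqrt_sq hp0]
      field_simp
      linear_combination K * e3

end IsProfile

end Spindle

/-! ### Turning points, rotation and minimal period. -/

namespace Spindle

open MeasureTheory

/-- The rotation of a geodesic with Clairaut constant `K` during one period. -/
noncomputable def rotation (r : ℝ → ℝ) (L W K : ℝ) : ℝ := if K = 0 then W else -deriv (act r L) K

/-- By the mean value theorem the derivative takes the values `f (t + 1) - f t`, which tend to `0`,
at times tending to infinity. -/
theorem tendsto_deriv_unique {f f' : ℝ → ℝ} {l d : ℝ} (hf : ∀ t, HasDerivAt f (f' t) t)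
    (h : Tendsto f atTop (𝓝 l)) (h' : Tendsto f' atTop (𝓝 d)) : d = 0 := by
  have hm (t : ℝ) : ∃ x ∈ Set.Ioo t (t + 1), f' x = (f (t + 1) - f t) / (t + 1 - t) :=
    exists_hasDerivAt_eq_slope f f' (by linarith)
      (fun x _ => (hf x).continuousAt.continuousWithinAt) fun x _ => hf x
  choose x hx hx' using hm
  have h1 : Tendsto x atTop atTop := tendsto_atTop_mono (fun t => (hx t).1.le) tendsto_id
  have h2 : Tendsto (fun t => f (t + 1) - f t) atTop (𝓝 (l - l)) :=
    (h.comp (tendsto_atTop_add_const_right _ 1 tendsto_id)).sub h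
  have h3 := h'.comp h1
  rw [sub_self] at h2
  refine tendsto_nhds_unique h3 (h2.congr fun t => ?_)
  simp [hx']

theorem exists_tendsto_of_deriv_nonneg {f f' : ℝ → ℝ} {M T : ℝ} (hf : ∀ t, HasDerivAt f (f' t) t)
    (h0 : ∀ t, T < t → 0 ≤ f' t) (hM : ∀ t, f t ≤ M) : ∃ l, Tendsto f atTop (𝓝 l) := by
  have hmono : MonotoneOn f (Set.Ici T) := monotoneOn_of_deriv_nonneg (convex_Ici T)
    (fun t _ => (hf t).continuousAt.continuousWithinAt)
    (fun t _ => (hf t).differentiableAt.differentiableWithinAt) fun t ht => by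
      rw [interior_Ici] at ht
      rw [(hf t).deriv]
      exact h0 t ht
  have hm : Monotone fun t => f (max t T) := fun x y hxy =>
    hmono (le_max_right x T) (le_max_right y T) (max_le_max_right T hxy)
  refine ⟨_, (tendsto_atTop_ciSup hm ⟨M, by rintro _ ⟨t, rfl⟩; exact hM _⟩).congr' ?_⟩
  filter_upwards [eventually_ge_atTop T] with t ht
  rw [max_eq_left ht]

theorem add_natCast_mul {s ψ : ℝ → ℝ} {T Δ : ℝ} (hT : ∀ t, s (t + T) = s t ∧ ψ (t + T) = ψ t + Δ) (q : ℕ)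
    (t : ℝ) : s (t + q * T) = s t ∧ ψ (t + q * T) = ψ t + q * Δ := by
  induction q with
  | zero => simp
  | succ q ih =>
    have := hT (t + q * T)
    rw [show t + ((q + 1 : ℕ) : ℝ) * T = t + q * T + T by push_cast; ring, this.1, this.2, ih.1, ih.2]
    refine ⟨rfl, ?_⟩
    push_cast
    ring

namespace RegSol

variable {r : ℝ → ℝ} {L K : ℝ} {s p ψ : ℝ → ℝ} (h : RegSol r L K s p ψ)

include h

theorem continuous_snd : Continuous p :=
  continuous_iff_continuousAt.2 fun t => (h t).hp.continuousAt

theorem neg : RegSol r L (-K) s p (fun t => -ψ t) := fun t =>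
  { pos := (h t).pos
    lt := (h t).lt
    hs := (h t).hs
    hp := by rw [neg_sq]; exact (h t).hp
    hψ := by rw [neg_div]; exact (h t).hψ.fun_neg
    energy := by rw [neg_div, neg_sq]; exact (h t).energy }

theorem reverse (t₀ : ℝ) : RegSol r L K (fun t => s (2 * t₀ - t)) (fun t => -p (2 * t₀ - t))
    (fun t => -ψ (2 * t₀ - t)) := fun t =>
  { pos := (h _).pos
    lt := (h _).lt
    hs := by simpa using (h (2 * t₀ - t)).hs.comp_const_sub (2 * t₀) t
    hp := by simpa using ((h (2 * t₀ - t)).hp.comp_const_sub (2 * t₀) t).fun_neg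
    hψ := by simpa using ((h (2 * t₀ - t)).hψ.comp_const_sub (2 * t₀) t).fun_neg
    energy := by rw [neg_sq]; exact (h _).energy }

theorem snd_periodic {ℓ : ℝ} (hs : ∀ t, s (t + ℓ) = s t) (t : ℝ) : p (t + ℓ) = p t := by
  have h1 := (h (t + ℓ)).hs.comp_add_const t ℓ
  simp_rw [hs] at h1
  exact h1.unique (h t).hs

theorem angle_strictMono (hr : ∀ t, 0 < r (s t)) (hK : 0 < K) : StrictMono ψ :=
  strictMono_of_deriv_pos fun t => by
    rw [(h t).hψ.deriv]
    exact div_pos hK (pow_pos (hr t) 2)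

end RegSol

namespace IsProfile

variable {r : ℝ → ℝ} {L a b c A B σ : ℝ} (hr : IsProfile r L a b) (hc : CritData r L c A B σ)
  {K t₀ t₁ : ℝ} {s p ψ : ℝ → ℝ}

include hr

/-- Time reversal about a turning point gives a solution with the same `s` and `p` at that time, so
uniqueness applies. -/
theorem symm_of_turning (h : RegSol r L K s p ψ) (h0 : p t₀ = 0) (t : ℝ) :
    s (2 * t₀ - t) = s t ∧ p (2 * t₀ - t) = -p t ∧ ψ (2 * t₀ - t) = 2 * ψ t₀ - ψ t := by
  obtain ⟨e1, e2⟩ := hr.eq_of_regSol (h.reverse t₀) h (t := t₀) (by ring_nf) (by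
    rw [show 2 * t₀ - t₀ = t₀ by ring, h0, neg_zero])
  have h1 := h.reverse t₀
  rw [e1, e2] at h1
  have h2 := angle_sub_const h1 h t t₀
  have h3 := congrFun e1 t
  have h4 := congrFun e2 t
  beta_reduce at h2 h3 h4
  rw [show 2 * t₀ - t₀ = t₀ by ring] at h2
  exact ⟨h3, by linarith, by linarith⟩

/-- Two reflections compose to a translation. -/
theorem add_of_turning (h : RegSol r L K s p ψ) (h0 : p t₀ = 0) (h1 : p t₁ = 0) (t : ℝ) :
    s (t + 2 * (t₁ - t₀)) = s t ∧ ψ (t + 2 * (t₁ - t₀)) = ψ t + 2 * (ψ t₁ - ψ t₀) := by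
  obtain ⟨e1, -, e3⟩ := hr.symm_of_turning h h0 t
  obtain ⟨f1, -, f3⟩ := hr.symm_of_turning h h1 (2 * t₀ - t)
  rw [show t + 2 * (t₁ - t₀) = 2 * t₁ - (2 * t₀ - t) by ring, f1, f3, e1, e3]
  exact ⟨rfl, by ring⟩

include hc

theorem exists_isCutoff {c' : ℝ} (h0 : 0 < c') (h1 : c' < c) : ∃ w η, IsCutoff r L a b c' w η := by
  obtain ⟨w, η, h2, h3, h4⟩ := hr.exists_cutoff hc h0 h1
  exact ⟨w, η, h0, fun s hs hs' => (h2 s hs hs').1, fun s hs hs' => (h2 s hs hs').2.1,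
    fun s hs hs' => (h2 s hs hs').2.2.1, fun s hs hs' => (h2 s hs hs').2.2.2, h3, h4⟩

omit hc in
theorem rot_eq_integral {c' : ℝ} {w η : ℝ → ℝ} (hw : IsCutoff r L a b c' w η) (h0 : 0 ≤ K)
    (h1 : K < c') : rotation r L (Real.pi * (1 / a + 1 / b)) K
      = 2 * ∫ s in (0 : ℝ)..L, rotDensity r c' w η K s := by
  rcases h0.eq_or_lt with rfl | h0
  · rw [rotation, if_pos rfl, hr.integral_rotDensity_zero hw]
    ring
  · rw [rotation, if_neg h0.ne', (hr.hasDerivAt_act hw h0 h1).deriv, neg_neg]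

/-- For `c'` between `K` and `c` the rotation is, near `K`, an integral that depends continuously on
the parameter even at `0`, where its value is the one prescribed in `rotation`. -/
theorem continuousOn_rot : ContinuousOn (rotation r L (Real.pi * (1 / a + 1 / b))) (Set.Ico 0 c) := by
  intro K hK
  obtain ⟨c', h1, h2⟩ := exists_between hK.2
  obtain ⟨w, η, hw⟩ := hr.exists_isCutoff hc (hK.1.trans_lt h1) h2
  have h3 : ContinuousWithinAt (fun K => 2 * ∫ s in (0 : ℝ)..L, rotDensity r c' w η K s)
      (Set.Ico 0 c) K := (continuousAt_const.mul (hr.continuousAt_integral_rotDensity hw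
    ((abs_of_nonneg hK.1).trans_lt h1))).continuousWithinAt
  refine h3.congr_of_eventuallyEq ?_ (hr.rot_eq_integral hw hK.1 h1)
  filter_upwards [self_mem_nhdsWithin, mem_nhdsWithin_of_mem_nhds (gt_mem_nhds h1)] with x hx hx'
  exact hr.rot_eq_integral hw hx.1 hx'

theorem hasDerivAt_act_rot (h0 : 0 < K) (h1 : K < c) :
    HasDerivAt (act r L) (-rotation r L (Real.pi * (1 / a + 1 / b)) K) K := by
  obtain ⟨c', h2, h3⟩ := exists_between h1
  obtain ⟨w, η, hw⟩ := hr.exists_isCutoff hc (h0.trans h2) h3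
  rw [hr.rot_eq_integral hw h0.le h2]
  exact hr.hasDerivAt_act hw h0 h2

/-- Otherwise `s` is eventually monotone and converges to some `l`. Then `p → 0`, so `r l = K`, and
the limit `r'(l) / K` of `p'` must be `0` as well, although `r` has no critical points below the
level `c`. -/
theorem exists_turning (h : RegSol r L K s p ψ) (h0 : 0 < K) (h1 : K < c) (T : ℝ) :
    ∃ t, T < t ∧ p t = 0 := by
  by_contra! hne
  have hp {t : ℝ} : 0 < r (s t) := hr.pos _ (h t).pos (h t).lt
  have hK {t : ℝ} : K ≤ r (s t) := by
    have h3 : (K / r (s t)) ^ 2 ≤ 1 := by nlinarith [(h t).energy, sq_nonneg (p t)]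
    rwa [sq_le_one_iff₀ (div_pos h0 hp).le, div_le_one hp] at h3
  have hsign : (∀ t, T < t → 0 < p t) ∨ (∀ t, T < t → p t < 0) := by
    have := (isPreconnected_Ioi (a := T)).image p h.continuous_snd.continuousOn
    by_contra! hcon
    obtain ⟨⟨x, hx, hx'⟩, y, hy, hy'⟩ := hcon
    obtain ⟨z, hz, hz'⟩ := this.ordConnected.out ⟨x, hx, rfl⟩ ⟨y, hy, rfl⟩ ⟨hx', hy'⟩
    exact hne z hz hz'
  obtain ⟨l, hl⟩ : ∃ l, Tendsto s atTop (𝓝 l) := by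
    rcases hsign with hs | hs
    · exact exists_tendsto_of_deriv_nonneg (fun t => (h t).hs) (fun t ht => (hs t ht).le)
        fun t => (h t).lt.le
    · obtain ⟨l, hl⟩ := exists_tendsto_of_deriv_nonneg (f := fun t => -s t)
        (fun t => (h t).hs.fun_neg) (fun t ht => (neg_pos.2 (hs t ht)).le) (M := 0)
        fun t => by linarith [(h t).pos]
      exact ⟨-l, by simpa using hl.neg⟩
  have hl0 : 0 ≤ l := ge_of_tendsto' hl fun t => (h t).pos.le
  have hlL : l ≤ L := le_of_tendsto' hl fun t => (h t).lt.le
  have hrl : Tendsto (fun t => r (s t)) atTop (𝓝 (r l)) := (hr.continuousAt hl0 hlL).tendsto.comp hl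
  have hKl : K ≤ r l := ge_of_tendsto' hrl fun t => hK
  have hrl0 : r l ≠ 0 := (h0.trans_le hKl).ne'
  have hsq : Tendsto (fun t => √(1 - (K / r (s t)) ^ 2)) atTop (𝓝 √(1 - (K / r l) ^ 2)) :=
    ((tendsto_const_nhds.sub ((tendsto_const_nhds.div hrl hrl0).pow 2))).sqrt
  have habs : ∀ t, √(1 - (K / r (s t)) ^ 2) = |p t| := fun t => by rw [h.sq_eq, Real.sqrt_sq_eq_abs]
  simp_rw [habs] at hsq
  have hq : √(1 - (K / r l) ^ 2) = 0 := by
    rcases hsign with hs | hs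
    · refine tendsto_deriv_unique (fun t => (h t).hs) hl (hsq.congr' ?_)
      filter_upwards [eventually_gt_atTop T] with t ht
      exact abs_of_pos (hs t ht)
    · refine tendsto_deriv_unique (fun t => (h t).hs.fun_neg) hl.neg (hsq.congr' ?_)
      filter_upwards [eventually_gt_atTop T] with t ht
      exact abs_of_neg (hs t ht)
  rw [hq] at hsq
  have hp0 : Tendsto p atTop (𝓝 0) := (tendsto_zero_iff_abs_tendsto_zero p).2 hsq
  have hrK : r l = K := by
    refine le_antisymm ?_ hKl
    rw [Real.sqrt_eq_zero', sub_nonpos, one_le_sq_iff₀ (div_nonneg h0.le (h0.le.trans hKl)),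
      one_le_div (h0.trans_le hKl)] at hq
    exact hq
  have hdl := tendsto_deriv_unique (fun t => (h t).hp) hp0 (((tendsto_const_nhds (x := K ^ 2)).mul
    ((hr.contDiffAt_deriv hl0 hlL).continuousAt.tendsto.comp hl)).div (hrl.pow 3)
    (pow_ne_zero 3 hrl0))
  have := hc.deriv_ne_zero hl0 hlL (hrK.trans_lt h1)
  have := h0.ne'
  simp_all

/-- Between two consecutive turning points, the geodesic moves away from the first pole. -/
theorem exists_half_period (h : RegSol r L K s p ψ) (h0 : 0 < K) (h1 : K < c) : ∃ t₀ t₁, t₀ < t₁ ∧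
    p t₀ = 0 ∧ p t₁ = 0 ∧ ∀ t ∈ Set.Ioo t₀ t₁, 0 < p t := by
  obtain ⟨x, -, hx⟩ := hr.exists_turning hc h h0 h1 0
  -- At a turning point `r = K < c`, so `r' ≠ 0` and `p' ≠ 0`. The turning point is thus isolated,
  -- and there is a next one, called `y` below.
  have hd : deriv p x ≠ 0 := by
    have e := hr.eq_of_turning h h0 hx
    rw [(h x).hp.deriv, e]
    have := hc.deriv_ne_zero (h x).pos.le (h x).lt.le (e.trans_lt h1)
    positivity
  have hiso : ∀ᶠ t in 𝓝[>] x, p t ≠ 0 := by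
    have := (h x).hp.eventually_ne (c := 0) (by rwa [← (h x).hp.deriv])
    exact this.filter_mono (nhdsWithin_mono _ fun t ht => (ne_of_gt ht))
  obtain ⟨d, hd0, hd1⟩ := (mem_nhdsGT_iff_exists_Ioo_subset).1 hiso
  have hZc : IsClosed {t | d ≤ t ∧ p t = 0} :=
    (isClosed_le continuous_const continuous_id).inter (isClosed_eq h.continuous_snd continuous_const)
  have hZn : {t | d ≤ t ∧ p t = 0}.Nonempty := by
    obtain ⟨y, hy, hy'⟩ := hr.exists_turning hc h h0 h1 d
    exact ⟨y, hy.le, hy'⟩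
  have hZb : BddBelow {t | d ≤ t ∧ p t = 0} := ⟨d, fun t ht => ht.1⟩
  obtain ⟨hy1, hy2⟩ := hZc.csInf_mem hZn hZb
  set y := sInf {t | d ≤ t ∧ p t = 0} with hy
  have hd0' : x < d := hd0
  have hne : ∀ t ∈ Set.Ioo x y, p t ≠ 0 := fun t ht h3 => by
    rcases lt_or_ge t d with h4 | h4
    · exact hd1 ⟨ht.1, h4⟩ h3
    · exact absurd (csInf_le hZb ⟨h4, h3⟩) (not_le.2 ht.2)
  have hsign : (∀ t ∈ Set.Ioo x y, 0 < p t) ∨ (∀ t ∈ Set.Ioo x y, p t < 0) := by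
    have := (isPreconnected_Ioo (a := x) (b := y)).image p h.continuous_snd.continuousOn
    by_contra! hcon
    obtain ⟨⟨x, hx, hx'⟩, y, hy, hy'⟩ := hcon
    obtain ⟨z, hz, hz'⟩ := this.ordConnected.out ⟨x, hx, rfl⟩ ⟨y, hy, rfl⟩ ⟨hx', hy'⟩
    exact hne z hz hz'
  rcases hsign with hs | hs
  · exact ⟨x, y, by linarith, hx, hy2, hs⟩
  -- If `s` decreases in between, the reflection at `y` provides an increasing half period.
  · refine ⟨y, 2 * y - x, by linarith, hy2, ?_, fun t ht => ?_⟩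
    · rw [(hr.symm_of_turning h hy2 x).2.1, hx, neg_zero]
    · have := (hr.symm_of_turning h hy2 t).2.1
      linarith [hs (2 * y - t) ⟨by linarith [ht.2], by linarith [ht.1]⟩]

/-- A geodesic with Clairaut constant `K` has minimal period `act K + K * rot K`. -/
theorem period_data (h : RegSol r L K s p ψ) (h0 : 0 < K) (h1 : K < c) {W T : ℝ}
    (hW : W = Real.pi * (1 / a + 1 / b)) (hT : T = act r L K + K * rotation r L W K) :
    0 < T ∧ (∀ t, s (t + T) = s t ∧ ψ (t + T) = ψ t + rotation r L W K) ∧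
      ∀ ℓ > 0, (∀ t, s (t + ℓ) = s t) → ∃ q : ℕ, 0 < q ∧ ℓ = q * T := by
  obtain ⟨t₀, t₁, hlt, e0, e1, hp⟩ := hr.exists_half_period hc h h0 h1
  obtain ⟨c', h2, h3⟩ := exists_between h1
  obtain ⟨w, η, hw⟩ := hr.exists_isCutoff hc (h0.trans h2) h3
  have hrot : 2 * (ψ t₁ - ψ t₀) = rotation r L W K := by
    rw [hW, hr.rot_eq_integral hw h0.le h2, hr.half_angle_eq hc hw h h0 h2 h1 hlt e0 e1 hp]
  have hT' : T = 2 * (t₁ - t₀) := by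
    rw [hT, hr.half_period_eq hc h h0 h1 hlt e0 e1 hp, hrot]
  have hT0 : 0 < T := by linarith
  have hper (t : ℝ) : s (t + T) = s t ∧ ψ (t + T) = ψ t + rotation r L W K := by
    rw [hT', ← hrot]
    exact hr.add_of_turning h e0 e1 t
  refine ⟨hT0, hper, fun ℓ hℓ hs => ?_⟩
  have hq0 : 0 ≤ ℓ / T := (div_pos hℓ hT0).le
  -- Multiples of `T` are removed. A remaining period shorter than `T` would put a turning point
  -- inside a half period, or give `s t₀ = s t₁`.
  set q := ⌊ℓ / T⌋₊ with hq
  have hq1 : q * T ≤ ℓ := (le_div_iff₀ hT0).1 (Nat.floor_le hq0)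
  have hq2 : ℓ < (q + 1) * T := (div_lt_iff₀ hT0).1 (Nat.lt_floor_add_one _)
  have hρ (t : ℝ) : s (t + (ℓ - q * T)) = s t := by
    rw [← (add_natCast_mul hper q _).1, add_assoc, sub_add_cancel, hs]
  have hρp := h.snd_periodic hρ t₀
  rw [e0] at hρp
  have hzero : ℓ - q * T = 0 := by
    by_contra hne
    have hpos : 0 < ℓ - q * T := lt_of_le_of_ne (by linarith) (Ne.symm hne)
    rcases lt_trichotomy (t₀ + (ℓ - q * T)) t₁ with h4 | h4 | h4
    · exact (hp _ ⟨by linarith, h4⟩).ne' hρp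
    · have := hρ t₀
      rw [h4] at this
      have hm := strictMonoOn_of_deriv_pos (convex_Icc t₀ t₁) (f := s)
        (fun t _ => (h t).hs.continuousAt.continuousWithinAt)
        (fun t ht => by rw [interior_Icc] at ht; rw [(h t).hs.deriv]; exact hp t ht)
        (Set.left_mem_Icc.2 hlt.le) (Set.right_mem_Icc.2 hlt.le) hlt
      linarith
    · have h5 := (hr.symm_of_turning h e1 (t₀ + (ℓ - q * T))).2.1
      rw [hρp, neg_zero] at h5
      exact (hp _ ⟨by linarith, by linarith⟩).ne' h5
  refine ⟨q, ?_, by linarith⟩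
  rcases Nat.eq_zero_or_pos q with h4 | h4
  · rw [h4] at hzero
    simp at hzero
    linarith
  · exact h4

end IsProfile

end Spindle

/-! ### Lengths of closed geodesics of a profile, and rigidity for constant period. -/

namespace Spindle

open MeasureTheory

namespace IsProfile

variable {r : ℝ → ℝ} {L a b c A B σ : ℝ} (hr : IsProfile r L a b) (hc : CritData r L c A B σ)
  {K W ℓ : ℝ} {s p ψ : ℝ → ℝ}

include hr

theorem le_of_regSol (h : RegSol r L K s p ψ) (h0 : 0 < K) (t : ℝ) : K ≤ r (s t) := by
  have hp := hr.pos _ (h t).pos (h t).lt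
  have h3 : (K / r (s t)) ^ 2 ≤ 1 := by nlinarith [(h t).energy, sq_nonneg (p t)]
  rwa [sq_le_one_iff₀ (div_pos h0 hp).le, div_le_one hp] at h3

theorem angle_pos : 0 < Real.pi * (1 / a + 1 / b) := by
  have := hr.a_pos
  have := hr.b_pos
  positivity

include hc

omit hr in
theorem crit_mem : 0 < σ ∧ σ < L :=
  ⟨hc.A_pos.trans_le hc.A_le, hc.le_B.trans_lt hc.B_lt⟩

omit hr in
theorem regSol_const (h0 : 0 < σ) (h1 : σ < L) :
    RegSol r L c (fun _ => σ) (fun _ => 0) (fun t => t / c) := fun t =>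
  { pos := h0
    lt := h1
    hs := hasDerivAt_const _ _
    hp := by simpa [hc.crit] using hasDerivAt_const t (0 : ℝ)
    hψ := by
      convert! (hasDerivAt_id t).div_const c using 1
      have := hc.c_pos.ne'
      rw [hc.val]
      field_simp
    energy := by rw [hc.val, div_self hc.c_pos.ne']; norm_num }

theorem exists_regSol_lt (h0 : 0 < K) (h1 : K < c) :
    ∃ s p ψ, RegSol r L K s p ψ ∧ s 0 = σ ∧ 0 < p 0 := by
  have h2 : 0 < 1 - (K / c) ^ 2 := by
    rw [sub_pos, sq_lt_one_iff₀ (div_pos h0 hc.c_pos).le, div_lt_one hc.c_pos]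
    exact h1
  obtain ⟨h3, h4⟩ := crit_mem hc
  obtain ⟨s, p, ψ, h, e1, e2, -⟩ := hr.exists_regSol (K := K) (p₀ := √(1 - (K / c) ^ 2)) h0.ne' h3 h4
    (by rw [Real.sq_sqrt h2.le, hc.val]; ring) 0
  exact ⟨s, p, ψ, h, e1, e2 ▸ Real.sqrt_pos.2 h2⟩

/-- For `K < c` the period data apply. For `K ≥ c` one has `ψ' = K / r² ≤ 1 / c` because `r ≥ K`, so
a rotation by at least `2 W` takes at least the time `2 W c`. -/
theorem le_or_exists_period (h : RegSol r L K s p ψ) (h0 : 0 < K)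
    (hW : W = Real.pi * (1 / a + 1 / b)) (hℓ : 0 < ℓ) (hs : ∀ t, s (t + ℓ) = s t) {k : ℤ}
    (hk : ψ (0 + ℓ) = ψ 0 + 2 * W * k) : 2 * W * c ≤ ℓ ∨ ∃ (q k : ℕ) (K : ℝ), 0 < q ∧ 0 < k ∧
      0 < K ∧ K < c ∧ q * rotation r L W K = 2 * W * k ∧ ℓ = q * (act r L K + K * rotation r L W K) := by
  have hW0 : 0 < W := hW ▸ hr.angle_pos
  have hmono := h.angle_strictMono (fun t => hr.pos _ (h t).pos (h t).lt) h0
  have hk0 : 0 < k := by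
    have h1 := hmono (show (0 : ℝ) < 0 + ℓ by linarith)
    rw [hk] at h1
    by_contra! hneg
    have : (k : ℝ) ≤ 0 := by exact_mod_cast hneg
    nlinarith
  rcases lt_or_ge K c with h1 | h1
  · right
    obtain ⟨-, hT, hq⟩ := hr.period_data hc h h0 h1 hW rfl
    obtain ⟨q, hq0, hq1⟩ := hq ℓ hℓ hs
    obtain ⟨j, rfl⟩ := Int.eq_ofNat_of_zero_le hk0.le
    refine ⟨q, j, K, hq0, by exact_mod_cast hk0, h0, h1, ?_, hq1⟩
    have := (add_natCast_mul hT q 0).2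
    rw [← hq1, hk] at this
    push_cast at this
    linarith
  · left
    have hk1 : (1 : ℝ) ≤ k := by exact_mod_cast hk0
    have hlip : ψ (0 + ℓ) - ψ 0 ≤ 1 / c * (0 + ℓ - 0) := by
      refine (convex_Icc 0 (0 + ℓ)).image_sub_le_mul_sub_of_deriv_le
        (fun t _ => (h t).hψ.continuousAt.continuousWithinAt)
        (fun t _ => (h t).hψ.differentiableAt.differentiableWithinAt) (fun t _ => ?_) 0
        ⟨le_rfl, by linarith⟩ (0 + ℓ) ⟨by linarith, le_rfl⟩ (by linarith)
      have h2 := hr.le_of_regSol h h0 t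
      have h3 := hc.c_pos
      rw [(h t).hψ.deriv, div_le_div_iff₀ (by nlinarith [hr.pos _ (h t).pos (h t).lt]) h3]
      nlinarith
    rw [hk, zero_add, sub_zero, one_div_mul_eq_div, le_div_iff₀ hc.c_pos] at hlip
    have h3 := mul_pos hW0 hc.c_pos
    nlinarith

/-- For `K < c` two periods rotate by `2 W = 2π N`. Otherwise `c ≤ K ≤ r ≤ c` along the geodesic,
which then is a parallel of length `2π c`. -/
theorem closed_of_rot_eq (hW : W = Real.pi * (1 / a + 1 / b))
    (hmax : ∀ x, 0 < x → x < L → r x ≤ c) (hrot : ∀ K, 0 < K → K < c → rotation r L W K = W) {N : ℕ}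
    (hN : W = Real.pi * N) (h : RegSol r L K s p ψ) (h0 : 0 < K) :
    ∃ ℓ > 0, ∀ t, s (t + ℓ) = s t ∧ ∃ k : ℤ, ψ (t + ℓ) = ψ t + 2 * Real.pi * k := by
  rcases lt_or_ge K c with h1 | h1
  · obtain ⟨hT0, hT, -⟩ := hr.period_data hc h h0 h1 hW rfl
    refine ⟨(2 : ℕ) * (act r L K + K * rotation r L W K), by positivity, fun t => ?_⟩
    obtain ⟨e1, e2⟩ := add_natCast_mul hT 2 t
    refine ⟨e1, N, ?_⟩
    rw [e2, hrot K h0 h1, hN]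
    push_cast
    ring
  · have hrc (t : ℝ) : r (s t) = c ∧ K = c := by
      have h2 := hr.le_of_regSol h h0 t
      have h3 := hmax _ (h t).pos (h t).lt
      constructor <;> linarith
    have hKc := (hrc 0).2
    have hc0 := hc.c_pos.ne'
    have hp (t : ℝ) : p t = 0 := by
      have := (h t).energy
      rw [(hrc t).1, hKc, div_self hc0] at this
      exact pow_eq_zero_iff two_ne_zero |>.1 (by linarith)
    have hsc (x y : ℝ) : s x = s y := is_const_of_deriv_eq_zero (fun t => (h t).hs.differentiableAt)
      (fun t => by rw [(h t).hs.deriv, hp]) x y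
    have hψc (x y : ℝ) : ψ x - x / c = ψ y - y / c := by
      have hd (t : ℝ) : HasDerivAt (fun t => ψ t - t / c) 0 t := by
        convert! (h t).hψ.fun_sub ((hasDerivAt_id t).div_const c) using 1
        rw [(hrc t).1, hKc]
        field_simp
        ring
      exact is_const_of_deriv_eq_zero (fun t => (hd t).differentiableAt) (fun t => (hd t).deriv) x y
    refine ⟨2 * Real.pi * c, by have := hc.c_pos; positivity, fun t => ⟨hsc _ _, 1, ?_⟩⟩
    have := hψc (t + 2 * Real.pi * c) t
    rw [add_div, mul_div_cancel_right₀ _ hc0] at this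
    push_cast
    linarith

/-- If all geodesics have the same period, then the geodesics near the smallest critical parallel
pass quickly to the other side of the critical region, which therefore is trivial. -/
theorem le_of_period_eq (hW : W = Real.pi * (1 / a + 1 / b))
    (hT : ∀ K, 0 < K → K < c → act r L K + K * rotation r L W K = 2 * L) : B ≤ σ := by
  obtain ⟨hσ0, hσL⟩ := crit_mem hc
  have hc0 := hc.c_pos
  have hL := hr.len_pos
  -- A quadratic bound at the critical point `σ`, as `r'` is Lipschitz and vanishes there.
  obtain ⟨M, hM⟩ : ∃ M : ℝ, ∀ x, σ ≤ x → x < L → r x - c ≤ M * (x - σ) ^ 2 := by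
    have hlip : ContDiffOn ℝ 1 (deriv r) (Set.Icc 0 L) := fun x hx =>
      (hr.contDiffAt_deriv hx.1 hx.2).contDiffWithinAt
    obtain ⟨M, hM⟩ := hlip.exists_lipschitzOnWith one_ne_zero (convex_Icc 0 L) isCompact_Icc
    refine ⟨M, fun x hx hxL => ?_⟩
    have := (convex_Icc σ x).image_sub_le_mul_sub_of_deriv_le (f := r) (C := M * (x - σ))
      (fun y hy => (hr.continuousAt (hσ0.le.trans hy.1) (hy.2.trans hxL.le)).continuousWithinAt)
      (fun y hy => by
        rw [interior_Icc] at hy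
        exact (hr.hasDerivAt (hσ0.le.trans hy.1.le)
          (hy.2.le.trans hxL.le)).differentiableAt.differentiableWithinAt)
      (fun y hy => by
        rw [interior_Icc] at hy
        have h1 := hM.dist_le_mul y ⟨hσ0.le.trans hy.1.le, hy.2.le.trans hxL.le⟩ σ ⟨hσ0.le, hσL.le⟩
        rw [Real.dist_eq, Real.dist_eq, hc.crit, sub_zero, abs_of_pos (sub_pos.2 hy.1)] at h1
        refine (le_abs_self _).trans (h1.trans ?_)
        have := hy.2
        gcongr)
      σ ⟨le_rfl, hx⟩ x ⟨hx, le_rfl⟩ hx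
    rw [hc.val] at this
    linarith
  -- Chosen such that `p ≤ C (√(c - K) + (s - σ))` for the geodesics below; `4 / c` bounds `(r + K)
  -- / r²` when `r ≥ K > c / 2`.
  obtain ⟨C, hC1, hC2, hC3⟩ : ∃ C : ℝ, 0 ≤ C ∧ 4 / c ≤ C ^ 2 ∧ 4 / c * M ≤ C ^ 2 := by
    have h1 : 0 < 4 / c := by positivity
    refine ⟨1 + 4 / c + |4 / c * M|, by positivity, ?_, ?_⟩ <;>
      nlinarith [abs_nonneg (4 / c * M), le_abs_self (4 / c * M)]
  -- A geodesic starts at `σ` in the direction of `B`. Its first turning point, at a time `y ≤ 2 L`,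
  -- lies beyond `B`, but by a Gronwall estimate it only gets as far as `O(√(c - K))` in this time.
  have key (K : ℝ) (h1 : c / 2 < K) (h2 : K < c) : B - σ ≤ √(c - K) * Real.exp (C * (2 * L)) := by
    have h0 : 0 < K := by linarith
    obtain ⟨s, p, ψ, h, e1, e2⟩ := hr.exists_regSol_lt hc h0 h2
    have hpc := h.continuous_snd
    have hper := (hr.period_data hc h h0 h2 hW rfl).2.1
    rw [hT K h0 h2] at hper
    have hZc : IsClosed {t | 0 ≤ t ∧ p t = 0} :=
      (isClosed_le continuous_const continuous_id).inter (isClosed_eq hpc continuous_const)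
    have hZn : {t | 0 ≤ t ∧ p t = 0}.Nonempty := by
      obtain ⟨y, hy, hy'⟩ := hr.exists_turning hc h h0 h2 0
      exact ⟨y, hy.le, hy'⟩
    have hZb : BddBelow {t | 0 ≤ t ∧ p t = 0} := ⟨0, fun t ht => ht.1⟩
    obtain ⟨hy1, hy2⟩ := hZc.csInf_mem hZn hZb
    set y := sInf {t | 0 ≤ t ∧ p t = 0} with hy
    have hy0 : 0 < y := hy1.lt_of_ne (by rintro h3; rw [← h3] at hy2; exact e2.ne' hy2)
    have hpos : ∀ t, 0 ≤ t → t < y → 0 < p t := by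
      intro t ht hty
      by_contra! hneg
      obtain ⟨x, hx, hx'⟩ := intermediate_value_Icc' ht hpc.continuousOn ⟨hneg, e2.le⟩
      linarith [csInf_le hZb (show x ∈ {t | 0 ≤ t ∧ p t = 0} from ⟨hx.1, hx'⟩), hx.2]
    have hsm : StrictMonoOn s (Set.Icc 0 y) := strictMonoOn_of_deriv_pos (convex_Icc 0 y)
      (fun t _ => (h t).hs.continuousAt.continuousWithinAt)
      (fun t ht => by
        rw [interior_Icc] at ht; rw [(h t).hs.deriv]; exact hpos t ht.1.le ht.2)
    -- `s` increases strictly up to the time `y`, whereas `2 L` is a period.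
    have hy2L : y ≤ 2 * L := by
      by_contra! hlt
      have h3 := hsm ⟨le_rfl, hy1⟩ ⟨by linarith, hlt.le⟩ (show (0 : ℝ) < 2 * L by linarith)
      have := (hper 0).1
      rw [zero_add] at this
      linarith
    -- At the turning point `r = K < c`, which is impossible on `[A, B]`.
    have hsy : B < s y := by
      by_contra! hle
      have h3 := hsm ⟨le_rfl, hy1⟩ ⟨hy1, le_rfl⟩ hy0
      have h4 := hc.le (s y) (by linarith [hc.A_le]) hle
      linarith [hr.eq_of_turning h h0 hy2]
    have hanti : AntitoneOn (fun t => (√(c - K) + (s t - σ)) * Real.exp (-(C * t)))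
        (Set.Icc 0 y) := by
      have hd (t : ℝ) : HasDerivAt (fun t => (√(c - K) + (s t - σ)) * Real.exp (-(C * t)))
          (p t * Real.exp (-(C * t))
            + (√(c - K) + (s t - σ)) * (Real.exp (-(C * t)) * -(C * 1))) t :=
        (((h t).hs.sub_const σ).const_add _).fun_mul (((hasDerivAt_id t).const_mul C).fun_neg.exp)
      refine antitoneOn_of_deriv_nonpos (convex_Icc 0 y)
        (fun t _ => (hd t).continuousAt.continuousWithinAt)
        (fun t _ => (hd t).differentiableAt.differentiableWithinAt) fun t ht => ?_
      rw [interior_Icc] at ht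
      rw [(hd t).deriv]
      have hst : σ < s t := e1 ▸ hsm ⟨le_rfl, hy1⟩ ⟨ht.1.le, ht.2.le⟩ ht.1
      have hK := hr.le_of_regSol h h0 t
      have hrp := h0.trans_le hK
      have hMt := hM _ hst.le (h t).lt
      have hε : 0 ≤ c - K := by linarith
      have hsq := Real.sq_sqrt hε
      have hsq0 := Real.sqrt_nonneg (c - K)
      have hp2 : p t ^ 2 ≤ 4 / c * (r (s t) - K) := by
        have e : 4 / c * (r (s t) - K) - p t ^ 2
            = (r (s t) - K) * (4 / c - (r (s t) + K) / r (s t) ^ 2) := by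
          rw [← h.sq_eq t]; field_simp; ring
        have h5 : (r (s t) + K) / r (s t) ^ 2 ≤ 4 / c := by
          rw [div_le_div_iff₀ (by positivity) hc0]
          nlinarith
        nlinarith
      have hp3 : p t ≤ C * (√(c - K) + (s t - σ)) := by
        refine le_of_sq_le_sq ?_ (by have := hst.le; positivity)
        have h6 : 4 / c * (r (s t) - K) ≤ C ^ 2 * ((c - K) + (s t - σ) ^ 2) := by
          have h7 : 0 < 4 / c := by positivity
          nlinarith [sq_nonneg (s t - σ)]
        have h8 : 0 ≤ C ^ 2 * (√(c - K) * (s t - σ)) := by have := hst.le; positivity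
        nlinarith
      have := Real.exp_pos (-(C * t))
      nlinarith
    have h9 := hanti ⟨le_rfl, hy1⟩ ⟨hy1, le_rfl⟩ hy1
    simp only [e1, sub_self, add_zero, mul_zero, neg_zero, Real.exp_zero, mul_one] at h9
    rw [Real.exp_neg, ← div_eq_mul_inv, div_le_iff₀ (Real.exp_pos _)] at h9
    have h10 : Real.exp (C * y) ≤ Real.exp (C * (2 * L)) :=
      Real.exp_le_exp.2 (mul_le_mul_of_nonneg_left hy2L hC1)
    have h11 := mul_le_mul_of_nonneg_left h10 (Real.sqrt_nonneg (c - K))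
    linarith [Real.sqrt_nonneg (c - K)]
  have hlim : Tendsto (fun K => √(c - K) * Real.exp (C * (2 * L))) (𝓝[<] c) (𝓝 0) := by
    have : ContinuousAt (fun K => √(c - K) * Real.exp (C * (2 * L))) c := by fun_prop
    have := this.tendsto
    simp only [sub_self, Real.sqrt_zero, zero_mul] at this
    exact this.mono_left nhdsWithin_le_nhds
  have := ge_of_tendsto hlim (b := B - σ) (by
    filter_upwards [Ioo_mem_nhdsLT (show c / 2 < c by linarith)] with K hK
    exact key K hK.1 hK.2)
  linarith

omit hr hc in
theorem act_reflect : act (fun s => r (L - s)) L K = act r L K := by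
  simp only [act]
  rw [intervalIntegral.integral_comp_sub_left (fun x => √(1 - (K / r x) ^ 2)) L]
  simp

/-- `le_of_period_eq`, applied from both poles, collapses the critical region to `σ`, so the profile
increases up to `σ` and decreases afterwards. -/
theorem le_crit_of_period_eq (hW : W = Real.pi * (1 / a + 1 / b))
    (hT : ∀ K, 0 < K → K < c → act r L K + K * rotation r L W K = 2 * L) {x : ℝ} (h0 : 0 ≤ x)
    (h1 : x ≤ L) : r x ≤ c := by
  have hB := hr.le_of_period_eq hc hW hT
  have hact : act (fun s => r (L - s)) L = act r L := funext fun K => act_reflect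
  have hA := hr.reflect.le_of_period_eq hc.reflect (W := W) (by rw [hW]; ring) (fun K h2 h3 => by
    rw [rotation, hact]; exact hT K h2 h3)
  have eA : σ = A := le_antisymm (by linarith) hc.A_le
  have eB : B = σ := le_antisymm hB hc.le_B
  rw [← hc.val]
  rcases le_or_gt x σ with h2 | h2
  · exact (hr.strictMonoOn hc).monotoneOn ⟨h0, h2.trans eA.le⟩ ⟨(crit_mem hc).1.le, eA.le⟩ h2
  · have := (hr.reflect.strictMonoOn hc.reflect).monotoneOn (a := L - x) (b := L - σ)
      ⟨by linarith, by linarith⟩ ⟨by linarith, by linarith⟩ (by linarith)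
    simpa using this

end IsProfile

end Spindle

/-! ### Minimization and the systolic inequality for an abstract length spectrum. -/

namespace Spindle

open MeasureTheory

/-- The set `S` consists of `4 * L`, of `2 * W * c`, of larger numbers, and of the multiples
`q * (act K + K * rot K)` for which `q * rot K` is a multiple of `2 * W`. -/
structure IsSpectrum (S : Set ℝ) (act rot : ℝ → ℝ) (L c W : ℝ) : Prop where
  len_pos : 0 < L
  c_pos : 0 < c
  W_pos : 0 < W
  continuous_act : Continuous act
  act_zero : act 0 = 2 * L
  act_nonneg : ∀ K, 0 ≤ act K
  continuousOn_rot : ContinuousOn rot (Set.Ico 0 c)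
  rot_zero : rot 0 = W
  hasDerivAt_act : ∀ K, 0 < K → K < c → HasDerivAt act (-rot K) K
  four_mul_len_mem : 4 * L ∈ S
  two_mul_crit_mem : 2 * W * c ∈ S
  mem : ∀ (q k : ℕ) (K : ℝ), 0 < q → 0 < k → 0 < K → K < c → q * rot K = 2 * W * k →
    q * (act K + K * rot K) ∈ S
  le_or_exists : ∀ ℓ ∈ S, 4 * L ≤ ℓ ∨ 2 * W * c ≤ ℓ ∨ ∃ (q k : ℕ) (K : ℝ), 0 < q ∧ 0 < k ∧
    0 < K ∧ K < c ∧ q * rot K = 2 * W * k ∧ ℓ = q * (act K + K * rot K)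

namespace IsSpectrum

variable {S : Set ℝ} {act rot : ℝ → ℝ} {L c W ℓ : ℝ} (h : IsSpectrum S act rot L c W)

include h

/-- There is a shortest element of the spectrum. -/
theorem exists_isLeast (hpos : ∀ K, 0 ≤ K → K < c → 0 < act K) : ∃ ℓ, IsLeast S ℓ := by
  have hW := h.W_pos
  have hc := h.c_pos
  have hL := h.len_pos
  set m := min (4 * L) (2 * W * c) with hm
  have hmS : m ∈ S := by
    rcases min_choice (4 * L) (2 * W * c) with e | e <;> rw [hm, e]
    exacts [h.four_mul_len_mem, h.two_mul_crit_mem]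
  by_cases hex : ∃ ℓ ∈ S, ℓ < m
  swap
  · push Not at hex
    exact ⟨m, hmS, hex⟩
  obtain ⟨ℓ₀, hℓ₀, hlt⟩ := hex
  have h1 : ℓ₀ < 4 * L := hlt.trans_le (min_le_left _ _)
  have h2 : ℓ₀ < 2 * W * c := hlt.trans_le (min_le_right _ _)
  -- A length `q act K + 2 W k K` with `k ≥ 1` and at most `ℓ₀` has `K ≤ K'`, which stays away from
  -- `c`.
  set K' := ℓ₀ / (2 * W) with hK'
  have hK'c : K' < c := by rw [hK', div_lt_iff₀ (by positivity)]; linarith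
  set f : ℕ → ℕ → ℝ → ℝ := fun q k K => q * act K + 2 * W * k * K with hf
  have hrep {ℓ : ℝ} (hℓ : ℓ ∈ S) (hle : ℓ ≤ ℓ₀) : ∃ (q k : ℕ) (K : ℝ), 0 < q ∧ 0 < k ∧ 0 < K ∧
      K ≤ K' ∧ q * rot K = 2 * W * k ∧ ℓ = f q k K := by
    rcases h.le_or_exists ℓ hℓ with h3 | h3 | ⟨q, k, K, h3, h4, h5, h6, h7, h8⟩
    · linarith
    · linarith
    have e : ℓ = f q k K := by rw [h8, hf]; linear_combination K * h7
    refine ⟨q, k, K, h3, h4, h5, ?_, h7, e⟩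
    have hk : (1 : ℝ) ≤ k := by exact_mod_cast h4
    have := mul_nonneg (Nat.cast_nonneg (α := ℝ) q) (h.act_nonneg K)
    rw [hK', le_div_iff₀ (by positivity)]
    have : K * (2 * W) * 1 ≤ K * (2 * W) * k := by gcongr
    rw [hf] at e
    beta_reduce at e
    linarith
  obtain ⟨q₀, k₀, K₀, -, -, hK₀, hK₀', -⟩ := hrep hℓ₀ le_rfl
  have hK'0 : 0 < K' := hK₀.trans_le hK₀'
  have hrotc : ContinuousOn rot (Set.Icc 0 K') :=
    h.continuousOn_rot.mono fun x hx => ⟨hx.1, hx.2.trans_lt hK'c⟩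
  -- On `[0, K']` the action is bounded below by a positive number and the rotation is bounded, so
  -- lengths up to `ℓ₀` involve finitely many pairs `(q, k)` only.
  obtain ⟨d, hd0, hd⟩ : ∃ d, 0 < d ∧ ∀ K ∈ Set.Icc 0 K', d ≤ act K := by
    obtain ⟨x, hx, hx'⟩ := isCompact_Icc.exists_isMinOn (Set.nonempty_Icc.2 hK'0.le)
      h.continuous_act.continuousOn
    exact ⟨act x, hpos x hx.1 (hx.2.trans_lt hK'c), fun K hK => hx' hK⟩
  obtain ⟨M, hM⟩ := isCompact_Icc.exists_bound_of_continuousOn hrotc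
  obtain ⟨Q, hQ⟩ := exists_nat_gt (ℓ₀ / d)
  obtain ⟨N, hN⟩ := exists_nat_gt (Q * M / (2 * W))
  set Z : ℕ → ℕ → Set ℝ := fun q k => {K ∈ Set.Icc 0 K' | q * rot K = 2 * W * k} with hZ
  have hZc (q k : ℕ) : IsCompact (Z q k) :=
    isCompact_Icc.of_isClosed_subset ((continuousOn_const.mul hrotc).preimage_isClosed_of_isClosed
      isClosed_Icc isClosed_singleton) fun x hx => hx.1
  set U : Set ℝ := ⋃ q ∈ Finset.range Q, ⋃ k ∈ Finset.range N,
    ⋃ (_ : 0 < q ∧ 0 < k), f q k '' Z q k with hU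
  have hUc : IsCompact U := (Finset.range Q).isCompact_biUnion fun q _ =>
    (Finset.range N).isCompact_biUnion fun k _ => isCompact_iUnion fun _ =>
      (hZc q k).image ((continuous_const.mul h.continuous_act).add
        (continuous_const.mul continuous_id))
  have hSU {ℓ : ℝ} (hℓ : ℓ ∈ S) (hle : ℓ ≤ ℓ₀) : ℓ ∈ U := by
    obtain ⟨q, k, K, h3, h4, h5, h6, h7, rfl⟩ := hrep hℓ hle
    have hK : K ∈ Set.Icc 0 K' := ⟨h5.le, h6⟩
    have hqQ : q < Q := by
      by_contra! hge
      have hge' : (Q : ℝ) ≤ q := by exact_mod_cast hge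
      have e1 := hd K hK
      rw [div_lt_iff₀ hd0] at hQ
      have e2 : (Q : ℝ) * d ≤ q * act K := by gcongr
      have e3 : 0 ≤ 2 * W * k * K := by positivity
      rw [hf] at hle
      beta_reduce at hle
      linarith
    have hkN : k < N := by
      have e1 := hM K hK
      rw [Real.norm_eq_abs] at e1
      have hqQ' : (q : ℝ) ≤ Q := by exact_mod_cast hqQ.le
      have e2 : q * rot K ≤ Q * M :=
        (mul_le_mul_of_nonneg_left ((le_abs_self _).trans e1) (Nat.cast_nonneg q)).trans
          (mul_le_mul_of_nonneg_right hqQ' ((abs_nonneg _).trans e1))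
      rw [div_lt_iff₀ (by positivity)] at hN
      have e3 : (k : ℝ) < N := by nlinarith
      exact_mod_cast e3
    simp only [hU, Set.mem_iUnion, Finset.mem_range]
    exact ⟨q, hqQ, k, hkN, ⟨h3, h4⟩, K, ⟨hK, h7⟩, rfl⟩
  obtain ⟨x, hxU, hx⟩ := hUc.exists_isLeast ⟨ℓ₀, hSU hℓ₀ le_rfl⟩
  refine ⟨x, ?_, fun ℓ hℓ => ?_⟩
  · have hxle := hx (hSU hℓ₀ le_rfl)
    simp only [hU, Set.mem_iUnion, Finset.mem_range] at hxU
    obtain ⟨q, -, k, -, ⟨h3, h4⟩, K, ⟨hK, h7⟩, rfl⟩ := hxU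
    rcases hK.1.eq_or_lt with rfl | hK0
    -- The compact set may also contain points with `K = 0`. There `q = 2 k`, and the value is `4 k
    -- L ≥ 4 L > ℓ₀`, so this is not the minimum.
    · exfalso
      rw [h.rot_zero] at h7
      have e : (q : ℝ) = 2 * k := by
        have : (q : ℝ) * W = 2 * k * W := by linarith
        exact mul_right_cancel₀ hW.ne' this
      have hk : (1 : ℝ) ≤ k := by exact_mod_cast h4
      rw [hf] at hxle
      simp only [mul_zero, add_zero, h.act_zero, e] at hxle
      nlinarith
    · have := h.mem q k K h3 h4 hK0 (hK.2.trans_lt hK'c) h7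
      have e : f q k K = q * (act K + K * rot K) := by rw [hf]; linear_combination -K * h7
      rwa [e]
  · rcases le_or_gt ℓ ℓ₀ with h3 | h3
    · exact hx (hSU hℓ h3)
    · exact (hx (hSU hℓ₀ le_rfl)).trans h3.le

/-- The action of short geodesics is bounded below in terms of the smallest element. -/
theorem le_act (hℓ : IsLeast S ℓ) (h0 : 0 < ℓ) {K : ℝ} (hK0 : 0 ≤ K) (hK1 : K ≤ ℓ / (2 * W)) :
    ℓ / 2 - W * K ≤ act K := by
  have hW := h.W_pos
  have h1 : ℓ ≤ 4 * L := hℓ.2 h.four_mul_len_mem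
  have h2 : ℓ / (2 * W) ≤ c := by
    rw [div_le_iff₀ (by positivity)]; linarith [hℓ.2 h.two_mul_crit_mem]
  have hcont : Continuous fun K => act K - (ℓ / 2 - W * K) := by
    have := h.continuous_act
    fun_prop
  -- The difference is examined at its minimum. At the ends it is nonnegative by `ℓ ≤ 4 L` and by
  -- `act ≥ 0`.
  obtain ⟨x, hx, hmin⟩ := isCompact_Icc.exists_isMinOn
    (Set.nonempty_Icc.2 (show 0 ≤ ℓ / (2 * W) by positivity)) hcont.continuousOn
  have hge : 0 ≤ act x - (ℓ / 2 - W * x) := by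
    by_contra! hneg
    rcases hx.1.eq_or_lt with rfl | hx0
    · rw [h.act_zero] at hneg; linarith
    rcases hx.2.eq_or_lt with rfl | hx1
    · have e : W * (ℓ / (2 * W)) = ℓ / 2 := by field_simp
      rw [e] at hneg
      linarith [h.act_nonneg (ℓ / (2 * W))]
    have hd := (h.hasDerivAt_act x hx0 (hx1.trans_le h2)).fun_sub
      (((hasDerivAt_id x).const_mul W).const_sub (ℓ / 2))
    have hz := (hmin.isLocalMin (Icc_mem_nhds hx0 hx1)).hasDerivAt_eq_zero hd
    have hrot : rot x = W := by linarith
    -- At an interior minimum the rotation is `W`, so two periods rotate by `2 W`, and `2 (act x + x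
    -- W)` belongs to the spectrum.
    have hmem := h.mem 2 1 x two_pos one_pos hx0 (hx1.trans_le h2) (by rw [hrot]; push_cast; ring)
    have := hℓ.2 hmem
    rw [hrot] at this
    push_cast at this
    linarith
  have h3 : act x - (ℓ / 2 - W * x) ≤ act K - (ℓ / 2 - W * K) := hmin ⟨hK0, hK1⟩
  linarith

omit h in
theorem integral_linear (hW : 0 < W) :
    ∫ K in (0 : ℝ)..(ℓ / (2 * W)), (ℓ / 2 - W * K) = ℓ ^ 2 / (8 * W) := by
  rw [intervalIntegral.integral_sub (by simp) (Continuous.intervalIntegrable (by fun_prop) _ _),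
    intervalIntegral.integral_const, intervalIntegral.integral_const_mul, integral_id]
  simp only [smul_eq_mul]
  field_simp
  ring

/-- The graph of the action lies above a right triangle with legs `ℓ / 2` and `ℓ / (2 W)`, and the
action is nonnegative beyond it. -/
theorem sq_le_integral (hℓ : IsLeast S ℓ) (h0 : 0 < ℓ) {R : ℝ} (hcR : c ≤ R) :
    ℓ ^ 2 ≤ 8 * W * ∫ K in (0 : ℝ)..R, act K := by
  have hW := h.W_pos
  have h2 : ℓ / (2 * W) ≤ c := by
    rw [div_le_iff₀ (by positivity)]; linarith [hℓ.2 h.two_mul_crit_mem]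
  have hK : 0 ≤ ℓ / (2 * W) := by positivity
  have hi (x y : ℝ) : IntervalIntegrable act volume x y := h.continuous_act.intervalIntegrable x y
  have h3 : ∫ K in (0 : ℝ)..(ℓ / (2 * W)), (ℓ / 2 - W * K) ≤ ∫ K in (0 : ℝ)..(ℓ / (2 * W)), act K :=
    intervalIntegral.integral_mono_on hK (Continuous.intervalIntegrable (by fun_prop) _ _) (hi _ _)
      fun K hK => h.le_act hℓ h0 hK.1 hK.2
  have h4 : 0 ≤ ∫ K in (ℓ / (2 * W))..R, act K :=
    intervalIntegral.integral_nonneg (h2.trans hcR) fun K _ => h.act_nonneg K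
  rw [integral_linear hW] at h3
  rw [← intervalIntegral.integral_add_adjacent_intervals (hi 0 (ℓ / (2 * W))) (hi _ R)]
  rw [div_le_iff₀ (by positivity)] at h3
  nlinarith

omit h in
theorem eq_zero_of_integral_eq_zero {f : ℝ → ℝ} {a b : ℝ} (hf : Continuous f)
    (h0 : ∀ x ∈ Set.Icc a b, 0 ≤ f x) (hab : a < b) (hi : ∫ x in a..b, f x = 0) :
    ∀ x ∈ Set.Icc a b, f x = 0 := by
  by_contra! hne
  obtain ⟨x, hx, hx'⟩ := hne
  have := intervalIntegral.integral_pos hab hf.continuousOn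
    (fun y hy => h0 y ⟨hy.1.le, hy.2⟩) ⟨x, hx, (h0 x hx).lt_of_ne' hx'⟩
  linarith

/-- In the case of equality all geodesics have the same rotation. -/
theorem rot_eq_of_sq_eq (hℓ : IsLeast S ℓ) (h0 : 0 < ℓ) {R : ℝ} (hcR : c ≤ R)
    (hpos : ∀ K, 0 ≤ K → K < R → 0 < act K) (heq : ℓ ^ 2 = 8 * W * ∫ K in (0 : ℝ)..R, act K) :
    c = R ∧ ∀ K, 0 < K → K < c → rot K = W := by
  have hW := h.W_pos
  have h2 : ℓ / (2 * W) ≤ c := by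
    rw [div_le_iff₀ (by positivity)]; linarith [hℓ.2 h.two_mul_crit_mem]
  have hK : 0 < ℓ / (2 * W) := by positivity
  have hi (x y : ℝ) : IntervalIntegrable act volume x y := h.continuous_act.intervalIntegrable x y
  have hil (x y : ℝ) : IntervalIntegrable (fun K => ℓ / 2 - W * K) volume x y :=
    Continuous.intervalIntegrable (by fun_prop) _ _
  have h3 : 0 ≤ ∫ K in (0 : ℝ)..(ℓ / (2 * W)), (act K - (ℓ / 2 - W * K)) :=
    intervalIntegral.integral_nonneg hK.le fun K hK => by linarith [h.le_act hℓ h0 hK.1 hK.2]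
  have h4 : 0 ≤ ∫ K in (ℓ / (2 * W))..R, act K :=
    intervalIntegral.integral_nonneg (h2.trans hcR) fun K _ => h.act_nonneg K
  -- Two nonnegative contributions add up to zero, so both vanish.
  have h5 : (∫ K in (0 : ℝ)..(ℓ / (2 * W)), (act K - (ℓ / 2 - W * K)))
      + ∫ K in (ℓ / (2 * W))..R, act K = 0 := by
    rw [← intervalIntegral.integral_add_adjacent_intervals (hi 0 (ℓ / (2 * W))) (hi _ R)] at heq
    rw [intervalIntegral.integral_sub (hi _ _) (hil _ _), integral_linear hW, heq]
    field_simp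
    ring
  -- The action is positive below `R`, but would vanish on a nontrivial interval `[ℓ / (2 W), R]`.
  have h6 : ℓ / (2 * W) = R := by
    by_contra hne
    have hlt := (h2.trans hcR).lt_of_ne hne
    have := eq_zero_of_integral_eq_zero h.continuous_act (fun x _ => h.act_nonneg x) hlt
      (by linarith) _ ⟨le_rfl, hlt.le⟩
    linarith [hpos _ hK.le hlt]
  have hcR' : c = R := le_antisymm hcR (h6 ▸ h2)
  refine ⟨hcR', fun K hK0 hKc => ?_⟩
  have h7 := eq_zero_of_integral_eq_zero (f := fun K => act K - (ℓ / 2 - W * K))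
    (by have := h.continuous_act; fun_prop) (fun x hx => by linarith [h.le_act hℓ h0 hx.1 hx.2])
    hK (by linarith)
  rw [h6, ← hcR'] at h7
  have hd := (h.hasDerivAt_act K hK0 hKc).fun_sub
    (((hasDerivAt_id K).const_mul W).const_sub (ℓ / 2))
  have hd0 : HasDerivAt (fun K => act K - (ℓ / 2 - W * id K)) 0 K := by
    refine (hasDerivAt_const K (0 : ℝ)).congr_of_eventuallyEq ?_
    filter_upwards [Icc_mem_nhds hK0 hKc] with x hx
    exact h7 x hx
  have := hd.unique hd0
  linarith

/-- A rational rotation is constant. -/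
theorem rot_eq_of_rational
    (hrat : ∀ K, 0 < K → K < c → ∃ (q : ℕ) (k : ℤ), 0 < q ∧ q * rot K = 2 * Real.pi * k) {N : ℕ}
    (hN : W = Real.pi * N) {K : ℝ} (h0 : 0 ≤ K) (h1 : K < c) : rot K = W := by
  have hpi := Real.pi_pos
  have hq {x : ℝ} (hx0 : 0 ≤ x) (hx1 : x < c) : rot x / (2 * Real.pi) ∈ Set.range ((↑) : ℚ → ℝ) := by
    rcases hx0.eq_or_lt with rfl | hx0
    · refine ⟨N / 2, ?_⟩
      rw [h.rot_zero, hN]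
      push_cast
      field_simp
    · obtain ⟨q, k, hq, e⟩ := hrat x hx0 hx1
      refine ⟨k / q, ?_⟩
      have : (q : ℝ) ≠ 0 := by exact_mod_cast hq.ne'
      push_cast
      field_simp
      linarith
  have hpre : IsPreconnected ((fun x => rot x / (2 * Real.pi)) '' Set.Ico 0 c) :=
    isPreconnected_Ico.image _ (h.continuousOn_rot.div_const _)
  -- A connected set of rational numbers has at most one element.
  have hsub : ((fun x => rot x / (2 * Real.pi)) '' Set.Ico 0 c).Subsingleton := by
    by_contra hne
    rw [Set.not_subsingleton_iff] at hne
    obtain ⟨x, hx, y, hy, hxy⟩ := hne.exists_lt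
    obtain ⟨z, hz, hxz, hzy⟩ := exists_irrational_btwn hxy
    obtain ⟨t, ht, rfl⟩ := hpre.ordConnected.out hx hy ⟨hxz.le, hzy.le⟩
    exact hz (hq ht.1 ht.2)
  have := hsub ⟨K, ⟨h0, h1⟩, rfl⟩ ⟨0, ⟨le_rfl, h.c_pos⟩, rfl⟩
  beta_reduce at this
  rw [h.rot_zero, div_left_inj' (by positivity)] at this
  exact this

theorem act_eq_of_rot_eq (hrot : ∀ K, 0 < K → K < c → rot K = W) {K : ℝ} (h0 : 0 ≤ K)
    (h1 : K ≤ c) : act K = 2 * L - W * K := by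
  have hd (x : ℝ) (hx0 : 0 < x) (hx1 : x < c) : HasDerivAt (fun K => act K + W * K) 0 x := by
    convert! (h.hasDerivAt_act x hx0 hx1).fun_add ((hasDerivAt_id x).const_mul W) using 1
    rw [hrot x hx0 hx1]; ring
  rcases h0.eq_or_lt with rfl | h0
  · rw [h.act_zero]; ring
  obtain ⟨x, hx, hx'⟩ := exists_hasDerivAt_eq_slope (fun K => act K + W * K) (fun _ => 0) h0
    (by have := h.continuous_act; fun_prop) fun x hx => hd x hx.1 (hx.2.trans_le h1)
  rw [eq_comm, div_eq_zero_iff, h.act_zero] at hx'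
  rcases hx' with hx' | hx' <;> linarith

/-- If all rotations agree and the critical value is the largest one, then equality holds. -/
theorem sq_eq_of_rot_eq (hℓ : IsLeast S ℓ) (hrot : ∀ K, 0 < K → K < c → rot K = W)
    (hact : act c = 0) : ℓ ^ 2 = 8 * W * ∫ K in (0 : ℝ)..c, act K := by
  have hW := h.W_pos
  have h1 := h.act_eq_of_rot_eq hrot h.c_pos.le le_rfl
  have h2 : W * c = 2 * L := by linarith
  -- Linearity and `act c = 0` give `2 W c = 4 L`, and the remaining lengths are `2 k · 2 L`.
  have h3 : ℓ = 4 * L := by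
    refine le_antisymm (hℓ.2 h.four_mul_len_mem) ?_
    rcases h.le_or_exists ℓ hℓ.1 with h4 | h4 | ⟨q, k, K, h4, h5, h6, h7, h8, h9⟩
    · exact h4
    · linarith
    · rw [h.act_eq_of_rot_eq hrot h6.le h7.le, hrot K h6 h7] at h9
      rw [hrot K h6 h7] at h8
      have h10 : (q : ℝ) = 2 * k := by
        have : (q : ℝ) * W = 2 * k * W := by linarith
        exact mul_right_cancel₀ hW.ne' this
      have hk : (1 : ℝ) ≤ k := by exact_mod_cast h5
      rw [h9, h10]
      nlinarith [h.len_pos]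
  have e : ℓ / (2 * W) = c := by
    rw [h3, div_eq_iff (by positivity)]; linarith
  have h4 : ∫ K in (0 : ℝ)..c, act K = ∫ K in (0 : ℝ)..(ℓ / (2 * W)), (ℓ / 2 - W * K) := by
    rw [e]
    refine intervalIntegral.integral_congr fun K hK => ?_
    rw [Set.uIcc_of_le h.c_pos.le] at hK
    rw [h.act_eq_of_rot_eq hrot hK.1 hK.2, h3]
    ring
  rw [h4, integral_linear hW]
  field_simp

end IsSpectrum

end Spindle

/-! ### The theorem for rotationally symmetric spindle metrics. -/

namespace Spindle

open MeasureTheory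

namespace Metric.RotSym

variable {m n : ℕ} {g : Metric m n} (hg : g.RotSym) {c A B σ : ℝ}

include hg

/-- The slopes `1 / m` and `1 / n` turn `π (1 / a + 1 / b)` into `W = π (m + n)`, so the condition
from the covering, an advance of the angle by `2π (m + n) k`, is exactly `2 W k`. -/
theorem isSpectrum (hc : CritData g.prof g.len c A B σ) : IsSpectrum g.contractibleLengths
    (act g.prof g.len) (rotation g.prof g.len (Real.pi * (m + n : ℕ))) g.len c
    (Real.pi * (m + n : ℕ)) := by
  have hr := hg.isProfile
  have hW : Real.pi * ((m + n : ℕ) : ℝ) = Real.pi * (1 / (1 / (m : ℝ)) + 1 / (1 / (n : ℝ))) := by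
    simp
  have hW0 : 0 < Real.pi * ((m + n : ℕ) : ℝ) := hW ▸ hr.angle_pos
  have hc0 := hc.c_pos
  exact
    { len_pos := hr.len_pos
      c_pos := hc0
      W_pos := hW0
      continuous_act := hr.continuous_act
      act_zero := IsProfile.act_zero
      act_nonneg := IsProfile.act_nonneg hr.len_pos.le
      continuousOn_rot := hW ▸ hr.continuousOn_rot hc
      rot_zero := if_pos rfl
      hasDerivAt_act := fun K h0 h1 => hW ▸ hr.hasDerivAt_act_rot hc h0 h1
      four_mul_len_mem := hg.four_mul_len_mem
      two_mul_crit_mem := by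
        obtain ⟨h0, h1⟩ := IsProfile.crit_mem hc
        refine hg.mem_contractibleLengths_of_regSol hc0.ne' (by positivity)
          (IsProfile.regSol_const hc h0 h1) (fun _ => rfl) 1 fun t => ?_
        field_simp
        push_cast
        ring
      mem := fun q k K hq hk h0 h1 hqk => by
        obtain ⟨s, p, ψ, h, -, -⟩ := hr.exists_regSol_lt hc h0 h1
        obtain ⟨hT0, hT, -⟩ := hr.period_data hc h h0 h1 hW rfl
        have hq' : (0 : ℝ) < q := by exact_mod_cast hq
        refine hg.mem_contractibleLengths_of_regSol h0.ne' (mul_pos hq' hT0) h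
          (fun t => (add_natCast_mul hT q t).1) k fun t => ?_
        rw [(add_natCast_mul hT q t).2, hqk]
        push_cast
        ring
      le_or_exists := fun ℓ hℓ => by
        obtain ⟨hℓ0, h1 | ⟨K, s, p, ψ, hK, h, hper⟩⟩ := hg.le_or_exists_of_mem hℓ
        · exact Or.inl h1
        right
        obtain ⟨k, hk⟩ := (hper 0).2
        -- Geodesics with negative Clairaut constant are mirror images of those with a positive one.
        rcases lt_or_gt_of_ne hK with h0 | h0
        · refine hr.le_or_exists_period hc h.neg (neg_pos.2 h0) hW hℓ0 (fun t => (hper t).1)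
            (k := -k) ?_
          rw [hk]
          push_cast
          ring
        · refine hr.le_or_exists_period hc h h0 hW hℓ0 (fun t => (hper t).1) (k := k) ?_
          rw [hk]
          ring }

theorem isBesse_of_rot_eq (hc : CritData g.prof g.len c A B σ)
    (hmax : ∀ x, 0 < x → x < g.len → g.prof x ≤ c)
    (hrot : ∀ K, 0 < K → K < c → rotation g.prof g.len (Real.pi * (m + n : ℕ)) K
      = Real.pi * (m + n : ℕ)) : g.IsBesse := by
  refine hg.isBesse_of_closed fun K s p ψ hK h => ?_
  rcases lt_or_gt_of_ne hK with h0 | h0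
  · obtain ⟨ℓ, hℓ, h1⟩ := hg.isProfile.closed_of_rot_eq hc (by simp) hmax hrot rfl h.neg
      (neg_pos.2 h0)
    refine ⟨ℓ, hℓ, fun t => ⟨(h1 t).1, ?_⟩⟩
    obtain ⟨k, hk⟩ := (h1 t).2
    refine ⟨-k, ?_⟩
    push_cast
    linarith
  · exact hg.isProfile.closed_of_rot_eq hc (by simp) hmax hrot rfl h h0

/-- A closed geodesic consists of `q` minimal periods, and its angle advances by a multiple of `2π`.
-/
theorem rot_rational_of_isBesse (hB : g.IsBesse) (hc : CritData g.prof g.len c A B σ) {K : ℝ}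
    (h0 : 0 < K) (h1 : K < c) : ∃ (q : ℕ) (k : ℤ), 0 < q ∧
      q * rotation g.prof g.len (Real.pi * (m + n : ℕ)) K = 2 * Real.pi * k := by
  obtain ⟨s, p, ψ, h, -, -⟩ := hg.isProfile.exists_regSol_lt hc h0 h1
  obtain ⟨-, hT, hq⟩ := hg.isProfile.period_data hc h h0 h1 (W := Real.pi * (m + n : ℕ))
    (by simp) rfl
  obtain ⟨ℓ, hℓ, hper⟩ := hg.closed_of_isBesse hB h
  obtain ⟨q, hq0, e⟩ := hq ℓ hℓ fun t => (hper t).1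
  obtain ⟨k, hk⟩ := (hper 0).2
  refine ⟨q, k, hq0, ?_⟩
  have := (add_natCast_mul hT q 0).2
  rw [← e, hk] at this
  linarith

theorem exists_max : ∃ x, 0 < x ∧ x < g.len ∧ ∀ y, 0 ≤ y → y ≤ g.len → g.prof y ≤ g.prof x := by
  have hr := hg.isProfile
  have hL := hr.len_pos
  obtain ⟨x, hx, hmax⟩ := isCompact_Icc.exists_isMaxOn (Set.nonempty_Icc.2 hL.le) hr.continuousOn
  have hx0 : 0 < g.prof x := (hr.pos (g.len / 2) (by linarith) (by linarith)).trans_le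
    (hmax ⟨by linarith, by linarith⟩)
  refine ⟨x, hx.1.lt_of_ne ?_, hx.2.lt_of_ne ?_, fun y h0 h1 => hmax ⟨h0, h1⟩⟩
  · rintro rfl; exact hx0.ne' hr.zero
  · rintro rfl; exact hx0.ne' hr.len

theorem systolic_inequality : IsLeast g.contractibleLengths g.contractibleSystole ∧
    g.contractibleSystolicRatio ≤ 2 * (Real.pi * (m + n : ℕ)) ∧
      (g.contractibleSystolicRatio = 2 * (Real.pi * (m + n : ℕ)) ↔ g.IsBesse) := by
  have hr := hg.isProfile
  obtain ⟨c, A, B, σ, hc⟩ := hr.exists_critData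
  obtain ⟨x, hx0, hxL, hmax⟩ := hg.exists_max
  have hS := hg.isSpectrum hc
  obtain ⟨hσ0, hσL⟩ := IsProfile.crit_mem hc
  have hcR : c ≤ g.prof x := hc.val ▸ hmax σ hσ0.le hσL.le
  have hpos : ∀ K, 0 ≤ K → K < g.prof x → 0 < act g.prof g.len K := fun K h0 h1 =>
    hr.act_pos h0 hx0 hxL h1
  obtain ⟨ℓ, hℓ⟩ := hS.exists_isLeast fun K h0 h1 => hpos K h0 (h1.trans_le hcR)
  have hℓ0 : 0 < ℓ := (hg.le_or_exists_of_mem hℓ.1).1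
  have hsys : g.contractibleSystole = ℓ := hℓ.csInf_eq
  -- `area = 2π ∫ r` and `∫ act = (π / 2) ∫ r`, where the action is integrated up to the maximum of
  -- the profile.
  have harea : g.area = 4 * ∫ K in (0 : ℝ)..(g.prof x), act g.prof g.len K := by
    rw [hg.area_eq, hr.integral_act fun s h0 h1 => hmax s h0.le h1.le]
    ring
  have hpi := Real.pi_pos
  have hW := hS.W_pos
  have hle := hS.sq_le_integral hℓ hℓ0 hcR
  have harea0 : 0 < g.area := by
    by_contra! hneg
    have : 0 < ℓ ^ 2 := by positivity
    nlinarith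
  rw [Metric.contractibleSystolicRatio, hsys]
  refine ⟨hℓ, ?_, ?_⟩
  · rw [div_le_iff₀ harea0, harea]
    linarith
  rw [div_eq_iff harea0.ne', harea]
  constructor
  · intro heq
    obtain ⟨h1, h2⟩ := hS.rot_eq_of_sq_eq hℓ hℓ0 hcR hpos (by linarith)
    exact hg.isBesse_of_rot_eq hc (fun y h3 h4 => h1 ▸ hmax y h3.le h4.le) h2
  -- Rational rotations are constant, so all periods equal `2 L`; then `c` is the maximum of the
  -- profile and the action is linear, which gives equality.
  · intro hB
    have hrot : ∀ K, 0 < K → K < c → rotation g.prof g.len (Real.pi * (m + n : ℕ)) K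
        = Real.pi * (m + n : ℕ) := fun K h0 h1 =>
      hS.rot_eq_of_rational (fun K h0 h1 => hg.rot_rational_of_isBesse hB hc h0 h1) rfl h0.le h1
    have hmaxc : ∀ y, 0 ≤ y → y ≤ g.len → g.prof y ≤ c := fun y h0 h1 =>
      hr.le_crit_of_period_eq hc (W := Real.pi * (m + n : ℕ)) (by simp) (fun K h2 h3 => by
        rw [hrot K h2 h3, hS.act_eq_of_rot_eq hrot h2.le h3.le]; ring) h0 h1
    have e : g.prof x = c := le_antisymm (hmaxc x hx0.le hxL.le) hcR
    rw [e, hS.sq_eq_of_rot_eq hℓ hrot (hr.act_eq_zero fun s h0 h1 => hmaxc s h0.le h1.le)]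
    ring

end Metric.RotSym

end Spindle

theorem theoremA (m n : ℕ) (hm : 0 < m) (hn : 0 < n) (g : Spindle.Metric m n)
    (hg : g.IsRotationallySymmetric) :
    IsLeast g.contractibleLengths g.contractibleSystole ∧
      g.contractibleSystolicRatio ≤ 2 * ((m : ℝ) + (n : ℝ)) * Real.pi ∧
      (g.contractibleSystolicRatio = 2 * ((m : ℝ) + (n : ℝ)) * Real.pi ↔ g.IsBesse) := by
  have h := Spindle.Metric.RotSym.systolic_inequality ⟨hm, hn, hg⟩
  rwa [show 2 * (Real.pi * ((m + n : ℕ) : ℝ)) = 2 * ((m : ℝ) + (n : ℝ)) * Real.pi by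
    push_cast; ring] at h
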